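/- **Conventions.** Let $\omega\ge 2$ be any exponent of matrix multiplication, that is, a real number such that two $N\times N$ matrices (it suffices: $0/1$ matrices, product over $\mathbb Z$) can be multiplied in time $O(N^{\omega})$. Running times are on a unit-cost word RAM with words of $w\ge d\log_2 (n+2)$ bits ($d$ a constant; words of $w \geq d\log_2(N+2)$ bits for matrix multiplication) and arithmetic instructions $+,-,\cdot,/,\bmod$; a randomized algorithm may also draw, in one step, a uniformly random element of $\{0,\dots,m-1\}$ for a word $m$. Memory is not assumed to be initialized. The input graph is given by adjacency lists. Since the exponents below are arbitrary real constants, the algorithm is also given the integers $\lfloor n^{e}\rfloor$ for a fixed finite list of exponents $e$, each a rational linear combination of $1,\alpha,\varepsilon,\omega$. **Theorem (Removing Most $k$-Cycles).** Fix constants $k\ge 4$ (an integer), $\alpha\in(0,\tfrac12)$ and $\varepsilon\in(0,\tfrac{3-\omega}{4})$. There is a randomized algorithm that, given any graph $G$ with $n\geq 1$ vertices and maximum degree at most $\sqrt n$, runs in time $O(n^{2-\varepsilon})$ (for every outcome of its random choices) and returns a set of edges $E'\subseteq E(G)$ and $s=\lfloor n^{3/2-3\alpha}\rfloor$ subgraphs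 $G_1,\dots,G_s\subseteq G$ such that: 1. Every edge $e\in E'$ participates in a triangle of $G$. 2. If an edge $e\in E(G)$ participates in a triangle of $G$, then $e\in E'$ or $e$ participates in a triangle of at least one $G_i$. 3. With high probability, every $G_i$ has $O(n^{1/2+\alpha})$ vertices and maximum degree $O(n^{\alpha})$: for every constant $c>0$ there is a constant $D_c$ such that with probability at least $1-n^{-c}$ every $G_i$ has at most $D_c n^{1/2+\alpha}$ vertices and maximum degree at most $D_c n^{\alpha}$. 4. For every $i$, the expected total number of cycles of $G_i$ of lengths $4\le k'\le k$ is $O(n^{\frac{\omega-1}{4}+k\alpha+\varepsilon})$. Properties 1 and 2 hold for every outcome of the random choices. The algorithm and all constants depend only on $k,\alpha,\varepsilon,\omega$ (and $D_c$ also on $c$). The set $E'$ is returned as an explicit list. The collection of subgraphs is returned in the following form: there are one common array of vertices and one common array of edges, and each $G_i$ is given by $q=O(1)$ pointers to blocks of the vertex array and $q$ pointers to blocks of the edge array, whose concatenations list the vertices and the edges of $G_i$, each exactly once. -/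

import Mathlib

/-!  A randomized word RAM.

Words are natural numbers below `2 ^ w`.  A machine has registers and a fixed finite number of
memory segments (those that its program mentions), each of which is addressed by words.  A program
is a structured program over the usual unit-cost instructions; one machine step executes one
instruction or one test. -/

namespace WordRAM

/-- Arithmetic instructions.  All results are reduced modulo `2 ^ w`; `sub` is truncated. -/
inductive Op
  | add | sub | mul | div | mod

/-- The value of an arithmetic instruction before reduction modulo `2 ^ w`. -/
def Op.eval : Op → ℕ → ℕ → ℕ
  | .add, a, b => a + b
  | .sub, a, b => a - b
  | .mul, a, b => a * b
  | .div, a, b => a / b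
  | .mod, a, b => a % b

/-- Programs.  Registers and memory segments are named by natural numbers. -/
inductive Cmd
  /-- do nothing -/
  | skip
  /-- `x := c` -/
  | const (x c : ℕ)
  /-- `x := y o z` -/
  | arith (x : ℕ) (o : Op) (y z : ℕ)
  /-- `x := a[i]`, where `i` is a register and `a` a memory segment -/
  | load (x a i : ℕ)
  /-- `a[i] := y` -/
  | store (a i y : ℕ)
  /-- `x :=` a uniformly random element of `{0, …, m - 1}`, where `m` is a register
  (`x := 0` if it holds `0`) -/
  | rand (x m : ℕ)
  /-- first `p`, then `q` -/
  | seq (p q : Cmd)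
  /-- if `x < y` then `p` else `q` -/
  | ite (x y : ℕ) (p q : Cmd)
  /-- while `x < y` do `p` -/
  | loop (x y : ℕ) (p : Cmd)

/-- The contents of the registers and of the memory segments. -/
@[ext]
structure State where
  reg : ℕ → ℕ
  mem : ℕ → ℕ → ℕ

/-- All cells hold words of `w` bits. -/
def State.IsWord (w : ℕ) (s : State) : Prop :=
  (∀ x, s.reg x < 2 ^ w) ∧ ∀ a i, s.mem a i < 2 ^ w

/-- Overwrite a register. -/
def State.setReg (s : State) (x v : ℕ) : State :=
  ⟨Function.update s.reg x v, s.mem⟩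

/-- Overwrite a memory cell. -/
def State.setMem (s : State) (a i v : ℕ) : State :=
  ⟨s.reg, Function.update s.mem a (Function.update (s.mem a) i v)⟩

/-- A configuration: the stack of commands that remain to be executed (this plays the role of the
program counter; only subprograms of the program ever occur in it) and the current state. -/
abbrev Config := List Cmd × State

/-- The uniform distribution on `{0, …, m - 1}`, and the point mass at `0` for `m = 0`. -/
noncomputable def uniformBelow (m : ℕ) : PMF ℕ :=
  if h : (Finset.range m).Nonempty then PMF.uniformOfFinset (Finset.range m) h else PMF.pure 0

/-- One step of the machine with word length `w`.  A configuration with empty command stack has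
halted and does not change any more. -/
noncomputable def step (w : ℕ) : Config → PMF Config
  | ([], s) => PMF.pure ([], s)
  | (.skip :: K, s) => PMF.pure (K, s)
  | (.const x c :: K, s) => PMF.pure (K, s.setReg x (c % 2 ^ w))
  | (.arith x o y z :: K, s) =>
      PMF.pure (K, s.setReg x (o.eval (s.reg y) (s.reg z) % 2 ^ w))
  | (.load x a i :: K, s) => PMF.pure (K, s.setReg x (s.mem a (s.reg i)))
  | (.store a i y :: K, s) => PMF.pure (K, s.setMem a (s.reg i) (s.reg y))
  | (.rand x m :: K, s) => (uniformBelow (s.reg m)).map fun v => (K, s.setReg x v)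
  | (.seq p q :: K, s) => PMF.pure (p :: q :: K, s)
  | (.ite x y p q :: K, s) => PMF.pure (if s.reg x < s.reg y then (p :: K, s) else (q :: K, s))
  | (.loop x y p :: K, s) =>
      PMF.pure (if s.reg x < s.reg y then (p :: .loop x y p :: K, s) else (K, s))

/-- The distribution of the configuration after `T` steps. -/
noncomputable def run (w : ℕ) : ℕ → Config → PMF Config
  | 0, c => PMF.pure c
  | T + 1, c => (step w c).bind (run w T)

/-- `P`, started in the state `s`, halts within `T` steps for every outcome of the random choices,
and each possible final state has the property `Q`. -/
def HaltsWith (w T : ℕ) (P : Cmd) (s : State) (Q : State → Prop) : Prop :=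
  ∀ c ∈ (run w T ([P], s)).support, c.1 = [] ∧ Q c.2

/-- Two `N × N` matrices can be multiplied in time `O(N ^ τ)`: some program computes the product
over the integers of every two `0/1` matrices of order `N ≥ 1`, on words of at least `d log₂ (N + 2)`
bits for some constant `d`.  The input is `N` in register `0` and the two matrices, row by row, in
segments `0` and `1`; the output is written to segment `2`; all other cells may initially hold
arbitrary words. -/
def MatMulInTime (τ : ℝ) : Prop :=
  ∃ (P : Cmd) (d : ℕ) (C : ℝ), ∀ N : ℕ, 1 ≤ N → ∀ w : ℕ, (N + 2) ^ d ≤ 2 ^ w →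
    ∀ A B : Matrix (Fin N) (Fin N) ℕ, (∀ i j, A i j ≤ 1) → (∀ i j, B i j ≤ 1) →
    ∀ s : State, s.IsWord w → s.reg 0 = N →
      (∀ i j : Fin N, s.mem 0 (i * N + j) = A i j) →
      (∀ i j : Fin N, s.mem 1 (i * N + j) = B i j) →
      ∃ T : ℕ, (T : ℝ) ≤ C * (N : ℝ) ^ τ ∧
        HaltsWith w T P s fun s' => ∀ i j : Fin N, s'.mem 2 (i * N + j) = (A * B) i j

/-- The state holds the graph `G` on the vertices `0, …, n - 1` as adjacency lists: register `0`
holds `n`, and the neighbours of `v`, each once and in any order, are the entries of segment `1` at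
the positions from `off v` up to, but excluding, `off (v + 1)`, where `off` is segment `0`.
Moreover the entries of segment `2` are the integers `⌊n ^ e⌋` for the exponents `e` in the list
`exps`.  All other cells may hold arbitrary words. -/
def HoldsInput {n : ℕ} (exps : List ℝ) (G : SimpleGraph (Fin n)) (s : State) : Prop :=
  s.reg 0 = n ∧ s.mem 0 0 = 0 ∧
  (∀ v : Fin n, s.mem 0 (v + 1) = s.mem 0 v + (G.neighborSet v).ncard) ∧
  (∀ v u : Fin n, G.Adj v u ↔ ∃ t, s.mem 0 v ≤ t ∧ t < s.mem 0 (v + 1) ∧ s.mem 1 t = u) ∧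
  ∀ j : Fin exps.length, s.mem 2 j = ⌊(n : ℝ) ^ exps.get j⌋₊

/-- The list `l` enumerates the set `S` without repetition. -/
def Enumerates {X : Type*} (l : List X) (S : Set X) : Prop :=
  l.Nodup ∧ ∀ x, x ∈ l ↔ x ∈ S

/-- The edges between corresponding entries of segments `a` and `b` at the positions
`lo, …, hi - 1`. -/
def edgesAt (s : State) (a b lo hi : ℕ) : List (Sym2 ℕ) :=
  (List.range' lo (hi - lo)).map fun t => s(s.mem a t, s.mem b t)

/-- The vertices in segment `a` at the positions `lo, …, hi - 1`. -/
def verticesAt (s : State) (a lo hi : ℕ) : List ℕ :=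
  (List.range' lo (hi - lo)).map (s.mem a)

/-- The vertex list of the `i`-th subgraph: the concatenation of `q` blocks of segment `5`, whose
boundaries are stored in segments `6` and `7`. -/
def vertexList (q i : ℕ) (s : State) : List ℕ :=
  (List.range q).flatMap fun j => verticesAt s 5 (s.mem 6 (i * q + j)) (s.mem 7 (i * q + j))

/-- The edge list of the `i`-th subgraph: the concatenation of `q` blocks of the edge array in
segments `8` and `9`, whose boundaries are stored in segments `10` and `11`. -/
def edgeList (q i : ℕ) (s : State) : List (Sym2 ℕ) :=
  (List.range q).flatMap fun j => edgesAt s 8 9 (s.mem 10 (i * q + j)) (s.mem 11 (i * q + j))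

/-- The state holds the set of edges `E'` and the subgraphs `H 0, …, H (r - 1)`.  The set `E'` is an
explicit list in segments `3` and `4`, of the length in register `1`; register `2` holds `r`; each
subgraph is given by pointers to `q` blocks of one common vertex array and to `q` blocks of one
common edge array, whose concatenations list its vertices and its edges, each exactly once. -/
def HoldsOutput {n : ℕ} {G : SimpleGraph (Fin n)} (q : ℕ) {r : ℕ}
    (E' : Set (Sym2 (Fin n))) (H : Fin r → G.Subgraph) (s : State) : Prop :=
  Enumerates (edgesAt s 3 4 0 (s.reg 1)) (Sym2.map Fin.val '' E') ∧
  s.reg 2 = r ∧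
  ∀ i : Fin r, Enumerates (vertexList q i s) (Fin.val '' (H i).verts) ∧
    Enumerates (edgeList q i s) (Sym2.map Fin.val '' (H i).edgeSet)

/-- The probability, under the final distribution `μ`, that the final state has the property `Q`. -/
noncomputable def prob (μ : PMF Config) (Q : State → Prop) : ENNReal :=
  μ.toOuterMeasure {c | Q c.2}

/-- The expectation, under the final distribution `μ`, of a quantity read off the final state. -/
noncomputable def expect (μ : PMF Config) (f : State → ℕ) : ENNReal :=
  ∑' c, μ c * (f c.2 : ENNReal)

/-- The edge `e` of `G` participates in a triangle of `G`. -/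
def EdgeInTriangle {V : Type*} (G : SimpleGraph V) (e : Sym2 V) : Prop :=
  ∃ u v x, e = s(u, v) ∧ G.Adj u v ∧ G.Adj v x ∧ G.Adj u x

/-- The total number of (simple, unlabelled) cycles of `G` whose length is between `4` and `k`. -/
noncomputable def numCycles {V : Type*} [Fintype V] (k : ℕ) (G : SimpleGraph V) : ℕ :=
  ∑ k' ∈ Finset.Icc 4 k, G.copyCount (SimpleGraph.cycleGraph k')

end WordRAM

open WordRAM

/-! ### Program logic: frame conditions, couplings and Hoare triples with time bounds -/

namespace WordRAM

/-! The algorithm first destroys most 4-cycles of `G` and then splits the rest at random by colours.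
Up to rounding, `r = n^(1/2)`, `L = n^((ω-1)/4)`, `θ = n^ε L`, `R = n^(1-ε)`, `p = n^(1/2-α)`. For
`R` rounds a uniformly random vertex `v` is drawn and the numbers `codeg v y` of common neighbours
in the current graph `H` are computed, in time `O(r² + n) = O(n)`. Call `y` dense if `codeg v y ≥
θ`. If there are at least `θ r` adjacent pairs consisting of a neighbour of `v` and a dense vertex,
all triangles of `H` through such a pair are marked and the edges of these pairs are deleted. Hence
every triangle of `G` is at any time marked on all its edges or still alive in `H` (`Complete.del`,
`heavy_spec`); the marked edges form `E'`.

Time. Consider a triangle `a b y` with `a` a neighbour of `v` and `b` dense. If `codeg v y < L`, it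
is found by running through the edges `b y` and the common neighbours of `v` and `y`, at cost `r L`
per dense vertex. At most `r²/L` vertices have `codeg v y ≥ L`; triangles with such a `y` are found
by multiplying `r × r` adjacency matrices between blocks of the three lists. The total is charged to
the deleted edges: the step is taken only if at least `θ r` of them are deleted, so each pays the
same amount (`heavyCost_add_le`), and there are at most `n r` oriented edges in total. The choice of
`L` balances the two cases and yields `O(n^(2-ε))` for every outcome (`Sizes.cost_le`).

Cycles. Let `sqSum H` be the sum of the squares of all `codeg v y`, `v = y` included. By
Cauchy-Schwarz there are at most `r^(k-4) sqSum H` closed walks of length `k`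
(`sum_numWalks_self_le`). A vertex that would not trigger a deletion contributes at most `2 θ r²` to
`sqSum`, any other at most `r³` (`sqSum_le`). Since a vertex of the second kind, when drawn, removes
at least `θ r` oriented edges, the number of such vertices is small on average over the rounds,
which bounds the expectation of `sqSum` at the end (`mean_sqSum_evolve_le`).

Splitting. The vertices receive independent uniform colours from `p` colours, and each triple of
colours induces one subgraph of `H`. Every triangle of `H` lies in one of them; a closed walk on `k`
distinct vertices lies in a given one with probability at most `(3/p)^k` (`mean_recolour_subset`);
and exponential moments bound the colour classes and their intersections with neighbourhoods
(`mean_two_pow_le`). The subgraphs are never copied: sorting vertices by colour and edges by pairs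
of colours makes each a concatenation of nine blocks.

The program is verified by coupling its runs with this abstract random process (`Spec`), so that
time bounds hold surely and expectations are computed for the process alone. -/

theorem pmf_bind_congr {α β : Type*} {μ : PMF α} {f g : α → PMF β}
    (h : ∀ a ∈ μ.support, f a = g a) : μ.bind f = μ.bind g := by
  ext b
  simp only [PMF.bind_apply]
  refine tsum_congr fun a => ?_
  by_cases ha : a ∈ μ.support
  · rw [h a ha]
  · rw [PMF.mem_support_iff, not_not] at ha
    simp [ha]

/-- Register `x` is assigned by some instruction of the program. -/
def Cmd.writes (x : ℕ) : Cmd → Bool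
  | .skip => false
  | .const y _ => x == y
  | .arith y _ _ _ => x == y
  | .load y _ _ => x == y
  | .store _ _ _ => false
  | .rand y _ => x == y
  | .seq p q => p.writes x || q.writes x
  | .ite _ _ p q => p.writes x || q.writes x
  | .loop _ _ p => p.writes x

/-- Segment `a` is written by some instruction of the program. -/
def Cmd.stores (a : ℕ) : Cmd → Bool
  | .skip => false
  | .const _ _ => false
  | .arith _ _ _ _ => false
  | .load _ _ _ => false
  | .store b _ _ => a == b
  | .rand _ _ => false
  | .seq p q => p.stores a || q.stores a
  | .ite _ _ p q => p.stores a || q.stores a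
  | .loop _ _ p => p.stores a

/-- What every execution of `P` from `s` to `s'` leaves unchanged. -/
structure Frame (w : ℕ) (P : Cmd) (s s' : State) : Prop where
  reg : ∀ x, P.writes x = false → s'.reg x = s.reg x
  mem : ∀ a, P.stores a = false → s'.mem a = s.mem a
  word : s.IsWord w → s'.IsWord w

@[simp] theorem State.setReg_reg (s : State) (x v y : ℕ) :
    (s.setReg x v).reg y = if y = x then v else s.reg y := by
  simp [State.setReg, Function.update_apply]

@[simp] theorem State.setReg_mem (s : State) (x v : ℕ) : (s.setReg x v).mem = s.mem := rfl

@[simp] theorem State.setMem_reg (s : State) (a i v : ℕ) : (s.setMem a i v).reg = s.reg := rfl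

@[simp] theorem State.setMem_mem (s : State) (a i v b : ℕ) :
    (s.setMem a i v).mem b = if b = a then Function.update (s.mem a) i v else s.mem b := by
  simp [State.setMem, Function.update_apply]

theorem State.IsWord.setReg {w : ℕ} {s : State} (h : s.IsWord w) {x v : ℕ} (hv : v < 2 ^ w) :
    (s.setReg x v).IsWord w :=
  ⟨fun y => by rw [State.setReg_reg]; split <;> [exact hv; exact h.1 y], h.2⟩

theorem State.IsWord.setMem {w : ℕ} {s : State} (h : s.IsWord w) {a i v : ℕ} (hv : v < 2 ^ w) :
    (s.setMem a i v).IsWord w :=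
  ⟨h.1, fun b j => by
    rw [State.setMem_mem]
    split
    · rw [Function.update_apply]; split <;> [exact hv; exact h.2 a j]
    · exact h.2 b j⟩

theorem mem_support_uniformBelow {m v : ℕ} (h : v ∈ (uniformBelow m).support) :
    v < m ∨ v = 0 := by
  unfold uniformBelow at h
  split at h
  · left; simpa using h
  · right; simpa using h

/-- A step pushes only subprograms of the command on top of the stack, so the property that nothing
on the stack touches a given cell is inherited. It is carried along with the equality to make the
induction over the run possible. -/
theorem step_frame {w : ℕ} {L : List Cmd} {s : State} {c : Config}
    (h : c ∈ (step w (L, s)).support) :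
    (∀ x, (∀ P ∈ L, P.writes x = false) →
      c.2.reg x = s.reg x ∧ ∀ P ∈ c.1, P.writes x = false) ∧
    (∀ a, (∀ P ∈ L, P.stores a = false) →
      c.2.mem a = s.mem a ∧ ∀ P ∈ c.1, P.stores a = false) ∧
    (s.IsWord w → c.2.IsWord w) := by
  match L with
  | [] => simp [step] at h; subst h; simp
  | .skip :: K =>
    simp [step] at h; subst h; simp +contextual
  | .const y v :: K =>
    simp [step] at h; subst h
    refine ⟨fun x hx => ?_, fun a ha => ?_, fun hw => hw.setReg (Nat.mod_lt _ (by positivity))⟩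
    · simp [Cmd.writes] at hx; simpa [State.setReg_reg, hx.1] using hx.2
    · simp [Cmd.stores] at ha; exact ⟨rfl, ha⟩
  | .arith y o z t :: K =>
    simp [step] at h; subst h
    refine ⟨fun x hx => ?_, fun a ha => ?_, fun hw => hw.setReg (Nat.mod_lt _ (by positivity))⟩
    · simp [Cmd.writes] at hx; simpa [State.setReg_reg, hx.1] using hx.2
    · simp [Cmd.stores] at ha; exact ⟨rfl, ha⟩
  | .load y b i :: K =>
    simp [step] at h; subst h
    refine ⟨fun x hx => ?_, fun a ha => ?_, fun hw => hw.setReg (hw.2 _ _)⟩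
    · simp [Cmd.writes] at hx; simpa [State.setReg_reg, hx.1] using hx.2
    · simp [Cmd.stores] at ha; exact ⟨rfl, ha⟩
  | .store b i y :: K =>
    simp [step] at h; subst h
    refine ⟨fun x hx => ?_, fun a ha => ?_, fun hw => hw.setMem (hw.1 _)⟩
    · simp [Cmd.writes] at hx; exact ⟨rfl, hx⟩
    · simp [Cmd.stores] at ha; simpa [State.setMem_mem, ha.1] using ha.2
  | .rand y m :: K =>
    simp only [step, PMF.mem_support_map_iff] at h
    obtain ⟨v, hv, rfl⟩ := h
    refine ⟨fun x hx => ?_, fun a ha => ?_, fun hw => hw.setReg ?_⟩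
    · simp [Cmd.writes] at hx; simpa [State.setReg_reg, hx.1] using hx.2
    · simp [Cmd.stores] at ha; exact ⟨rfl, ha⟩
    · rcases mem_support_uniformBelow hv with h | h
      · exact h.trans (hw.1 _)
      · subst h; positivity
  | .seq p q :: K =>
    simp [step] at h; subst h
    simp +contextual [Cmd.writes, Cmd.stores]
  | .ite y z p q :: K =>
    simp [step] at h
    split at h <;> subst h <;> simp +contextual [Cmd.writes, Cmd.stores]
  | .loop y z p :: K =>
    simp [step] at h
    split at h <;> subst h <;> simp +contextual [Cmd.writes, Cmd.stores]

theorem run_frame {w N : ℕ} {L : List Cmd} {s : State} {c : Config}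
    (h : c ∈ (run w N (L, s)).support) :
    (∀ x, (∀ P ∈ L, P.writes x = false) → c.2.reg x = s.reg x) ∧
    (∀ a, (∀ P ∈ L, P.stores a = false) → c.2.mem a = s.mem a) ∧
    (s.IsWord w → c.2.IsWord w) := by
  induction N generalizing L s with
  | zero => simp [run] at h; subst h; simp
  | succ N ih =>
    simp only [run, PMF.mem_support_bind_iff] at h
    obtain ⟨⟨L', s'⟩, h1, h2⟩ := h
    obtain ⟨a1, a2, a3⟩ := step_frame h1
    obtain ⟨b1, b2, b3⟩ := ih h2
    refine ⟨fun x hx => ?_, fun x hx => ?_, fun h => b3 (a3 h)⟩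
    · rw [b1 x (a1 x hx).2, (a1 x hx).1]
    · rw [b2 x (a2 x hx).2, (a2 x hx).1]

/-- Every run of `P` from `s` halts within `T` steps, and its final state can be coupled with an
outcome `i` of the law `μ` such that it satisfies `Q i`. -/
def Spec (w : ℕ) {ι : Type} (P : Cmd) (s : State) (T : ℕ) (μ : PMF ι)
    (Q : ι → State → Prop) : Prop :=
  ∃ κ : PMF (ι × State × ℕ), κ.map Prod.fst = μ ∧
    (∀ x ∈ κ.support, x.2.2 ≤ T ∧ Q x.1 x.2.1) ∧
    ∀ K N, T ≤ N → run w N (P :: K, s) = κ.bind fun x => run w (N - x.2.2) (K, x.2.1)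

/-- Every run of `P` from `s` halts within `T` steps in a state satisfying `Q`. -/
def Hoare (w : ℕ) (P : Cmd) (s : State) (T : ℕ) (Q : State → Prop) : Prop :=
  Spec w P s T (PMF.pure ()) fun _ => Q

theorem run_nil (w N : ℕ) (s : State) : run w N ([], s) = PMF.pure ([], s) := by
  induction N with
  | zero => rfl
  | succ N ih => simp [run, step, ih]

/-- A halted configuration never changes, so the variable halting times disappear when the run is
observed at time `T`. -/
theorem Spec.run_eq {w : ℕ} {ι : Type} {P : Cmd} {s : State} {T : ℕ} {μ : PMF ι}
    {Q : ι → State → Prop} (h : Spec w P s T μ Q) :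
    ∃ κ : PMF (ι × State), κ.map Prod.fst = μ ∧ (∀ x ∈ κ.support, Q x.1 x.2) ∧
      run w T ([P], s) = κ.map fun x => ([], x.2) := by
  obtain ⟨κ, h1, h2, h3⟩ := h
  refine ⟨κ.map fun x => (x.1, x.2.1), ?_, ?_, ?_⟩
  · rw [PMF.map_comp, ← h1]; rfl
  · intro x hx
    rw [PMF.mem_support_map_iff] at hx
    obtain ⟨y, hy, rfl⟩ := hx
    exact (h2 y hy).2
  · rw [h3 [] T le_rfl, PMF.map_comp]
    simp only [run_nil]
    rfl

theorem Spec.mono {w : ℕ} {ι : Type} {P : Cmd} {s : State} {T T' : ℕ} {μ : PMF ι}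
    {Q Q' : ι → State → Prop} (h : Spec w P s T μ Q) (hT : T ≤ T')
    (hQ : ∀ i s', Q i s' → Q' i s') : Spec w P s T' μ Q' := by
  obtain ⟨κ, h1, h2, h3⟩ := h
  exact ⟨κ, h1, fun x hx => ⟨(h2 x hx).1.trans hT, hQ _ _ (h2 x hx).2⟩,
    fun K N hN => h3 K N (hT.trans hN)⟩

theorem Spec.frame {w : ℕ} {ι : Type} {P : Cmd} {s : State} {T : ℕ} {μ : PMF ι}
    {Q : ι → State → Prop} (h : Spec w P s T μ Q) :
    Spec w P s T μ fun i s' => Q i s' ∧ Frame w P s s' := by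
  obtain ⟨κ, h1, h2, h3⟩ := h
  refine ⟨κ, h1, fun x hx => ⟨(h2 x hx).1, (h2 x hx).2, ?_⟩, h3⟩
  have hc : (([], x.2.1) : Config) ∈ (run w T ([P], s)).support := by
    rw [h3 [] T le_rfl, PMF.mem_support_bind_iff]
    exact ⟨x, hx, by simp [run_nil]⟩
  obtain ⟨a1, a2, a3⟩ := run_frame hc
  exact ⟨fun y hy => a1 y (by simpa using hy), fun y hy => a2 y (by simpa using hy), a3⟩

theorem Spec.map {w : ℕ} {ι ι' : Type} {P : Cmd} {s : State} {T : ℕ} {μ : PMF ι}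
    {Q : ι → State → Prop} {Q' : ι' → State → Prop} (f : ι → ι') (h : Spec w P s T μ Q)
    (hQ : ∀ i s', Q i s' → Q' (f i) s') : Spec w P s T (μ.map f) Q' := by
  obtain ⟨κ, h1, h2, h3⟩ := h
  refine ⟨κ.map fun x => (f x.1, x.2), ?_, ?_, fun K N hN => ?_⟩
  · rw [← h1, PMF.map_comp, PMF.map_comp]; rfl
  · intro x hx
    rw [PMF.mem_support_map_iff] at hx
    obtain ⟨y, hy, rfl⟩ := hx
    exact ⟨(h2 y hy).1, hQ _ _ (h2 y hy).2⟩
  · rw [h3 K N hN, PMF.bind_map]; rfl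

/-- Since the equation in `Spec` is required for every continuation `K`, the coupling of `P` may be
used with continuation `R :: K` and then composed with the coupling of `R`. The extra step is spent
on unfolding `seq`. -/
theorem Spec.seq {w : ℕ} {ι ι' : Type} {P R : Cmd} {s : State} {T₁ T₂ : ℕ} {μ : PMF ι}
    {ν : ι → PMF ι'} {Q : ι → State → Prop} {Q' : ι' → State → Prop}
    (h : Spec w P s T₁ μ Q)
    (h' : ∀ i s', Frame w P s s' → Q i s' → Spec w R s' T₂ (ν i) Q') :
    Spec w (.seq P R) s (T₁ + T₂ + 1) (μ.bind ν) Q' := by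
  classical
  obtain ⟨κ, h1, h2, h3⟩ := h.frame
  have key : ∀ x : ι × State × ℕ, ∃ κ' : PMF (ι' × State × ℕ), x ∈ κ.support →
      κ'.map Prod.fst = ν x.1 ∧ (∀ y ∈ κ'.support, y.2.2 ≤ T₂ ∧ Q' y.1 y.2.1) ∧
      ∀ K N, T₂ ≤ N →
        run w N (R :: K, x.2.1) = κ'.bind fun y => run w (N - y.2.2) (K, y.2.1) := by
    intro x
    by_cases hx : x ∈ κ.support
    · obtain ⟨κ', hκ⟩ := h' x.1 x.2.1 (h2 x hx).2.2 (h2 x hx).2.1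
      exact ⟨κ', fun _ => hκ⟩
    -- Off the support any law will do; `ν x.1` supplies one without an element of `ι'` at hand.
    · exact ⟨(ν x.1).map fun i => (i, s, 0), fun h => (hx h).elim⟩
  choose κ' hκ' using key
  refine ⟨κ.bind fun x => (κ' x).map fun y => (y.1, y.2.1, x.2.2 + y.2.2 + 1), ?_, ?_, ?_⟩
  · rw [PMF.map_bind, ← h1, PMF.bind_map]
    refine pmf_bind_congr fun x hx => ?_
    rw [PMF.map_comp]
    exact (hκ' x hx).1
  · intro z hz
    rw [PMF.mem_support_bind_iff] at hz
    obtain ⟨x, hx, hz⟩ := hz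
    rw [PMF.mem_support_map_iff] at hz
    obtain ⟨y, hy, rfl⟩ := hz
    have a := (h2 x hx).1
    have b := (hκ' x hx).2.1 y hy
    exact ⟨by dsimp only; omega, b.2⟩
  · intro K N hN
    obtain ⟨M, rfl⟩ : ∃ M, N = M + 1 := ⟨N - 1, by omega⟩
    simp only [run, step, PMF.pure_bind]
    rw [h3 _ M (by omega), PMF.bind_bind]
    refine pmf_bind_congr fun x hx => ?_
    have a := (h2 x hx).1
    rw [(hκ' x hx).2.2 K _ (by omega), PMF.bind_map]
    refine pmf_bind_congr fun y hy => ?_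
    simp only [Function.comp]
    congr 1
    omega

theorem Spec.of_step {w : ℕ} {ι : Type} {P : Cmd} {s : State} {μ : PMF ι}
    {f : ι → State} {Q : ι → State → Prop}
    (h : ∀ K, step w (P :: K, s) = μ.map fun i => (K, f i)) (hQ : ∀ i ∈ μ.support, Q i (f i)) :
    Spec w P s 1 μ Q := by
  refine ⟨μ.map fun i => (i, f i, 1), ?_, ?_, ?_⟩
  · rw [PMF.map_comp]; exact PMF.map_id μ
  · intro x hx
    rw [PMF.mem_support_map_iff] at hx
    obtain ⟨y, hy, rfl⟩ := hx
    exact ⟨le_rfl, hQ y hy⟩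
  · intro K N hN
    obtain ⟨M, rfl⟩ : ∃ M, N = M + 1 := ⟨N - 1, by omega⟩
    simp only [run, h, PMF.bind_map]
    rfl

theorem Spec.of_step_spec {w : ℕ} {ι : Type} {P P' : Cmd} {s s' : State} {T : ℕ} {μ : PMF ι}
    {Q : ι → State → Prop}
    (h : ∀ K, step w (P :: K, s) = PMF.pure (P' :: K, s')) (h' : Spec w P' s' T μ Q) :
    Spec w P s (T + 1) μ Q := by
  obtain ⟨κ, h1, h2, h3⟩ := h'
  refine ⟨κ.map fun x => (x.1, x.2.1, x.2.2 + 1), ?_, ?_, ?_⟩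
  · rw [PMF.map_comp, ← h1]; rfl
  · intro x hx
    rw [PMF.mem_support_map_iff] at hx
    obtain ⟨y, hy, rfl⟩ := hx
    exact ⟨by have := (h2 y hy).1; dsimp only; omega, (h2 y hy).2⟩
  · intro K N hN
    obtain ⟨M, rfl⟩ : ∃ M, N = M + 1 := ⟨N - 1, by omega⟩
    simp only [run, h, PMF.pure_bind]
    rw [h3 K M (by omega), PMF.bind_map]
    refine pmf_bind_congr fun y hy => ?_
    simp only [Function.comp]
    congr 1
    omega

theorem Spec.loop_exit {w : ℕ} {x y : ℕ} {P : Cmd} {s : State} {ι : Type} {i : ι}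
    {Q : ι → State → Prop} (h : ¬ s.reg x < s.reg y) (hQ : Q i s) :
    Spec w (.loop x y P) s 1 (PMF.pure i) Q :=
  Spec.of_step (f := fun _ => s) (fun K => by simp [step, h, PMF.pure_map])
    (by simpa using hQ)

/-- When the test succeeds, one step turns the loop into the same stack that `seq` of the body and
the loop would produce, so the coupling for `seq` can be reused. -/
theorem Spec.loop_enter {w : ℕ} {ι ι' : Type} {x y : ℕ} {P : Cmd} {s : State} {T₁ T₂ : ℕ}
    {μ : PMF ι} {ν : ι → PMF ι'} {Q : ι → State → Prop} {Q' : ι' → State → Prop}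
    (hlt : s.reg x < s.reg y) (h : Spec w P s T₁ μ Q)
    (h' : ∀ i s', Frame w P s s' → Q i s' → Spec w (.loop x y P) s' T₂ (ν i) Q') :
    Spec w (.loop x y P) s (T₁ + T₂ + 1) (μ.bind ν) Q' := by
  obtain ⟨κ, h1, h2, h3⟩ := Spec.seq h h'
  refine ⟨κ, h1, h2, fun K N hN => ?_⟩
  rw [← h3 K N hN]
  obtain ⟨M, rfl⟩ : ∃ M, N = M + 1 := ⟨N - 1, by omega⟩
  simp [run, step, hlt]

theorem Hoare.mono {w : ℕ} {P : Cmd} {s : State} {T T' : ℕ} {Q Q' : State → Prop}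
    (h : Hoare w P s T Q) (hT : T ≤ T') (hQ : ∀ s', Q s' → Q' s') : Hoare w P s T' Q' :=
  Spec.mono h hT fun _ => hQ

theorem Hoare.le {w : ℕ} {P : Cmd} {s : State} {T T' : ℕ} {Q : State → Prop}
    (h : Hoare w P s T Q) (hT : T ≤ T') : Hoare w P s T' Q := h.mono hT fun _ => id

theorem Hoare.frame {w : ℕ} {P : Cmd} {s : State} {T : ℕ} {Q : State → Prop}
    (h : Hoare w P s T Q) : Hoare w P s T fun s' => Q s' ∧ Frame w P s s' := Spec.frame h

theorem Hoare.seq {w : ℕ} {P R : Cmd} {s : State} {T₁ T₂ : ℕ} {Q Q' : State → Prop}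
    (h : Hoare w P s T₁ Q) (h' : ∀ s', Frame w P s s' → Q s' → Hoare w R s' T₂ Q') :
    Hoare w (.seq P R) s (T₁ + T₂ + 1) Q' := by
  have := Spec.seq h (ν := fun _ => PMF.pure ()) (Q' := fun _ => Q') fun _ s' => h' s'
  rwa [PMF.pure_bind] at this

/-- A deterministic program followed by a randomized one. -/
theorem Hoare.seqSpec {w : ℕ} {ι : Type} {P R : Cmd} {s : State} {T₁ T₂ : ℕ} {Q : State → Prop}
    {μ : PMF ι} {Q' : ι → State → Prop}
    (h : Hoare w P s T₁ Q) (h' : ∀ s', Frame w P s s' → Q s' → Spec w R s' T₂ μ Q') :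
    Spec w (.seq P R) s (T₁ + T₂ + 1) μ Q' := by
  have := Spec.seq h (ν := fun _ => μ) (Q' := Q') fun _ s' => h' s'
  rwa [PMF.pure_bind] at this

theorem Spec.seqHoare {w : ℕ} {ι : Type} {P R : Cmd} {s : State} {T₁ T₂ : ℕ}
    {μ : PMF ι} {Q Q' : ι → State → Prop}
    (h : Spec w P s T₁ μ Q)
    (h' : ∀ i s', Frame w P s s' → Q i s' → Hoare w R s' T₂ (Q' i)) :
    Spec w (.seq P R) s (T₁ + T₂ + 1) μ Q' := by
  have := Spec.seq h (ν := fun i => PMF.pure i) (Q' := Q') fun i s' hf hq => by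
    have := Spec.map (Q' := Q') (fun _ : Unit => i) (h' i s' hf hq) (fun _ _ h => h)
    rwa [PMF.pure_map] at this
  rwa [PMF.bind_pure] at this

theorem Hoare.of_step {w : ℕ} {P : Cmd} {s s' : State} {Q : State → Prop}
    (h : ∀ K, step w (P :: K, s) = PMF.pure (K, s')) (hQ : Q s') : Hoare w P s 1 Q :=
  Spec.of_step (f := fun _ => s') (fun K => by rw [h, PMF.pure_map]) fun _ _ => hQ

theorem Hoare.ite {w : ℕ} {x y : ℕ} {P R : Cmd} {s : State} {T : ℕ} {Q : State → Prop}
    (h₁ : s.reg x < s.reg y → Hoare w P s T Q) (h₂ : ¬ s.reg x < s.reg y → Hoare w R s T Q) :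
    Hoare w (.ite x y P R) s (T + 1) Q := by
  by_cases h : s.reg x < s.reg y
  · exact Spec.of_step_spec (fun K => by simp [step, h]) (h₁ h)
  · exact Spec.of_step_spec (fun K => by simp [step, h]) (h₂ h)

theorem Hoare.skip {w : ℕ} {s : State} {Q : State → Prop} (h : Q s) : Hoare w .skip s 1 Q :=
  Hoare.of_step (fun _ => rfl) h

/-- The effect of a loop-free deterministic program. -/
def exec (w : ℕ) : Cmd → State → State
  | .const x c, s => s.setReg x (c % 2 ^ w)
  | .arith x o y z, s => s.setReg x (o.eval (s.reg y) (s.reg z) % 2 ^ w)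
  | .load x a i, s => s.setReg x (s.mem a (s.reg i))
  | .store a i y, s => s.setMem a (s.reg i) (s.reg y)
  | .seq p q, s => exec w q (exec w p s)
  | .ite x y p q, s => if s.reg x < s.reg y then exec w p s else exec w q s
  | _, s => s

/-- A bound on the number of steps of a loop-free program. -/
def Cmd.time : Cmd → ℕ
  | .seq p q => p.time + q.time + 1
  | .ite _ _ p q => max p.time q.time + 1
  | _ => 1

/-- The program contains neither loops nor random draws. -/
def Cmd.straight : Cmd → Bool
  | .seq p q => p.straight && q.straight
  | .ite _ _ p q => p.straight && q.straight
  | .rand _ _ => false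
  | .loop _ _ _ => false
  | _ => true

theorem Hoare.exec {w : ℕ} {P : Cmd} {s : State} {T : ℕ} {Q : State → Prop}
    (hP : P.straight = true) (hT : P.time ≤ T) (h : Q (exec w P s)) : Hoare w P s T Q := by
  refine Hoare.le ?_ hT
  clear hT T
  induction P generalizing s Q with
  | skip => exact Hoare.skip h
  | const x c => exact Hoare.of_step (fun _ => rfl) h
  | arith x o y z => exact Hoare.of_step (fun _ => rfl) h
  | load x a i => exact Hoare.of_step (fun _ => rfl) h
  | store a i y => exact Hoare.of_step (fun _ => rfl) h
  | rand x m => simp [Cmd.straight] at hP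
  | seq p q ihp ihq =>
    simp only [Cmd.straight, Bool.and_eq_true] at hP
    exact Hoare.seq (ihp (Q := fun s' => s' = WordRAM.exec w p s) hP.1 rfl)
      fun s' _ hs' => ihq hP.2 (by subst hs'; exact h)
  | ite x y p q ihp ihq =>
    simp only [Cmd.straight, Bool.and_eq_true] at hP
    refine Hoare.ite (fun hc => (ihp hP.1 ?_).le (le_max_left _ _))
      fun hc => (ihq hP.2 ?_).le (le_max_right _ _)
    · simpa [WordRAM.exec, hc] using h
    · simpa [WordRAM.exec, hc] using h
  | loop x y p => simp [Cmd.straight] at hP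

/-- A loop with an invariant indexed by the number of finished iterations. -/
theorem Hoare.loop {w : ℕ} {x y : ℕ} {P : Cmd} {s : State} {c N : ℕ} {Inv : ℕ → State → Prop}
    (h0 : Inv 0 s)
    (hbody : ∀ k s', Inv k s' → Frame w P s s' → s'.reg x < s'.reg y →
      Hoare w P s' c (Inv (k + 1)))
    (hend : ∀ s', Inv N s' → ¬ s'.reg x < s'.reg y) :
    Hoare w (.loop x y P) s (N * (c + 1) + 1)
      fun s' => (∃ k ≤ N, Inv k s') ∧ ¬ s'.reg x < s'.reg y := by
  have key : ∀ m k s', k + m = N → Inv k s' → Frame w P s s' →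
      Hoare w (.loop x y P) s' (m * (c + 1) + 1)
        fun s' => (∃ k ≤ N, Inv k s') ∧ ¬ s'.reg x < s'.reg y := by
    intro m
    induction m with
    | zero =>
      intro k s' hk hI hF
      obtain rfl : k = N := by omega
      exact Hoare.le (Spec.loop_exit (hend s' hI) ⟨⟨k, le_rfl, hI⟩, hend s' hI⟩) (by omega)
    | succ m ih =>
      intro k s' hk hI hF
      by_cases hlt : s'.reg x < s'.reg y
      · have := Spec.loop_enter (ν := fun _ => PMF.pure ()) (T₂ := m * (c + 1) + 1)
          (Q' := fun _ s' => (∃ k ≤ N, Inv k s') ∧ ¬ s'.reg x < s'.reg y) hlt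
          (hbody k s' hI hF hlt) fun _ s'' hF' hI' => ih (k + 1) s'' (by omega) hI'
            ⟨fun z hz => (hF'.reg z hz).trans (hF.reg z hz),
              fun z hz => (hF'.mem z hz).trans (hF.mem z hz), fun h => hF'.word (hF.word h)⟩
        rw [PMF.pure_bind] at this
        exact Hoare.le this (by rw [Nat.succ_mul]; omega)
      · exact Hoare.le (Spec.loop_exit hlt ⟨⟨k, by omega, hI⟩, hlt⟩) (by omega)
  exact key N 0 s (by omega) h0 ⟨fun _ _ => rfl, fun _ _ => rfl, fun h => h⟩

/-- `HaltsWith` observes an isolated program at one fixed time, whereas `Hoare` must resume an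
arbitrary continuation as soon as each run has halted. The induction on `T` recovers the halting
time of every branch. This is needed for the multiplication program, of which nothing but
`HaltsWith` is known. -/
theorem HaltsWith.hoare {w T : ℕ} {P : Cmd} {s : State} {Q : State → Prop}
    (h : HaltsWith w T P s Q) : Hoare w P s T Q := by
  classical
  have key : ∀ T L s, (∀ c ∈ (run w T (L, s)).support, c.1 = [] ∧ Q c.2) →
      ∃ κ : PMF (State × ℕ), (∀ x ∈ κ.support, x.2 ≤ T ∧ Q x.1) ∧
        ∀ K N, T ≤ N → run w N (L ++ K, s) = κ.bind fun x => run w (N - x.2) (K, x.1) := by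
    intro T
    induction T with
    | zero =>
      intro L s h
      obtain ⟨h1, h2⟩ := h (L, s) (by simp [run])
      simp only at h1 h2
      subst h1
      exact ⟨PMF.pure (s, 0), by simpa using h2, by simp⟩
    | succ T ih =>
      intro L s h
      rcases L with _ | ⟨P, L⟩
      · refine ⟨PMF.pure (s, 0), ?_, by simp⟩
        have := h ([], s) (by rw [run_nil]; simp)
        simpa using this.2
      -- A step of a nonempty stack acts on its top only; the commands `K` below are carried along.
      · have hstep : ∀ K, step w (P :: L ++ K, s)
            = (step w (P :: L, s)).map fun c => (c.1 ++ K, c.2) := by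
          intro K
          cases P <;> simp [step, PMF.pure_map, PMF.map_comp, Function.comp_def]
          · split <;> rfl
          · split <;> rfl
        have key : ∀ c : Config, ∃ κ : PMF (State × ℕ), c ∈ (step w (P :: L, s)).support →
            (∀ x ∈ κ.support, x.2 ≤ T ∧ Q x.1) ∧
            ∀ K N, T ≤ N → run w N (c.1 ++ K, c.2) = κ.bind fun x => run w (N - x.2) (K, x.1) := by
          intro c
          by_cases hc : c ∈ (step w (P :: L, s)).support
          · obtain ⟨κ, hκ⟩ := ih c.1 c.2 fun c' hc' => h c' (by
              simp only [run, PMF.mem_support_bind_iff]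
              exact ⟨c, hc, hc'⟩)
            exact ⟨κ, fun _ => hκ⟩
          · exact ⟨PMF.pure (s, 0), fun h => (hc h).elim⟩
        choose κ hκ using key
        refine ⟨(step w (P :: L, s)).bind fun c => (κ c).map fun x => (x.1, x.2 + 1), ?_, ?_⟩
        · intro x hx
          rw [PMF.mem_support_bind_iff] at hx
          obtain ⟨c, hc, hx⟩ := hx
          rw [PMF.mem_support_map_iff] at hx
          obtain ⟨y, hy, rfl⟩ := hx
          have := (hκ c hc).1 y hy
          exact ⟨by dsimp only; omega, this.2⟩
        · intro K N hN
          obtain ⟨M, rfl⟩ : ∃ M, N = M + 1 := ⟨N - 1, by omega⟩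
          simp only [run, hstep, PMF.bind_map, PMF.bind_bind]
          refine pmf_bind_congr fun c hc => ?_
          simp only [Function.comp]
          rw [(hκ c hc).2 K M (by omega)]
          refine pmf_bind_congr fun y hy => ?_
          congr 1
          dsimp only
          omega
  obtain ⟨κ, h1, h2⟩ := key T [P] s h
  refine ⟨κ.map fun x => ((), x), ?_, ?_, fun K N hN => ?_⟩
  · rw [PMF.map_comp]
    exact PMF.map_const κ ()
  · intro x hx
    rw [PMF.mem_support_map_iff] at hx
    obtain ⟨y, hy, rfl⟩ := hx
    exact h1 y hy
  · rw [PMF.bind_map]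
    exact h2 K N hN

/-! ### Moving a program to fresh registers and segments -/

/-- The program with the names of all registers and segments shifted by `b`. -/
def Cmd.shift (b : ℕ) : Cmd → Cmd
  | .skip => .skip
  | .const x c => .const (x + b) c
  | .arith x o y z => .arith (x + b) o (y + b) (z + b)
  | .load x a i => .load (x + b) (a + b) (i + b)
  | .store a i y => .store (a + b) (i + b) (y + b)
  | .rand x m => .rand (x + b) (m + b)
  | .seq p q => .seq (p.shift b) (q.shift b)
  | .ite x y p q => .ite (x + b) (y + b) (p.shift b) (q.shift b)
  | .loop x y p => .loop (x + b) (y + b) (p.shift b)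

/-- The part of the state that a program shifted by `b` can see. -/
def State.shift (b : ℕ) (s : State) : State :=
  ⟨fun x => s.reg (x + b), fun a => s.mem (a + b)⟩

theorem Cmd.writes_shift {b x : ℕ} (h : x < b) (P : Cmd) : (P.shift b).writes x = false := by
  induction P <;> simp_all [Cmd.shift, Cmd.writes] <;> omega

theorem Cmd.stores_shift {b x : ℕ} (h : x < b) (P : Cmd) : (P.shift b).stores x = false := by
  induction P <;> simp_all [Cmd.shift, Cmd.stores] <;> omega

theorem State.shift_setReg (b : ℕ) (s : State) (x v : ℕ) :
    (s.setReg (x + b) v).shift b = (s.shift b).setReg x v := by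
  ext y <;> simp [State.shift, State.setReg, Function.update_apply]

theorem State.shift_setMem (b : ℕ) (s : State) (a i v : ℕ) :
    (s.setMem (a + b) i v).shift b = (s.shift b).setMem a i v := by
  ext y <;> simp [State.shift, State.setMem, Function.update_apply]

/-- Simulation: every step of the shifted program projects to a step of the original one. Inclusion
of supports is enough, because `HaltsWith` is a statement about all possible outcomes. -/
theorem step_shift {w b : ℕ} {L : List Cmd} {s : State} {c : Config}
    (h : c ∈ (step w (L.map (Cmd.shift b), s)).support) :
    ∃ L', c.1 = L'.map (Cmd.shift b) ∧ (L', c.2.shift b) ∈ (step w (L, s.shift b)).support := by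
  match L with
  | [] => simp [step] at h; subst h; exact ⟨[], by simp [step]⟩
  | .skip :: K => simp [step, Cmd.shift] at h; subst h; exact ⟨K, by simp [step]⟩
  | .const x v :: K =>
    simp [step, Cmd.shift] at h; subst h; exact ⟨K, by simp [step, State.shift_setReg]⟩
  | .arith x o y z :: K =>
    simp [step, Cmd.shift] at h; subst h
    exact ⟨K, by simp [step, State.shift_setReg]; simp [State.shift]⟩
  | .load x a i :: K =>
    simp [step, Cmd.shift] at h; subst h
    exact ⟨K, by simp [step, State.shift_setReg]; simp [State.shift]⟩
  | .store a i y :: K =>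
    simp [step, Cmd.shift] at h; subst h
    exact ⟨K, by simp [step, State.shift_setMem]; simp [State.shift]⟩
  | .rand x m :: K =>
    simp only [List.map_cons, Cmd.shift, step, PMF.mem_support_map_iff] at h
    obtain ⟨v, hv, rfl⟩ := h
    refine ⟨K, rfl, ?_⟩
    simp only [step, PMF.mem_support_map_iff, State.shift_setReg]
    exact ⟨v, hv, rfl⟩
  | .seq p q :: K =>
    simp [step, Cmd.shift] at h; subst h; exact ⟨p :: q :: K, by simp [step]⟩
  | .ite x y p q :: K =>
    simp [step, Cmd.shift] at h
    split at h
    · subst h; exact ⟨p :: K, by simp [step]; simp [State.shift, *]⟩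
    · subst h; exact ⟨q :: K, by simp [step]; simp [State.shift, *]⟩
  | .loop x y p :: K =>
    simp [step, Cmd.shift] at h
    split at h
    · subst h; exact ⟨p :: .loop x y p :: K, by simp [Cmd.shift], by simp [step]; simp [State.shift, *]⟩
    · subst h; exact ⟨K, by simp [step]; simp [State.shift, *]⟩

theorem HaltsWith.shift {w T : ℕ} {P : Cmd} {s : State} {Q : State → Prop} {b : ℕ}
    (h : HaltsWith w T P (s.shift b) Q) :
    HaltsWith w T (P.shift b) s fun s' => Q (s'.shift b) := by
  have key : ∀ T L s c, c ∈ (run w T (L.map (Cmd.shift b), s)).support →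
      ∃ L', c.1 = L'.map (Cmd.shift b) ∧
        (L', c.2.shift b) ∈ (run w T (L, s.shift b)).support := by
    intro T
    induction T with
    | zero => intro L s c hc; simp [run] at hc; subst hc; exact ⟨L, by simp [run]⟩
    | succ T ih =>
      intro L s c hc
      simp only [run, PMF.mem_support_bind_iff] at hc
      obtain ⟨⟨L1, s1⟩, h1, h2⟩ := hc
      obtain ⟨L2, e, h3⟩ := step_shift h1
      simp only at e h3
      subst e
      obtain ⟨L3, h4, h5⟩ := ih _ _ _ h2
      refine ⟨L3, h4, ?_⟩
      simp only [run, PMF.mem_support_bind_iff]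
      exact ⟨_, h3, h5⟩
  intro c hc
  obtain ⟨L', h1, h2⟩ := key T [P] s c hc
  have := h _ h2
  exact ⟨by rw [h1, show L' = [] from this.1]; rfl, this.2⟩

theorem Frame.trans {w : ℕ} {P P₁ P₂ : Cmd} {s s' s'' : State} (h₁ : Frame w P₁ s s')
    (h₂ : Frame w P₂ s' s'')
    (hw : ∀ x, P.writes x = false → P₁.writes x = false ∧ P₂.writes x = false)
    (hs : ∀ x, P.stores x = false → P₁.stores x = false ∧ P₂.stores x = false) :
    Frame w P s s'' :=
  ⟨fun x hx => (h₂.reg x (hw x hx).2).trans (h₁.reg x (hw x hx).1),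
    fun x hx => (h₂.mem x (hs x hx).2).trans (h₁.mem x (hs x hx).1),
    fun h => h₂.word (h₁.word h)⟩

/-! ### Counting loops -/

/-- `for i = 0, …, h - 1 do body`, where register `9` holds `1`. -/
def Cmd.forUp (i h : ℕ) (body : Cmd) : Cmd :=
  .seq (.const i 0) (.loop i h (.seq body (.arith i .add i 9)))

/-- The body leaves the control registers of a loop alone. -/
def Cmd.loopOk (i h : ℕ) (body : Cmd) : Bool :=
  !(body.writes i || body.writes h || body.writes 9 || h == i || 9 == i || 9 == h)

/-- The bound `lo + N < 2 ^ w` keeps the counter from wrapping around. `hst` lets the invariant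
ignore the counter, whose value `lo + j` is supplied to the body separately. -/
theorem loop_counter {w : ℕ} {i h : ℕ} {body : Cmd} {s : State} {c lo N : ℕ}
    {Inv : ℕ → State → Prop} (hok : body.loopOk i h = true) (h9 : s.reg 9 = 1)
    (hi : s.reg i = lo) (hh : s.reg h = lo + N) (hN : lo + N < 2 ^ w)
    (hst : ∀ j s v, Inv j s → Inv j (s.setReg i v)) (h0 : Inv 0 s)
    (hbody : ∀ j s', j < N → Frame w (.seq body (.arith i .add i 9)) s s' → s'.reg i = lo + j →
      Inv j s' → Hoare w body s' c (Inv (j + 1))) :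
    Hoare w (.loop i h (.seq body (.arith i .add i 9))) s (N * (c + 3) + 1) (Inv N) := by
  simp only [Cmd.loopOk, Bool.not_eq_true', Bool.or_eq_false_iff, beq_eq_false_iff_ne] at hok
  obtain ⟨⟨⟨⟨⟨hbi, hbh⟩, hb9⟩, hhi⟩, h9i⟩, -⟩ := hok
  refine (Hoare.loop (N := N) (c := c + 2)
    (Inv := fun k s => Inv k s ∧ s.reg i = lo + k ∧ k ≤ N ∧ s.reg h = lo + N ∧ s.reg 9 = 1)
    ⟨h0, by simpa using hi, by omega, hh, h9⟩ ?_ ?_).mono le_rfl ?_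
  · rintro k s' ⟨hI, hi', hk, hh', h9'⟩ hF hlt
    rw [hi', hh'] at hlt
    refine Hoare.seq (T₁ := c) (T₂ := 1) (hbody k s' (by omega) hF hi' hI) fun s1 hF1 hI1 => ?_
    refine Hoare.exec rfl le_rfl ?_
    have e1 : s1.reg i = lo + k := (hF1.reg i hbi).trans hi'
    have e2 : s1.reg h = lo + N := (hF1.reg h hbh).trans hh'
    have e3 : s1.reg 9 = 1 := (hF1.reg 9 hb9).trans h9'
    refine ⟨hst _ _ _ hI1, ?_, by omega, ?_, ?_⟩
    · simp only [exec, State.setReg_reg, Op.eval, e1, e3, if_true]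
      rw [Nat.mod_eq_of_lt (by omega)]; omega
    · simp [exec, State.setReg_reg, hhi, e2]
    · simp [exec, State.setReg_reg, h9i, e3]
  · rintro s' ⟨-, h1, -, h2, -⟩
    omega
  · rintro s' ⟨⟨k, hk, hI, h1, -, h2, -⟩, hlt⟩
    obtain rfl : k = N := by omega
    exact hI

theorem forUp_spec {w : ℕ} {i h : ℕ} {body : Cmd} {s : State} {c N : ℕ}
    (Inv : ℕ → State → Prop) (hok : body.loopOk i h = true) (h9 : s.reg 9 = 1)
    (hh : s.reg h = N) (hN : N < 2 ^ w)
    (hst : ∀ j s v, Inv j s → Inv j (s.setReg i v)) (h0 : Inv 0 s)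
    (hbody : ∀ j s', j < N → Frame w (.forUp i h body) s s' → s'.reg i = j →
      Inv j s' → Hoare w body s' c (Inv (j + 1))) :
    Hoare w (.forUp i h body) s (N * (c + 3) + 3) (Inv N) := by
  have hok' := hok
  simp only [Cmd.loopOk, Bool.not_eq_true', Bool.or_eq_false_iff, beq_eq_false_iff_ne] at hok'
  obtain ⟨⟨⟨⟨⟨hbi, hbh⟩, hb9⟩, hhi⟩, h9i⟩, -⟩ := hok'
  refine (Hoare.seq (T₁ := 1) (Q := fun s' => s' = s.setReg i 0) ?_ ?_).le (by omega)
    (T := 1 + (N * (c + 3) + 1) + 1)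
  · exact Hoare.exec rfl le_rfl (by simp [exec])
  · rintro s1 hF1 rfl
    refine loop_counter (lo := 0) hok ?_ ?_ ?_ (by omega) hst (hst _ _ _ h0) ?_
    · simp [State.setReg_reg, h9i, h9]
    · simp [State.setReg_reg]
    · simp [State.setReg_reg, hhi, hh]
    · intro j s' hj hF hi hI
      exact hbody j s' hj (hF1.trans hF (fun x hx => by simp_all [Cmd.forUp, Cmd.writes])
        fun x hx => by simp_all [Cmd.forUp, Cmd.stores]) (by simpa using hi) hI

/-! ### Instances, constant registers and traversal of adjacency lists -/

/-- The data of an instance: word length, number of vertices, integer parameters, adjacency lists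
and the graph they describe. -/
structure Data where
  (w n p r R θ L S : ℕ)
  (off nb : ℕ → ℕ)
  G : SimpleGraph ℕ
  n_pos : 1 ≤ n
  adj : ∀ u v, G.Adj u v ↔ u < n ∧ ∃ t, off u ≤ t ∧ t < off (u + 1) ∧ nb t = v
  nb_inj : ∀ u < n, ∀ t t', off u ≤ t → t < off (u + 1) → off u ≤ t' → t' < off (u + 1) →
    nb t = nb t' → t = t'
  off_mono : ∀ u < n, off u ≤ off (u + 1)
  deg_le : ∀ u < n, off (u + 1) ≤ off u + r
  off_lt : ∀ u, off u < 2 ^ w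
  rr : r * r ≤ n
  r_pos : 1 ≤ r
  θ_pos : 1 ≤ θ
  θ_le : θ ≤ n
  L_pos : 1 ≤ L
  p_pos : 1 ≤ p
  p_le : p ≤ n
  S_le : S ≤ n * n
  R_le : R ≤ n
  word : 16 * (n + 2) ^ 6 < 2 ^ w
  ppp : p * p * p ≤ S

namespace Data
variable (D : Data)

/-- The neighbours of `u` in the order of its adjacency list. -/
def nbrs (u : ℕ) : List ℕ := (List.range' (D.off u) (D.off (u + 1) - D.off u)).map D.nb

variable {D}

theorem lt_of_adj {u v : ℕ} (h : D.G.Adj u v) : u < D.n ∧ v < D.n :=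
  ⟨((D.adj u v).1 h).1, ((D.adj v u).1 h.symm).1⟩

theorem mem_nbrs {u v : ℕ} (hu : u < D.n) : v ∈ D.nbrs u ↔ D.G.Adj u v := by
  have := D.off_mono u hu
  simp only [nbrs, List.mem_map, List.mem_range'_1, D.adj, hu, true_and]
  refine exists_congr fun t => ?_
  omega

theorem nodup_nbrs {u : ℕ} (hu : u < D.n) : (D.nbrs u).Nodup := by
  have := D.off_mono u hu
  refine List.Nodup.map_on ?_ List.nodup_range'
  intro t ht t' ht' h
  simp only [List.mem_range'_1] at ht ht'
  exact D.nb_inj u hu t t' (by omega) (by omega) (by omega) (by omega) h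

theorem length_nbrs {u : ℕ} (hu : u < D.n) : (D.nbrs u).length ≤ D.r := by
  have := D.deg_le u hu
  simp only [nbrs, List.length_map, List.length_range']
  omega

theorem off_le {u v : ℕ} (huv : u ≤ v) (hv : v ≤ D.n) : D.off u ≤ D.off v := by
  induction v, huv using Nat.le_induction with
  | base => rfl
  | succ m hm ih => exact (ih (by omega)).trans (D.off_mono m (by omega))

theorem r_le : D.r ≤ D.n := by nlinarith [D.rr, D.r_pos]

theorem lt_word {x : ℕ} (h : x ≤ 16 * (D.n + 2) ^ 6) : x < 2 ^ D.w := h.trans_lt D.word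

theorem quartic_lt {x : ℕ} (h : x ≤ 16 * (D.n + 2) ^ 4) : x < 2 ^ D.w :=
  D.lt_word (h.trans (Nat.mul_le_mul_left _ (Nat.pow_le_pow_right (by omega) (by omega))))

theorem sq_lt {x : ℕ} (h : x ≤ 16 * (D.n + 2) ^ 2) : x < 2 ^ D.w :=
  D.lt_word (h.trans (Nat.mul_le_mul_left _ (Nat.pow_le_pow_right (by omega) (by omega))))

theorem idx_lt {n u v : ℕ} (hu : u < n) (hv : v < n) : u * n + v < n * n := by nlinarith

theorem idx_word {u v : ℕ} (hu : u < D.n) (hv : v < D.n) : u * D.n + v < 2 ^ D.w :=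
  D.sq_lt (by nlinarith [idx_lt hu hv])

theorem idx_inj {n u v u' v' : ℕ} (hv : v < n) (hv' : v' < n)
    (h : u * n + v = u' * n + v') : u = u' ∧ v = v' := by
  have h1 : u = u' := by
    have := congrArg (· / n) h
    simpa [Nat.add_div_of_dvd_right, Nat.mul_div_cancel _ (by omega : 0 < n),
      Nat.div_eq_of_lt hv, Nat.div_eq_of_lt hv', Nat.mul_add_div, Nat.mul_comm _ n,
      (by omega : 0 < n)] using this
  subst h1
  omega

end Data

/-- The constant registers and the input segments. -/
structure Env (D : Data) (s : State) : Prop where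
  word : s.IsWord D.w
  r0 : s.reg 0 = D.n
  r2 : s.reg 2 = D.S
  r3 : s.reg 3 = D.p
  r4 : s.reg 4 = D.r
  r5 : s.reg 5 = D.R
  r6 : s.reg 6 = D.θ
  r7 : s.reg 7 = D.L
  r8 : s.reg 8 = 0
  r9 : s.reg 9 = 1
  r10 : s.reg 10 = D.θ * D.r
  r11 : s.reg 11 = D.off D.n
  r12 : s.reg 12 = D.p + 1
  r13 : s.reg 13 = D.n * D.n
  r14 : s.reg 14 = 2 * D.n
  r15 : s.reg 15 = 4 * D.n
  m0 : s.mem 0 = D.off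
  m1 : s.mem 1 = D.nb

/-- The program changes neither the constant registers nor the input segments. -/
def Cmd.keeps (P : Cmd) : Bool :=
  ([0, 2, 3, 4, 5, 6, 7, 8, 9, 10, 11, 12, 13, 14, 15].all fun x => !P.writes x) &&
    !P.stores 0 && !P.stores 1

theorem Env.frame {D : Data} {P : Cmd} {s s' : State} (h : Env D s)
    (f : Frame D.w P s s') (hP : P.keeps = true) : Env D s' := by
  simp only [Cmd.keeps, List.all_cons, List.all_nil, Bool.and_true, Bool.and_eq_true,
    Bool.not_eq_true', and_assoc] at hP
  obtain ⟨h0, h2, h3, h4, h5, h6, h7, h8, h9, h10, h11, h12, h13, h14, h15, m0, m1⟩ := hP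
  exact ⟨f.word h.word, (f.reg _ h0).trans h.r0, (f.reg _ h2).trans h.r2, (f.reg _ h3).trans h.r3,
    (f.reg _ h4).trans h.r4, (f.reg _ h5).trans h.r5, (f.reg _ h6).trans h.r6,
    (f.reg _ h7).trans h.r7, (f.reg _ h8).trans h.r8, (f.reg _ h9).trans h.r9,
    (f.reg _ h10).trans h.r10, (f.reg _ h11).trans h.r11, (f.reg _ h12).trans h.r12,
    (f.reg _ h13).trans h.r13, (f.reg _ h14).trans h.r14, (f.reg _ h15).trans h.r15,
    (f.mem _ m0).trans h.m0, (f.mem _ m1).trans h.m1⟩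

/-- `for` all positions `t` of the adjacency list of `u` `do body`. -/
def Cmd.forNbr (u t h : ℕ) (body : Cmd) : Cmd :=
  .seq (.load t 0 u) (.seq (.arith h .add u 9) (.seq (.load h 0 h)
    (.loop t h (.seq body (.arith t .add t 9)))))

/-- The invariant is indexed by the prefix of the list already treated rather than by a number, so
that later invariants can be stated by filtering this prefix. -/
theorem forNbr_spec {D : Data} {u t h U : ℕ} {body : Cmd} {s : State} {c : ℕ}
    (Inv : List ℕ → State → Prop) (hE : Env D s)
    (hok : (body.loopOk t h && (u != t)) = true) (hu : s.reg u = U) (hU : U < D.n)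
    (hst : ∀ l s v, Inv l s → Inv l (s.setReg t v))
    (hst' : ∀ l s v, Inv l s → Inv l (s.setReg h v)) (h0 : Inv [] s)
    (hbody : ∀ l x s', l ++ [x] <+: D.nbrs U → Frame D.w (.forNbr u t h body) s s' →
      D.off U ≤ s'.reg t → s'.reg t < D.off (U + 1) → D.nb (s'.reg t) = x →
      Inv l s' → Hoare D.w body s' c (Inv (l ++ [x]))) :
    Hoare D.w (.forNbr u t h body) s (D.r * (c + 3) + 7) (Inv (D.nbrs U)) := by
  rw [Bool.and_eq_true] at hok
  obtain ⟨hok, hut⟩ := hok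
  have hok' := hok
  simp only [Cmd.loopOk, Bool.not_eq_true', Bool.or_eq_false_iff, beq_eq_false_iff_ne] at hok'
  obtain ⟨⟨⟨⟨⟨hbi, hbh⟩, hb9⟩, hhi⟩, h9i⟩, h9h⟩ := hok'
  simp only [bne_iff_ne, ne_eq] at hut
  set N := D.off (U + 1) - D.off U with hNdef
  have hmono := D.off_mono U hU
  have hdeg := D.deg_le U hU
  have hword : U + 1 < 2 ^ D.w := D.sq_lt (by nlinarith)
  have hpre : ∀ j < N, ((D.nbrs U).take j ++ [D.nb (D.off U + j)]) = (D.nbrs U).take (j + 1) := by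
    intro j hj
    rw [List.take_add_one, List.getElem?_eq_getElem (by simpa [Data.nbrs] using hj)]
    simp [Data.nbrs]
  have main : ∀ s1, s1 = (((s.setReg t (D.off U)).setReg h (U + 1)).setReg h (D.off (U + 1))) →
      Frame D.w (.forNbr u t h body) s s1 →
      Hoare D.w (.loop t h (.seq body (.arith t .add t 9))) s1 (N * (c + 3) + 1)
        (Inv (D.nbrs U)) := by
    intro s1 hs1 hF1
    have hlen : (D.nbrs U).take N = D.nbrs U := by
      apply List.take_of_length_le; simp [Data.nbrs, hNdef]
    rw [← hlen]
    refine loop_counter (lo := D.off U) (Inv := fun j s => Inv ((D.nbrs U).take j) s) hok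
      ?_ ?_ ?_ ?_ (fun j s v => hst _ s v) ?_ ?_
    · subst hs1; simp [State.setReg_reg, h9i, h9h, hE.r9]
    · subst hs1; simp [State.setReg_reg, Ne.symm hhi]
    · subst hs1; simp [State.setReg_reg]; omega
    · have := D.off_lt (U + 1); omega
    · subst hs1; exact hst' _ _ _ (hst' _ _ _ (hst _ _ _ (by simpa using h0)))
    · intro j s' hj hF hi hI
      rw [← hpre j hj]
      refine hbody _ _ s' ?_ (hF1.trans hF (fun x hx => by simp_all [Cmd.forNbr, Cmd.writes])
        fun x hx => by simp_all [Cmd.forNbr, Cmd.stores]) (by omega) (by omega) (by rw [hi]) hI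
      rw [hpre j hj]
      exact List.take_prefix _ _
  refine (Hoare.seq (T₁ := 1) (T₂ := 1 + (1 + (N * (c + 3) + 1) + 1) + 1)
    (Q := fun s' => s' = s.setReg t (D.off U)) (Hoare.exec rfl le_rfl ?_) ?_).le ?_
  · simp [exec, hE.m0, hu]
  · rintro s1 hF1 rfl
    refine Hoare.seq (Q := fun s' => s' = (s.setReg t (D.off U)).setReg h (U + 1))
      (Hoare.exec rfl le_rfl ?_) ?_
    · simp [exec, Op.eval, State.setReg_reg, hu, h9i, hE.r9, hut, Nat.mod_eq_of_lt hword]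
    · rintro s2 hF2 rfl
      refine Hoare.seq (Q := fun s' => s' =
        ((s.setReg t (D.off U)).setReg h (U + 1)).setReg h (D.off (U + 1)))
        (Hoare.exec rfl le_rfl ?_) ?_
      · simp [exec, State.setReg_reg, State.setReg_mem, hE.m0]
      · rintro s3 hF3 rfl
        refine main _ rfl ⟨fun x hx => ?_, fun x hx => ?_, fun hw => hF3.word (hF2.word (hF1.word hw))⟩
        · simp [Cmd.forNbr, Cmd.writes] at hx
          simp [State.setReg_reg, hx]
        · rfl
  · have : N * (c + 3) ≤ D.r * (c + 3) := Nat.mul_le_mul_right _ (by omega)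
    omega

/-! ### Adjacency tests in uninitialized memory -/

/-- Register `32` receives `1` or `0` according to whether the vertices in registers `30` and `31`
are adjacent in the graph represented by segment `12`. -/
def adjTest : Cmd :=
  .seq (.arith 33 .mul 30 0) <| .seq (.arith 33 .add 33 31) <| .seq (.load 33 12 33) <|
  .seq (.load 34 0 30) <| .seq (.arith 35 .add 30 9) <| .seq (.load 35 0 35) <|
  .seq (.load 36 1 33) <| .seq (.const 32 0) <|
  .ite 33 34 .skip (.ite 33 35 (.ite 36 31 .skip (.ite 31 36 .skip (.const 32 1))) .skip)

/-- The memory segment `m` represents the graph `H`. -/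
def Alive (D : Data) (H : SimpleGraph ℕ) (m : ℕ → ℕ) : Prop :=
  ∀ u v, u < D.n → v < D.n → (H.Adj u v ↔ D.off u ≤ m (u * D.n + v) ∧
    m (u * D.n + v) < D.off (u + 1) ∧ D.nb (m (u * D.n + v)) = v)

-- The table entry at `u * n + v` is only a claim that `v` occurs at some position of the list of
-- `u`, and the test verifies this claim. An uninitialized word is therefore harmless: when tested
-- against the range of the list and its contents, it cannot feign adjacency in the input graph.
open Classical in
theorem adjTest_spec {D : Data} {H : SimpleGraph ℕ} {s : State} {u v : ℕ} (hE : Env D s)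
    (hA : Alive D H (s.mem 12)) (h30 : s.reg 30 = u) (h31 : s.reg 31 = v) (hu : u < D.n)
    (hv : v < D.n) :
    Hoare D.w adjTest s 30 fun s' => s'.reg 32 = if H.Adj u v then 1 else 0 := by
  refine Hoare.exec rfl (by decide) ?_
  have e1 : u * D.n % 2 ^ D.w = u * D.n := Nat.mod_eq_of_lt (by have := D.idx_word hu hv; omega)
  have e2 : (u * D.n + v) % 2 ^ D.w = u * D.n + v := Nat.mod_eq_of_lt (D.idx_word hu hv)
  have e3 : (u + 1) % 2 ^ D.w = u + 1 := Nat.mod_eq_of_lt (D.sq_lt (by nlinarith))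
  have e4 : 1 % 2 ^ D.w = 1 := Nat.mod_eq_of_lt (D.sq_lt (by nlinarith))
  simp [adjTest, exec, State.setReg_reg, State.setReg_mem, Op.eval, hE.r0, hE.r9, hE.m0, hE.m1,
    h30, h31, e1, e2, e3, e4, hA u v hu hv, -Nat.one_mod_two_pow_eq_one]
  generalize s.mem 12 (u * D.n + v) = t
  split_ifs <;> simp_all [State.setReg_reg] <;> omega

/-- `x := y`, where register `8` holds `0`. -/
def Cmd.copy (x y : ℕ) : Cmd := .arith x .add y 8

/-- Adjacency test for the vertices in registers `a` and `b`. -/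
def Cmd.adjPre (a b : ℕ) : Cmd := .seq (.copy 30 a) (.seq (.copy 31 b) adjTest)

/-- Run `P` if the vertices in registers `a` and `b` are adjacent. -/
def Cmd.ifAdj (a b : ℕ) (P : Cmd) : Cmd := .seq (.adjPre a b) (.ite 8 32 P .skip)

open Classical in
theorem adjPre_spec {D : Data} {H : SimpleGraph ℕ} {s : State} {a b u v : ℕ}
    (hE : Env D s) (hA : Alive D H (s.mem 12)) (hb30 : b ≠ 30) (ha : s.reg a = u)
    (hb : s.reg b = v) (hu : u < D.n) (hv : v < D.n) :
    Hoare D.w (.adjPre a b) s 34 fun s' => s'.reg 32 = if H.Adj u v then 1 else 0 := by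
  have e1 : u % 2 ^ D.w = u := Nat.mod_eq_of_lt (D.sq_lt (by nlinarith))
  have e2 : v % 2 ^ D.w = v := Nat.mod_eq_of_lt (D.sq_lt (by nlinarith))
  refine Hoare.seq (T₁ := 1) (T₂ := 32) (Q := fun s' => s' = s.setReg 30 u)
    (Hoare.exec rfl le_rfl ?_) ?_
  · simp [exec, Cmd.copy, Op.eval, ha, hE.r8, e1]
  · rintro s1 hF1 rfl
    have hE1 := hE.frame hF1 rfl
    refine Hoare.seq (T₁ := 1) (T₂ := 30) (Q := fun s' => s' = (s.setReg 30 u).setReg 31 v)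
      (Hoare.exec rfl le_rfl ?_) ?_
    · simp [exec, Cmd.copy, Op.eval, hb, State.setReg_reg, hE.r8, e2, hb30]
    · rintro s2 hF2 rfl
      exact adjTest_spec (hE1.frame hF2 rfl) hA (by simp [State.setReg_reg])
        (by simp [State.setReg_reg]) hu hv

theorem ifAdj_spec {D : Data} {H : SimpleGraph ℕ} {s : State} {a b u v c : ℕ} {P : Cmd}
    {Q : State → Prop} (hE : Env D s) (hA : Alive D H (s.mem 12)) (hb30 : b ≠ 30)
    (ha : s.reg a = u) (hb : s.reg b = v) (hu : u < D.n) (hv : v < D.n)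
    (h₁ : H.Adj u v → ∀ s', Frame D.w (.adjPre a b) s s' → Hoare D.w P s' c Q)
    (h₂ : ¬ H.Adj u v → ∀ s', Frame D.w (.adjPre a b) s s' → Q s') (hc : 1 ≤ c := by omega) :
    Hoare D.w (.ifAdj a b P) s (c + 36) Q := by
  refine (Hoare.seq (T₁ := 34) (T₂ := c + 1) (adjPre_spec hE hA hb30 ha hb hu hv) ?_).le
    (by omega)
  intro s1 hF1 h32
  have h8 := (hE.frame hF1 rfl).r8
  refine Hoare.ite (fun hlt => ?_) fun hlt => ?_
  · rw [h8, h32] at hlt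
    split_ifs at hlt with h
    · exact h₁ h s1 hF1
    · omega
  · rw [h8, h32] at hlt
    split_ifs at hlt with h
    · omega
    · exact (Hoare.skip (h₂ h s1 hF1)).le hc

/-! ### Lists, buckets and the enumeration of all arcs -/

/-- The list `l` is stored in `m` from position `b` on. -/
def ListAt (m : ℕ → ℕ) (b : ℕ) (l : List ℕ) : Prop :=
  ∀ i (h : i < l.length), m (b + i) = l[i]

theorem ListAt.nil {m : ℕ → ℕ} {b : ℕ} : ListAt m b [] := fun i h => absurd h (by simp)

theorem ListAt.append {m : ℕ → ℕ} {b x : ℕ} {l : List ℕ} (h : ListAt m b l) :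
    ListAt (Function.update m (b + l.length) x) b (l ++ [x]) := by
  intro i hi
  rw [List.length_append, List.length_singleton] at hi
  rw [List.getElem_append, Function.update_apply]
  split_ifs with h1 h2 h2
  · omega
  · have : i = l.length := by omega
    simp [this]
  · exact h i h2
  · omega

theorem ListAt.update {m : ℕ → ℕ} {b k x : ℕ} {l : List ℕ} (h : ListAt m b l)
    (hk : k < b ∨ b + l.length ≤ k) : ListAt (Function.update m k x) b l := by
  intro i hi
  rw [Function.update_of_ne (by omega)]
  exact h i hi

theorem ListAt.eq_map {m : ℕ → ℕ} {b : ℕ} {l : List ℕ} (h : ListAt m b l) :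
    (List.range' b l.length).map m = l := by
  refine List.ext_getElem (by simp) fun i h1 h2 => ?_
  simpa using h i h2

/-- Bucket `b` with capacity `M` contains the list `l`. -/
def Bucket (cnt data : ℕ → ℕ) (M b : ℕ) (l : List ℕ) : Prop :=
  cnt b = l.length ∧ ListAt data (b * M) l

theorem ListAt.update_bucket {data : ℕ → ℕ} {M b b₀ i x : ℕ} {l : List ℕ}
    (h : ListAt data (b * M) l) (hl : l.length ≤ M) (hb : b ≠ b₀) (hi : i < M) :
    ListAt (Function.update data (b₀ * M + i) x) (b * M) l := by
  refine h.update ?_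
  rcases lt_or_gt_of_ne hb with h | h
  · right
    have : (b + 1) * M ≤ b₀ * M := Nat.mul_le_mul_right _ h
    rw [Nat.succ_mul] at this; omega
  · left
    have : (b₀ + 1) * M ≤ b * M := Nat.mul_le_mul_right _ h
    rw [Nat.succ_mul] at this; omega

/-- Buckets have disjoint address ranges of `M` cells, so an append that respects the capacity of
its bucket leaves the other buckets intact. -/
theorem Bucket.update {cnt data : ℕ → ℕ} {M b b₀ x : ℕ} {l l₀ : List ℕ}
    (h : Bucket cnt data M b l) (h₀ : Bucket cnt data M b₀ l₀) (hl : l.length ≤ M)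
    (hl₀ : l₀.length < M) :
    Bucket (Function.update cnt b₀ (l₀.length + 1))
      (Function.update data (b₀ * M + l₀.length) x) M b (if b = b₀ then l₀ ++ [x] else l) := by
  split_ifs with hb
  · subst hb
    exact ⟨by simp, h₀.2.append⟩
  · exact ⟨by rw [Function.update_of_ne hb]; exact h.1, h.2.update_bucket hl hb hl₀⟩

namespace Data
variable (D : Data)

/-- All ordered pairs of adjacent vertices, in the order of the adjacency lists of the first `m`
vertices. -/
def arcs (m : ℕ) : List (ℕ × ℕ) := (List.range m).flatMap fun u => (D.nbrs u).map (Prod.mk u)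

variable {D}

theorem arcs_succ (m : ℕ) : D.arcs (m + 1) = D.arcs m ++ (D.nbrs m).map (Prod.mk m) := by
  simp [arcs, List.range_succ]

theorem arcs_prefix {m m' : ℕ} (h : m ≤ m') : D.arcs m <+: D.arcs m' := by
  induction m', h using Nat.le_induction with
  | base => exact List.prefix_rfl
  | succ k hk ih => exact ih.trans (by rw [arcs_succ]; exact List.prefix_append _ _)

theorem mem_arcs {u v : ℕ} : (u, v) ∈ D.arcs D.n ↔ D.G.Adj u v := by
  simp only [arcs, List.mem_flatMap, List.mem_range, List.mem_map, Prod.mk.injEq]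
  constructor
  · rintro ⟨a, ha, b, hb, rfl, rfl⟩
    exact (mem_nbrs ha).1 hb
  · intro h
    exact ⟨u, (lt_of_adj h).1, v, (mem_nbrs (lt_of_adj h).1).2 h, rfl, rfl⟩

theorem nodup_arcs : (D.arcs D.n).Nodup := by
  rw [arcs, List.nodup_flatMap]
  refine ⟨fun u hu => (nodup_nbrs (by simpa using hu)).map (Prod.mk_right_injective u), ?_⟩
  refine List.Nodup.pairwise_of_forall_ne List.nodup_range fun a _ b _ hab => ?_
  simp only [Function.onFun, List.Disjoint, List.mem_map]
  rintro ⟨x, y⟩ ⟨z, -, h⟩ ⟨z', -, h'⟩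
  simp only [Prod.mk.injEq] at h h'
  omega

theorem length_arcs : (D.arcs D.n).length ≤ D.n * D.r := by
  simp only [arcs, List.length_flatMap, List.length_map]
  refine (List.sum_le_card_nsmul _ D.r ?_).trans (by simp)
  intro x hx
  simp only [List.mem_map, List.mem_range] at hx
  obtain ⟨u, hu, rfl⟩ := hx
  exact length_nbrs hu

end Data

/-- `for` all `(u, x)` with `x` in the adjacency list of `u` `do body`. -/
def Cmd.forArcs (u t h : ℕ) (body : Cmd) : Cmd := .forUp u 0 (.forNbr u t h body)

theorem forArcs_spec {D : Data} {u t h : ℕ} {body : Cmd} {s : State} {c : ℕ}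
    (Inv : List (ℕ × ℕ) → State → Prop) (hE : Env D s)
    (hok : (body.loopOk t h && (u != t) && (Cmd.forNbr u t h body).loopOk u 0 &&
      (Cmd.forArcs u t h body).keeps) = true)
    (hst : ∀ l s v, Inv l s → Inv l (s.setReg u v) ∧ Inv l (s.setReg t v) ∧ Inv l (s.setReg h v))
    (h0 : Inv [] s)
    (hbody : ∀ l U x s', l ++ [(U, x)] <+: D.arcs D.n → D.G.Adj U x → Env D s' →
      Frame D.w (.forArcs u t h body) s s' → s'.reg u = U →
      D.off U ≤ s'.reg t → s'.reg t < D.off (U + 1) → D.nb (s'.reg t) = x →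
      Inv l s' → Hoare D.w body s' c (Inv (l ++ [(U, x)]))) :
    Hoare D.w (.forArcs u t h body) s (D.n * (D.r * (c + 3) + 10) + 3) (Inv (D.arcs D.n)) := by
  simp only [Bool.and_eq_true] at hok
  obtain ⟨⟨⟨hok1, hok2⟩, hok3⟩, hok4⟩ := hok
  have hwu : (Cmd.forNbr u t h body).writes u = false := by
    simp only [Cmd.loopOk, Bool.not_eq_true', Bool.or_eq_false_iff] at hok3
    exact hok3.1.1.1.1.1
  refine forUp_spec (c := D.r * (c + 3) + 7) (fun j s => Inv (D.arcs j) s) hok3 hE.r9 hE.r0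
    (D.sq_lt (by nlinarith)) (fun j s v hI => (hst _ s v hI).1) (by simpa [Data.arcs] using h0) ?_
  intro j s' hj hF hu hI
  have hE' := hE.frame hF hok4
  rw [Data.arcs_succ]
  refine forNbr_spec (fun l s => Inv (D.arcs j ++ l.map (Prod.mk j)) s) hE'
    (by simp [hok1, hok2]) hu hj (fun l s v hI => (hst _ s v hI).2.1)
    (fun l s v hI => (hst _ s v hI).2.2) (by simpa using hI) ?_
  intro l x s'' hl hF' h1 h2 h3 hI'
  have hx : x ∈ D.nbrs j := hl.subset (by simp)
  have hFF : Frame D.w (.forArcs u t h body) s s'' := hF.trans hF' (fun y hy => ⟨hy, by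
      simp [Cmd.forArcs, Cmd.forUp, Cmd.writes] at hy; exact hy.2.1⟩) fun y hy => ⟨hy, by
      simp [Cmd.forArcs, Cmd.forUp, Cmd.stores] at hy; exact hy⟩
  have := hbody (D.arcs j ++ l.map (Prod.mk j)) j x s'' ?_ ((Data.mem_nbrs hj).1 hx)
    (hE.frame hFF hok4) hFF ?_ h1 h2 h3 hI'
  · simpa using this
  · rw [List.append_assoc]
    refine List.IsPrefix.trans ?_ (Data.arcs_prefix (show j + 1 ≤ D.n by omega))
    rw [Data.arcs_succ, List.prefix_append_right_inj]
    simpa using hl.map (Prod.mk j)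
  · rw [hF'.reg u hwu, hu]

/-- Initialize the position table (segment `12`) and the table of marks (segment `13`). -/
def initTables : Cmd :=
  .forArcs 20 21 22 <| .seq (.load 23 1 21) <| .seq (.arith 24 .mul 20 0) <|
    .seq (.arith 24 .add 24 23) <| .seq (.store 12 24 21) (.store 13 24 8)

/-- Only the at most `n r` cells that belong to arcs are written, never all `n²` cells. For `Alive`
the remaining cells do not matter, since passing the test already proves adjacency; marks are only
ever consulted for adjacent pairs. -/
theorem initTables_spec {D : Data} {s : State} (hE : Env D s) :
    Hoare D.w initTables s (D.n * (D.r * 23 + 10) + 3) fun s' =>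
      Alive D D.G (s'.mem 12) ∧ ∀ u v, D.G.Adj u v → s'.mem 13 (u * D.n + v) = 0 := by
  refine (forArcs_spec (c := 20) (fun l s => ∀ u v, (u, v) ∈ l →
    (D.off u ≤ s.mem 12 (u * D.n + v) ∧ s.mem 12 (u * D.n + v) < D.off (u + 1) ∧
      D.nb (s.mem 12 (u * D.n + v)) = v) ∧ s.mem 13 (u * D.n + v) = 0) hE rfl
    (fun _ _ _ h => ⟨h, h, h⟩) (by simp) ?_).mono le_rfl ?_
  · intro l U x s' hl hadj hE' hF hu h1 h2 h3 hI
    refine Hoare.exec rfl (by decide) ?_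
    obtain ⟨hU, hx⟩ := Data.lt_of_adj hadj
    have e1 : U * D.n % 2 ^ D.w = U * D.n := Nat.mod_eq_of_lt (by have := D.idx_word hU hx; omega)
    have e2 : (U * D.n + x) % 2 ^ D.w = U * D.n + x := Nat.mod_eq_of_lt (D.idx_word hU hx)
    intro u v huv
    simp only [exec, State.setReg_reg, State.setReg_mem, State.setMem_reg, State.setMem_mem,
      Op.eval, hE'.r0, hE'.r8, hE'.m1, hu, h3, e1, e2, Function.update_apply, Nat.reduceEqDiff,
      if_true, if_false]
    by_cases hc : u * D.n + v = U * D.n + x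
    · rw [List.mem_append] at huv
      have hv : u < D.n ∧ v < D.n := by
        refine Data.lt_of_adj (Data.mem_arcs.1 (hl.subset (List.mem_append.2 huv)))
      obtain ⟨rfl, rfl⟩ := Data.idx_inj hv.2 hx hc
      simp [h1, h2, h3]
    · have : (u, v) ∈ l := by
        simp only [List.mem_append, List.mem_singleton, Prod.mk.injEq] at huv
        rcases huv with h | ⟨rfl, rfl⟩
        · exact h
        · exact (hc rfl).elim
      simpa [hc] using hI u v this
  · intro s' h
    refine ⟨fun u v hu hv => ⟨fun h' => (h u v (Data.mem_arcs.2 h')).1, fun h' => ?_⟩,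
      fun u v h' => (h u v (Data.mem_arcs.2 h')).2⟩
    exact (D.adj u v).2 ⟨hu, _, h'⟩

end WordRAM

namespace WordRAM

open Classical
-- Scanning the second neighbourhood of a vertex
namespace Data
variable (D : Data) (H : SimpleGraph ℕ) (v : ℕ)

/-- The neighbours of `v` in `H`, as a list. -/
noncomputable def nbrsIn : List ℕ := (D.nbrs v).filter (H.Adj v ·)

/-- The common neighbours of `v` and `y` in `H`, as a list. -/
noncomputable def common (y : ℕ) : List ℕ := (D.nbrsIn H v).filter (H.Adj · y)

/-- The number of common neighbours of `v` and `y` in `H`. -/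
noncomputable def codeg (y : ℕ) : ℕ := (D.common H v y).length

/-- The vertices that have at least `m` common neighbours with `v` in `H`, as a list. -/
noncomputable def popular (m : ℕ) : List ℕ := (List.range D.n).filter (m ≤ D.codeg H v ·)

/-- The number of edges between the neighbours of `v` and the vertices with at least `θ` common
neighbours with `v`. -/
noncomputable def weight : ℕ := ((D.popular H v D.θ).map (D.codeg H v)).sum

variable {D H v}

theorem mem_nbrsIn (hH : H ≤ D.G) {a : ℕ} : a ∈ D.nbrsIn H v ↔ v < D.n ∧ H.Adj v a := by
  simp only [nbrsIn, List.mem_filter, decide_eq_true_eq]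
  constructor
  · rintro ⟨h1, h2⟩
    exact ⟨(lt_of_adj (hH h2)).1, h2⟩
  · rintro ⟨h1, h2⟩
    exact ⟨(mem_nbrs h1).2 (hH h2), h2⟩

theorem mem_common (hH : H ≤ D.G) {a y : ℕ} :
    a ∈ D.common H v y ↔ v < D.n ∧ H.Adj v a ∧ H.Adj a y := by
  simp [common, mem_nbrsIn hH, and_assoc]

theorem length_nbrsIn (hv : v < D.n) : (D.nbrsIn H v).length ≤ D.r :=
  (List.length_filter_le _ _).trans (length_nbrs hv)

theorem codeg_le (hv : v < D.n) (y : ℕ) : D.codeg H v y ≤ D.r :=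
  (List.length_filter_le _ _).trans (length_nbrsIn hv)

theorem length_popular (m : ℕ) : (D.popular H v m).length ≤ D.n :=
  (List.length_filter_le _ _).trans (by simp)

theorem mem_popular {m y : ℕ} : y ∈ D.popular H v m ↔ y < D.n ∧ m ≤ D.codeg H v y := by
  simp [popular]

end Data

/-- Append register `23` to the bucket of vertex `29` (counters in segment `14`, data in `15`). -/
def pushCommon : Cmd :=
  .seq (.load 37 14 29) <| .seq (.arith 38 .mul 29 0) <| .seq (.arith 38 .add 38 37) <|
  .seq (.store 15 38 23) <| .seq (.arith 37 .add 37 9) (.store 14 29 37)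

/-- Append the vertex `23` to the bucket of each of its neighbours. -/
def scanInner : Cmd :=
  .forNbr 23 27 28 (.seq (.load 29 1 27) (.ifAdj 23 29 pushCommon))

/-- List the neighbours of vertex `25` from position `0` of segment `16` on, with their number in
register `26`, and for each vertex `y` the common neighbours of `25` and `y` in a bucket. -/
def scanNbrs : Cmd :=
  .seq (.forUp 20 0 (.store 14 20 8)) <| .seq (.const 26 0) <|
    .forNbr 25 21 22 (.seq (.load 23 1 21) (.ifAdj 25 23
      (.seq (.store 16 26 23) (.seq (.arith 26 .add 26 9) scanInner))))

theorem pushCommon_spec {D : Data} {s : State} {a y : ℕ} {B : ℕ → List ℕ} (hE : Env D s)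
    (ha : s.reg 23 = a) (hy : s.reg 29 = y) (hyn : y < D.n)
    (hB : ∀ z < D.n, Bucket (s.mem 14) (s.mem 15) D.n z (B z))
    (hlen : ∀ z < D.n, (B z).length < D.n) :
    Hoare D.w pushCommon s 20 fun s' => ∀ z < D.n,
      Bucket (s'.mem 14) (s'.mem 15) D.n z (if z = y then B y ++ [a] else B z) := by
  refine Hoare.exec rfl (by decide) fun z hz => ?_
  have h1 := hlen y hyn
  have e0 : s.mem 14 y = (B y).length := (hB y hyn).1
  have e1 : y * D.n % 2 ^ D.w = y * D.n := Nat.mod_eq_of_lt (by have := D.idx_word hyn h1; omega)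
  have e2 : (y * D.n + (B y).length) % 2 ^ D.w = y * D.n + (B y).length :=
    Nat.mod_eq_of_lt (D.idx_word hyn h1)
  have e3 : ((B y).length + 1) % 2 ^ D.w = (B y).length + 1 :=
    Nat.mod_eq_of_lt (D.sq_lt (by nlinarith))
  simp only [pushCommon, exec, State.setReg_reg, State.setReg_mem, State.setMem_reg,
    State.setMem_mem, Op.eval, hE.r0, hE.r9, ha, hy, e0, e1, e2, e3, Nat.reduceEqDiff,
    if_true, if_false]
  exact (hB z hz).update (hB y hyn) (hlen z hz).le h1

/-- The adjacency list of `a` has no repetitions, so each bucket receives `a` at most once. The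
spare cell demanded by `hlen` keeps every bucket below capacity even after this append. -/
theorem scanInner_spec {D : Data} {H : SimpleGraph ℕ} {s : State} {a : ℕ} {B : ℕ → List ℕ}
    (hE : Env D s) (hH : H ≤ D.G) (hA : Alive D H (s.mem 12)) (ha : s.reg 23 = a) (han : a < D.n)
    (hB : ∀ z < D.n, Bucket (s.mem 14) (s.mem 15) D.n z (B z))
    (hlen : ∀ z < D.n, (B z).length + 1 < D.n) :
    Hoare D.w scanInner s (D.r * 67 + 7) fun s' => ∀ z < D.n,
      Bucket (s'.mem 14) (s'.mem 15) D.n z (if H.Adj a z then B z ++ [a] else B z) := by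
  refine Hoare.mono (forNbr_spec (c := 64) (fun l s => ∀ z < D.n, Bucket (s.mem 14) (s.mem 15) D.n z
    (if z ∈ l ∧ H.Adj a z then B z ++ [a] else B z)) hE rfl ha han (fun _ _ _ h => h)
    (fun _ _ _ h => h) (by simpa using hB) ?_) le_rfl ?_
  · intro l x s' hl hF h1 h2 h3 hI
    have hx : x ∈ D.nbrs a := hl.subset (by simp)
    have hxn := (Data.lt_of_adj ((Data.mem_nbrs han).1 hx)).2
    have hxl : x ∉ l := by
      have := (Data.nodup_nbrs han).sublist hl.sublist
      rw [List.nodup_append] at this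
      exact fun h => this.2.2 x h x (by simp) rfl
    have hE' := hE.frame hF rfl
    refine Hoare.seq (T₁ := 1) (T₂ := 62) (Q := fun s1 => s1 = s'.setReg 29 x)
      (Hoare.exec rfl le_rfl (by simp [exec, hE'.m1, h3])) ?_
    rintro s1 hF1 rfl
    have hE1 := hE'.frame hF1 rfl
    refine (ifAdj_spec (c := 20) (H := H) hE1 (by simpa [State.setReg_mem, hF.mem 12 rfl] using hA)
      (by decide) (u := a) (v := x) ?_ (by simp [State.setReg_reg]) han hxn ?_ ?_).le (by omega)
    · simpa [State.setReg_reg] using (hF.reg 23 rfl).trans ha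
    · intro hadj s2 hF2
      refine (pushCommon_spec (a := a) (y := x) (hE1.frame hF2 rfl) ?_ ?_ hxn
        (B := fun z => if z ∈ l ∧ H.Adj a z then B z ++ [a] else B z) ?_ ?_).mono le_rfl ?_
      · rw [hF2.reg 23 rfl, State.setReg_reg]; simpa using (hF.reg 23 rfl).trans ha
      · rw [hF2.reg 29 rfl, State.setReg_reg]; simp
      · rw [hF2.mem 14 rfl, hF2.mem 15 rfl]; exact hI
      · intro z hz
        have := hlen z hz
        split_ifs <;> simp <;> omega
      · intro s3 h z hz
        have := h z hz
        by_cases hzx : z = x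
        · subst hzx; simpa [hxl, hadj] using this
        · simpa [hzx] using this
    · intro hadj s2 hF2 z hz
      rw [hF2.mem 14 rfl, hF2.mem 15 rfl]
      have := hI z hz
      by_cases hzx : z = x
      · subst hzx; simpa [hxl, hadj] using this
      · simpa [hzx] using this
  · intro s' h z hz
    have := h z hz
    by_cases hz : H.Adj a z
    · simpa [hz, (Data.mem_nbrs han).2 (hH hz)] using this
    · simpa [hz] using this

theorem scanNbrs_spec {D : Data} {H : SimpleGraph ℕ} {s : State} {v : ℕ}
    (hE : Env D s) (hH : H ≤ D.G) (hA : Alive D H (s.mem 12)) (hv : s.reg 25 = v) (hvn : v < D.n) :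
    Hoare D.w scanNbrs s (D.n * 300) fun s' =>
      s'.reg 26 = (D.nbrsIn H v).length ∧ ListAt (s'.mem 16) 0 (D.nbrsIn H v) ∧
      ∀ z < D.n, Bucket (s'.mem 14) (s'.mem 15) D.n z (D.common H v z) := by
  have hnw : D.n < 2 ^ D.w := D.sq_lt (by nlinarith)
  refine (Hoare.seq (T₁ := D.n * 4 + 3) (T₂ := 1 + (D.r * (D.r * 67 + 7 + 50 + 3) + 7) + 1)
    (Q := fun s1 => ∀ z < D.n, s1.mem 14 z = 0) ?_ ?_).le ?_
  · refine Hoare.mono (forUp_spec (c := 1) (fun j s1 => ∀ z < j, s1.mem 14 z = 0) rfl hE.r9 hE.r0 hnw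
      (fun _ _ _ h => h) (by simp) ?_) le_rfl fun _ h => h
    intro j s' hj hF hi hI
    refine Hoare.exec rfl le_rfl fun z hz => ?_
    have h8 : s'.reg 8 = 0 := (hF.reg 8 rfl).trans hE.r8
    simp only [exec, State.setMem_mem, if_true, Function.update_apply, hi, h8]
    split_ifs with h
    · rfl
    · exact hI z (by omega)
  · intro s1 hF1 hz1
    have hE1 := hE.frame hF1 rfl
    refine Hoare.seq (T₁ := 1) (Q := fun s2 => s2 = s1.setReg 26 0)
      (Hoare.exec rfl le_rfl (by simp [exec])) ?_
    rintro s2 hF2 rfl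
    have hE2 := hE1.frame hF2 rfl
    have hv2 : (s1.setReg 26 0).reg 25 = v := by
      simpa [State.setReg_reg] using (hF1.reg 25 rfl).trans hv
    refine Hoare.mono (forNbr_spec (c := D.r * 67 + 7 + 50) (fun l s =>
      s.reg 26 = (l.filter (H.Adj v ·)).length ∧ ListAt (s.mem 16) 0 (l.filter (H.Adj v ·)) ∧
      ∀ z < D.n, Bucket (s.mem 14) (s.mem 15) D.n z ((l.filter (H.Adj v ·)).filter (H.Adj · z)))
      hE2 rfl hv2 hvn (fun _ _ _ h => h)
      (fun _ _ _ h => h) ?_ ?_) le_rfl fun _ h => h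
    · refine ⟨by simp [State.setReg_reg], ListAt.nil, fun z hz => ⟨?_, ListAt.nil⟩⟩
      simpa [State.setReg_mem] using hz1 z hz
    · intro l x s' hl hF h1 h2 h3 hI
      have hx : x ∈ D.nbrs v := hl.subset (by simp)
      have hxn := (Data.lt_of_adj ((Data.mem_nbrs hvn).1 hx)).2
      have hE' := hE2.frame hF rfl
      have hll : l.length + 1 ≤ D.r := by
        have := hl.length_le
        have := Data.length_nbrs hvn
        simp at *; omega
      have hlen := (List.length_filter_le (fun y => decide (H.Adj v y)) l)
      refine (Hoare.seq (T₁ := 1) (T₂ := D.r * 67 + 7 + 48) (Q := fun s1 => s1 = s'.setReg 23 x)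
        (Hoare.exec rfl le_rfl (by simp [exec, hE'.m1, h3])) ?_).le (by omega)
      rintro s3 hF3 rfl
      have hE3 := hE'.frame hF3 rfl
      have hA3 : Alive D H ((s'.setReg 23 x).mem 12) := by
        rw [State.setReg_mem, hF.mem 12 rfl, State.setReg_mem, hF1.mem 12 rfl]; exact hA
      refine (ifAdj_spec (c := 1 + (1 + (D.r * 67 + 7) + 1) + 1) (H := H) hE3 hA3
        (by decide) (u := v) (v := x) ?_ (by simp [State.setReg_reg]) hvn hxn ?_ ?_).le (by omega)
      · simpa [State.setReg_reg] using (hF.reg 25 rfl).trans hv2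
      · intro hadj s4 hF4
        have hE4 := hE3.frame hF4 rfl
        have h26 : s4.reg 26 = (l.filter (H.Adj v ·)).length := by
          rw [hF4.reg 26 rfl]; simpa [State.setReg_reg] using hI.1
        have h23 : s4.reg 23 = x := by rw [hF4.reg 23 rfl]; simp [State.setReg_reg]
        refine Hoare.seq (T₁ := 1) (Q := fun s5 => s5 = s4.setMem 16 (l.filter (H.Adj v ·)).length x)
          (Hoare.exec rfl le_rfl (by simp [exec, h26, h23])) ?_
        rintro s5 hF5 rfl
        refine Hoare.seq (T₁ := 1) (Q := fun s6 =>
          s6 = (s4.setMem 16 (l.filter (H.Adj v ·)).length x).setReg 26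
            ((l.filter (H.Adj v ·)).length + 1)) (Hoare.exec rfl le_rfl ?_) ?_
        · simp only [exec, State.setMem_reg, h26, hE4.r9, Op.eval]
          rw [Nat.mod_eq_of_lt (D.sq_lt (by nlinarith [D.r_le]))]
        rintro s6 hF6 rfl
        have hE6 := (hE4.frame hF5 rfl).frame hF6 rfl
        have hm : ∀ a, a ≠ 16 → ((s4.setMem 16 (l.filter (H.Adj v ·)).length x).setReg 26
            ((l.filter (H.Adj v ·)).length + 1)).mem a = s'.mem a := by
          intro a ha
          rw [State.setReg_mem, State.setMem_mem, if_neg ha, hF4.mem a rfl, State.setReg_mem]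
        refine (Hoare.frame (scanInner_spec (H := H) (a := x) hE6 hH (by rw [hm 12 (by decide)]; exact hA3)
          (by simp [State.setReg_reg, State.setMem_reg, h23]) hxn
          (B := fun z => (l.filter (H.Adj v ·)).filter (H.Adj · z)) ?_ ?_)).mono le_rfl ?_
        · rw [hm 14 (by decide), hm 15 (by decide)]; exact hI.2.2
        · intro z hz
          have := List.length_filter_le (fun y => decide (H.Adj y z)) (l.filter (H.Adj v ·))
          have := D.r_le
          have hlt : (l.filter (H.Adj v ·)).length + 1 < D.n ∨ D.n ≤ (l.filter (H.Adj v ·)).length + 1 := by omega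
          rcases hlt with h | h
          · omega
          · exfalso
            -- Capacity of the buckets: the earlier neighbours, `x` and `v` itself are distinct
            -- vertices, so at most `n - 2` neighbours have been treated before `x`.
            have hnd : (x :: v :: l.filter (H.Adj v ·)).Nodup := by
              have hnd := (Data.nodup_nbrs hvn).sublist hl.sublist
              rw [List.nodup_append] at hnd
              refine List.nodup_cons.2 ⟨?_, List.nodup_cons.2 ⟨?_, hnd.1.filter _⟩⟩
              · simp only [List.mem_cons, List.mem_filter, not_or]
                exact ⟨hadj.ne', fun h => hnd.2.2 x h.1 x (by simp) rfl⟩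
              · simp
            have hsub : (x :: v :: l.filter (H.Adj v ·)) ⊆ List.range D.n := by
              intro y hy
              simp only [List.mem_cons, List.mem_filter, decide_eq_true_eq] at hy
              rw [List.mem_range]
              rcases hy with rfl | rfl | ⟨-, hy⟩
              · exact hxn
              · exact hvn
              · exact (Data.lt_of_adj (hH hy)).2
            have := (hnd.subperm hsub).length_le
            simp at this
            omega
        · rintro s7 ⟨h7, hF7⟩
          refine ⟨?_, ?_, fun z hz => ?_⟩
          · rw [hF7.reg 26 rfl]
            simp [State.setReg_reg, List.filter_append, hadj]
          · rw [hF7.mem 16 rfl, State.setReg_mem, State.setMem_mem, if_pos rfl, hF4.mem 16 rfl,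
              State.setReg_mem]
            have := hI.2.1.append (x := x)
            simpa [List.filter_append, hadj] using this
          · have := h7 z hz
            by_cases hz : H.Adj x z <;> simpa [List.filter_append, hadj, hz] using this
      · intro hadj s4 hF4
        have e : (l ++ [x]).filter (fun y => decide (H.Adj v y)) = l.filter (H.Adj v ·) := by
          simp [List.filter_append, hadj]
        rw [e, hF4.reg 26 rfl, hF4.mem 14 rfl, hF4.mem 15 rfl, hF4.mem 16 rfl]
        simpa [State.setReg_reg] using hI
  -- Here `r² ≤ n` makes the scan of a second neighbourhood linear in `n`.
  · have := D.rr
    have := D.r_le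
    have := D.n_pos
    nlinarith

/-- List the vertices with at least `θ` common neighbours (segment `16` from `2 n` on, number in
register `43`) and those with at least `L` common neighbours (from `4 n` on, number in register
`44`), and sum up the former numbers of common neighbours in register `45`. -/
def scanPopular : Cmd :=
  .seq (.const 43 0) <| .seq (.const 44 0) <| .seq (.const 45 0) <| .forUp 20 0 <|
    .seq (.load 23 14 20) <| .seq (.ite 23 6 .skip <|
      .seq (.arith 24 .add 14 43) <| .seq (.store 16 24 20) <| .seq (.arith 43 .add 43 9)
        (.arith 45 .add 45 23)) <|
    .ite 23 7 .skip <|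
      .seq (.arith 24 .add 15 44) <| .seq (.store 16 24 20) (.arith 44 .add 44 9)

/-- The result of the scan of the neighbourhood of `v`. -/
structure Scanned (D : Data) (H : SimpleGraph ℕ) (v : ℕ) (s : State) : Prop where
  r26 : s.reg 26 = (D.nbrsIn H v).length
  r43 : s.reg 43 = (D.popular H v D.θ).length
  r44 : s.reg 44 = (D.popular H v D.L).length
  r45 : s.reg 45 = D.weight H v
  bucket : ∀ z < D.n, Bucket (s.mem 14) (s.mem 15) D.n z (D.common H v z)
  nbrs : ListAt (s.mem 16) 0 (D.nbrsIn H v)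
  dense : ListAt (s.mem 16) (2 * D.n) (D.popular H v D.θ)
  high : ListAt (s.mem 16) (4 * D.n) (D.popular H v D.L)

theorem scanPopular_spec {D : Data} {H : SimpleGraph ℕ} {s : State} {v : ℕ}
    (hE : Env D s) (hvn : v < D.n) (h26 : s.reg 26 = (D.nbrsIn H v).length)
    (hS : ListAt (s.mem 16) 0 (D.nbrsIn H v))
    (hB : ∀ z < D.n, Bucket (s.mem 14) (s.mem 15) D.n z (D.common H v z)) :
    Hoare D.w scanPopular s (D.n * 60) (Scanned D H v) := by
  have hnw : D.n < 2 ^ D.w := D.sq_lt (by nlinarith)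
  let pop := fun j m => (List.range j).filter (m ≤ D.codeg H v ·)
  have hpop : ∀ j m, (pop j m).length ≤ j := fun j m =>
    (List.length_filter_le _ _).trans (by simp)
  have hr := D.r_le
  have hS' := Data.length_nbrsIn (H := H) hvn
  refine (Hoare.seq (T₁ := 1) (T₂ := 1 + (1 + (D.n * (30 + 3) + 3) + 1) + 1)
    (Q := fun s1 => s1 = s.setReg 43 0) (Hoare.exec rfl le_rfl (by simp [exec])) ?_).le
    (by have := D.n_pos; omega)
  rintro s1 hF1 rfl
  refine Hoare.seq (Q := fun s1 => s1 = (s.setReg 43 0).setReg 44 0)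
    (Hoare.exec rfl le_rfl (by simp [exec])) ?_
  rintro s1 hF2 rfl
  refine Hoare.seq (Q := fun s1 => s1 = ((s.setReg 43 0).setReg 44 0).setReg 45 0)
    (Hoare.exec rfl le_rfl (by simp [exec])) ?_
  rintro s1 hF3 rfl
  have hE3 := ((hE.frame hF1 rfl).frame hF2 rfl).frame hF3 rfl
  refine Hoare.mono (Hoare.frame (forUp_spec (fun j s => s.reg 43 = (pop j D.θ).length ∧
    s.reg 44 = (pop j D.L).length ∧ s.reg 45 = ((pop j D.θ).map (D.codeg H v)).sum ∧
    ListAt (s.mem 16) 0 (D.nbrsIn H v) ∧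
    ListAt (s.mem 16) (2 * D.n) (pop j D.θ) ∧ ListAt (s.mem 16) (4 * D.n) (pop j D.L))
    rfl hE3.r9 hE3.r0 hnw (fun _ _ _ h => h) ?_ ?_)) le_rfl ?_
  · simp only [pop, List.range_zero, List.filter_nil, List.length_nil, List.map_nil, List.sum_nil]
    exact ⟨rfl, rfl, rfl, hS, ListAt.nil, ListAt.nil⟩
  · intro j s' hj hF hi ⟨i1, i2, i3, i4, i5, i6⟩
    have hE' := hE3.frame hF rfl
    refine Hoare.exec rfl (by decide) ?_
    have hc : s'.mem 14 j = D.codeg H v j := by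
      rw [hF.mem 14 rfl]; exact (hB j hj).1
    have hcr : D.codeg H v j ≤ D.n := (D.codeg_le hvn j).trans hr
    have l1 := hpop j D.θ
    have l2 := hpop j D.L
    have e1 : ((pop j D.θ).length + 1) % 2 ^ D.w = (pop j D.θ).length + 1 :=
      Nat.mod_eq_of_lt (by omega)
    have e2 : ((pop j D.L).length + 1) % 2 ^ D.w = (pop j D.L).length + 1 :=
      Nat.mod_eq_of_lt (by omega)
    have e3 : (2 * D.n + (pop j D.θ).length) % 2 ^ D.w = 2 * D.n + (pop j D.θ).length :=
      Nat.mod_eq_of_lt (D.sq_lt (by nlinarith))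
    have e4 : (4 * D.n + (pop j D.L).length) % 2 ^ D.w = 4 * D.n + (pop j D.L).length :=
      Nat.mod_eq_of_lt (D.sq_lt (by nlinarith))
    have hsum : ((pop j D.θ).map (D.codeg H v)).sum ≤ D.n * D.n := by
      refine (List.sum_le_card_nsmul _ D.n ?_).trans ?_
      · intro x hx
        obtain ⟨y, -, rfl⟩ := List.mem_map.1 hx
        exact (D.codeg_le hvn y).trans hr
      · simp only [List.length_map, smul_eq_mul]
        exact Nat.mul_le_mul_right _ (by omega)
    have e5 : (((pop j D.θ).map (D.codeg H v)).sum + D.codeg H v j) % 2 ^ D.w =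
        ((pop j D.θ).map (D.codeg H v)).sum + D.codeg H v j :=
      Nat.mod_eq_of_lt (D.sq_lt (by nlinarith))
    have p : ∀ m, pop (j + 1) m = if D.codeg H v j < m then pop j m else pop j m ++ [j] := by
      intro m
      simp only [pop, List.range_succ, List.filter_append]
      split_ifs with h
      · simp [h]
      · simp [not_lt.1 h]
    -- The three lists start `2 n` apart and have at most `n` entries each, so appending to one does
    -- not touch another.
    have q1 : ∀ x, ListAt (Function.update (s'.mem 16) (2 * D.n + (pop j D.θ).length) x) 0
        (D.nbrsIn H v) := fun x => i4.update (by omega)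
    have q2 : ∀ x, ListAt (Function.update (s'.mem 16) (2 * D.n + (pop j D.θ).length) x) (4 * D.n)
        (pop j D.L) := fun x => i6.update (by omega)
    rw [p, p]
    by_cases c1 : D.codeg H v j < D.θ <;> by_cases c2 : D.codeg H v j < D.L <;>
      simp only [exec, State.setReg_reg, State.setReg_mem, State.setMem_reg, State.setMem_mem,
        Op.eval, hE'.r6, hE'.r7, hE'.r9, hE'.r15, hE'.r14, hi, hc, Nat.reduceEqDiff, if_true,
        if_false, c1, c2, i1, i2, i3, e1, e2, e3, e4, e5]
    · exact ⟨trivial, trivial, trivial, i4, i5, i6⟩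
    · exact ⟨trivial, by simp, trivial, i4.update (by omega), i5.update (by omega), i6.append⟩
    · exact ⟨by simp, trivial, by simp, q1 _, i5.append, q2 _⟩
    · exact ⟨by simp, by simp, by simp, (q1 _).update (by omega),
        i5.append.update (by simp; omega), (q2 _).append⟩
  · rintro s' ⟨⟨i1, i2, i3, i4, i5, i6⟩, hF⟩
    exact ⟨(hF.reg 26 rfl).trans h26, i1, i2, i3, fun z hz => by
      rw [hF.mem 14 rfl, hF.mem 15 rfl]; exact hB z hz, i4, i5, i6⟩

/-! ### Marks, and triangles whose third vertex has few common neighbours with `v` -/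

/-- The pair `u`, `v` is adjacent and marked in the memory segment `m`. -/
def Marked (D : Data) (m : ℕ → ℕ) (u v : ℕ) : Prop := D.G.Adj u v ∧ 0 < m (u * D.n + v)

/-- The edge `u v` is in a triangle. -/
def InTri (G : SimpleGraph ℕ) (u v : ℕ) : Prop := ∃ x, G.Adj u v ∧ G.Adj v x ∧ G.Adj u x

/-- Only edges of triangles are marked. -/
def MarksOK (D : Data) (m : ℕ → ℕ) : Prop := ∀ u v, Marked D m u v → InTri D.G u v

/-- Only edges of triangles have been marked on the way from `m` to `m'`. -/
def MStep (D : Data) (m m' : ℕ → ℕ) : Prop :=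
  (MarksOK D m → MarksOK D m') ∧ ∀ u v, Marked D m u v → Marked D m' u v

/-- All edges between the three vertices are marked. -/
def AllMarked (D : Data) (m : ℕ → ℕ) (a b c : ℕ) : Prop :=
  Marked D m a b ∧ Marked D m b a ∧ Marked D m b c ∧ Marked D m c b ∧ Marked D m a c ∧
    Marked D m c a

theorem MStep.refl {D : Data} {m : ℕ → ℕ} : MStep D m m := ⟨id, fun _ _ => id⟩

theorem MStep.trans {D : Data} {m m' m'' : ℕ → ℕ} (h : MStep D m m') (h' : MStep D m' m'') :
    MStep D m m'' := ⟨fun hm => h'.1 (h.1 hm), fun u v hm => h'.2 u v (h.2 u v hm)⟩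

theorem AllMarked.mono {D : Data} {m m' : ℕ → ℕ} {a b c : ℕ} (h : AllMarked D m a b c)
    (hm : MStep D m m') : AllMarked D m' a b c :=
  ⟨hm.2 _ _ h.1, hm.2 _ _ h.2.1, hm.2 _ _ h.2.2.1, hm.2 _ _ h.2.2.2.1, hm.2 _ _ h.2.2.2.2.1,
    hm.2 _ _ h.2.2.2.2.2⟩

theorem InTri.symm {G : SimpleGraph ℕ} {u v : ℕ} (h : InTri G u v) : InTri G v u := by
  obtain ⟨x, h1, h2, h3⟩ := h
  exact ⟨x, h1.symm, h3, h2⟩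

/-- Distinct pairs of vertices occupy distinct cells, so this write creates the mark of one pair
only, and that pair lies in a triangle. -/
theorem Marked.update {D : Data} {m : ℕ → ℕ} {u v : ℕ} (h : InTri D.G u v) :
    MStep D m (Function.update m (u * D.n + v) 1) ∧
      Marked D (Function.update m (u * D.n + v) 1) u v := by
  have h' := h
  obtain ⟨x, h1, -, -⟩ := h
  obtain ⟨hu, hv⟩ := Data.lt_of_adj h1
  refine ⟨⟨fun hm a b hab => ?_, fun a b hab => ⟨hab.1, ?_⟩⟩, h1, by simp⟩
  · by_cases hc : a * D.n + b = u * D.n + v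
    · obtain ⟨rfl, rfl⟩ := Data.idx_inj (Data.lt_of_adj hab.1).2 hv hc
      exact h'
    · refine hm a b ⟨hab.1, ?_⟩
      simpa [Function.update_apply, hc] using hab.2
  · rw [Function.update_apply]
    split_ifs
    · exact one_pos
    · exact hab.2

/-- Mark the edge between the vertices in registers `a` and `b`, in both directions. -/
def Cmd.mark (a b : ℕ) : Cmd :=
  .seq (.arith 33 .mul a 0) <| .seq (.arith 33 .add 33 b) <| .seq (.store 13 33 9) <|
  .seq (.arith 33 .mul b 0) <| .seq (.arith 33 .add 33 a) (.store 13 33 9)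

theorem mark_spec {D : Data} {s : State} {a b u v : ℕ} (hE : Env D s) (ha33 : a ≠ 33)
    (hb33 : b ≠ 33) (ha : s.reg a = u) (hb : s.reg b = v) (h : InTri D.G u v) :
    Hoare D.w (.mark a b) s 11 fun s' => MStep D (s.mem 13) (s'.mem 13) ∧
      Marked D (s'.mem 13) u v ∧ Marked D (s'.mem 13) v u := by
  have h' := h
  obtain ⟨x, h1, -, -⟩ := h
  obtain ⟨hu, hv⟩ := Data.lt_of_adj h1
  refine Hoare.exec rfl (le_of_eq rfl) ?_
  have e1 : u * D.n % 2 ^ D.w = u * D.n := Nat.mod_eq_of_lt (by have := D.idx_word hu hv; omega)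
  have e2 : (u * D.n + v) % 2 ^ D.w = u * D.n + v := Nat.mod_eq_of_lt (D.idx_word hu hv)
  have e3 : v * D.n % 2 ^ D.w = v * D.n := Nat.mod_eq_of_lt (by have := D.idx_word hv hu; omega)
  have e4 : (v * D.n + u) % 2 ^ D.w = v * D.n + u := Nat.mod_eq_of_lt (D.idx_word hv hu)
  simp only [Cmd.mark, exec, State.setReg_reg, State.setReg_mem, State.setMem_reg,
    State.setMem_mem, Op.eval, hE.r0, hE.r9, ha, hb, e1, e2, e3, e4, Nat.reduceEqDiff, if_true,
    if_false, ha33, hb33]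
  obtain ⟨a1, a2⟩ := Marked.update (m := s.mem 13) h'
  obtain ⟨b1, b2⟩ := Marked.update (m := Function.update (s.mem 13) (u * D.n + v) 1) h'.symm
  exact ⟨a1.trans b1, b1.2 _ _ a2, b2⟩

/-- Mark the triangles formed by the vertices `23`, `29` and those in the bucket of `29`. -/
def lowInner : Cmd :=
  .forUp 27 37 <| .seq (.arith 38 .mul 29 0) <| .seq (.arith 38 .add 38 27) <|
    .seq (.load 39 15 38) <|
      .ifAdj 39 23 <| .seq (.mark 39 23) <| .seq (.mark 23 29) (.mark 39 29)

/-- For each listed dense vertex, mark all its triangles with a neighbour of `v` and a third vertex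
with few common neighbours with `v`. -/
def lowLoop : Cmd :=
  .forUp 20 43 <| .seq (.arith 24 .add 14 20) <| .seq (.load 23 16 24) <|
    .forNbr 23 21 22 <| .seq (.load 29 1 21) <| .ifAdj 23 29 <| .seq (.load 37 14 29) <|
      .ite 37 7 lowInner .skip

/-- The apex `a` of a triangle with `b` and `y` that is a neighbour of `v` lies in the bucket of
`y`, since it is a common neighbour of `v` and `y`. Running through this bucket takes fewer than `L`
iterations. -/
theorem lowInner_spec {D : Data} {H : SimpleGraph ℕ} {s : State} {v b y : ℕ}
    (hE : Env D s) (hH : H ≤ D.G) (hA : Alive D H (s.mem 12)) (hv : v < D.n) (hb : s.reg 23 = b)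
    (hy : s.reg 29 = y) (hadj : H.Adj b y) (hc : s.reg 37 = D.codeg H v y)
    (hB : ListAt (s.mem 15) (y * D.n) (D.common H v y)) (hL : D.codeg H v y < D.L) :
    Hoare D.w lowInner s (D.L * 103 + 3) fun s' => MStep D (s.mem 13) (s'.mem 13) ∧
      ∀ a, H.Adj v a → H.Adj a y → H.Adj a b → AllMarked D (s'.mem 13) a b y := by
  obtain ⟨hbn, hyn⟩ := Data.lt_of_adj (hH hadj)
  have hcr := (D.codeg_le (H := H) hv y).trans D.r_le
  refine Hoare.mono (forUp_spec (c := 100) (fun j s1 => MStep D (s.mem 13) (s1.mem 13) ∧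
    ∀ i (hi : i < (D.common H v y).length), i < j →
      H.Adj (D.common H v y)[i] b → AllMarked D (s1.mem 13) (D.common H v y)[i] b y) rfl hE.r9 hc
    (D.sq_lt (by nlinarith)) (fun _ _ _ h => h) ⟨MStep.refl, by omega⟩ ?_) ?_ ?_
  · intro j s1 hj hF hi ⟨hI1, hI2⟩
    have hE1 := hE.frame hF rfl
    have hbr : s1.reg 23 = b := (hF.reg 23 rfl).trans hb
    have hyr : s1.reg 29 = y := (hF.reg 29 rfl).trans hy
    have hjn : j < D.n := by omega
    set a := (D.common H v y)[j]'hj with ha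
    have hmem : a ∈ D.common H v y := List.getElem_mem _
    rw [Data.mem_common hH] at hmem
    obtain ⟨-, hva, hay⟩ := hmem
    have han := (Data.lt_of_adj (hH hay)).1
    have hl : s1.mem 15 (y * D.n + j) = a := by rw [hF.mem 15 rfl]; exact hB j hj
    refine (Hoare.seq (T₁ := 1) (T₂ := 90) (Q := fun s2 => s2 = s1.setReg 38 (y * D.n))
      (Hoare.exec rfl le_rfl ?_) ?_).le (by omega)
    · simp only [exec, Op.eval, hyr, hE1.r0]
      rw [Nat.mod_eq_of_lt (by have := D.idx_word hyn hbn; omega)]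
    rintro s2 hF2 rfl
    have hE2 := hE1.frame hF2 rfl
    refine (Hoare.seq (T₁ := 1) (T₂ := 80) (Q := fun s2 => s2 = (s1.setReg 38 (y * D.n)).setReg 38
      (y * D.n + j)) (Hoare.exec rfl le_rfl ?_) ?_).le (by omega)
    · simp only [exec, Op.eval, State.setReg_reg, hi, Nat.reduceEqDiff, if_true, if_false]
      rw [Nat.mod_eq_of_lt (D.idx_word hyn hjn)]
    rintro s3 hF3 rfl
    have hE3 := hE2.frame hF3 rfl
    refine (Hoare.seq (T₁ := 1) (T₂ := 71) (Q := fun s2 => s2 = ((s1.setReg 38 (y * D.n)).setReg 38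
      (y * D.n + j)).setReg 39 a) (Hoare.exec rfl le_rfl ?_) ?_).le (by omega)
    · simp [exec, hl]
    rintro s4 hF4 rfl
    have hE4 := hE3.frame hF4 rfl
    have hcov : ∀ (m : ℕ → ℕ), MStep D (s1.mem 13) m → (H.Adj a b → AllMarked D m a b y) →
        MStep D (s.mem 13) m ∧ ∀ i (hi : i < (D.common H v y).length), i < j + 1 →
          H.Adj (D.common H v y)[i] b → AllMarked D m (D.common H v y)[i] b y := by
      intro m hm hm'
      refine ⟨hI1.trans hm, fun i hi hij hadj => ?_⟩
      by_cases hc : i = j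
      · subst hc; exact hm' hadj
      · exact (hI2 i hi (by omega) hadj).mono hm
    refine (ifAdj_spec (c := 35) (H := H) (u := a) (v := b) hE4
      (by simpa [hF.mem 12 rfl] using hA) (by decide) (by simp) (by simpa using hbr)
      han hbn ?_ ?_)
    · intro hab s5 hF5
      have hE5 := hE4.frame hF5 rfl
      refine Hoare.seq (T₁ := 11) (T₂ := 23) (mark_spec (u := a) (v := b) hE5 (by decide)
        (by decide) (by rw [hF5.reg 39 rfl]; simp) (by rw [hF5.reg 23 rfl]; simpa using hbr)
        ⟨y, hH hab, hH hadj, hH hay⟩) ?_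
      intro s6 hF6 h6
      refine Hoare.seq (T₁ := 11) (T₂ := 11) (mark_spec (u := b) (v := y) (hE5.frame hF6 rfl)
        (by decide) (by decide) (by rw [hF6.reg 23 rfl, hF5.reg 23 rfl]; simpa using hbr)
        (by rw [hF6.reg 29 rfl, hF5.reg 29 rfl]; simpa using hyr)
        ⟨a, hH hadj, hH hay.symm, hH hab.symm⟩) ?_
      intro s7 hF7 h7
      refine Hoare.mono (mark_spec (u := a) (v := y) ((hE5.frame hF6 rfl).frame hF7 rfl) (by decide)
        (by decide) (by rw [hF7.reg 39 rfl, hF6.reg 39 rfl, hF5.reg 39 rfl]; simp)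
        (by rw [hF7.reg 29 rfl, hF6.reg 29 rfl, hF5.reg 29 rfl]; simpa using hyr)
        ⟨b, hH hay, hH hadj.symm, hH hab⟩) le_rfl ?_
      intro s8 h8
      have hm5 : s5.mem 13 = s1.mem 13 := by rw [hF5.mem 13 rfl]; rfl
      rw [hm5] at h6
      refine hcov _ (h6.1.trans (h7.1.trans h8.1)) fun _ => ⟨?_, ?_, ?_, ?_, h8.2.1, h8.2.2⟩
      · exact h8.1.2 _ _ (h7.1.2 _ _ h6.2.1)
      · exact h8.1.2 _ _ (h7.1.2 _ _ h6.2.2)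
      · exact h8.1.2 _ _ h7.2.1
      · exact h8.1.2 _ _ h7.2.2
    · intro hab s5 hF5
      have hm5 : s5.mem 13 = s1.mem 13 := by rw [hF5.mem 13 rfl]; rfl
      rw [hm5]
      exact hcov _ MStep.refl fun h => (hab h).elim
  · nlinarith
  · rintro s' ⟨h1, h2⟩
    refine ⟨h1, fun a hva hay hab => ?_⟩
    obtain ⟨i, hi, rfl⟩ := List.getElem_of_mem ((Data.mem_common hH).2 ⟨hv, hva, hay⟩)
    exact h2 i hi hi hab

/-- Each dense vertex `b` has at most `r` neighbours `y`, and each of them costs `O(L)` by the bound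
on its bucket. -/
theorem lowLoop_spec {D : Data} {H : SimpleGraph ℕ} {s : State} {v : ℕ}
    (hE : Env D s) (hH : H ≤ D.G) (hA : Alive D H (s.mem 12)) (hv : v < D.n)
    (hS : Scanned D H v s) :
    Hoare D.w lowLoop s ((D.popular H v D.θ).length * (180 * (D.r * D.L)) + 3) fun s' =>
      MStep D (s.mem 13) (s'.mem 13) ∧
      ∀ b y, b < D.n → D.θ ≤ D.codeg H v b → H.Adj b y → D.codeg H v y < D.L →
        ∀ a, H.Adj v a → H.Adj a y → H.Adj a b → AllMarked D (s'.mem 13) a b y := by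
  have hlen := D.length_popular (H := H) (v := v) D.θ
  refine Hoare.mono (forUp_spec (c := D.r * (D.L * 103 + 58) + 13)
    (fun j s1 => MStep D (s.mem 13) (s1.mem 13) ∧
    ∀ i (hi : i < (D.popular H v D.θ).length), i < j → ∀ y,
      H.Adj (D.popular H v D.θ)[i] y → D.codeg H v y < D.L →
        ∀ a, H.Adj v a → H.Adj a y → H.Adj a (D.popular H v D.θ)[i] →
          AllMarked D (s1.mem 13) a (D.popular H v D.θ)[i] y) rfl hE.r9 hS.r43
    (D.sq_lt (by nlinarith)) (fun _ _ _ h => h) ⟨MStep.refl, by omega⟩ ?_) ?_ ?_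
  · intro j s1 hj hF hi ⟨hI1, hI2⟩
    have hE1 := hE.frame hF rfl
    set b := (D.popular H v D.θ)[j]'hj with hb
    have hbn : b < D.n := (Data.mem_popular.1 (List.getElem_mem hj)).1
    refine (Hoare.seq (T₁ := 1) (T₂ := D.r * (D.L * 103 + 58) + 10)
      (Q := fun s2 => s2 = s1.setReg 24 (2 * D.n + j))
      (Hoare.exec rfl le_rfl ?_) ?_).le (by omega)
    · simp only [exec, Op.eval, hi, hE1.r14]
      rw [Nat.mod_eq_of_lt (D.sq_lt (by nlinarith))]
    rintro s2 hF2 rfl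
    have hE2 := hE1.frame hF2 rfl
    refine (Hoare.seq (T₁ := 1) (T₂ := D.r * (D.L * 103 + 58) + 7)
      (Q := fun s2 => s2 = (s1.setReg 24 (2 * D.n + j)).setReg 23 b)
      (Hoare.exec rfl le_rfl ?_) ?_).le (by omega)
    · simp only [exec, State.setReg_reg, State.setReg_mem, if_true, hF.mem 16 rfl]
      rw [hS.dense j hj]
    rintro s3 hF3 rfl
    have hE3 := hE2.frame hF3 rfl
    refine Hoare.mono (forNbr_spec (fun l s2 => MStep D (s1.mem 13) (s2.mem 13) ∧
      ∀ y ∈ l, H.Adj b y → D.codeg H v y < D.L →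
        ∀ a, H.Adj v a → H.Adj a y → H.Adj a b → AllMarked D (s2.mem 13) a b y) hE3 rfl
      (U := b) (by simp) hbn (fun _ _ _ h => h) (fun _ _ _ h => h) ⟨MStep.refl, by simp⟩ ?_)
      le_rfl ?_
    · intro l y s4 hl hF4 _ _ hy hI
      have hE4 := hE3.frame hF4 rfl
      have hyn : y < D.n := (Data.lt_of_adj ((Data.mem_nbrs hbn).1 (hl.subset (by simp)))).2
      have hcov : ∀ (m : ℕ → ℕ), MStep D (s4.mem 13) m → (H.Adj b y → D.codeg H v y < D.L →
          ∀ a, H.Adj v a → H.Adj a y → H.Adj a b → AllMarked D m a b y) →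
          MStep D (s1.mem 13) m ∧ ∀ y' ∈ l ++ [y], H.Adj b y' → D.codeg H v y' < D.L →
          ∀ a, H.Adj v a → H.Adj a y' → H.Adj a b → AllMarked D m a b y' := by
        intro m hm hm'
        refine ⟨hI.1.trans hm, fun y' hy' => ?_⟩
        rw [List.mem_append, List.mem_singleton] at hy'
        rcases hy' with hy' | rfl
        · exact fun h1 h2 a h3 h4 h5 => (hI.2 y' hy' h1 h2 a h3 h4 h5).mono hm
        · exact hm'
      refine (Hoare.seq (T₁ := 1) (T₂ := D.L * 103 + 6 + 36) (Q := fun s5 => s5 = s4.setReg 29 y)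
        (Hoare.exec rfl le_rfl (by simp [exec, hE4.m1, hy])) ?_).le (by omega)
      rintro s5 hF5 rfl
      have hE5 := hE4.frame hF5 rfl
      have h23 : s4.reg 23 = b := by rw [hF4.reg 23 rfl]; simp
      have hm : ∀ a, lowLoop.stores a = false → s4.mem a = s.mem a := by
        intro a ha
        rw [hF4.mem a (by simp [lowLoop, Cmd.forUp, Cmd.stores] at ha; exact ha)]
        exact hF.mem a ha
      refine ifAdj_spec (H := H) (u := b) (v := y) hE5
        (by simpa [hm 12 rfl] using hA) (by decide) (by simpa using h23) (by simp) hbn hyn ?_ ?_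
      · intro hby s6 hF6
        have hE6 := hE5.frame hF6 rfl
        refine (Hoare.seq (T₁ := 1) (T₂ := D.L * 103 + 3 + 1)
          (Q := fun s7 => s7 = s6.setReg 37 (D.codeg H v y))
          (Hoare.exec rfl le_rfl ?_) ?_).le (by omega)
        · have : s6.mem 14 y = D.codeg H v y := by
            rw [hF6.mem 14 rfl, State.setReg_mem, hm 14 rfl]; exact (hS.bucket y hyn).1
          simp [exec, hF6.reg 29 rfl, this]
        rintro s7 hF7 rfl
        have hE7 := hE6.frame hF7 rfl
        have h13 : (s6.setReg 37 (D.codeg H v y)).mem 13 = s4.mem 13 := by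
          rw [State.setReg_mem, hF6.mem 13 rfl]; rfl
        refine Hoare.ite (fun hlt => ?_) fun hlt => ?_
        · simp only [State.setReg_reg, if_true, hE7.r7] at hlt
          have hlt : D.codeg H v y < D.L := by simpa [hE6.r7] using hlt
          refine Hoare.mono (lowInner_spec (v := v) (b := b) (y := y) hE7 hH
            (by rw [State.setReg_mem, hF6.mem 12 rfl, State.setReg_mem, hm 12 rfl]; exact hA) hv
            (by simp [hF6.reg 23 rfl, h23]) (by simp [hF6.reg 29 rfl]) hby (by simp) ?_ hlt)
            le_rfl ?_
          · rw [State.setReg_mem, hF6.mem 15 rfl, State.setReg_mem, hm 15 rfl]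
            exact (hS.bucket y hyn).2
          · rintro s8 ⟨h8, h8'⟩
            rw [h13] at h8
            exact hcov _ h8 fun _ _ => h8'
        · have hlt : ¬ D.codeg H v y < D.L := by simpa [hE6.r7] using hlt
          refine (Hoare.skip ?_).le (by omega)
          rw [h13]
          exact hcov _ MStep.refl fun _ h => (hlt h).elim
      · intro hby s6 hF6
        have h13 : s6.mem 13 = s4.mem 13 := by rw [hF6.mem 13 rfl]; rfl
        rw [h13]
        exact hcov _ MStep.refl fun h => (hby h).elim
    · rintro s4 ⟨h1, h2⟩
      refine ⟨hI1.trans h1, fun i hi hij y hy => ?_⟩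
      by_cases hc : i = j
      · subst hc
        exact h2 y ((Data.mem_nbrs hbn).2 (hH hy)) hy
      · exact fun h3 a h4 h5 h6 => (hI2 i hi (by omega) y hy h3 a h4 h5 h6).mono h1
  · have h1 := D.r_pos
    have h2 := D.L_pos
    have h3 : 1 ≤ D.r * D.L := Nat.mul_pos h1 h2
    have h4 : D.r ≤ D.r * D.L := Nat.le_mul_of_pos_right _ h2
    have h5 : D.r * (D.L * 103 + 58) + 13 + 3 ≤ 180 * (D.r * D.L) := by nlinarith
    have := Nat.mul_le_mul_left (D.popular H v D.θ).length h5
    omega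
  · rintro s' ⟨h1, h2⟩
    refine ⟨h1, fun b y hbn hb => ?_⟩
    obtain ⟨i, hi, rfl⟩ := List.getElem_of_mem (Data.mem_popular.2 ⟨hbn, hb⟩)
    exact h2 i hi hi y

/-! ### Triangles whose third vertex has many common neighbours with `v`: matrix multiplication -/

/-- Append `r` dummy vertices to each of the three lists in segment `16`. -/
def padLists : Cmd :=
  .forUp 20 4 <| .seq (.arith 24 .add 26 20) <| .seq (.store 16 24 8) <|
    .seq (.arith 24 .add 14 43) <| .seq (.arith 24 .add 24 20) <| .seq (.store 16 24 8) <|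
    .seq (.arith 24 .add 15 44) <| .seq (.arith 24 .add 24 20) (.store 16 24 8)

/-- The three lists in segment `m` are followed by at least `r` vertices. -/
structure Padded (D : Data) (H : SimpleGraph ℕ) (v : ℕ) (m : ℕ → ℕ) : Prop where
  nbrs : ∀ i < D.r, m i < D.n
  dense : ∀ i < (D.popular H v D.θ).length + D.r, m (2 * D.n + i) < D.n
  high : ∀ i < (D.popular H v D.L).length + D.r, m (4 * D.n + i) < D.n

theorem ListAt.padded {m : ℕ → ℕ} {b r n : ℕ} {l : List ℕ} (h : ListAt m b l)
    (hl : ∀ x ∈ l, x < n) (hn : 0 < n) (h0 : ∀ i < r, m (b + l.length + i) = 0) :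
    ∀ i < l.length + r, m (b + i) < n := by
  intro i hi
  by_cases hc : i < l.length
  · rw [h i hc]; exact hl _ (List.getElem_mem hc)
  · have := h0 (i - l.length) (by omega)
    rw [show b + l.length + (i - l.length) = b + i by omega] at this
    omega

/-- The lists are cut into blocks of exactly `r` entries, and the last block may run past the end.
Padding with the vertex `0` guarantees that even there the adjacency tests receive vertices;
whatever such dummies cause to be marked is still a genuine triangle. -/
theorem padLists_spec {D : Data} {H : SimpleGraph ℕ} {s : State} {v : ℕ}
    (hE : Env D s) (hH : H ≤ D.G) (hv : v < D.n) (hS : Scanned D H v s) :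
    Hoare D.w padLists s (D.r * 23 + 3) fun s' => Scanned D H v s' ∧ Padded D H v (s'.mem 16) := by
  have hr := D.r_le
  have hn := D.n_pos
  have l1 := D.length_popular (H := H) (v := v) D.θ
  have l2 := D.length_popular (H := H) (v := v) D.L
  have l0 := Data.length_nbrsIn (H := H) hv
  refine Hoare.mono (Hoare.frame (forUp_spec (c := 20) (fun j s1 =>
    ListAt (s1.mem 16) 0 (D.nbrsIn H v) ∧ ListAt (s1.mem 16) (2 * D.n) (D.popular H v D.θ) ∧
    ListAt (s1.mem 16) (4 * D.n) (D.popular H v D.L) ∧ ∀ i < j,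
      s1.mem 16 (0 + (D.nbrsIn H v).length + i) = 0 ∧
      s1.mem 16 (2 * D.n + (D.popular H v D.θ).length + i) = 0 ∧
      s1.mem 16 (4 * D.n + (D.popular H v D.L).length + i) = 0) rfl hE.r9 hE.r4
    (D.sq_lt (by nlinarith)) (fun _ _ _ h => h) ⟨hS.nbrs, hS.dense, hS.high, by simp⟩ ?_))
    le_rfl ?_
  · intro j s1 hj hF hi ⟨i1, i2, i3, i4⟩
    have hE1 := hE.frame hF rfl
    refine Hoare.exec rfl (by decide) ?_
    have e1 : ((D.nbrsIn H v).length + j) % 2 ^ D.w = (D.nbrsIn H v).length + j :=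
      Nat.mod_eq_of_lt (D.sq_lt (by nlinarith))
    have e2 : (2 * D.n + (D.popular H v D.θ).length) % 2 ^ D.w =
      2 * D.n + (D.popular H v D.θ).length := Nat.mod_eq_of_lt (D.sq_lt (by nlinarith))
    have e3 : (2 * D.n + (D.popular H v D.θ).length + j) % 2 ^ D.w =
      2 * D.n + (D.popular H v D.θ).length + j := Nat.mod_eq_of_lt (D.sq_lt (by nlinarith))
    have e4 : (4 * D.n + (D.popular H v D.L).length) % 2 ^ D.w =
      4 * D.n + (D.popular H v D.L).length := Nat.mod_eq_of_lt (D.sq_lt (by nlinarith))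
    have e5 : (4 * D.n + (D.popular H v D.L).length + j) % 2 ^ D.w =
      4 * D.n + (D.popular H v D.L).length + j := Nat.mod_eq_of_lt (D.sq_lt (by nlinarith))
    have f1 := (hF.reg 26 rfl).trans hS.r26
    have f2 := (hF.reg 43 rfl).trans hS.r43
    have f3 := (hF.reg 44 rfl).trans hS.r44
    simp only [exec, State.setReg_reg, State.setReg_mem, State.setMem_reg, State.setMem_mem,
      Op.eval, hE1.r8, hE1.r15, hE1.r14, hi, f1, f2, f3, Nat.reduceEqDiff, if_true,
      if_false, e1, e2, e3, e4, e5]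
    refine ⟨((i1.update ?_).update ?_).update ?_, ((i2.update ?_).update ?_).update ?_,
      ((i3.update ?_).update ?_).update ?_, fun i hi => ?_⟩
    any_goals omega
    simp only [Function.update_apply]
    by_cases hc : i = j
    · subst hc
      refine ⟨?_, ?_, ?_⟩ <;> split_ifs <;> first | rfl | omega
    · have := i4 i (by omega)
      refine ⟨?_, ?_, ?_⟩ <;> split_ifs <;> first | rfl | omega
  · rintro s' ⟨⟨i1, i2, i3, i4⟩, hF⟩
    refine ⟨⟨(hF.reg _ rfl).trans hS.r26, (hF.reg _ rfl).trans hS.r43, (hF.reg _ rfl).trans hS.r44,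
      (hF.reg _ rfl).trans hS.r45, fun z hz => ?_, i1, i2, i3⟩, fun i hi => ?_,
      i2.padded (fun x hx => (Data.mem_popular.1 hx).1) hn fun i hi => (i4 i hi).2.1,
      i3.padded (fun x hx => (Data.mem_popular.1 hx).1) hn fun i hi => (i4 i hi).2.2⟩
    · rw [hF.mem 14 rfl, hF.mem 15 rfl]; exact hS.bucket z hz
    · have := i1.padded (r := D.r) (n := D.n) (fun x hx =>
        (Data.lt_of_adj (hH ((Data.mem_nbrsIn hH).1 hx).2)).2) hn (fun i hi => (i4 i hi).1) i
        (by omega)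
      simpa using this

/-- `for i, j = 0, …, r - 1 do body`. -/
def Cmd.forGrid (body : Cmd) : Cmd := .forUp 20 4 (.forUp 21 4 body)

theorem forGrid_spec {D : Data} {body : Cmd} {s : State} {c : ℕ}
    (Inv : ℕ → State → Prop) (hE : Env D s)
    (hok : (body.loopOk 21 4 && !body.writes 20 && body.keeps) = true)
    (hst : ∀ k s v, Inv k s → Inv k (s.setReg 20 v) ∧ Inv k (s.setReg 21 v)) (h0 : Inv 0 s)
    (hbody : ∀ i j s', i < D.r → j < D.r → Env D s' → Frame D.w (.forGrid body) s s' →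
      s'.reg 20 = i → s'.reg 21 = j → Inv (i * D.r + j) s' →
      Hoare D.w body s' c (Inv (i * D.r + j + 1))) :
    Hoare D.w (.forGrid body) s (D.r * (D.r * (c + 3) + 6) + 3) (Inv (D.r * D.r)) := by
  simp only [Bool.and_eq_true, Bool.not_eq_true'] at hok
  obtain ⟨⟨hok1, hok2⟩, hok3⟩ := hok
  have hk : (Cmd.forUp 21 4 body).keeps = true := by
    simp only [Cmd.keeps, Bool.and_eq_true, Bool.not_eq_true', List.all_eq_true] at hok3 ⊢
    refine ⟨⟨fun x hx => ?_, ?_⟩, ?_⟩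
    · have := hok3.1.1 x hx
      simp only [Cmd.forUp, Cmd.writes, this, Bool.or_false, Bool.false_or, Bool.or_self,
        beq_eq_false_iff_ne]
      rintro rfl
      simp at hx
    · simp [Cmd.forUp, Cmd.stores, hok3.1.2]
    · simp [Cmd.forUp, Cmd.stores, hok3.2]
  have hk' : (Cmd.forGrid body).keeps = true := by
    simp only [Cmd.keeps, Bool.and_eq_true, Bool.not_eq_true', List.all_eq_true] at hk ⊢
    refine ⟨⟨fun x hx => ?_, ?_⟩, ?_⟩
    · have := hk.1.1 x hx
      rw [Cmd.forGrid, Cmd.forUp]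
      simp only [Cmd.writes, this, Bool.or_false, Bool.false_or, Bool.or_self,
        beq_eq_false_iff_ne]
      rintro rfl
      simp at hx
    · rw [Cmd.forGrid, Cmd.forUp]; simp only [Cmd.stores, hk.1.2, Bool.or_self]
    · rw [Cmd.forGrid, Cmd.forUp]; simp only [Cmd.stores, hk.2, Bool.or_self]
  have hrw : D.r < 2 ^ D.w := D.sq_lt (by nlinarith [D.r_le])
  have hw20 : (Cmd.forUp 21 4 body).writes 20 = false := by simp [Cmd.forUp, Cmd.writes, hok2]
  have hlo : (Cmd.forUp 21 4 body).loopOk 20 4 = true := by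
    have : body.writes 4 = false ∧ body.writes 9 = false := by
      simp only [Cmd.loopOk, Bool.not_eq_true', Bool.or_eq_false_iff] at hok1
      exact ⟨hok1.1.1.1.1.2, hok1.1.1.1.2⟩
    simp [Cmd.loopOk, hok2, Cmd.forUp, Cmd.writes, this]
  refine forUp_spec (c := D.r * (c + 3) + 3) (fun i s => Inv (i * D.r) s) hlo hE.r9 hE.r4 hrw
    (fun _ _ _ h => (hst _ _ _ h).1) (by simpa using h0) ?_
  intro i s1 hi hF h20 hI
  have hE1 := hE.frame hF hk'
  rw [show (i + 1) * D.r = i * D.r + D.r by ring]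
  refine forUp_spec (fun j s => Inv (i * D.r + j) s) hok1 hE1.r9 hE1.r4 hrw
    (fun _ _ _ h => (hst _ _ _ h).2) hI ?_
  intro j s2 hj hF2 h21 hI2
  have hFF : Frame D.w (.forGrid body) s s2 := hF.trans hF2 (fun y hy => ⟨hy, by
    rw [Cmd.forGrid, Cmd.forUp] at hy
    simp only [Cmd.writes, Bool.or_eq_false_iff] at hy; exact hy.2.1⟩) fun y hy => ⟨hy, by
    rw [Cmd.forGrid, Cmd.forUp] at hy
    simp only [Cmd.stores, Bool.or_eq_false_iff] at hy; exact hy.2.1⟩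
  exact hbody i j s2 hi hj (hE1.frame hF2 hk) hFF ((hF2.reg 20 hw20).trans h20) h21 hI2

/-- Fetch the vertices number `reg 20` and `reg 21` of the lists starting at positions `reg a` and
`reg b` of segment `16`. -/
def getPair (a b : ℕ) : Cmd :=
  .seq (.arith 23 .add a 20) <| .seq (.load 23 16 23) <| .seq (.arith 24 .add b 21) (.load 24 16 24)

theorem getPair_spec {D : Data} {s : State} {a b A B i j : ℕ} (hi : s.reg 20 = i)
    (hj : s.reg 21 = j) (ha : s.reg a = A) (hb : s.reg b = B) (hb23 : b ≠ 23)
    (hA : A + i < 2 ^ D.w) (hB : B + j < 2 ^ D.w) :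
    Hoare D.w (getPair a b) s 7 fun s' =>
      s'.reg 23 = s.mem 16 (A + i) ∧ s'.reg 24 = s.mem 16 (B + j) := by
  refine Hoare.exec rfl (le_of_eq rfl) ?_
  simp [getPair, exec, Op.eval, hi, hj, ha, hb, hb23, Nat.mod_eq_of_lt hA, Nat.mod_eq_of_lt hB]

/-- Write the adjacency matrices between three lists of vertices to segments `100` and `101`. -/
def fillMatrices : Cmd :=
  .forGrid <| .seq (getPair 40 41) <| .seq (.adjPre 23 24) <| .seq (.arith 38 .mul 20 4) <|
    .seq (.arith 38 .add 38 21) <| .seq (.store 100 38 32) <|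
    .seq (getPair 41 42) <| .seq (.adjPre 23 24) (.store 101 38 32)

/-- Mark the edges between the first and the third list that correspond to positive entries of
the matrix in segment `102`. -/
def readMatrix : Cmd :=
  .forGrid <| .seq (.arith 38 .mul 20 4) <| .seq (.arith 38 .add 38 21) <| .seq (.load 37 102 38) <|
    .ite 8 37 (.seq (getPair 40 42) (.ifAdj 23 24 (.mark 23 24))) .skip

/-- Three lists of `r` vertices each, starting at the positions `X`, `Y`, `Z` of segment `16`, which
are held by the registers `40`, `41` and `42`. -/
structure Lists (D : Data) (q : ℕ → ℕ) (X Y Z : ℕ) (s : State) : Prop where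
  mem : s.mem 16 = q
  r40 : s.reg 40 = X
  r41 : s.reg 41 = Y
  r42 : s.reg 42 = Z
  hX : ∀ i < D.r, q (X + i) < D.n
  hY : ∀ i < D.r, q (Y + i) < D.n
  hZ : ∀ i < D.r, q (Z + i) < D.n
  bX : X ≤ 5 * D.n
  bY : Y ≤ 5 * D.n
  bZ : Z ≤ 5 * D.n

theorem Lists.frame {D : Data} {q : ℕ → ℕ} {X Y Z : ℕ} {s s' : State} {P : Cmd}
    (h : Lists D q X Y Z s) (hF : Frame D.w P s s')
    (hP : (P.writes 40 || P.writes 41 || P.writes 42 || P.stores 16) = false) :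
    Lists D q X Y Z s' := by
  simp only [Bool.or_eq_false_iff] at hP
  obtain ⟨⟨⟨h1, h2⟩, h3⟩, h4⟩ := hP
  exact ⟨(hF.mem _ h4).trans h.mem, (hF.reg _ h1).trans h.r40, (hF.reg _ h2).trans h.r41,
    (hF.reg _ h3).trans h.r42, h.hX, h.hY, h.hZ, h.bX, h.bY, h.bZ⟩

/-- The entries of the adjacency matrix between two lists of vertices. -/
noncomputable def adjEntry (H : SimpleGraph ℕ) (q : ℕ → ℕ) (X Y i j : ℕ) : ℕ :=
  if H.Adj (q (X + i)) (q (Y + j)) then 1 else 0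

theorem fillMatrices_spec {D : Data} {H : SimpleGraph ℕ} {s : State} {q : ℕ → ℕ} {X Y Z : ℕ}
    (hE : Env D s) (hA : Alive D H (s.mem 12)) (hL : Lists D q X Y Z s) :
    Hoare D.w fillMatrices s (D.r * (D.r * 103 + 6) + 3) fun s' =>
      ∀ i < D.r, ∀ j < D.r, s'.mem 100 (i * D.r + j) = adjEntry H q X Y i j ∧
        s'.mem 101 (i * D.r + j) = adjEntry H q Y Z i j := by
  have hr := D.r_le
  refine Hoare.mono (forGrid_spec (c := 100) (fun k s1 => ∀ i < D.r, ∀ j < D.r, i * D.r + j < k →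
    s1.mem 100 (i * D.r + j) = adjEntry H q X Y i j ∧
      s1.mem 101 (i * D.r + j) = adjEntry H q Y Z i j) hE rfl (fun _ _ _ h => ⟨h, h⟩)
      (by simp) ?_) le_rfl ?_
  · intro i j s1 hi hj hE1 hF h20 h21 hI
    have hL1 := hL.frame hF rfl
    have hw : ∀ B ≤ 5 * D.n, ∀ i < D.r, B + i < 2 ^ D.w := fun B hB i hi => D.sq_lt (by nlinarith)
    refine (Hoare.seq (T₁ := 7) (T₂ := 90) (getPair_spec h20 h21 hL1.r40 hL1.r41 (by decide)
      (hw _ hL.bX i hi) (hw _ hL.bY j hj)) ?_).le (by omega)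
    rintro s2 hF2 ⟨h23, h24⟩
    rw [hL1.mem] at h23 h24
    have hE2 := hE1.frame hF2 rfl
    refine (Hoare.seq (T₁ := 34) (T₂ := 55) (adjPre_spec (H := H) hE2
      (by rw [hF2.mem 12 rfl, hF.mem 12 rfl]; exact hA) (by decide) h23 h24
      (hL.hX i hi) (hL.hY j hj)) ?_).le (by omega)
    intro s3 hF3 h32
    have hE3 := hE2.frame hF3 rfl
    have e1 : i * D.r % 2 ^ D.w = i * D.r := Nat.mod_eq_of_lt (D.sq_lt (by nlinarith))
    have e2 : (i * D.r + j) % 2 ^ D.w = i * D.r + j := Nat.mod_eq_of_lt (D.sq_lt (by nlinarith))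
    have g20 : s3.reg 20 = i := by rw [hF3.reg 20 rfl, hF2.reg 20 rfl, h20]
    have g21 : s3.reg 21 = j := by rw [hF3.reg 21 rfl, hF2.reg 21 rfl, h21]
    refine (Hoare.seq (T₁ := 1) (T₂ := 53) (Q := fun s4 => s4 = s3.setReg 38 (i * D.r))
      (Hoare.exec rfl le_rfl (by simp [exec, Op.eval, g20, hE3.r4, e1])) ?_).le (by omega)
    rintro s4 hF4 rfl
    refine (Hoare.seq (T₁ := 1) (T₂ := 51) (Q := fun s4 => s4 = s3.setReg 38 (i * D.r + j))
      (Hoare.exec rfl le_rfl ?_) ?_).le (by omega)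
    · simp [exec, Op.eval, g21, e2, State.setReg]
    rintro s5 hF5 rfl
    have hE5 := (hE3.frame hF4 rfl).frame hF5 rfl
    refine (Hoare.seq (T₁ := 1) (T₂ := 49) (Q := fun s4 => s4 = (s3.setReg 38 (i * D.r + j)).setMem
      100 (i * D.r + j) (adjEntry H q X Y i j)) (Hoare.exec rfl le_rfl ?_) ?_).le (by omega)
    · simp only [exec, State.setReg_reg, Nat.reduceEqDiff, if_true, if_false, h32]; rfl
    rintro s6 hF6 rfl
    have hE6 := hE5.frame hF6 rfl
    have hL3 := (hL1.frame hF2 rfl).frame hF3 rfl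
    refine (Hoare.seq (T₁ := 7) (T₂ := 41) (getPair_spec (i := i) (j := j) (A := Y) (B := Z)
      (by simpa using g20) (by simpa using g21) (by simpa using hL3.r41) (by simpa using hL3.r42)
      (by decide) (hw _ hL.bY i hi) (hw _ hL.bZ j hj)) ?_).le (by omega)
    rintro s7 hF7 ⟨h23, h24⟩
    simp only [State.setMem_mem, State.setReg_mem, Nat.reduceEqDiff, if_false, hL3.mem] at h23 h24
    have hE7 := hE6.frame hF7 rfl
    refine (Hoare.seq (T₁ := 34) (T₂ := 5) (adjPre_spec (H := H) hE7
      (by rw [hF7.mem 12 rfl]; simpa [hF3.mem 12 rfl, hF2.mem 12 rfl, hF.mem 12 rfl] using hA)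
      (by decide) h23 h24 (hL.hY i hi) (hL.hZ j hj)) ?_).le (by omega)
    intro s8 hF8 h32'
    replace h32' : s8.reg 32 = adjEntry H q Y Z i j := h32'
    have g38 : s8.reg 38 = i * D.r + j := by rw [hF8.reg 38 rfl, hF7.reg 38 rfl]; simp
    have m100 : s8.mem 100 = Function.update (s1.mem 100) (i * D.r + j) (adjEntry H q X Y i j) := by
      rw [hF8.mem 100 rfl, hF7.mem 100 rfl]
      simp [hF3.mem 100 rfl, hF2.mem 100 rfl]
    have m101 : s8.mem 101 = s1.mem 101 := by
      rw [hF8.mem 101 rfl, hF7.mem 101 rfl]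
      simp [hF3.mem 101 rfl, hF2.mem 101 rfl]
    refine Hoare.exec rfl (by decide) ?_
    intro i' hi' j' hj' hlt
    simp only [exec, State.setMem_mem, Nat.reduceEqDiff, if_true, if_false, g38, m100, m101, h32',
      Function.update_apply]
    by_cases hc : i' * D.r + j' = i * D.r + j
    · obtain ⟨rfl, rfl⟩ := Data.idx_inj hj' hj hc
      simp
    · simpa [hc] using hI i' hi' j' hj' (by omega)
  · intro s' h i hi j hj
    exact h i hi j hj (Data.idx_lt hi hj)

/-- An entry of the product counts the positions of the second list whose vertex is adjacent to both
ends. If it is positive and the ends are adjacent, there is a triangle, and only the edge between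
its ends is marked here. -/
theorem readMatrix_spec {D : Data} {H : SimpleGraph ℕ} {s : State} {q : ℕ → ℕ} {X Y Z : ℕ}
    (hE : Env D s) (hH : H ≤ D.G) (hA : Alive D H (s.mem 12)) (hL : Lists D q X Y Z s)
    (hM : ∀ i < D.r, ∀ j < D.r, s.mem 102 (i * D.r + j) =
      ∑ l ∈ Finset.range D.r, adjEntry H q X Y i l * adjEntry H q Y Z l j) :
    Hoare D.w readMatrix s (D.r * (D.r * 73 + 6) + 3) fun s' =>
      MStep D (s.mem 13) (s'.mem 13) ∧ ∀ i < D.r, ∀ l < D.r, ∀ j < D.r,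
        H.Adj (q (X + i)) (q (Y + l)) → H.Adj (q (Y + l)) (q (Z + j)) →
        H.Adj (q (X + i)) (q (Z + j)) → Marked D (s'.mem 13) (q (X + i)) (q (Z + j)) ∧
          Marked D (s'.mem 13) (q (Z + j)) (q (X + i)) := by
  have hr := D.r_le
  refine Hoare.mono (forGrid_spec (c := 70) (fun k s1 => MStep D (s.mem 13) (s1.mem 13) ∧
      ∀ i < D.r, ∀ j < D.r, i * D.r + j < k → ∀ l < D.r,
        H.Adj (q (X + i)) (q (Y + l)) → H.Adj (q (Y + l)) (q (Z + j)) →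
        H.Adj (q (X + i)) (q (Z + j)) → Marked D (s1.mem 13) (q (X + i)) (q (Z + j)) ∧
          Marked D (s1.mem 13) (q (Z + j)) (q (X + i))) hE rfl (fun _ _ _ h => ⟨h, h⟩)
      ⟨MStep.refl, by simp⟩ ?_) le_rfl ?_
  · intro i j s1 hi hj hE1 hF h20 h21 hI
    have hL1 := hL.frame hF rfl
    have hw : ∀ B ≤ 5 * D.n, ∀ i < D.r, B + i < 2 ^ D.w := fun B hB i hi => D.sq_lt (by nlinarith)
    have e1 : i * D.r % 2 ^ D.w = i * D.r := Nat.mod_eq_of_lt (D.sq_lt (by nlinarith))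
    have e2 : (i * D.r + j) % 2 ^ D.w = i * D.r + j := Nat.mod_eq_of_lt (D.sq_lt (by nlinarith))
    have hcov : ∀ (m : ℕ → ℕ), MStep D (s1.mem 13) m → (∀ l < D.r,
        H.Adj (q (X + i)) (q (Y + l)) → H.Adj (q (Y + l)) (q (Z + j)) →
        H.Adj (q (X + i)) (q (Z + j)) → Marked D m (q (X + i)) (q (Z + j)) ∧
          Marked D m (q (Z + j)) (q (X + i))) →
        MStep D (s.mem 13) m ∧ ∀ i' < D.r, ∀ j' < D.r, i' * D.r + j' < i * D.r + j + 1 →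
          ∀ l < D.r, H.Adj (q (X + i')) (q (Y + l)) → H.Adj (q (Y + l)) (q (Z + j')) →
          H.Adj (q (X + i')) (q (Z + j')) → Marked D m (q (X + i')) (q (Z + j')) ∧
          Marked D m (q (Z + j')) (q (X + i')) := by
      intro m hm hm'
      refine ⟨hI.1.trans hm, fun i' hi' j' hj' hlt l hl h1 h2 h3 => ?_⟩
      by_cases hc : i' * D.r + j' = i * D.r + j
      · obtain ⟨rfl, rfl⟩ := Data.idx_inj hj' hj hc
        exact hm' l hl h1 h2 h3
      · have := hI.2 i' hi' j' hj' (by omega) l hl h1 h2 h3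
        exact ⟨hm.2 _ _ this.1, hm.2 _ _ this.2⟩
    refine (Hoare.seq (T₁ := 1) (T₂ := 68) (Q := fun s4 => s4 = s1.setReg 38 (i * D.r))
      (Hoare.exec rfl le_rfl (by simp [exec, Op.eval, h20, hE1.r4, e1])) ?_)
    rintro s2 hF2 rfl
    refine (Hoare.seq (T₁ := 1) (T₂ := 64) (Q := fun s4 => s4 = s1.setReg 38 (i * D.r + j))
      (Hoare.exec rfl le_rfl ?_) ?_).le (by omega)
    · simp [exec, Op.eval, h21, e2, State.setReg]
    rintro s3 hF3 rfl
    refine (Hoare.seq (T₁ := 1) (T₂ := 60) (Q := fun s4 => s4 = (s1.setReg 38 (i * D.r + j)).setReg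
      37 (∑ l ∈ Finset.range D.r, adjEntry H q X Y i l * adjEntry H q Y Z l j))
      (Hoare.exec rfl le_rfl ?_) ?_).le (by omega)
    · simp [exec, hF.mem 102 rfl, hM i hi j hj]
    rintro s4 hF4 rfl
    have hE4 := ((hE1.frame hF2 rfl).frame hF3 rfl).frame hF4 rfl
    refine (Hoare.ite (T := 55) (fun hlt => ?_) fun hlt => ?_).le (by omega)
    · simp only [hE4.r8] at hlt
      have hpos : 0 < ∑ l ∈ Finset.range D.r, adjEntry H q X Y i l * adjEntry H q Y Z l j := by
        simpa using hlt
      obtain ⟨l, hl, hne⟩ := Finset.exists_ne_zero_of_sum_ne_zero hpos.ne'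
      obtain ⟨hXY, hYZ⟩ : H.Adj (q (X + i)) (q (Y + l)) ∧ H.Adj (q (Y + l)) (q (Z + j)) := by
        simpa [adjEntry, and_comm] using hne
      refine (Hoare.seq (T₁ := 7) (T₂ := 47) (getPair_spec (i := i) (j := j) (A := X) (B := Z)
        (by simpa using h20) (by simpa using h21) (by simpa using hL1.r40) (by simpa using hL1.r42)
        (by decide) (hw _ hL.bX i hi) (hw _ hL.bZ j hj)) ?_)
      rintro s5 hF5 ⟨h23, h24⟩
      simp only [State.setReg_mem, hL1.mem] at h23 h24
      have hE5 := hE4.frame hF5 rfl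
      have h13 : s5.mem 13 = s1.mem 13 := by rw [hF5.mem 13 rfl]; rfl
      refine ifAdj_spec (c := 11) (H := H) hE5 (by
        rw [hF5.mem 12 rfl]; simpa [hF.mem 12 rfl] using hA) (by decide) h23 h24 (hL.hX i hi)
        (hL.hZ j hj) ?_ ?_
      · intro hXZ s6 hF6
        refine Hoare.mono (mark_spec (hE5.frame hF6 rfl) (by decide) (by decide)
          ((hF6.reg 23 rfl).trans h23) ((hF6.reg 24 rfl).trans h24)
          ⟨_, hH hXZ, hH hYZ.symm, hH hXY⟩) le_rfl ?_
        rintro s7 ⟨h7, h7'⟩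
        rw [hF6.mem 13 rfl, h13] at h7
        exact hcov _ h7 fun _ _ _ _ _ => h7'
      · intro hXZ s6 hF6
        rw [hF6.mem 13 rfl, h13]
        exact hcov _ MStep.refl fun _ _ _ _ h => (hXZ h).elim
    · refine (Hoare.skip ?_).le (by omega)
      simp only [State.setReg_mem]
      refine hcov _ MStep.refl fun l hl h1 h2 h3 => ?_
      simp only [hE4.r8] at hlt
      have hz : ∑ l ∈ Finset.range D.r, adjEntry H q X Y i l * adjEntry H q Y Z l j = 0 := by
        simpa using hlt
      rw [Finset.sum_eq_zero_iff] at hz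
      have := hz l (Finset.mem_range.2 hl)
      simp [adjEntry, h1, h2] at this
  · rintro s' ⟨h, h'⟩
    exact ⟨h, fun i hi l hl j hj => h' i hi j hj (Data.idx_lt hi hj) l hl⟩

/-- `mm` multiplies `r × r` matrices within `Tm` steps, using only registers and segments from `100`
on. -/
structure MulSpec (D : Data) (mm : Cmd) (Tm : ℕ) : Prop where
  writes : ∀ x < 100, mm.writes x = false
  stores : ∀ x < 100, mm.stores x = false
  spec : ∀ (A B : ℕ → ℕ → ℕ) (s : State), (∀ i j, A i j ≤ 1) → (∀ i j, B i j ≤ 1) →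
    s.IsWord D.w → s.reg 100 = D.r → (∀ i < D.r, ∀ j < D.r, s.mem 100 (i * D.r + j) = A i j) →
    (∀ i < D.r, ∀ j < D.r, s.mem 101 (i * D.r + j) = B i j) →
    Hoare D.w mm s Tm fun s' => ∀ i < D.r, ∀ j < D.r,
      s'.mem 102 (i * D.r + j) = ∑ l ∈ Finset.range D.r, A i l * B l j

/-- Mark the edges between the first and the third list that are in a triangle with a vertex of
the second list. -/
def markBlock (mm : Cmd) : Cmd := .seq fillMatrices (.seq (.copy 100 4) (.seq mm readMatrix))

theorem MulSpec.env {D : Data} {mm : Cmd} {Tm : ℕ} (h : MulSpec D mm Tm) {s s' : State}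
    (hF : Frame D.w mm s s') (hE : Env D s) : Env D s' := by
  refine hE.frame hF ?_
  simp [Cmd.keeps, h.writes, h.stores]

theorem markBlock_spec {D : Data} {H : SimpleGraph ℕ} {s : State} {q : ℕ → ℕ} {X Y Z Tm : ℕ}
    {mm : Cmd} (hmm : MulSpec D mm Tm)
    (hE : Env D s) (hH : H ≤ D.G) (hA : Alive D H (s.mem 12)) (hL : Lists D q X Y Z s) :
    Hoare D.w (markBlock mm) s (200 * (D.r * D.r) + Tm) fun s' =>
      MStep D (s.mem 13) (s'.mem 13) ∧ ∀ i < D.r, ∀ l < D.r, ∀ j < D.r,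
        H.Adj (q (X + i)) (q (Y + l)) → H.Adj (q (Y + l)) (q (Z + j)) →
        H.Adj (q (X + i)) (q (Z + j)) → Marked D (s'.mem 13) (q (X + i)) (q (Z + j)) ∧
          Marked D (s'.mem 13) (q (Z + j)) (q (X + i)) := by
  have hr := D.r_le
  have hr' := D.r_pos
  refine (Hoare.seq (T₁ := D.r * (D.r * 103 + 6) + 3)
    (T₂ := 1 + (Tm + (D.r * (D.r * 73 + 6) + 3) + 1) + 1) (fillMatrices_spec hE hA hL) ?_).le
    (by nlinarith)
  intro s1 hF1 h1
  have hE1 := hE.frame hF1 rfl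
  have e : D.r % 2 ^ D.w = D.r := Nat.mod_eq_of_lt (D.sq_lt (by nlinarith))
  refine Hoare.seq (Q := fun s2 => s2 = s1.setReg 100 D.r) (Hoare.exec rfl le_rfl
    (by simp [exec, Cmd.copy, Op.eval, hE1.r4, hE1.r8, e])) ?_
  rintro s2 hF2 rfl
  have hE2 := hE1.frame hF2 rfl
  refine Hoare.seq (hmm.spec (adjEntry H q X Y) (adjEntry H q Y Z) _ ?_ ?_ hE2.word (by simp)
    (fun i hi j hj => (h1 i hi j hj).1) (fun i hi j hj => (h1 i hi j hj).2)) ?_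
  · intro i j; unfold adjEntry; split <;> simp
  · intro i j; unfold adjEntry; split <;> simp
  intro s3 hF3 h3
  have h13 : s3.mem 13 = s.mem 13 := by
    rw [hF3.mem 13 (hmm.stores 13 (by decide)), State.setReg_mem, hF1.mem 13 rfl]
  have h12 : s3.mem 12 = s.mem 12 := by
    rw [hF3.mem 12 (hmm.stores 12 (by decide)), State.setReg_mem, hF1.mem 12 rfl]
  rw [← h13]
  refine readMatrix_spec (hmm.env hF3 hE2) hH (by rw [h12]; exact hA)
    (((hL.frame hF1 rfl).frame hF2 rfl).frame hF3 ?_) h3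
  simp [hmm.writes, hmm.stores]

/-- The programs change the same registers and segments among the first `100`. -/
def Cmd.Agree (P Q : Cmd) : Prop :=
  ∀ x < 100, P.writes x = Q.writes x ∧ P.stores x = Q.stores x

namespace Cmd.Agree
variable {P P' Q Q' : Cmd}

theorem refl : P.Agree P := fun _ _ => ⟨rfl, rfl⟩

theorem seq (h : P.Agree Q) (h' : P'.Agree Q') : (Cmd.seq P P').Agree (Cmd.seq Q Q') :=
  fun x hx => by simp [Cmd.writes, Cmd.stores, h x hx, h' x hx]

theorem ite {a b : ℕ} (h : P.Agree Q) (h' : P'.Agree Q') :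
    (Cmd.ite a b P P').Agree (Cmd.ite a b Q Q') :=
  fun x hx => by simp [Cmd.writes, Cmd.stores, h x hx, h' x hx]

theorem loop {a b : ℕ} (h : P.Agree Q) : (Cmd.loop a b P).Agree (Cmd.loop a b Q) :=
  fun x hx => by simp [Cmd.writes, Cmd.stores, h x hx]

theorem reg {w : ℕ} {s s' : State} (h : P.Agree Q) (hF : Frame w P s s') (x : ℕ)
    (hx : (decide (x < 100) && !Q.writes x) = true) : s'.reg x = s.reg x := by
  simp only [Bool.and_eq_true, decide_eq_true_eq, Bool.not_eq_true'] at hx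
  exact hF.reg x ((h x hx.1).1.trans hx.2)

theorem mem {w : ℕ} {s s' : State} (h : P.Agree Q) (hF : Frame w P s s') (x : ℕ)
    (hx : (decide (x < 100) && !Q.stores x) = true) : s'.mem x = s.mem x := by
  simp only [Bool.and_eq_true, decide_eq_true_eq, Bool.not_eq_true'] at hx
  exact hF.mem x ((h x hx.1).2.trans hx.2)

theorem env {D : Data} {s s' : State} (h : P.Agree Q) (hF : Frame D.w P s s') (hE : Env D s)
    (hQ : Q.keeps = true) : Env D s' := by
  refine hE.frame hF ?_
  simp only [Cmd.keeps, List.all_cons, List.all_nil] at hQ ⊢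
  rw [(h 0 (by decide)).1, (h 2 (by decide)).1, (h 3 (by decide)).1, (h 4 (by decide)).1,
    (h 5 (by decide)).1, (h 6 (by decide)).1, (h 7 (by decide)).1, (h 8 (by decide)).1,
    (h 9 (by decide)).1, (h 10 (by decide)).1, (h 11 (by decide)).1, (h 12 (by decide)).1,
    (h 13 (by decide)).1, (h 14 (by decide)).1, (h 15 (by decide)).1, (h 0 (by decide)).2,
    (h 1 (by decide)).2]
  exact hQ

end Cmd.Agree

/-- The multiplication program is a variable, so evaluation cannot decide what a program containing
it writes. Replacing it by `skip` changes nothing among the first hundred registers and segments and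
makes these frame conditions computable. -/
theorem MulSpec.agree {D : Data} {mm : Cmd} {Tm : ℕ} (h : MulSpec D mm Tm) : mm.Agree .skip :=
  fun x hx => ⟨h.writes x hx, h.stores x hx⟩

/-- Load the registers `40`, `41`, `42`. -/
def Cmd.bases (x y z : ℕ) : Cmd := .seq (.copy 40 x) (.seq (.copy 41 y) (.copy 42 z))

theorem bases_spec {D : Data} {s : State} {x y z X Y Z : ℕ} (hE : Env D s)
    (hx : s.reg x = X) (hy : s.reg y = Y) (hz : s.reg z = Z)
    (hne : (y != 40 && z != 40 && z != 41) = true) :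
    Hoare D.w (.bases x y z) s 5 fun s' => s'.reg 40 = X ∧ s'.reg 41 = Y ∧ s'.reg 42 = Z := by
  simp only [Bool.and_eq_true, bne_iff_ne, ne_eq] at hne
  have h := hE.word.1
  have hX : X % 2 ^ D.w = X := Nat.mod_eq_of_lt (hx ▸ h x)
  have hY : Y % 2 ^ D.w = Y := Nat.mod_eq_of_lt (hy ▸ h y)
  have hZ : Z % 2 ^ D.w = Z := Nat.mod_eq_of_lt (hz ▸ h z)
  refine Hoare.exec rfl (le_of_eq rfl) ?_
  simp [Cmd.bases, Cmd.copy, exec, Op.eval, hE.r8, hx, hy, hz, hne, hX, hY, hZ]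

/-- Mark all triangles between the list at `0` and the blocks at `reg 46` and `reg 47` of the two
other lists. -/
def markTriple (mm : Cmd) : Cmd :=
  .seq (.const 48 0) <| .seq (.arith 49 .add 14 46) <| .seq (.arith 50 .add 15 47) <|
  .seq (.bases 48 49 50) <| .seq (markBlock mm) <| .seq (.bases 48 50 49) <|
  .seq (markBlock mm) <| .seq (.bases 49 48 50) (markBlock mm)

theorem MulSpec.agree_block {D : Data} {mm : Cmd} {Tm : ℕ} (h : MulSpec D mm Tm) :
    (markBlock mm).Agree (markBlock .skip) :=
  Cmd.Agree.refl.seq (Cmd.Agree.refl.seq (h.agree.seq Cmd.Agree.refl))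

theorem MulSpec.agree_triple {D : Data} {mm : Cmd} {Tm : ℕ} (h : MulSpec D mm Tm) :
    (markTriple mm).Agree (markTriple .skip) := by
  have := h.agree_block
  unfold markTriple
  exact .seq .refl <| .seq .refl <| .seq .refl <| .seq .refl <| .seq this <| .seq .refl <|
    .seq this <| .seq .refl this

/-- A product reveals only edges between the two outer lists, so three products are formed, with
each of the lists in the middle once. -/
theorem markTriple_spec {D : Data} {H : SimpleGraph ℕ} {s : State} {q : ℕ → ℕ} {I J Tm : ℕ}
    {mm : Cmd} (hmm : MulSpec D mm Tm) (hE : Env D s) (hH : H ≤ D.G) (hA : Alive D H (s.mem 12))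
    (hq : s.mem 16 = q) (hI : s.reg 46 = I) (hJ : s.reg 47 = J) (hIn : I ≤ D.n) (hJn : J ≤ D.n)
    (hX : ∀ i < D.r, q i < D.n) (hY : ∀ i < D.r, q (2 * D.n + I + i) < D.n)
    (hZ : ∀ i < D.r, q (4 * D.n + J + i) < D.n) :
    Hoare D.w (markTriple mm) s (3 * (200 * (D.r * D.r) + Tm) + 30) fun s' =>
      MStep D (s.mem 13) (s'.mem 13) ∧ ∀ i < D.r, ∀ l < D.r, ∀ j < D.r,
        H.Adj (q i) (q (2 * D.n + I + l)) → H.Adj (q (2 * D.n + I + l)) (q (4 * D.n + J + j)) →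
        H.Adj (q i) (q (4 * D.n + J + j)) →
        AllMarked D (s'.mem 13) (q i) (q (2 * D.n + I + l)) (q (4 * D.n + J + j)) := by
  have e1 : (2 * D.n + I) % 2 ^ D.w = 2 * D.n + I := Nat.mod_eq_of_lt (D.sq_lt (by nlinarith))
  have e2 : (4 * D.n + J) % 2 ^ D.w = 4 * D.n + J := Nat.mod_eq_of_lt (D.sq_lt (by nlinarith))
  have ha := hmm.agree_block
  set B := 200 * (D.r * D.r) + Tm with hB
  refine (Hoare.seq (T₁ := 1) (T₂ := 3 * B + 28) (Q := fun s1 => s1 = s.setReg 48 0)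
    (Hoare.exec rfl le_rfl (by simp only [exec]; simp)) ?_).le (by omega)
  rintro s1 hF1 rfl
  refine (Hoare.seq (T₁ := 1) (T₂ := 3 * B + 26) (Q := fun s1 => s1 = (s.setReg 48 0).setReg 49
    (2 * D.n + I)) (Hoare.exec rfl le_rfl (by simp [exec, Op.eval, hI, hE.r14, e1])) ?_).le (by omega)
  rintro s1 hF2 rfl
  refine (Hoare.seq (T₁ := 1) (T₂ := 3 * B + 24) (Q := fun s1 => s1 = ((s.setReg 48 0).setReg 49
    (2 * D.n + I)).setReg 50 (4 * D.n + J))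
    (Hoare.exec rfl le_rfl (by simp [exec, Op.eval, hJ, hE.r15, e2])) ?_).le (by omega)
  rintro s1 hF3 h1
  have hE1 := ((hE.frame hF1 rfl).frame hF2 rfl).frame hF3 rfl
  have a48 : s1.reg 48 = 0 := by simp [h1]
  have a49 : s1.reg 49 = 2 * D.n + I := by simp [h1]
  have a50 : s1.reg 50 = 4 * D.n + J := by simp [h1]
  have a16 : s1.mem 16 = q := by simp [h1, hq]
  have a12 : s1.mem 12 = s.mem 12 := by simp [h1]
  have a13 : s1.mem 13 = s.mem 13 := by simp [h1]
  have hX' : ∀ i < D.r, q (0 + i) < D.n := by simpa using hX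
  have b0 : 0 ≤ 5 * D.n := by omega
  have b1 : 2 * D.n + I ≤ 5 * D.n := by omega
  have b2 : 4 * D.n + J ≤ 5 * D.n := by omega
  refine (Hoare.seq (T₁ := 5) (T₂ := 3 * B + 18) (bases_spec hE1 a48 a49 a50 rfl) ?_).le (by omega)
  rintro s2 hF4 ⟨h40, h41, h42⟩
  have hE2 := hE1.frame hF4 rfl
  refine (Hoare.seq (T₁ := B) (T₂ := 2 * B + 17) (markBlock_spec (H := H) hmm hE2 hH
    (by rw [hF4.mem 12 rfl, a12]; exact hA)
    ⟨by rw [hF4.mem 16 rfl, a16], h40, h41, h42, hX', hY, hZ, b0, b1, b2⟩) ?_).le (by omega)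
  rintro s3 hF5 ⟨h3, h3'⟩
  have hE3 := ha.env hF5 hE2 rfl
  refine (Hoare.seq (T₁ := 5) (T₂ := 2 * B + 11) (bases_spec hE3 (X := 0) (Y := 4 * D.n + J)
    (Z := 2 * D.n + I) (by rw [ha.reg hF5 48 rfl, hF4.reg 48 rfl, a48])
    (by rw [ha.reg hF5 50 rfl, hF4.reg 50 rfl, a50])
    (by rw [ha.reg hF5 49 rfl, hF4.reg 49 rfl, a49]) rfl) ?_).le (by omega)
  rintro s4 hF6 ⟨h40, h41, h42⟩
  have hE4 := hE3.frame hF6 rfl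
  refine (Hoare.seq (T₁ := B) (T₂ := B + 10) (markBlock_spec (H := H) hmm hE4 hH
    (by rw [hF6.mem 12 rfl, ha.mem hF5 12 rfl, hF4.mem 12 rfl, a12]; exact hA)
    ⟨by rw [hF6.mem 16 rfl, ha.mem hF5 16 rfl, hF4.mem 16 rfl, a16], h40, h41, h42, hX', hZ, hY,
      b0, b2, b1⟩) ?_).le (by omega)
  rintro s5 hF7 ⟨h5, h5'⟩
  have hE5 := ha.env hF7 hE4 rfl
  refine (Hoare.seq (T₁ := 5) (T₂ := B) (bases_spec hE5 (X := 2 * D.n + I) (Y := 0)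
    (Z := 4 * D.n + J)
    (by rw [ha.reg hF7 49 rfl, hF6.reg 49 rfl, ha.reg hF5 49 rfl, hF4.reg 49 rfl, a49])
    (by rw [ha.reg hF7 48 rfl, hF6.reg 48 rfl, ha.reg hF5 48 rfl, hF4.reg 48 rfl, a48])
    (by rw [ha.reg hF7 50 rfl, hF6.reg 50 rfl, ha.reg hF5 50 rfl, hF4.reg 50 rfl, a50])
    rfl) ?_).le (by omega)
  rintro s6 hF8 ⟨h40, h41, h42⟩
  have hE6 := hE5.frame hF8 rfl
  refine Hoare.mono (markBlock_spec (H := H) hmm hE6 hH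
    (by rw [hF8.mem 12 rfl, ha.mem hF7 12 rfl, hF6.mem 12 rfl, ha.mem hF5 12 rfl, hF4.mem 12 rfl,
          a12]; exact hA)
    ⟨by rw [hF8.mem 16 rfl, ha.mem hF7 16 rfl, hF6.mem 16 rfl, ha.mem hF5 16 rfl, hF4.mem 16 rfl,
      a16], h40, h41, h42, hY, hX', hZ, b1, b0, b2⟩) le_rfl ?_
  rintro s7 ⟨h7, h7'⟩
  rw [hF4.mem 13 rfl, a13] at h3
  rw [hF6.mem 13 rfl] at h5
  rw [hF8.mem 13 rfl] at h7
  simp only [Nat.zero_add] at h3' h5' h7'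
  refine ⟨h3.trans (h5.trans h7), fun i hi l hl j hj hab hbc hac => ?_⟩
  -- The three products mark the edge opposite to the vertex of the second, third and first list,
  -- respectively.
  have g3 := h3' i hi l hl j hj hab hbc hac
  have g5 := h5' i hi j hj l hl hac hbc.symm hab
  have g7 := h7' l hl i hi j hj hab.symm hac hbc
  exact ⟨h7.2 _ _ g5.1, h7.2 _ _ g5.2, g7.1, g7.2, h7.2 _ _ (h5.2 _ _ g3.1),
    h7.2 _ _ (h5.2 _ _ g3.2)⟩

/-- A loop that advances in steps of `r`. -/
theorem loop_stride {D : Data} {i h : ℕ} {body : Cmd} {s : State} {c N : ℕ}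
    {Inv : ℕ → State → Prop}
    (hw : body.writes i = false ∧ body.writes h = false ∧ body.writes 4 = false)
    (hne : (h != i && 4 != i) = true) (h4 : s.reg 4 = D.r) (hi : s.reg i = 0)
    (hh : s.reg h = N) (hN : N ≤ D.n)
    (hst : ∀ j s v, Inv j s → Inv j (s.setReg i v)) (h0 : Inv 0 s)
    (hbody : ∀ k s', k * D.r < N → Frame D.w (.seq body (.arith i .add i 4)) s s' →
      s'.reg i = k * D.r → Inv k s' → Hoare D.w body s' c (Inv (k + 1))) :
    Hoare D.w (.loop i h (.seq body (.arith i .add i 4))) s ((N / D.r + 1) * (c + 3) + 1)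
      fun s' => ∃ k, N ≤ k * D.r ∧ Inv k s' := by
  simp only [Bool.and_eq_true, bne_iff_ne, ne_eq] at hne
  obtain ⟨hwi, hwh, hw4⟩ := hw
  refine Hoare.mono (Hoare.loop (N := N / D.r + 1) (c := c + 2) (Inv := fun k s => Inv k s ∧
    s.reg i = k * D.r ∧ s.reg h = N ∧ s.reg 4 = D.r) ⟨h0, by simpa using hi, hh, h4⟩ ?_ ?_) le_rfl ?_
  · rintro k s' ⟨hI, hi', hh', h4'⟩ hF hlt
    rw [hi', hh'] at hlt
    refine Hoare.seq (T₁ := c) (T₂ := 1) (hbody k s' hlt hF hi' hI) fun s1 hF1 hI1 => ?_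
    refine Hoare.exec rfl le_rfl ?_
    have e1 : s1.reg i = k * D.r := (hF1.reg i hwi).trans hi'
    have e2 : s1.reg h = N := (hF1.reg h hwh).trans hh'
    have e3 : s1.reg 4 = D.r := (hF1.reg 4 hw4).trans h4'
    refine ⟨hst _ _ _ hI1, ?_, ?_, ?_⟩
    · simp only [exec, State.setReg_reg, Op.eval, e1, e3, if_true]
      rw [Nat.mod_eq_of_lt (D.sq_lt (by nlinarith [D.r_le])), Nat.succ_mul]
    · simp [exec, hne.1, e2]
    · simp [exec, hne.2, e3]
  · rintro s' ⟨-, h1, h2, -⟩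
    rw [h1, h2, not_lt]
    -- After `N / r + 1` strides the counter exceeds `N`.
    have := Nat.lt_div_mul_add (a := N) (b := D.r) D.r_pos
    rw [Nat.succ_mul]; omega
  · rintro s' ⟨⟨k, -, hI, h1, h2, -⟩, hlt⟩
    exact ⟨k, by omega, hI⟩

/-- Go through the blocks of the third list. -/
def highInner (mm : Cmd) : Cmd :=
  .seq (.const 47 0) (.loop 47 44 (.seq (markTriple mm) (.arith 47 .add 47 4)))

/-- Mark all triangles between the three lists in segment `16`. -/
def highLoop (mm : Cmd) : Cmd :=
  .seq (.const 46 0) (.loop 46 43 (.seq (highInner mm) (.arith 46 .add 46 4)))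

theorem MulSpec.agree_inner {D : Data} {mm : Cmd} {Tm : ℕ} (h : MulSpec D mm Tm) :
    (highInner mm).Agree (highInner .skip) :=
  .seq .refl (.loop (.seq h.agree_triple .refl))

theorem MulSpec.agree_high {D : Data} {mm : Cmd} {Tm : ℕ} (h : MulSpec D mm Tm) :
    (highLoop mm).Agree (highLoop .skip) :=
  .seq .refl (.loop (.seq h.agree_inner .refl))

theorem highInner_spec {D : Data} {H : SimpleGraph ℕ} {s : State} {q : ℕ → ℕ} {I N Tm : ℕ}
    {mm : Cmd} (hmm : MulSpec D mm Tm) (hE : Env D s) (hH : H ≤ D.G) (hA : Alive D H (s.mem 12))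
    (hq : s.mem 16 = q) (hI : s.reg 46 = I) (hIn : I ≤ D.n) (hN : s.reg 44 = N) (hNn : N ≤ D.n)
    (hX : ∀ i < D.r, q i < D.n) (hY : ∀ i < D.r, q (2 * D.n + I + i) < D.n)
    (hZ : ∀ i < N + D.r, q (4 * D.n + i) < D.n) :
    Hoare D.w (highInner mm) s ((N / D.r + 1) * (3 * (200 * (D.r * D.r) + Tm) + 33) + 3) fun s' =>
      MStep D (s.mem 13) (s'.mem 13) ∧ ∀ i < D.r, ∀ l < D.r, ∀ j < N,
        H.Adj (q i) (q (2 * D.n + I + l)) → H.Adj (q (2 * D.n + I + l)) (q (4 * D.n + j)) →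
        H.Adj (q i) (q (4 * D.n + j)) →
        AllMarked D (s'.mem 13) (q i) (q (2 * D.n + I + l)) (q (4 * D.n + j)) := by
  have ha := hmm.agree_triple
  refine (Hoare.seq (T₁ := 1) (T₂ := (N / D.r + 1) * (3 * (200 * (D.r * D.r) + Tm) + 33) + 1)
    (Q := fun s1 => s1 = s.setReg 47 0)
    (Hoare.exec rfl le_rfl (by simp [exec])) ?_).le (by omega)
  rintro s1 hF1 h1
  have hE1 := hE.frame hF1 rfl
  refine Hoare.mono (loop_stride (c := 3 * (200 * (D.r * D.r) + Tm) + 30) (N := N)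
    (Inv := fun k s2 => MStep D (s.mem 13) (s2.mem 13) ∧
      ∀ i < D.r, ∀ l < D.r, ∀ j < k * D.r,
        H.Adj (q i) (q (2 * D.n + I + l)) → H.Adj (q (2 * D.n + I + l)) (q (4 * D.n + j)) →
        H.Adj (q i) (q (4 * D.n + j)) →
        AllMarked D (s2.mem 13) (q i) (q (2 * D.n + I + l)) (q (4 * D.n + j)))
    ⟨(ha 47 (by decide)).1, (ha 44 (by decide)).1, (ha 4 (by decide)).1⟩ rfl hE1.r4 (by simp [h1])
    (by simp [h1, hN]) hNn (fun _ _ _ h => h) ⟨by simp [h1, MStep.refl], by simp⟩ ?_)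
    (le_of_eq (by ring)) ?_
  · intro k s2 hk hF2 h47 ⟨hI1, hI2⟩
    have ha' : (Cmd.seq (markTriple mm) (.arith 47 .add 47 4)).Agree
      (.seq (markTriple .skip) (.arith 47 .add 47 4)) := ha.seq .refl
    refine Hoare.mono (markTriple_spec (H := H) (q := q) (I := I) hmm (ha'.env hF2 hE1 rfl) hH
      ?_ ?_ ?_ h47 hIn (by omega) hX hY ?_) le_rfl ?_
    · rw [ha'.mem hF2 12 rfl, hF1.mem 12 rfl]; exact hA
    · rw [ha'.mem hF2 16 rfl, hF1.mem 16 rfl]; exact hq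
    · rw [ha'.reg hF2 46 rfl, hF1.reg 46 rfl]; exact hI
    · intro i hi
      -- The block starts at `k * r < N`, so it overshoots the list by less than `r`, which the
      -- padding covers.
      rw [Nat.add_assoc]
      exact hZ _ (by omega)
    · rintro s3 ⟨h3, h3'⟩
      refine ⟨hI1.trans h3, fun i hi l hl j hj => ?_⟩
      by_cases hc : j < k * D.r
      · exact fun g1 g2 g3 => (hI2 i hi l hl j hc g1 g2 g3).mono h3
      · have := h3' i hi l hl (j - k * D.r) (by rw [Nat.succ_mul] at hj; omega)
        rwa [show 4 * D.n + k * D.r + (j - k * D.r) = 4 * D.n + j by omega] at this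
  · rintro s2 ⟨k, hk, h2, h2'⟩
    exact ⟨h2, fun i hi l hl j hj => h2' i hi l hl j (by omega)⟩

/-- The neighbours of `v` fill a single block, so only the pairs of a block of dense vertices and a
block of vertices with codegree at least `L` have to be treated. This gives the product of the two
block counts in the time bound. -/
theorem highLoop_spec {D : Data} {H : SimpleGraph ℕ} {s : State} {v Tm : ℕ}
    {mm : Cmd} (hmm : MulSpec D mm Tm) (hE : Env D s) (hH : H ≤ D.G) (hA : Alive D H (s.mem 12))
    (hv : v < D.n) (hS : Scanned D H v s) (hP : Padded D H v (s.mem 16)) :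
    Hoare D.w (highLoop mm) s (((D.popular H v D.θ).length / D.r + 1) *
      (((D.popular H v D.L).length / D.r + 1) * (700 * (D.r * D.r) + 3 * Tm)) + 3) fun s' =>
      MStep D (s.mem 13) (s'.mem 13) ∧
      ∀ b y, b < D.n → D.θ ≤ D.codeg H v b → y < D.n → H.Adj b y → D.L ≤ D.codeg H v y →
        ∀ a, H.Adj v a → H.Adj a y → H.Adj a b → AllMarked D (s'.mem 13) a b y := by
  have ha := hmm.agree_inner
  set N := (D.popular H v D.θ).length with hNdef
  set N' := (D.popular H v D.L).length with hNdef'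
  have hN : N ≤ D.n := D.length_popular _
  have hN' : N' ≤ D.n := D.length_popular _
  have hrr : 1 ≤ D.r * D.r := Nat.mul_pos D.r_pos D.r_pos
  set c := (N' / D.r + 1) * (3 * (200 * (D.r * D.r) + Tm) + 33) + 3 with hc
  have hc' : c + 3 ≤ (N' / D.r + 1) * (700 * (D.r * D.r) + 3 * Tm) := by
    have : (N' / D.r + 1) * (3 * (200 * (D.r * D.r) + Tm) + 39) ≤
      (N' / D.r + 1) * (700 * (D.r * D.r) + 3 * Tm) := Nat.mul_le_mul_left _ (by omega)
    have e : (N' / D.r + 1) * (3 * (200 * (D.r * D.r) + Tm) + 39) =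
      (N' / D.r + 1) * (3 * (200 * (D.r * D.r) + Tm) + 33) + (N' / D.r + 1) * 6 := by ring
    have : 0 ≤ N' / D.r := Nat.zero_le _
    generalize N' / D.r = Y at *
    omega
  refine (Hoare.seq (T₁ := 1) (T₂ := (N / D.r + 1) * (c + 3) + 1)
    (Q := fun s1 => s1 = s.setReg 46 0)
    (Hoare.exec rfl le_rfl (by simp [exec])) ?_).le
    (by have := Nat.mul_le_mul_left (N / D.r + 1) hc'; omega)
  rintro s1 hF1 h1
  have hE1 := hE.frame hF1 rfl
  have key : Hoare D.w (.loop 46 43 (.seq (highInner mm) (.arith 46 .add 46 4))) s1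
      ((N / D.r + 1) * (c + 3) + 1) fun s' => MStep D (s.mem 13) (s'.mem 13) ∧
      ∀ i < D.r, ∀ l < N, ∀ j < N', H.Adj (s.mem 16 i) (s.mem 16 (2 * D.n + l)) →
        H.Adj (s.mem 16 (2 * D.n + l)) (s.mem 16 (4 * D.n + j)) →
        H.Adj (s.mem 16 i) (s.mem 16 (4 * D.n + j)) → AllMarked D (s'.mem 13) (s.mem 16 i)
          (s.mem 16 (2 * D.n + l)) (s.mem 16 (4 * D.n + j)) := by
    refine Hoare.mono (loop_stride (N := N)
      (Inv := fun k s2 => MStep D (s.mem 13) (s2.mem 13) ∧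
        ∀ i < D.r, ∀ l < k * D.r, ∀ j < N', H.Adj (s.mem 16 i) (s.mem 16 (2 * D.n + l)) →
        H.Adj (s.mem 16 (2 * D.n + l)) (s.mem 16 (4 * D.n + j)) →
        H.Adj (s.mem 16 i) (s.mem 16 (4 * D.n + j)) → AllMarked D (s2.mem 13) (s.mem 16 i)
          (s.mem 16 (2 * D.n + l)) (s.mem 16 (4 * D.n + j)))
      ⟨(ha 46 (by decide)).1, (ha 43 (by decide)).1, (ha 4 (by decide)).1⟩ rfl hE1.r4 (by simp [h1])
      (by simp [h1, hS.r43, hNdef]) hN (fun _ _ _ h => h) ⟨by simp [h1, MStep.refl], by simp⟩ ?_) le_rfl ?_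
    · intro k s2 hk hF2 h46 ⟨hI1, hI2⟩
      have ha' : (Cmd.seq (highInner mm) (.arith 46 .add 46 4)).Agree
        (.seq (highInner .skip) (.arith 46 .add 46 4)) := ha.seq .refl
      refine Hoare.mono (highInner_spec (H := H) (q := s.mem 16) (I := k * D.r) (N := N') hmm
        (ha'.env hF2 hE1 rfl) hH ?_ ?_ h46 (by omega) ?_ hN' hP.nbrs ?_ hP.high) le_rfl ?_
      · rw [ha'.mem hF2 12 rfl, hF1.mem 12 rfl]; exact hA
      · rw [ha'.mem hF2 16 rfl, hF1.mem 16 rfl]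
      · rw [ha'.reg hF2 44 rfl, hF1.reg 44 rfl, hS.r44]
      · intro i hi
        rw [Nat.add_assoc]
        exact hP.dense _ (by omega)
      · rintro s3 ⟨h3, h3'⟩
        refine ⟨hI1.trans h3, fun i hi l hl j hj => ?_⟩
        by_cases hc : l < k * D.r
        · exact fun g1 g2 g3 => (hI2 i hi l hc j hj g1 g2 g3).mono h3
        · have := h3' i hi (l - k * D.r) (by rw [Nat.succ_mul] at hl; omega) j hj
          rwa [show 2 * D.n + k * D.r + (l - k * D.r) = 2 * D.n + l by omega] at this
    · rintro s2 ⟨k, hk, h2, h2'⟩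
      exact ⟨h2, fun i hi l hl => h2' i hi l (by omega)⟩
  refine Hoare.mono key le_rfl ?_
  rintro s2 ⟨h2, h2'⟩
  refine ⟨h2, fun b y hb hbθ hy hby hyL a hva hay hab => ?_⟩
  obtain ⟨i, hi, rfl⟩ := List.getElem_of_mem ((Data.mem_nbrsIn hH).2 ⟨hv, hva⟩)
  obtain ⟨l, hl, rfl⟩ := List.getElem_of_mem (Data.mem_popular.2 ⟨hb, hbθ⟩)
  obtain ⟨j, hj, rfl⟩ := List.getElem_of_mem (Data.mem_popular.2 ⟨hy, hyL⟩)
  have e1 := hS.nbrs i hi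
  have e2 := hS.dense l hl
  have e3 := hS.high j hj
  rw [Nat.zero_add] at e1
  have := h2' i (hi.trans_le (Data.length_nbrsIn hv)) l hl j hj
  rw [e1, e2, e3] at this
  exact this hab hby hay
-- Deletion of the edges between neighbours of `v` and dense vertices
namespace Data

/-- One of the two vertices is a neighbour of `v` and the other one has at least `θ` common
neighbours with `v`. -/
def Kill (D : Data) (H : SimpleGraph ℕ) (v a x : ℕ) : Prop :=
  (H.Adj v a ∧ D.θ ≤ D.codeg H v x) ∨ (H.Adj v x ∧ D.θ ≤ D.codeg H v a)

theorem Kill.symm {D : Data} {H : SimpleGraph ℕ} {v a x : ℕ} (h : D.Kill H v a x) :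
    D.Kill H v x a := Or.symm h

/-- Delete all edges between the neighbours of `v` and the vertices that have at least `θ` common
neighbours with `v`. -/
def del (D : Data) (H : SimpleGraph ℕ) (v : ℕ) : SimpleGraph ℕ where
  Adj a x := H.Adj a x ∧ ¬ D.Kill H v a x
  symm := ⟨fun _ _ h => ⟨h.1.symm, fun h' => h.2 h'.symm⟩⟩
  loopless := ⟨fun a h => H.loopless.irrefl a h.1⟩

theorem del_le {D : Data} {H : SimpleGraph ℕ} {v : ℕ} : D.del H v ≤ H := fun _ _ h => h.1

/-- The effect of processing the vertex `v`. -/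
noncomputable def next (D : Data) (H : SimpleGraph ℕ) (v : ℕ) : SimpleGraph ℕ :=
  if D.weight H v < D.θ * D.r then H else D.del H v

theorem next_le {D : Data} {H : SimpleGraph ℕ} {v : ℕ} : D.next H v ≤ H := by
  unfold next
  split_ifs
  · exact le_rfl
  · exact del_le

end Data

/-- Delete the edge between the vertices in registers `23` and `29` if the latter is dense. -/
def killPair : Cmd :=
  .seq (.load 29 1 21) <| .seq (.load 37 14 29) <| .ite 37 6 .skip <|
  .seq (.arith 38 .mul 23 0) <| .seq (.arith 38 .add 38 29) <| .seq (.store 12 38 11) <|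
  .seq (.arith 38 .mul 29 0) <| .seq (.arith 38 .add 38 23) (.store 12 38 11)

/-- Delete the edges between the neighbours of `v` and the dense vertices. -/
def killLoop : Cmd :=
  .forUp 20 26 (.seq (.load 23 16 20) (.forNbr 23 21 22 killPair))

/-- Some of the edges that are to be deleted have been deleted on the way from `m` to `m'`. -/
def KStep (D : Data) (H : SimpleGraph ℕ) (v : ℕ) (m m' : ℕ → ℕ) : Prop :=
  ∀ u x, u < D.n → x < D.n → m' (u * D.n + x) = m (u * D.n + x) ∨
    (m' (u * D.n + x) = D.off D.n ∧ D.Kill H v u x)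

theorem KStep.refl {D : Data} {H : SimpleGraph ℕ} {v : ℕ} {m : ℕ → ℕ} : KStep D H v m m :=
  fun _ _ _ _ => Or.inl rfl

theorem KStep.trans {D : Data} {H : SimpleGraph ℕ} {v : ℕ} {m m' m'' : ℕ → ℕ}
    (h : KStep D H v m m') (h' : KStep D H v m' m'') : KStep D H v m m'' := by
  intro u x hu hx
  rcases h' u x hu hx with e | e
  · rw [e]; exact h u x hu hx
  · exact Or.inr e

theorem KStep.off {D : Data} {H : SimpleGraph ℕ} {v u x : ℕ} {m m' : ℕ → ℕ}
    (h : KStep D H v m m') (hu : u < D.n) (hx : x < D.n) (hm : m (u * D.n + x) = D.off D.n) :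
    m' (u * D.n + x) = D.off D.n := by
  rcases h u x hu hx with e | e
  · rw [e, hm]
  · exact e.1

theorem KStep.update {D : Data} {H : SimpleGraph ℕ} {v u x : ℕ} {m : ℕ → ℕ}
    (hx : x < D.n) (h : D.Kill H v u x) :
    KStep D H v m (Function.update m (u * D.n + x) (D.off D.n)) := by
  intro u' x' hu' hx'
  rw [Function.update_apply]
  split_ifs with hc
  · obtain ⟨rfl, rfl⟩ := Data.idx_inj hx' hx hc
    exact Or.inr ⟨rfl, h⟩
  · exact Or.inl rfl

theorem killPair_spec {D : Data} {H : SimpleGraph ℕ} {s : State} {v a x : ℕ} (hE : Env D s)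
    (hva : H.Adj v a) (ha : s.reg 23 = a) (han : a < D.n) (hxn : x < D.n)
    (hx : D.nb (s.reg 21) = x) (hc : s.mem 14 x = D.codeg H v x) :
    Hoare D.w killPair s 16 fun s' => KStep D H v (s.mem 12) (s'.mem 12) ∧
      (D.θ ≤ D.codeg H v x → s'.mem 12 (a * D.n + x) = D.off D.n ∧
        s'.mem 12 (x * D.n + a) = D.off D.n) := by
  refine Hoare.exec rfl (le_of_eq rfl) ?_
  have e1 : a * D.n % 2 ^ D.w = a * D.n := Nat.mod_eq_of_lt (by have := D.idx_word han hxn; omega)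
  have e2 : (a * D.n + x) % 2 ^ D.w = a * D.n + x := Nat.mod_eq_of_lt (D.idx_word han hxn)
  have e3 : x * D.n % 2 ^ D.w = x * D.n := Nat.mod_eq_of_lt (by have := D.idx_word hxn han; omega)
  have e4 : (x * D.n + a) % 2 ^ D.w = x * D.n + a := Nat.mod_eq_of_lt (D.idx_word hxn han)
  by_cases hlt : D.codeg H v x < D.θ
  · simp [killPair, exec, hE.m1, hE.r6, hx, hc, hlt, KStep.refl, not_le.2 hlt]
  · simp only [killPair, exec, State.setReg_reg, State.setReg_mem, State.setMem_reg,
      State.setMem_mem, Op.eval, hE.r0, hE.m1, hE.r6, hE.r11, hx, hc, ha, e1, e2, e3, e4,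
      Nat.reduceEqDiff, if_true, if_false, hlt]
    have hk : D.Kill H v a x := Or.inl ⟨hva, not_lt.1 hlt⟩
    have k1 := KStep.update (m := s.mem 12) hxn hk
    have k2 := KStep.update (m := Function.update (s.mem 12) (a * D.n + x) (D.off D.n)) han hk.symm
    exact ⟨k1.trans k2, fun _ => ⟨k2.off han hxn (by simp), by simp⟩⟩

/-- The loop runs over the adjacency lists of the input graph without asking whether an edge is
still alive: deleting an edge twice is harmless, and `KStep` shows that no other edge is affected.
-/
theorem killLoop_spec {D : Data} {H : SimpleGraph ℕ} {s : State} {v : ℕ} (hE : Env D s)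
    (hH : H ≤ D.G) (hA : Alive D H (s.mem 12)) (hv : v < D.n) (hS : Scanned D H v s) :
    Hoare D.w killLoop s (D.r * (D.r * 19 + 12) + 3) fun s' => Alive D (D.del H v) (s'.mem 12) := by
  have hlen := Data.length_nbrsIn (H := H) hv
  have hmul := Nat.mul_le_mul_right (D.r * 19 + 12) hlen
  refine Hoare.mono (forUp_spec (c := D.r * 19 + 9) (fun j s1 =>
    KStep D H v (s.mem 12) (s1.mem 12) ∧ ∀ i (hi : i < (D.nbrsIn H v).length), i < j →
      ∀ x, x < D.n → D.G.Adj (D.nbrsIn H v)[i] x → D.θ ≤ D.codeg H v x →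
        s1.mem 12 ((D.nbrsIn H v)[i] * D.n + x) = D.off D.n ∧
        s1.mem 12 (x * D.n + (D.nbrsIn H v)[i]) = D.off D.n) rfl hE.r9 hS.r26
    (D.sq_lt (by nlinarith [D.r_le])) (fun _ _ _ h => h) ⟨KStep.refl, by omega⟩ ?_) (Nat.add_le_add_right hmul 3) ?_
  · intro j s1 hj hF hi ⟨hI1, hI2⟩
    have hE1 := hE.frame hF rfl
    set a := (D.nbrsIn H v)[j]'hj with ha
    have hva : H.Adj v a := ((Data.mem_nbrsIn hH).1 (List.getElem_mem hj)).2
    have han := (Data.lt_of_adj (hH hva)).2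
    refine (Hoare.seq (T₁ := 1) (T₂ := D.r * 19 + 7) (Q := fun s2 => s2 = s1.setReg 23 a)
      (Hoare.exec rfl le_rfl ?_) ?_).le (by omega)
    · have := hS.nbrs j hj
      rw [Nat.zero_add] at this
      simp [exec, hi, hF.mem 16 rfl, this, ha]
    rintro s2 hF2 rfl
    have hE2 := hE1.frame hF2 rfl
    refine Hoare.mono (forNbr_spec (c := 16) (fun l s2 => KStep D H v (s1.mem 12) (s2.mem 12) ∧
      ∀ x ∈ l, D.θ ≤ D.codeg H v x → s2.mem 12 (a * D.n + x) = D.off D.n ∧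
        s2.mem 12 (x * D.n + a) = D.off D.n) hE2 rfl (U := a) (by simp) han (fun _ _ _ h => h)
      (fun _ _ _ h => h) ⟨KStep.refl, by simp⟩ ?_) le_rfl ?_
    · intro l x s3 hl hF3 _ _ hx ⟨hJ1, hJ2⟩
      have hlG : ∀ y ∈ l ++ [x], y < D.n := fun y hy =>
        (Data.lt_of_adj ((Data.mem_nbrs han).1 (hl.subset hy))).2
      have hxn : x < D.n := hlG x (by simp)
      refine Hoare.mono (killPair_spec (H := H) (v := v) (a := a) (x := x) (hE2.frame hF3 rfl) hva
        ?_ han hxn hx ?_) le_rfl ?_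
      · rw [hF3.reg 23 rfl]; simp
      · rw [hF3.mem 14 rfl, State.setReg_mem, hF.mem 14 rfl]; exact (hS.bucket x hxn).1
      · rintro s4 ⟨h1, h2⟩
        refine ⟨hJ1.trans h1, fun y hy hθ => ?_⟩
        have hyn := hlG y hy
        rw [List.mem_append, List.mem_singleton] at hy
        rcases hy with hy | rfl
        · exact ⟨h1.off han hyn (hJ2 y hy hθ).1, h1.off hyn han (hJ2 y hy hθ).2⟩
        · exact h2 hθ
    · rintro s3 ⟨h1, h2⟩
      refine ⟨hI1.trans h1, fun i hi hij x hxn hx hθ => ?_⟩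
      by_cases hc : i = j
      · subst hc
        exact h2 x ((Data.mem_nbrs han).2 hx) hθ
      · obtain ⟨g1, g2⟩ := hI2 i hi (by omega) x hxn hx hθ
        have hin := (Data.lt_of_adj hx).1
        exact ⟨h1.off hin hxn g1, h1.off hxn hin g2⟩
  · rintro s' ⟨h1, h2⟩ u x hu hx
    -- The value `off n` lies behind the end of every adjacency list, so an entry holding it always
    -- fails the test.
    have hdead : s'.mem 12 (u * D.n + x) = D.off D.n → ¬ (D.off u ≤ s'.mem 12 (u * D.n + x) ∧
        s'.mem 12 (u * D.n + x) < D.off (u + 1) ∧ D.nb (s'.mem 12 (u * D.n + x)) = x) := by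
      rintro e ⟨-, h, -⟩
      have := Data.off_le (D := D) (u := u + 1) (v := D.n) hu le_rfl
      omega
    by_cases hk : D.Kill H v u x
    · rw [iff_false_left (fun h => h.2 hk)]
      by_cases hux : H.Adj u x
      · apply hdead
        rcases hk with ⟨g1, g2⟩ | ⟨g1, g2⟩
        · obtain ⟨i, hi, rfl⟩ := List.getElem_of_mem ((Data.mem_nbrsIn hH).2 ⟨hv, g1⟩)
          exact (h2 i hi hi x hx (hH hux) g2).1
        · obtain ⟨i, hi, rfl⟩ := List.getElem_of_mem ((Data.mem_nbrsIn hH).2 ⟨hv, g1⟩)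
          exact (h2 i hi hi u hu (hH hux.symm) g2).2
      · rcases h1 u x hu hx with e | e
        · rw [e, ← hA u x hu hx]; exact hux
        · exact hdead e.1
    · rcases h1 u x hu hx with e | e
      · rw [e, ← hA u x hu hx]
        exact ⟨fun h => h.1, fun h => ⟨h, hk⟩⟩
      · exact (hk e.2).elim

/-! ### Processing one vertex -/

/-- Mark the edges of all triangles that contain an edge that is going to be deleted, and delete
these edges. -/
def heavy (mm : Cmd) : Cmd := .seq padLists (.seq lowLoop (.seq (highLoop mm) killLoop))

/-- Process the vertex in register `25`. -/
def process (mm : Cmd) : Cmd := .seq scanNbrs (.seq scanPopular (.ite 45 10 .skip (heavy mm)))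

/-- Every triangle of the input graph is marked or survives in `H`. -/
def Complete (D : Data) (H : SimpleGraph ℕ) (m : ℕ → ℕ) : Prop :=
  ∀ a b c, D.G.Adj a b → D.G.Adj b c → D.G.Adj a c →
    AllMarked D m a b c ∨ (H.Adj a b ∧ H.Adj b c ∧ H.Adj a c)

/-- The state represents the current graph `H` and the marks. -/
structure Represents (D : Data) (H : SimpleGraph ℕ) (s : State) : Prop where
  env : Env D s
  le : H ≤ D.G
  alive : Alive D H (s.mem 12)
  marks : MarksOK D (s.mem 13)
  complete : Complete D H (s.mem 13)

/-- The time for `heavy`. -/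
noncomputable def Data.heavyCost (D : Data) (Tm : ℕ) (H : SimpleGraph ℕ) (v : ℕ) : ℕ :=
  (D.popular H v D.θ).length * (180 * (D.r * D.L)) +
    ((D.popular H v D.θ).length / D.r + 1) *
      (((D.popular H v D.L).length / D.r + 1) * (700 * (D.r * D.r) + 3 * Tm)) +
    70 * (D.r * D.r)

theorem MulSpec.agree_heavy {D : Data} {mm : Cmd} {Tm : ℕ} (h : MulSpec D mm Tm) :
    (heavy mm).Agree (heavy .skip) :=
  .seq .refl (.seq .refl (.seq h.agree_high .refl))

theorem MulSpec.agree_process {D : Data} {mm : Cmd} {Tm : ℕ} (h : MulSpec D mm Tm) :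
    (process mm).Agree (process .skip) :=
  .seq .refl (.seq .refl (.ite .refl h.agree_heavy))

theorem AllMarked.rot {D : Data} {m : ℕ → ℕ} {a b c : ℕ} (h : AllMarked D m a b c) :
    AllMarked D m b c a := by
  obtain ⟨h1, h2, h3, h4, h5, h6⟩ := h
  exact ⟨h3, h4, h6, h5, h2, h1⟩

theorem AllMarked.swap {D : Data} {m : ℕ → ℕ} {a b c : ℕ} (h : AllMarked D m a b c) :
    AllMarked D m b a c := by
  obtain ⟨h1, h2, h3, h4, h5, h6⟩ := h
  exact ⟨h2, h1, h5, h6, h3, h4⟩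

/-- A triangle dies only by losing an edge between a neighbour `a` of `v` and a dense vertex `b`.
Whichever of its edges that is, and in whichever orientation, permuting the vertices reduces to the
case covered by `h'`. -/
theorem Complete.del {D : Data} {H : SimpleGraph ℕ} {v : ℕ} {m m' : ℕ → ℕ}
    (h : Complete D H m) (hm : MStep D m m')
    (h' : ∀ b y, D.θ ≤ D.codeg H v b → H.Adj b y → ∀ a, H.Adj v a → H.Adj a y →
      H.Adj a b → AllMarked D m' a b y) : Complete D (D.del H v) m' := by
  intro a b c hab hbc hac
  rcases h a b c hab hbc hac with g | ⟨g1, g2, g3⟩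
  · exact Or.inl (g.mono hm)
  · have key : ∀ a b c, H.Adj a b → H.Adj b c → H.Adj a c → D.Kill H v a b →
        AllMarked D m' a b c := by
      rintro a b c g1 g2 g3 (⟨k1, k2⟩ | ⟨k1, k2⟩)
      · exact h' b c k2 g2 a k1 g3 g1
      · exact (h' a c k2 g3 b k1 g2 g1.symm).swap
    by_cases k1 : D.Kill H v a b
    · exact Or.inl (key a b c g1 g2 g3 k1)
    by_cases k2 : D.Kill H v b c
    · exact Or.inl (key b c a g2 g3.symm g1.symm k2).rot.rot
    by_cases k3 : D.Kill H v a c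
    · exact Or.inl (key a c b g3 g2.symm g1 k3).swap.rot
    exact Or.inr ⟨⟨g1, k1⟩, ⟨g2, k2⟩, ⟨g3, k3⟩⟩

theorem heavy_spec {D : Data} {H : SimpleGraph ℕ} {s : State} {v Tm : ℕ} {mm : Cmd}
    (hmm : MulSpec D mm Tm) (hR : Represents D H s) (hv : v < D.n) (hS : Scanned D H v s) :
    Hoare D.w (heavy mm) s (D.heavyCost Tm H v) (Represents D (D.del H v)) := by
  have hE := hR.env
  have hr := D.r_pos
  have hrr : D.r ≤ D.r * D.r := Nat.le_mul_of_pos_left _ hr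
  have e : D.r * (D.r * 19 + 12) = 19 * (D.r * D.r) + 12 * D.r := by ring
  refine (Hoare.seq (T₁ := D.r * 23 + 3) (T₂ := ((D.popular H v D.θ).length *
    (180 * (D.r * D.L)) + 3) + ((((D.popular H v D.θ).length / D.r + 1) *
      (((D.popular H v D.L).length / D.r + 1) * (700 * (D.r * D.r) + 3 * Tm)) + 3) +
      (D.r * (D.r * 19 + 12) + 3) + 1) + 1) (padLists_spec hE hR.le hv hS) ?_).le
    (by unfold Data.heavyCost; omega)
  rintro s1 hF1 ⟨hS1, hP1⟩
  have hE1 := hE.frame hF1 rfl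
  have hA1 : Alive D H (s1.mem 12) := by rw [hF1.mem 12 rfl]; exact hR.alive
  refine Hoare.seq (lowLoop_spec hE1 hR.le hA1 hv hS1) ?_
  rintro s2 hF2 ⟨hM2, hC2⟩
  have hE2 := hE1.frame hF2 rfl
  have hS2 : Scanned D H v s2 := by
    constructor
    · rw [hF2.reg 26 rfl]; exact hS1.r26
    · rw [hF2.reg 43 rfl]; exact hS1.r43
    · rw [hF2.reg 44 rfl]; exact hS1.r44
    · rw [hF2.reg 45 rfl]; exact hS1.r45
    · rw [hF2.mem 14 rfl, hF2.mem 15 rfl]; exact hS1.bucket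
    · rw [hF2.mem 16 rfl]; exact hS1.nbrs
    · rw [hF2.mem 16 rfl]; exact hS1.dense
    · rw [hF2.mem 16 rfl]; exact hS1.high
  have hA2 : Alive D H (s2.mem 12) := by rw [hF2.mem 12 rfl]; exact hA1
  refine Hoare.seq (highLoop_spec hmm hE2 hR.le hA2 hv hS2 (by rw [hF2.mem 16 rfl]; exact hP1)) ?_
  rintro s3 hF3 ⟨hM3, hC3⟩
  have ha := hmm.agree_high
  have hE3 := ha.env hF3 hE2 rfl
  have hS3 : Scanned D H v s3 := by
    constructor
    · rw [ha.reg hF3 26 rfl]; exact hS2.r26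
    · rw [ha.reg hF3 43 rfl]; exact hS2.r43
    · rw [ha.reg hF3 44 rfl]; exact hS2.r44
    · rw [ha.reg hF3 45 rfl]; exact hS2.r45
    · rw [ha.mem hF3 14 rfl, ha.mem hF3 15 rfl]; exact hS2.bucket
    · rw [ha.mem hF3 16 rfl]; exact hS2.nbrs
    · rw [ha.mem hF3 16 rfl]; exact hS2.dense
    · rw [ha.mem hF3 16 rfl]; exact hS2.high
  refine Hoare.mono (Hoare.frame (killLoop_spec hE3 hR.le
    (by rw [ha.mem hF3 12 rfl]; exact hA2) hv hS3)) le_rfl ?_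
  rintro s4 ⟨hA4, hF4⟩
  rw [hF1.mem 13 rfl] at hM2
  have hM : MStep D (s.mem 13) (s4.mem 13) := by
    rw [hF4.mem 13 rfl]; exact hM2.trans hM3
  refine ⟨hE3.frame hF4 rfl, Data.del_le.trans hR.le, hA4, hM.1 hR.marks,
    hR.complete.del hM fun b y hb hby a hva hay hab => ?_⟩
  obtain ⟨hbn, hyn⟩ := Data.lt_of_adj (hR.le hby)
  rw [hF4.mem 13 rfl]
  -- The codegree of the third vertex with `v` decides whether the bucket search or the matrix
  -- product has found the triangle.
  rcases lt_or_ge (D.codeg H v y) D.L with hL | hL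
  · exact (hC2 b y hbn hb hby hL a hva hay hab).mono hM3
  · exact hC3 b y hbn hb hyn hby hL a hva hay hab

theorem process_spec {D : Data} {H : SimpleGraph ℕ} {s : State} {v Tm : ℕ} {mm : Cmd}
    (hmm : MulSpec D mm Tm) (hR : Represents D H s) (h25 : s.reg 25 = v) (hv : v < D.n) :
    Hoare D.w (process mm) s (D.n * 370 +
      if D.weight H v < D.θ * D.r then 0 else D.heavyCost Tm H v) (Represents D (D.next H v)) := by
  have hn := D.n_pos
  have hE := hR.env
  set c := if D.weight H v < D.θ * D.r then 0 else D.heavyCost Tm H v with hc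
  refine (Hoare.seq (T₁ := D.n * 300) (T₂ := D.n * 60 + (c + 1 + 1) + 1)
    (scanNbrs_spec hE hR.le hR.alive h25 hv) ?_).le (by omega)
  rintro s1 hF1 ⟨h1, h2, h3⟩
  have hE1 := hE.frame hF1 rfl
  refine Hoare.seq (scanPopular_spec hE1 hv h1 h2 h3) ?_
  rintro s2 hF2 hS
  have hR2 : Represents D H s2 := by
    refine ⟨hE1.frame hF2 rfl, hR.le, ?_, ?_, ?_⟩
    · rw [hF2.mem 12 rfl, hF1.mem 12 rfl]; exact hR.alive
    · rw [hF2.mem 13 rfl, hF1.mem 13 rfl]; exact hR.marks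
    · rw [hF2.mem 13 rfl, hF1.mem 13 rfl]; exact hR.complete
  refine Hoare.ite (fun hlt => ?_) fun hlt => ?_
  · rw [hS.r45, hR2.env.r10] at hlt
    refine (Hoare.skip ?_).le (by omega)
    rwa [Data.next, if_pos hlt]
  · rw [hS.r45, hR2.env.r10] at hlt
    rw [Data.next, if_neg hlt]
    exact (heavy_spec hmm hR2 hv hS).le (by rw [hc, if_neg hlt]; omega)

/-! ### The random sparsification -/

/-- A loop whose body draws a random number first; the time may depend on that number. -/
theorem Spec.loop_rand {w : ℕ} {ι : Type} {x y z m : ℕ} {B : Cmd} {s : State} {T : ℕ}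
    {ν : ℕ → PMF ι} {Q' : ι → State → Prop} (hlt : s.reg x < s.reg y)
    (h : ∀ v ∈ (uniformBelow (s.reg m)).support, ∃ (T₁ T₂ : ℕ) (Q : State → Prop),
      T₁ + T₂ + 3 ≤ T ∧ Hoare w B (s.setReg z v) T₁ Q ∧
      ∀ s', Frame w B (s.setReg z v) s' → Q s' →
        Spec w (.loop x y (.seq (.rand z m) B)) s' T₂ (ν v) Q') :
    Spec w (.loop x y (.seq (.rand z m) B)) s T ((uniformBelow (s.reg m)).bind ν) Q' := by
  set L := Cmd.loop x y (.seq (.rand z m) B) with hL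
  have key : ∀ v, ∃ κ : PMF (ι × State × ℕ), v ∈ (uniformBelow (s.reg m)).support →
      κ.map Prod.fst = ν v ∧ (∀ y ∈ κ.support, y.2.2 + 2 ≤ T ∧ Q' y.1 y.2.1) ∧
      ∀ K N, T ≤ N + 2 →
        run w N (.seq B L :: K, s.setReg z v) = κ.bind fun y => run w (N - y.2.2) (K, y.2.1) := by
    intro v
    by_cases hv : v ∈ (uniformBelow (s.reg m)).support
    · obtain ⟨T₁, T₂, Q, hT, h1, h2⟩ := h v hv
      obtain ⟨κ, a1, a2, a3⟩ := Hoare.seqSpec h1 h2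
      refine ⟨κ, fun _ => ⟨a1, fun y hy => ⟨?_, (a2 y hy).2⟩, fun K N hN => a3 K N (by omega)⟩⟩
      have := (a2 y hy).1
      omega
    · exact ⟨(ν v).map fun i => (i, s, 0), fun h => (hv h).elim⟩
  choose κ hκ using key
  obtain ⟨v₀, hv₀⟩ := (uniformBelow (s.reg m)).support_nonempty
  have hT3 : 3 ≤ T := by
    obtain ⟨T₁, T₂, _, hT, _⟩ := h v₀ hv₀
    omega
  refine ⟨(uniformBelow (s.reg m)).bind fun v => (κ v).map fun y => (y.1, y.2.1, y.2.2 + 2),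
    ?_, ?_, ?_⟩
  · rw [PMF.map_bind]
    refine pmf_bind_congr fun v hv => ?_
    rw [PMF.map_comp]
    exact (hκ v hv).1
  · intro q hq
    rw [PMF.mem_support_bind_iff] at hq
    obtain ⟨v, hv, hq⟩ := hq
    rw [PMF.mem_support_map_iff] at hq
    obtain ⟨y, hy, rfl⟩ := hq
    exact (hκ v hv).2.1 y hy
  · intro K N hN
    obtain ⟨M, rfl⟩ : ∃ M, N = M + 3 := ⟨N - 3, by omega⟩
    have e : run w (M + 3) (L :: K, s) = (uniformBelow (s.reg m)).bind fun v =>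
        run w M (B :: L :: K, s.setReg z v) := by
      have hL' : step w (L :: K, s) = PMF.pure (.seq (.rand z m) B :: L :: K, s) := by
        simp [hL, step, hlt]
      rw [show M + 3 = M + 1 + 1 + 1 from rfl, run, hL', PMF.pure_bind, run]
      simp only [step, PMF.pure_bind, run, PMF.bind_map]
      rfl
    rw [e, PMF.bind_bind]
    refine pmf_bind_congr fun v hv => ?_
    -- Folding the rest of the body and the loop back into one `seq` costs one step and makes the
    -- coupling of `seq` applicable after the draw. Together with the three steps before, this
    -- explains the shift by `2` in the step count.
    have e' : run w M (B :: L :: K, s.setReg z v) =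
        run w (M + 1) (.seq B L :: K, s.setReg z v) := by
      simp [run, step]
    rw [e', (hκ v hv).2.2 K (M + 1) (by omega), PMF.bind_map]
    refine pmf_bind_congr fun y hy => ?_
    simp only [Function.comp]
    congr 1
    omega

theorem support_uniformBelow_lt {m v : ℕ} (hm : 0 < m) (h : v ∈ (uniformBelow m).support) :
    v < m := by
  rcases mem_support_uniformBelow h with h | h
  · exact h
  · omega

/-- The law of the graph after processing `m` random vertices. -/
noncomputable def Data.evolve (D : Data) : ℕ → SimpleGraph ℕ → PMF (SimpleGraph ℕ)
  | 0, H => PMF.pure H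
  | m + 1, H => (uniformBelow D.n).bind fun v => D.evolve m (D.next H v)

/-- Process random vertices, as many as register `5` says. -/
def sparsify (mm : Cmd) : Cmd :=
  .seq (.const 17 0) (.loop 17 5 (.seq (.rand 25 0) (.seq (process mm) (.arith 17 .add 17 9))))

theorem Represents.frame {D : Data} {H : SimpleGraph ℕ} {P : Cmd} {s s' : State}
    (h : Represents D H s) (hF : Frame D.w P s s')
    (hP : (P.keeps && !P.stores 12 && !P.stores 13) = true) : Represents D H s' := by
  simp only [Bool.and_eq_true, Bool.not_eq_true'] at hP
  refine ⟨h.env.frame hF hP.1.1, h.le, ?_, ?_, ?_⟩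
  · rw [hF.mem 12 hP.1.2]; exact h.alive
  · rw [hF.mem 13 hP.2]; exact h.marks
  · rw [hF.mem 13 hP.2]; exact h.complete

theorem Env.setReg {D : Data} {s : State} {x v : ℕ} (hE : Env D s) (hx : 15 < x)
    (hv : v < 2 ^ D.w) : Env D (s.setReg x v) := by
  have hne : ∀ y, y ≤ 15 → (s.setReg x v).reg y = s.reg y := fun y hy => by
    rw [State.setReg_reg, if_neg (by omega)]
  refine ⟨hE.word.setReg hv, ?_, ?_, ?_, ?_, ?_, ?_, ?_, ?_, ?_, ?_, ?_, ?_, ?_, ?_, ?_, hE.m0, hE.m1⟩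
  all_goals rw [hne _ (by omega)]
  exacts [hE.r0, hE.r2, hE.r3, hE.r4, hE.r5, hE.r6, hE.r7, hE.r8, hE.r9, hE.r10, hE.r11, hE.r12,
    hE.r13, hE.r14, hE.r15]

theorem Represents.setReg {D : Data} {H : SimpleGraph ℕ} {s : State} {x v : ℕ}
    (h : Represents D H s) (hx : 15 < x) (hv : v < 2 ^ D.w) : Represents D H (s.setReg x v) :=
  ⟨h.env.setReg hx hv, h.le, h.alive, h.marks, h.complete⟩

/-- Amortized analysis with the potential `e`: a heavy step is paid for by the decrease of `e` that
its deletions cause, so the worst-case bound contains `e H` only once, whatever vertices are drawn.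
-/
theorem sparsify_loop_spec {D : Data} {Tm : ℕ} {mm : Cmd} (hmm : MulSpec D mm Tm)
    (e : SimpleGraph ℕ → ℕ)
    (hK : ∀ H v, H ≤ D.G → v < D.n → ¬ D.weight H v < D.θ * D.r →
      D.heavyCost Tm H v + e (D.del H v) ≤ e H) (m : ℕ) :
    ∀ (H : SimpleGraph ℕ) (s : State), Represents D H s → s.reg 17 + m = D.R →
    Spec D.w (.loop 17 5 (.seq (.rand 25 0) (.seq (process mm) (.arith 17 .add 17 9)))) s
      (m * (D.n * 370 + 5) + e H + 1) (D.evolve m H) (Represents D) := by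
  induction m with
  | zero =>
    intro H s hR h17
    refine (Spec.loop_exit (i := H) (Q := Represents D) ?_ hR).mono (by omega) fun _ _ h => h
    rw [hR.env.r5]; omega
  | succ m ih =>
    intro H s hR h17
    have hr5 := hR.env.r5
    have hr0 := hR.env.r0
    have := Spec.loop_rand (w := D.w) (ι := SimpleGraph ℕ) (x := 17) (y := 5) (z := 25) (m := 0)
      (B := .seq (process mm) (.arith 17 .add 17 9)) (s := s)
      (T := (m + 1) * (D.n * 370 + 5) + e H + 1)
      (ν := fun v => D.evolve m (D.next H v)) (Q' := Represents D) (by omega) ?_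
    · rw [hr0] at this; exact this
    intro v hv
    rw [hr0] at hv
    have hv := support_uniformBelow_lt D.n_pos hv
    have hR' : Represents D H (s.setReg 25 v) := hR.setReg (by omega) (D.sq_lt (by nlinarith))
    have hag := hmm.agree_process
    refine ⟨(D.n * 370 + if D.weight H v < D.θ * D.r then 0 else D.heavyCost Tm H v) + 1 + 1,
      m * (D.n * 370 + 5) + e (D.next H v) + 1,
      fun s' => Represents D (D.next H v) s' ∧ s'.reg 17 = s.reg 17 + 1, ?_, ?_, ?_⟩
    · have : (if D.weight H v < D.θ * D.r then 0 else D.heavyCost Tm H v) + e (D.next H v)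
          ≤ e H := by
        unfold Data.next
        split_ifs with hc
        · omega
        · exact hK H v hR.le hv hc
      rw [Nat.succ_mul]; omega
    · refine Hoare.seq (process_spec hmm hR' (by simp) hv) fun s1 hF1 hR1 => ?_
      have h17' : s1.reg 17 = s.reg 17 := by rw [hag.reg hF1 17 rfl]; simp
      have e17 : (s.reg 17 + 1) % 2 ^ D.w = s.reg 17 + 1 :=
        Nat.mod_eq_of_lt (D.sq_lt (by nlinarith [D.R_le]))
      refine Hoare.exec rfl le_rfl ?_
      simp only [exec, Op.eval, h17', hR1.env.r9, e17]
      exact ⟨hR1.setReg (by omega) (D.sq_lt (by nlinarith [D.R_le])), by simp⟩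
    · rintro s1 - ⟨hR1, h1⟩
      exact ih _ s1 hR1 (by omega)

theorem sparsify_spec {D : Data} {Tm : ℕ} {mm : Cmd} (hmm : MulSpec D mm Tm)
    (e : SimpleGraph ℕ → ℕ)
    (hK : ∀ H v, H ≤ D.G → v < D.n → ¬ D.weight H v < D.θ * D.r →
      D.heavyCost Tm H v + e (D.del H v) ≤ e H) {H : SimpleGraph ℕ} {s : State}
    (hR : Represents D H s) :
    Spec D.w (sparsify mm) s (D.R * (D.n * 370 + 5) + e H + 3) (D.evolve D.R H)
      (Represents D) := by
  refine Spec.mono (Hoare.seqSpec (T₁ := 1) (T₂ := D.R * (D.n * 370 + 5) + e H + 1)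
    (Q := fun s1 => s1 = s.setReg 17 0)
    (Hoare.exec rfl le_rfl (by simp [exec])) fun s1 hF h1 => ?_) (by omega) fun _ _ h => h
  exact sparsify_loop_spec hmm e hK _ _ _ (hR.frame hF rfl) (by simp [h1])

/-! ### Random colouring, and sorting vertices and edges by colours -/

/-- The law of the colouring obtained from `c` by colouring the vertices `j, …, j + m - 1` at
random with `p` colours. -/
noncomputable def recolour (p : ℕ) : ℕ → ℕ → (ℕ → ℕ) → PMF (ℕ → ℕ)
  | _, 0, c => PMF.pure c
  | j, m + 1, c => (uniformBelow p).bind fun a => recolour p (j + 1) m (Function.update c j a)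

/-- Colour the vertices at random (segment `17`). -/
def colour : Cmd :=
  .seq (.const 17 0) (.loop 17 0 (.seq (.rand 25 3) (.seq (.store 17 17 25)
    (.arith 17 .add 17 9))))

/-- The state represents the graph `H` and the colouring `c`. -/
def Coloured (D : Data) (H : SimpleGraph ℕ) (c : ℕ → ℕ) (s : State) : Prop :=
  Represents D H s ∧ (∀ u < D.n, c u < D.p) ∧ s.mem 17 = c

theorem colour_loop_spec {D : Data} {H : SimpleGraph ℕ} (m : ℕ) :
    ∀ (c : ℕ → ℕ) (s : State), Represents D H s → s.reg 17 + m = D.n → s.mem 17 = c →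
    (∀ u < s.reg 17, c u < D.p) →
    Spec D.w (.loop 17 0 (.seq (.rand 25 3) (.seq (.store 17 17 25) (.arith 17 .add 17 9)))) s
      (m * 6 + 1) (recolour D.p (D.n - m) m c) (Coloured D H) := by
  induction m with
  | zero =>
    intro c s hR h17 hc hcp
    refine Spec.loop_exit (by rw [hR.env.r0]; omega) ⟨hR, fun u hu => hcp u (by omega), hc⟩
  | succ m ih =>
    intro c s hR h17 hc hcp
    have hr0 := hR.env.r0
    have hr3 := hR.env.r3
    have := Spec.loop_rand (w := D.w) (ι := ℕ → ℕ) (x := 17) (y := 0) (z := 25) (m := 3)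
      (B := .seq (.store 17 17 25) (.arith 17 .add 17 9)) (s := s) (T := (m + 1) * 6 + 1)
      (ν := fun a => recolour D.p (D.n - (m + 1) + 1) m (Function.update c (D.n - (m + 1)) a))
      (Q' := Coloured D H) (by omega) ?_
    · rw [hr3] at this; exact this
    intro a ha
    rw [hr3] at ha
    have ha := support_uniformBelow_lt D.p_pos ha
    have hp := D.p_le
    have hj : D.n - (m + 1) = s.reg 17 := by omega
    have hR' : Represents D H (s.setReg 25 a) := hR.setReg (by omega) (D.sq_lt (by nlinarith))
    refine ⟨3, m * 6 + 1, fun s' => s' = ((s.setReg 25 a).setMem 17 (s.reg 17) a).setReg 17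
      (s.reg 17 + 1), by omega, Hoare.exec rfl (le_of_eq rfl) ?_, ?_⟩
    · simp only [exec, Op.eval, State.setReg_reg, State.setMem_reg, hR.env.r9, Nat.reduceEqDiff,
        if_true, if_false]
      rw [Nat.mod_eq_of_lt (D.sq_lt (by nlinarith))]
    · intro s1 hF h1
      rw [hj, show s.reg 17 + 1 = D.n - m by omega]
      refine ih _ s1 (hR'.frame hF rfl) (by simp [h1]; omega) (by simp [h1, hc]) ?_
      intro u hu
      rw [Function.update_apply]
      split_ifs with h
      · exact ha
      · refine hcp u ?_
        simp [h1] at hu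
        omega

theorem colour_spec {D : Data} {H : SimpleGraph ℕ} {s : State} (hR : Represents D H s) :
    Spec D.w colour s (D.n * 6 + 3) (recolour D.p 0 D.n (s.mem 17)) (Coloured D H) := by
  refine Spec.mono (Hoare.seqSpec (T₁ := 1) (T₂ := D.n * 6 + 1) (Q := fun s1 => s1 = s.setReg 17 0)
    (Hoare.exec rfl le_rfl (by simp [exec])) fun s1 hF h1 => ?_) (by omega) fun _ _ h => h
  have := colour_loop_spec (D := D) (H := H) D.n (s.mem 17) s1 (hR.frame hF rfl) (by simp [h1])
    (by simp [h1]) (by simp [h1])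
  rwa [Nat.sub_self] at this

theorem Env.p_lt {D : Data} : (D.p + 1) * (D.p + 1) < 2 ^ D.w :=
  D.sq_lt (by nlinarith [D.p_le])

theorem zeroLoop_spec {D : Data} {s : State} {a h N : ℕ} (hE : Env D s) (hh : s.reg h = N)
    (hN : N < 2 ^ D.w) (hok : (Cmd.store a 20 8).loopOk 20 h = true) :
    Hoare D.w (.forUp 20 h (.store a 20 8)) s (N * 4 + 3) fun s' => ∀ i < N, s'.mem a i = 0 := by
  refine Hoare.mono (forUp_spec (c := 1) (fun j s1 => ∀ z < j, s1.mem a z = 0) hok hE.r9 hh hN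
      (fun _ _ _ h => h) (by simp) ?_) le_rfl fun _ h => h
  intro j s' hj hF hi hI
  refine Hoare.exec rfl le_rfl fun z hz => ?_
  have h8 : s'.reg 8 = 0 := (hF.reg 8 rfl).trans hE.r8
  simp only [exec, State.setMem_mem, if_true, Function.update_apply, hi, h8]
  split_ifs with h
  · rfl
  · exact hI z (by omega)

/-- Append the vertex `20` to the bucket of its colour (segment `5`, counters in segment `18`). -/
def pushVertex : Cmd :=
  .seq (.load 23 17 20) <| .seq (.load 37 18 23) <| .seq (.arith 38 .mul 23 0) <|
  .seq (.arith 38 .add 38 37) <| .seq (.store 5 38 20) <| .seq (.arith 37 .add 37 9)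
    (.store 18 23 37)

/-- Sort the vertices into buckets according to their colours. -/
def vertexBuckets : Cmd := .seq (.forUp 20 12 (.store 18 20 8)) (.forUp 20 0 pushVertex)

/-- The vertices of colour `b`. -/
def colourClass (D : Data) (c : ℕ → ℕ) (b : ℕ) : List ℕ := (List.range D.n).filter (c · = b)

/-- There is one bucket more than there are colours: the bucket of the unused colour `p` stays empty
and will serve as the block to which superfluous pointers refer. -/
theorem vertexBuckets_spec {D : Data} {s : State} {c : ℕ → ℕ} (hE : Env D s)
    (hc : s.mem 17 = c) (hcp : ∀ u < D.n, c u < D.p) :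
    Hoare D.w vertexBuckets s ((D.p + 1) * 4 + D.n * 16 + 7) fun s' =>
      ∀ b < D.p + 1, Bucket (s'.mem 18) (s'.mem 5) D.n b (colourClass D c b) := by
  have hp := D.p_le
  refine (Hoare.seq (zeroLoop_spec hE hE.r12 (D.sq_lt (by nlinarith)) rfl)
    (T₂ := D.n * 16 + 3) ?_).le (by omega)
  intro s1 hF1 hz
  have hE1 := hE.frame hF1 rfl
  refine Hoare.mono (forUp_spec (c := 13) (fun j s2 => ∀ b < D.p + 1,
    Bucket (s2.mem 18) (s2.mem 5) D.n b ((List.range j).filter (c · = b))) rfl hE1.r9 hE1.r0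
    (D.sq_lt (by nlinarith)) (fun _ _ _ h => h) ?_ ?_) le_rfl fun _ h => h
  · exact fun b hb => ⟨by simpa using hz b hb, ListAt.nil⟩
  · intro j s2 hj hF2 hi hI
    have hE2 := hE1.frame hF2 rfl
    have hcj : s2.mem 17 j = c j := by rw [hF2.mem 17 rfl, hF1.mem 17 rfl, hc]
    have hcjp := hcp j hj
    have hlen : ∀ b, ((List.range j).filter (c · = b)).length ≤ j := fun b =>
      (List.length_filter_le _ _).trans (by simp)
    have hl := hlen (c j)
    have h18 : s2.mem 18 (c j) = ((List.range j).filter (c · = c j)).length :=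
      (hI (c j) (by omega)).1
    have e1 : c j * D.n % 2 ^ D.w = c j * D.n :=
      Nat.mod_eq_of_lt (by have := D.idx_word (u := c j) (v := j) (by omega) hj; omega)
    have e2 : (c j * D.n + ((List.range j).filter (c · = c j)).length) % 2 ^ D.w =
        c j * D.n + ((List.range j).filter (c · = c j)).length :=
      Nat.mod_eq_of_lt (D.idx_word (by omega) (by omega))
    have e3 : (((List.range j).filter (c · = c j)).length + 1) % 2 ^ D.w =
        ((List.range j).filter (c · = c j)).length + 1 :=
      Nat.mod_eq_of_lt (D.sq_lt (by nlinarith))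
    refine Hoare.exec rfl (le_of_eq rfl) fun b hb => ?_
    simp only [pushVertex, exec, State.setReg_reg, State.setReg_mem, State.setMem_reg,
      State.setMem_mem, Op.eval, hE2.r0, hE2.r9, hi, hcj, h18, e1, e2, e3, Nat.reduceEqDiff,
      if_true, if_false]
    have := (hI b hb).update (hI (c j) (by omega)) (x := j) (by have := hlen b; omega) (by omega)
    rw [List.range_succ, List.filter_append]
    by_cases hbc : b = c j
    · subst hbc
      simpa using this
    · have hbc' : ¬ c j = b := fun h => hbc h.symm
      simpa [hbc, hbc'] using this

/-- Append the edge between `20` and `23` to the bucket of its pair of colours (segments `8` and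
`9`, counters in segment `19`). -/
def pushEdge : Cmd :=
  .seq (.load 24 17 20) <| .seq (.load 29 17 23) <| .seq (.arith 24 .mul 24 12) <|
  .seq (.arith 24 .add 24 29) <| .seq (.load 37 19 24) <| .seq (.arith 38 .mul 24 13) <|
  .seq (.arith 38 .add 38 37) <| .seq (.store 8 38 20) <| .seq (.store 9 38 23) <|
  .seq (.arith 37 .add 37 9) (.store 19 24 37)

/-- Sort the edges into buckets according to the colours of their endpoints. -/
def edgeBuckets : Cmd :=
  .seq (.arith 50 .mul 12 12) <| .seq (.forUp 20 50 (.store 19 20 8)) <|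
  .forArcs 20 21 22 (.seq (.load 23 1 21) (.ite 20 23 (.ifAdj 20 23 pushEdge) .skip))

/-- The edges of `H` that are among the given arcs and whose endpoints have the colours encoded by
`b`. -/
noncomputable def edgeClass (D : Data) (H : SimpleGraph ℕ) (c : ℕ → ℕ) (l : List (ℕ × ℕ)) (b : ℕ) :
    List (ℕ × ℕ) :=
  l.filter fun e => e.1 < e.2 ∧ H.Adj e.1 e.2 ∧ c e.1 * (D.p + 1) + c e.2 = b

/-- Bucket `b` contains the list `l` of pairs. -/
def Bucket₂ (cnt d₁ d₂ : ℕ → ℕ) (M b : ℕ) (l : List (ℕ × ℕ)) : Prop :=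
  Bucket cnt d₁ M b (l.map Prod.fst) ∧ Bucket cnt d₂ M b (l.map Prod.snd)

theorem Bucket₂.update {cnt d₁ d₂ : ℕ → ℕ} {M b b₀ x y : ℕ} {l l₀ : List (ℕ × ℕ)}
    (h : Bucket₂ cnt d₁ d₂ M b l) (h₀ : Bucket₂ cnt d₁ d₂ M b₀ l₀) (hl : l.length ≤ M)
    (hl₀ : l₀.length < M) :
    Bucket₂ (Function.update cnt b₀ (l₀.length + 1))
      (Function.update d₁ (b₀ * M + l₀.length) x) (Function.update d₂ (b₀ * M + l₀.length) y) M b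
      (if b = b₀ then l₀ ++ [(x, y)] else l) := by
  have h1 := h.1.update h₀.1 (x := x) (by simpa using hl) (by simpa using hl₀)
  have h2 := h.2.update h₀.2 (x := y) (by simpa using hl) (by simpa using hl₀)
  rw [List.length_map] at h1 h2
  split_ifs at h1 h2 ⊢ with hb
  · exact ⟨by simpa using h1, by simpa using h2⟩
  · exact ⟨h1, h2⟩

theorem pushEdge_spec {D : Data} {s : State} {c : ℕ → ℕ} {u x : ℕ} {B : ℕ → List (ℕ × ℕ)}
    (hE : Env D s) (hc : s.mem 17 = c) (hu : s.reg 20 = u) (hx : s.reg 23 = x)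
    (hcu : c u < D.p) (hcx : c x < D.p)
    (hB : ∀ b < (D.p + 1) * (D.p + 1),
      Bucket₂ (s.mem 19) (s.mem 8) (s.mem 9) (D.n * D.n) b (B b))
    (hlen : ∀ b, (B b).length < D.n * D.n) :
    Hoare D.w pushEdge s 21 fun s' => ∀ b < (D.p + 1) * (D.p + 1),
      Bucket₂ (s'.mem 19) (s'.mem 8) (s'.mem 9) (D.n * D.n) b
        (if c u * (D.p + 1) + c x = b then B b ++ [(u, x)] else B b) := by
  have hp := D.p_le
  set k := c u * (D.p + 1) + c x with hk
  have hkp : k < (D.p + 1) * (D.p + 1) := Data.idx_lt (by omega) (by omega)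
  have hkn : k < (D.n + 1) * (D.n + 1) := hkp.trans_le (Nat.mul_le_mul (by omega) (by omega))
  have hl := hlen k
  have e0 : c u * (D.p + 1) % 2 ^ D.w = c u * (D.p + 1) :=
    Nat.mod_eq_of_lt (by have := D.sq_lt (x := k) (by nlinarith); omega)
  have e1 : (c u * (D.p + 1) + c x) % 2 ^ D.w = k :=
    Nat.mod_eq_of_lt (D.sq_lt (by nlinarith))
  -- About `n²` pairs of colours with capacity `n²` each: addresses are quartic in `n`, although
  -- only the cells in use are ever visited.
  have hidx : k * (D.n * D.n) + (B k).length < 2 ^ D.w := by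
    refine D.quartic_lt ?_
    have a1 : k * (D.n * D.n) + (B k).length ≤ (k + 1) * (D.n * D.n) := by
      rw [Nat.succ_mul]; omega
    have a2 : (k + 1) * (D.n * D.n) ≤ ((D.n + 1) * (D.n + 1)) * ((D.n + 2) * (D.n + 2)) :=
      Nat.mul_le_mul hkn (by nlinarith)
    have a3 : ((D.n + 1) * (D.n + 1)) * ((D.n + 2) * (D.n + 2)) ≤
        ((D.n + 2) * (D.n + 2)) * ((D.n + 2) * (D.n + 2)) :=
      Nat.mul_le_mul_right _ (by nlinarith)
    have a4 : ((D.n + 2) * (D.n + 2)) * ((D.n + 2) * (D.n + 2)) = (D.n + 2) ^ 4 := by ring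
    omega
  have e2 : k * (D.n * D.n) % 2 ^ D.w = k * (D.n * D.n) := Nat.mod_eq_of_lt (by omega)
  have e3 : (k * (D.n * D.n) + (B k).length) % 2 ^ D.w = k * (D.n * D.n) + (B k).length :=
    Nat.mod_eq_of_lt hidx
  have e4 : ((B k).length + 1) % 2 ^ D.w = (B k).length + 1 :=
    Nat.mod_eq_of_lt (D.sq_lt (by nlinarith))
  have h19 : s.mem 19 k = (B k).length := by simpa using (hB k hkp).1.1
  refine Hoare.exec rfl (le_of_eq rfl) fun b hb => ?_
  simp only [pushEdge, exec, State.setReg_reg, State.setReg_mem, State.setMem_reg,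
    State.setMem_mem, Op.eval, hE.r9, hE.r12, hE.r13, hu, hx, hc, e0, e1, h19, e2, e3, e4,
    Nat.reduceEqDiff, if_true, if_false]
  have := (hB b hb).update (hB k hkp) (x := u) (y := x) (hlen b).le hl
  by_cases hbk : b = k
  · subst hbk
    simpa using this
  · have hbk' : ¬ k = b := fun h => hbk h.symm
    simpa [hbk, hbk'] using this

theorem edgeBuckets_spec {D : Data} {H : SimpleGraph ℕ} {s : State} {c : ℕ → ℕ} (hE : Env D s)
    (hA : Alive D H (s.mem 12)) (hc : s.mem 17 = c) (hcp : ∀ u < D.n, c u < D.p) :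
    Hoare D.w edgeBuckets s ((D.p + 1) * (D.p + 1) * 4 + D.n * (D.r * 70 + 10) + 9) fun s' =>
      ∀ b < (D.p + 1) * (D.p + 1), Bucket₂ (s'.mem 19) (s'.mem 8) (s'.mem 9) (D.n * D.n) b
        (edgeClass D H c (D.arcs D.n) b) := by
  have hp := D.p_le
  refine (Hoare.seq (T₁ := 1) (T₂ := ((D.p + 1) * (D.p + 1) * 4 + 3) +
    (D.n * (D.r * 70 + 10) + 3) + 1)
    (Q := fun s1 => s1 = s.setReg 50 ((D.p + 1) * (D.p + 1))) (Hoare.exec rfl le_rfl ?_) ?_).le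
    (by omega)
  · simp [exec, Op.eval, hE.r12, Nat.mod_eq_of_lt (Env.p_lt (D := D))]
  intro s1 hF1 h1
  have hE1 := hE.frame hF1 rfl
  refine Hoare.seq (zeroLoop_spec hE1 (by simp [h1]) Env.p_lt rfl) fun s2 hF2 hz => ?_
  have hE2 := hE1.frame hF2 rfl
  refine Hoare.mono (forArcs_spec (c := 67) (fun l s3 => ∀ b < (D.p + 1) * (D.p + 1),
    Bucket₂ (s3.mem 19) (s3.mem 8) (s3.mem 9) (D.n * D.n) b (edgeClass D H c l b)) hE2 rfl
    (fun _ _ _ h => ⟨h, h, h⟩) ?_ ?_) le_rfl fun _ h => h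
  · exact fun b hb => ⟨⟨by simpa [edgeClass] using hz b hb, ListAt.nil⟩,
      ⟨by simpa [edgeClass] using hz b hb, ListAt.nil⟩⟩
  · intro l u x s3 hl hux hE3 hF3 h20 _ _ hnb hI
    obtain ⟨hun, hxn⟩ := Data.lt_of_adj hux
    have hll : l.length + 1 ≤ D.n * D.n := by
      have := hl.length_le.trans Data.length_arcs
      have := this.trans (Nat.mul_le_mul_left _ D.r_le)
      simpa using this
    have happ : ∀ b, edgeClass D H c (l ++ [(u, x)]) b =
        if u < x ∧ H.Adj u x ∧ c u * (D.p + 1) + c x = b then edgeClass D H c l b ++ [(u, x)]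
        else edgeClass D H c l b := by
      intro b
      by_cases h : u < x ∧ H.Adj u x ∧ c u * (D.p + 1) + c x = b
      · simp [edgeClass, List.filter_append, h]
      · rw [if_neg h, edgeClass, List.filter_append]
        simp only [edgeClass]
        rw [List.filter_cons_of_neg (by simpa using h)]
        simp
    refine (Hoare.seq (T₁ := 1) (T₂ := 58) (Q := fun s4 => s4 = s3.setReg 23 x)
      (Hoare.exec rfl le_rfl (by simp [exec, hE3.m1, hnb])) ?_).le (by omega)
    intro s4 hF4 h4
    have hE4 := hE3.frame hF4 rfl
    have h20' : s4.reg 20 = u := by rw [hF4.reg 20 rfl, h20]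
    have h23' : s4.reg 23 = x := by simp [h4]
    have hA4 : Alive D H (s4.mem 12) := by
      rw [hF4.mem 12 rfl, hF3.mem 12 rfl, hF2.mem 12 rfl, hF1.mem 12 rfl]; exact hA
    have h17' : s4.mem 17 = c := by
      rw [hF4.mem 17 rfl, hF3.mem 17 rfl, hF2.mem 17 rfl, hF1.mem 17 rfl]; exact hc
    have hI4 : ∀ b < (D.p + 1) * (D.p + 1),
        Bucket₂ (s4.mem 19) (s4.mem 8) (s4.mem 9) (D.n * D.n) b (edgeClass D H c l b) := by
      rw [hF4.mem 19 rfl, hF4.mem 8 rfl, hF4.mem 9 rfl]; exact hI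
    refine Hoare.ite (fun hlt => ?_) fun hlt => ?_
    · rw [h20', h23'] at hlt
      refine ifAdj_spec (c := 21) (H := H) hE4 hA4 (by decide) h20' h23' hun hxn ?_ ?_
      · intro hadj s5 hF5
        have hI5 : ∀ b < (D.p + 1) * (D.p + 1),
            Bucket₂ (s5.mem 19) (s5.mem 8) (s5.mem 9) (D.n * D.n) b (edgeClass D H c l b) := by
          rw [hF5.mem 19 rfl, hF5.mem 8 rfl, hF5.mem 9 rfl]; exact hI4
        refine Hoare.mono (pushEdge_spec (c := c) (u := u) (x := x) (hE4.frame hF5 rfl)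
          (by rw [hF5.mem 17 rfl]; exact h17') (by rw [hF5.reg 20 rfl]; exact h20')
          (by rw [hF5.reg 23 rfl]; exact h23') (hcp u hun) (hcp x hxn) hI5 ?_) le_rfl ?_
        · intro b
          have := List.length_filter_le (fun e : ℕ × ℕ => decide (e.1 < e.2 ∧ H.Adj e.1 e.2 ∧
            c e.1 * (D.p + 1) + c e.2 = b)) l
          unfold edgeClass
          omega
        · intro s6 h6 b hb
          rw [happ]
          simpa [hlt, hadj] using h6 b hb
      · intro hadj s5 hF5 b hb
        rw [happ, if_neg (fun h => hadj h.2.1), hF5.mem 19 rfl, hF5.mem 8 rfl, hF5.mem 9 rfl]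
        exact hI4 b hb
    · rw [h20', h23'] at hlt
      refine (Hoare.skip fun b hb => ?_).le (by omega)
      rw [happ, if_neg (fun h => hlt h.1)]
      exact hI4 b hb

/-! ### Writing the output: marked edges and pointers for the triples of colours -/

/-- Write the list of marked edges to segments `3` and `4`, and its length to register `1`. -/
def outputMarks : Cmd :=
  .seq (.const 1 0) <| .forArcs 20 21 22 <| .seq (.load 23 1 21) <| .ite 20 23
    (.seq (.arith 24 .mul 20 0) <| .seq (.arith 24 .add 24 23) <| .seq (.load 24 13 24) <|
      .ite 8 24 (.seq (.store 3 1 20) <| .seq (.store 4 1 23) (.arith 1 .add 1 9)) .skip) .skip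

/-- The marked edges among the given arcs. -/
noncomputable def markedArcs (D : Data) (m : ℕ → ℕ) (l : List (ℕ × ℕ)) : List (ℕ × ℕ) :=
  l.filter fun e => e.1 < e.2 ∧ 0 < m (e.1 * D.n + e.2)

theorem outputMarks_spec {D : Data} {s : State} (hE : Env D s) :
    Hoare D.w outputMarks s (D.n * (D.r * 23 + 10) + 5) fun s' =>
      s'.reg 1 = (markedArcs D (s.mem 13) (D.arcs D.n)).length ∧
      ListAt (s'.mem 3) 0 ((markedArcs D (s.mem 13) (D.arcs D.n)).map Prod.fst) ∧
      ListAt (s'.mem 4) 0 ((markedArcs D (s.mem 13) (D.arcs D.n)).map Prod.snd) := by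
  refine (Hoare.seq (T₁ := 1) (T₂ := D.n * (D.r * 23 + 10) + 3)
    (Q := fun s1 => s1 = s.setReg 1 0) (Hoare.exec rfl le_rfl (by simp [exec])) ?_).le (by omega)
  intro s1 hF1 h1
  have hE1 := hE.frame hF1 rfl
  refine Hoare.mono (forArcs_spec (c := 20) (fun l s2 =>
      s2.reg 1 = (markedArcs D (s.mem 13) l).length ∧
      ListAt (s2.mem 3) 0 ((markedArcs D (s.mem 13) l).map Prod.fst) ∧
      ListAt (s2.mem 4) 0 ((markedArcs D (s.mem 13) l).map Prod.snd)) hE1 rfl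
    (fun _ _ _ h => ⟨h, h, h⟩) ?_ ?_) le_rfl fun _ h => h
  · exact ⟨by simp [h1, markedArcs], ListAt.nil, ListAt.nil⟩
  · intro l u x s2 hl hux hE2 hF2 h20 _ _ hnb ⟨hI1, hI2, hI3⟩
    obtain ⟨hun, hxn⟩ := Data.lt_of_adj hux
    have hll : l.length + 1 ≤ D.n * D.n := by
      have := hl.length_le.trans Data.length_arcs
      have := this.trans (Nat.mul_le_mul_left _ D.r_le)
      simpa using this
    have h13 : s2.mem 13 = s.mem 13 := by rw [hF2.mem 13 rfl, hF1.mem 13 rfl]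
    have e1 : u * D.n % 2 ^ D.w = u * D.n := Nat.mod_eq_of_lt (by have := D.idx_word hun hxn; omega)
    have e2 : (u * D.n + x) % 2 ^ D.w = u * D.n + x := Nat.mod_eq_of_lt (D.idx_word hun hxn)
    have hlen := List.length_filter_le (fun e : ℕ × ℕ =>
      decide (e.1 < e.2 ∧ 0 < s.mem 13 (e.1 * D.n + e.2))) l
    have e3 : ((markedArcs D (s.mem 13) l).length + 1) % 2 ^ D.w =
        (markedArcs D (s.mem 13) l).length + 1 :=
      Nat.mod_eq_of_lt (D.sq_lt (by unfold markedArcs; nlinarith))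
    have happ : markedArcs D (s.mem 13) (l ++ [(u, x)]) =
        if u < x ∧ 0 < s.mem 13 (u * D.n + x) then markedArcs D (s.mem 13) l ++ [(u, x)]
        else markedArcs D (s.mem 13) l := by
      by_cases h : u < x ∧ 0 < s.mem 13 (u * D.n + x)
      · simp [markedArcs, List.filter_append, h]
      · rw [if_neg h, markedArcs, List.filter_append]
        rw [List.filter_cons_of_neg (by simpa using h)]
        simp [markedArcs]
    refine Hoare.exec rfl (by decide) ?_
    rw [happ]
    by_cases hlt : u < x
    · by_cases hm : 0 < s.mem 13 (u * D.n + x)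
      · simp only [exec, State.setReg_reg, State.setReg_mem, State.setMem_reg,
          State.setMem_mem, Op.eval, hE2.r0, hE2.r8, hE2.r9, hE2.m1, h20, hnb, h13, e1, e2, hlt, hm,
          hI1, e3, Nat.reduceEqDiff, if_true, if_false, and_self]
        refine ⟨by simp, ?_, ?_⟩
        · have := hI2.append (x := u)
          simpa using this
        · have := hI3.append (x := x)
          simpa using this
      · simp only [exec, State.setReg_reg, State.setReg_mem, State.setMem_reg,
          State.setMem_mem, Op.eval, hE2.r0, hE2.r8, hE2.r9, hE2.m1, h20, hnb, h13, e1, e2, hlt, hm,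
          hI1, e3, Nat.reduceEqDiff, if_true, if_false, and_false]
        exact ⟨trivial, hI2, hI3⟩
    · simp only [exec, State.setReg_reg, State.setReg_mem, hE2.m1, h20, hnb, hlt,
          hI1, Nat.reduceEqDiff, if_true, if_false, false_and]
      exact ⟨trivial, hI2, hI3⟩

/-- The three colours of the triple number `t`; repetitions, and all three colours if there is no
such triple, are replaced by the unused colour `p`. -/
def tripleCol (p t x : ℕ) : ℕ :=
  if t < p * p * p then
    if x = 0 then t / p / p
    else if x = 1 then if t / p % p = t / p / p then p else t / p % p
    else if t % p = t / p / p ∨ t % p = t / p % p then p else t % p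
  else p

theorem tripleCol_le {p t x : ℕ} (hp : 1 ≤ p) : tripleCol p t x ≤ p := by
  have h1 := Nat.mod_lt t hp
  have h2 := Nat.mod_lt (t / p) hp
  have h3 : t < p * p * p → t / p / p < p := by
    intro h
    rw [Nat.div_div_eq_div_mul]
    exact Nat.div_lt_of_lt_mul h
  unfold tripleCol
  split_ifs <;> omega

/-- Replace the colour in register `a` by the unused one if it equals that in register `b`. -/
def dedup (a b : ℕ) : Cmd := .ite b a .skip (.ite a b .skip (.copy a 3))

/-- Compute the colours of the triple whose number is in register `20`. -/
def setTriple : Cmd :=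
  .ite 20 50
    (.seq (.arith 23 .div 20 3) <| .seq (.arith 24 .mod 23 3) <| .seq (.arith 23 .div 23 3) <|
      .seq (.arith 29 .mod 20 3) <| .seq (dedup 24 23) <| .seq (dedup 29 23) (dedup 29 24))
    (.seq (.copy 23 3) <| .seq (.copy 24 3) (.copy 29 3))

theorem setTriple_spec {D : Data} {s : State} {t : ℕ} (hE : Env D s) (h20 : s.reg 20 = t)
    (h50 : s.reg 50 = D.p * D.p * D.p) :
    Hoare D.w setTriple s 20 fun s' => s'.reg 23 = tripleCol D.p t 0 ∧
      s'.reg 24 = tripleCol D.p t 1 ∧ s'.reg 29 = tripleCol D.p t 2 := by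
  have hp := D.p_le
  have hp1 := D.p_pos
  refine Hoare.exec rfl (by decide) ?_
  have ht : t < 2 ^ D.w := h20 ▸ hE.word.1 20
  have hpw : D.p < 2 ^ D.w := D.sq_lt (by nlinarith)
  have e1 : t / D.p % 2 ^ D.w = t / D.p :=
    Nat.mod_eq_of_lt ((Nat.div_le_self _ _).trans_lt ht)
  have e2 : t / D.p % D.p % 2 ^ D.w = t / D.p % D.p :=
    Nat.mod_eq_of_lt ((Nat.mod_lt _ hp1).trans hpw)
  have e3 : t / D.p / D.p % 2 ^ D.w = t / D.p / D.p :=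
    Nat.mod_eq_of_lt (((Nat.div_le_self _ _).trans (Nat.div_le_self _ _)).trans_lt ht)
  have e4 : t % D.p % 2 ^ D.w = t % D.p := Nat.mod_eq_of_lt ((Nat.mod_lt _ hp1).trans hpw)
  have e5 : D.p % 2 ^ D.w = D.p := Nat.mod_eq_of_lt hpw
  by_cases htp : t < D.p * D.p * D.p
  · have h1 := Nat.mod_lt t hp1
    have h2 := Nat.mod_lt (t / D.p) hp1
    have h3 : t / D.p / D.p < D.p := by
      rw [Nat.div_div_eq_div_mul]; exact Nat.div_lt_of_lt_mul htp
    simp only [setTriple, dedup, Cmd.copy, exec, Op.eval, State.setReg_reg, h20, h50, hE.r3, hE.r8,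
      e1, e2, e3, e4, htp, tripleCol, if_true, Nat.reduceEqDiff, if_false, Nat.add_zero, e5]
    generalize t / D.p / D.p = i at *
    generalize t / D.p % D.p = j at *
    generalize t % D.p = l at *
    -- The program has only the test `<`, so equality of two colours is decided by two tests; hence
    -- the case distinction over all orderings.
    rcases lt_trichotomy i j with g1 | g1 | g1 <;> rcases lt_trichotomy i l with g2 | g2 | g2 <;>
      rcases lt_trichotomy j l with g3 | g3 | g3 <;>
      first
      | (exfalso; omega)
      | (subst_vars
         simp [*, hE.r3, hE.r8, Nat.lt_asymm, not_lt_of_gt, ne_of_gt, ne_of_lt, lt_irrefl, le_of_lt])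
  · simp [setTriple, Cmd.copy, exec, Op.eval, h20, h50, hE.r3, hE.r8, e5, htp, tripleCol]

/-- Write the pointers to the vertices of colour `v` and to the edges of colours `a` and `b`. -/
def emit (a v b : ℕ) : Cmd :=
  .seq (.arith 30 .mul v 0) <| .seq (.store 6 27 30) <| .seq (.load 31 18 v) <|
  .seq (.arith 30 .add 30 31) <| .seq (.store 7 27 30) <|
  .seq (.arith 30 .mul a 12) <| .seq (.arith 30 .add 30 b) <| .seq (.load 31 19 30) <|
  .seq (.arith 30 .mul 30 13) <| .seq (.store 10 27 30) <| .seq (.arith 30 .add 30 31) <|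
  .seq (.store 11 27 30) (.arith 27 .add 27 9)

/-- The pointers with index `i` point to the vertices of colour `v` and to the edges of the pair
`k` of colours. -/
structure Pointers (D : Data) (cv ce : ℕ → ℕ) (s : State) (i v k : ℕ) : Prop where
  m6 : s.mem 6 i = v * D.n
  m7 : s.mem 7 i = v * D.n + cv v
  m10 : s.mem 10 i = k * (D.n * D.n)
  m11 : s.mem 11 i = k * (D.n * D.n) + ce k

/-- The colour of the `j`-th vertex block of the triple number `t`. -/
def blockCol (p t j : ℕ) : ℕ := if j % 3 = 0 then tripleCol p t (j / 3) else p

/-- The pair of colours of the `j`-th edge block of the triple number `t`. -/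
def blockKey (p t j : ℕ) : ℕ := tripleCol p t (j / 3) * (p + 1) + tripleCol p t (j % 3)

/-- The pointers up to index `I` have been written. -/
structure Emitted (D : Data) (cv ce : ℕ → ℕ) (I : ℕ) (s : State) : Prop where
  env : Env D s
  m18 : s.mem 18 = cv
  m19 : s.mem 19 = ce
  ptr : ∀ t j, j < 9 → t * 9 + j < I →
    Pointers D cv ce s (t * 9 + j) (blockCol D.p t j) (blockKey D.p t j)

set_option maxHeartbeats 1000000 in
-- Since `J < 9`, the index `t * 9 + J` determines `t` and `J`, so one more set of four pointers
-- extends `Emitted` without disturbing earlier ones. `hne` keeps the arguments away from scratch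
-- registers and from the pointer counter.
theorem emit_spec {D : Data} {s : State} {cv ce : ℕ → ℕ} {t J a v b : ℕ}
    (hcv : ∀ i < D.p + 1, cv i ≤ D.n) (hce : ∀ i < (D.p + 1) * (D.p + 1), ce i ≤ D.n * D.n)
    (h : Emitted D cv ce (t * 9 + J) s) (ht : t < D.S) (hJ : J < 9) (h27 : s.reg 27 = t * 9 + J)
    (ha : s.reg a = tripleCol D.p t (J / 3)) (hv : s.reg v = blockCol D.p t J)
    (hb : s.reg b = tripleCol D.p t (J % 3))
    (hne : (a != 30 && b != 30 && a != 31 && a != 27 && v != 27 && v != 30 && b != 31) = true) :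
    Hoare D.w (emit a v b) s 25 fun s' => Emitted D cv ce (t * 9 + (J + 1)) s' ∧
      s'.reg 27 = t * 9 + (J + 1) := by
  simp only [Bool.and_eq_true, bne_iff_ne, ne_eq] at hne
  obtain ⟨⟨⟨⟨⟨⟨g1, g2⟩, g3⟩, g4⟩, g5⟩, g6⟩, g7⟩ := hne
  have hp := D.p_le
  have hn := D.n_pos
  have hE := h.env
  have hS := D.S_le
  set A := tripleCol D.p t (J / 3) with hA
  set B := tripleCol D.p t (J % 3) with hB
  set V := blockCol D.p t J with hV
  have hAp : A ≤ D.p := tripleCol_le D.p_pos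
  have hBp : B ≤ D.p := tripleCol_le D.p_pos
  have hVp : V ≤ D.p := by
    rw [hV, blockCol]
    split_ifs
    · exact tripleCol_le D.p_pos
    · exact le_rfl
  have hk : A * (D.p + 1) + B < (D.p + 1) * (D.p + 1) := Data.idx_lt (by omega) (by omega)
  have hkey : blockKey D.p t J = A * (D.p + 1) + B := rfl
  set k := A * (D.p + 1) + B with hkdef
  have hkn : k < (D.n + 1) * (D.n + 1) := hk.trans_le (Nat.mul_le_mul (by omega) (by omega))
  have hcV := hcv V (by omega)
  have hcK := hce k hk
  have hVn : V * D.n ≤ D.n * D.n := Nat.mul_le_mul_right _ (by omega)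
  have e1 : V * D.n % 2 ^ D.w = V * D.n := Nat.mod_eq_of_lt (D.sq_lt (by nlinarith))
  have e2 : (V * D.n + cv V) % 2 ^ D.w = V * D.n + cv V := Nat.mod_eq_of_lt (D.sq_lt (by nlinarith))
  have e3 : A * (D.p + 1) % 2 ^ D.w = A * (D.p + 1) :=
    Nat.mod_eq_of_lt (by have := D.sq_lt (x := k) (by nlinarith); omega)
  have e4 : (A * (D.p + 1) + B) % 2 ^ D.w = k := Nat.mod_eq_of_lt (D.sq_lt (by nlinarith))
  have hidx : k * (D.n * D.n) + ce k < 2 ^ D.w := by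
    refine D.quartic_lt ?_
    have a1 : k * (D.n * D.n) + ce k ≤ (k + 1) * (D.n * D.n) := by
      rw [Nat.succ_mul]; omega
    have a2 : (k + 1) * (D.n * D.n) ≤ ((D.n + 1) * (D.n + 1)) * ((D.n + 2) * (D.n + 2)) :=
      Nat.mul_le_mul hkn (by nlinarith)
    have a3 : ((D.n + 1) * (D.n + 1)) * ((D.n + 2) * (D.n + 2)) ≤
        ((D.n + 2) * (D.n + 2)) * ((D.n + 2) * (D.n + 2)) :=
      Nat.mul_le_mul_right _ (by nlinarith)
    have a4 : ((D.n + 2) * (D.n + 2)) * ((D.n + 2) * (D.n + 2)) = (D.n + 2) ^ 4 := by ring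
    omega
  have e5 : k * (D.n * D.n) % 2 ^ D.w = k * (D.n * D.n) := Nat.mod_eq_of_lt (by omega)
  have e6 : (k * (D.n * D.n) + ce k) % 2 ^ D.w = k * (D.n * D.n) + ce k := Nat.mod_eq_of_lt hidx
  have e7 : (t * 9 + J + 1) % 2 ^ D.w = t * 9 + J + 1 := Nat.mod_eq_of_lt (D.sq_lt (by nlinarith))
  refine Hoare.mono (Hoare.frame (Hoare.exec (Q := fun s' => s'.reg 27 = t * 9 + J + 1 ∧
    s'.mem 6 = Function.update (s.mem 6) (t * 9 + J) (V * D.n) ∧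
    s'.mem 7 = Function.update (s.mem 7) (t * 9 + J) (V * D.n + cv V) ∧
    s'.mem 10 = Function.update (s.mem 10) (t * 9 + J) (k * (D.n * D.n)) ∧
    s'.mem 11 = Function.update (s.mem 11) (t * 9 + J) (k * (D.n * D.n) + ce k))
    rfl (le_of_eq rfl) ?_)) le_rfl ?_
  · simp only [emit, exec, State.setReg_reg, State.setReg_mem, State.setMem_reg, State.setMem_mem,
      Op.eval, hE.r0, hE.r9, hE.r12, hE.r13, h27, ha, hv, hb, h.m18, h.m19, e1, e2, e3, e4, e5, e6,
      e7, g1, g2, g3, g4, g5, g6, g7, Nat.reduceEqDiff, if_true, if_false, and_self]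
  · rintro s' ⟨⟨f27, f6, f7, f10, f11⟩, hF⟩
    refine ⟨⟨hE.frame hF rfl, by rw [hF.mem 18 rfl, h.m18], by rw [hF.mem 19 rfl, h.m19],
      fun t' j hj hlt => ?_⟩, by rw [f27]; rfl⟩
    by_cases hc : t' * 9 + j = t * 9 + J
    · obtain rfl : t' = t := by omega
      obtain rfl : j = J := by omega
      rw [hkey, ← hV]
      exact ⟨by simp [f6], by simp [f7], by simp [f10], by simp [f11]⟩
    · have := h.ptr t' j hj (by omega)
      exact ⟨by simpa [f6, hc] using this.m6, by simpa [f7, hc] using this.m7,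
        by simpa [f10, hc] using this.m10, by simpa [f11, hc] using this.m11⟩

/-- Write the pointers of three blocks. -/
def emitRow (a : ℕ) : Cmd := .seq (emit a a 23) (.seq (emit a 3 24) (emit a 3 29))

/-- The colours of the triple `t` are in the registers `23`, `24`, `29`. -/
def TripleRegs (D : Data) (t : ℕ) (s : State) : Prop :=
  s.reg 23 = tripleCol D.p t 0 ∧ s.reg 24 = tripleCol D.p t 1 ∧ s.reg 29 = tripleCol D.p t 2

theorem TripleRegs.frame {D : Data} {t : ℕ} {s s' : State} {P : Cmd} (h : TripleRegs D t s)
    (hF : Frame D.w P s s') (hP : (!P.writes 23 && !P.writes 24 && !P.writes 29) = true) :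
    TripleRegs D t s' := by
  simp only [Bool.and_eq_true, Bool.not_eq_true'] at hP
  exact ⟨(hF.reg _ hP.1.1).trans h.1, (hF.reg _ hP.1.2).trans h.2.1, (hF.reg _ hP.2).trans h.2.2⟩

theorem emitRow_spec {D : Data} {s : State} {cv ce : ℕ → ℕ} {t x a : ℕ}
    (hcv : ∀ i < D.p + 1, cv i ≤ D.n) (hce : ∀ i < (D.p + 1) * (D.p + 1), ce i ≤ D.n * D.n)
    (h : Emitted D cv ce (t * 9 + 3 * x) s) (ht : t < D.S) (hx : x < 3)
    (h27 : s.reg 27 = t * 9 + 3 * x) (hT : TripleRegs D t s)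
    (ha : s.reg a = tripleCol D.p t x)
    (hne : (a != 30 && a != 31 && a != 27) = true) :
    Hoare D.w (emitRow a) s 77 fun s' => Emitted D cv ce (t * 9 + 3 * (x + 1)) s' ∧
      s'.reg 27 = t * 9 + 3 * (x + 1) := by
  have hne' := hne
  simp only [Bool.and_eq_true, bne_iff_ne, ne_eq] at hne'
  have d0 : 3 * x / 3 = x := by omega
  have d1 : (3 * x + 1) / 3 = x := by omega
  have d2 : (3 * x + 1 + 1) / 3 = x := by omega
  have m0 : 3 * x % 3 = 0 := by omega
  have m1 : (3 * x + 1) % 3 = 1 := by omega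
  have m2 : (3 * x + 1 + 1) % 3 = 2 := by omega
  refine Hoare.seq (T₁ := 25) (T₂ := 51) (emit_spec hcv hce h ht (by omega) h27 (by rw [d0, ha])
    (by rw [blockCol, m0, d0, if_pos rfl, ha]) (by rw [m0, hT.1]) (by simp [hne'])) ?_
  rintro s1 hF1 ⟨h1, h1'⟩
  have hT1 := hT.frame hF1 rfl
  have ha1 : s1.reg a = tripleCol D.p t x := by
    rw [hF1.reg a (by simp [emit, Cmd.writes, hne']), ha]
  refine Hoare.seq (T₁ := 25) (T₂ := 25) (emit_spec hcv hce h1 ht (by omega) h1' (by rw [d1, ha1])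
    (by rw [blockCol, m1, if_neg (by omega), h1.env.r3]) (by rw [m1, hT1.2.1]) (by simp [hne'])) ?_
  rintro s2 hF2 ⟨h2, h2'⟩
  have hT2 := hT1.frame hF2 rfl
  have ha2 : s2.reg a = tripleCol D.p t x := by
    rw [hF2.reg a (by simp [emit, Cmd.writes, hne']), ha1]
  exact emit_spec (J := 3 * x + 1 + 1) hcv hce h2 ht (by omega) h2' (by rw [d2, ha2])
    (by rw [blockCol, m2, if_neg (by omega), h2.env.r3]) (by rw [m2, hT2.2.2]) (by simp [hne'])

/-- Write the pointers of all subgraphs. -/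
def outputTriples : Cmd :=
  .seq (.arith 50 .mul 3 3) <| .seq (.arith 50 .mul 50 3) <| .seq (.const 27 0) <|
    .forUp 20 2 (.seq setTriple (.seq (emitRow 23) (.seq (emitRow 24) (emitRow 29))))

theorem outputTriples_spec {D : Data} {s : State} {cv ce : ℕ → ℕ}
    (hcv : ∀ i < D.p + 1, cv i ≤ D.n) (hce : ∀ i < (D.p + 1) * (D.p + 1), ce i ≤ D.n * D.n)
    (hE : Env D s) (h18 : s.mem 18 = cv) (h19 : s.mem 19 = ce) :
    Hoare D.w outputTriples s (D.S * 257 + 9) (Emitted D cv ce (D.S * 9)) := by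
  have hp := D.p_le
  have hS := D.S_le
  have hppp := D.ppp
  have hpp : D.p * D.p < 2 ^ D.w := D.sq_lt (by nlinarith)
  have hppp' : D.p * D.p * D.p < 2 ^ D.w := D.sq_lt (by nlinarith)
  have hSw : D.S < 2 ^ D.w := D.sq_lt (by nlinarith)
  refine (Hoare.seq (T₁ := 1) (T₂ := 1 + (1 + (D.S * (254 + 3) + 3) + 1) + 1)
    (Q := fun s1 => s1.reg 50 = D.p * D.p) (Hoare.exec rfl le_rfl ?_) ?_).le (by omega)
  · simp [exec, Op.eval, hE.r3, Nat.mod_eq_of_lt hpp]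
  intro s1 hF1 h1
  have hE1 := hE.frame hF1 rfl
  refine Hoare.seq (Q := fun s1 => s1.reg 50 = D.p * D.p * D.p) (Hoare.exec rfl le_rfl ?_) ?_
  · simp [exec, Op.eval, hE1.r3, h1, Nat.mod_eq_of_lt hppp']
  intro s2 hF2 h2
  have hE2 := hE1.frame hF2 rfl
  refine Hoare.seq (Q := fun s1 => s1.reg 27 = 0) (Hoare.exec rfl le_rfl (by simp [exec])) ?_
  intro s3 hF3 h3
  have hE3 := hE2.frame hF3 rfl
  have h50 : s3.reg 50 = D.p * D.p * D.p := by rw [hF3.reg 50 rfl, h2]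
  have h18' : s3.mem 18 = cv := by rw [hF3.mem 18 rfl, hF2.mem 18 rfl, hF1.mem 18 rfl, h18]
  have h19' : s3.mem 19 = ce := by rw [hF3.mem 19 rfl, hF2.mem 19 rfl, hF1.mem 19 rfl, h19]
  -- The invariant keeps only the pointers and their counter: it has to survive an arbitrary value
  -- in the loop register, which `Env` with its bound on words would not.
  refine Hoare.mono (Hoare.frame (forUp_spec (c := 254) (fun t s => (∀ t' j, j < 9 → t' * 9 + j < t * 9 →
      Pointers D cv ce s (t' * 9 + j) (blockCol D.p t' j) (blockKey D.p t' j)) ∧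
      s.reg 27 = t * 9) rfl hE3.r9 hE3.r2 hSw ?_ ?_ ?_)) le_rfl ?_
  · rintro t s' v ⟨h1, h2⟩
    exact ⟨fun t j hj hlt => ⟨(h1 t j hj hlt).m6, (h1 t j hj hlt).m7, (h1 t j hj hlt).m10,
      (h1 t j hj hlt).m11⟩, h2⟩
  · exact ⟨by omega, by rw [h3]⟩
  · rintro t s4 ht hF4 h20 ⟨hI1, hI2⟩
    have hE4 := hE3.frame hF4 rfl
    refine (Hoare.seq (T₁ := 20) (T₂ := 233) (setTriple_spec hE4 h20
      (by rw [hF4.reg 50 rfl, h50])) ?_)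
    intro s5 hF5 hT
    have h5 : Emitted D cv ce (t * 9 + 3 * 0) s5 := by
      refine ⟨hE4.frame hF5 rfl, by rw [hF5.mem 18 rfl, hF4.mem 18 rfl, h18'],
        by rw [hF5.mem 19 rfl, hF4.mem 19 rfl, h19'], fun t' j hj hlt => ?_⟩
      have := hI1 t' j hj hlt
      exact ⟨by rw [hF5.mem 6 rfl, this.m6], by rw [hF5.mem 7 rfl, this.m7],
        by rw [hF5.mem 10 rfl, this.m10], by rw [hF5.mem 11 rfl, this.m11]⟩
    refine Hoare.seq (T₁ := 77) (T₂ := 155) (emitRow_spec (x := 0) hcv hce h5 ht (by omega)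
      (by rw [hF5.reg 27 rfl, hI2]; rfl) hT hT.1 rfl) ?_
    rintro s6 hF6 ⟨h6, h6'⟩
    have hT6 : TripleRegs D t s6 := TripleRegs.frame hT hF6 rfl
    refine Hoare.seq (T₁ := 77) (T₂ := 77) (emitRow_spec (x := 1) hcv hce h6 ht (by omega)
      h6' hT6 hT6.2.1 rfl) ?_
    rintro s7 hF7 ⟨h7, h7'⟩
    have hT7 : TripleRegs D t s7 := TripleRegs.frame hT6 hF7 rfl
    refine Hoare.mono (emitRow_spec (x := 2) hcv hce h7 ht (by omega) h7' hT7 hT7.2.2 rfl)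
      le_rfl ?_
    rintro s8 ⟨h8, h8'⟩
    rw [Nat.succ_mul]
    exact ⟨h8.ptr, h8'⟩
  · rintro s4 ⟨h4, hF4⟩
    exact ⟨hE3.frame hF4 rfl, by rw [hF4.mem 18 rfl, h18'], by rw [hF4.mem 19 rfl, h19'], h4.1⟩

/-! ### The complete program -/

/-- Load the constant registers. -/
def setup : Cmd :=
  .seq (.const 8 0) <| .seq (.const 9 1) <| .seq (.load 3 2 8) <| .seq (.load 4 2 9) <|
  .seq (.arith 20 .add 9 9) <| .seq (.load 5 2 20) <| .seq (.arith 20 .add 20 9) <|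
  .seq (.load 6 2 20) <| .seq (.arith 20 .add 20 9) <| .seq (.load 7 2 20) <|
  .seq (.arith 20 .add 20 9) <| .seq (.load 2 2 20) <| .seq (.arith 10 .mul 6 4) <|
  .seq (.load 11 0 0) <| .seq (.arith 12 .add 3 9) <| .seq (.arith 13 .mul 0 0) <|
  .seq (.arith 14 .add 0 0) (.arith 15 .add 14 14)

/-- The state holds the input described by `D`. -/
structure Input (D : Data) (s : State) : Prop where
  word : s.IsWord D.w
  r0 : s.reg 0 = D.n
  m0 : s.mem 0 = D.off
  m1 : s.mem 1 = D.nb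
  p : s.mem 2 0 = D.p
  r : s.mem 2 1 = D.r
  R : s.mem 2 2 = D.R
  θ : s.mem 2 3 = D.θ
  L : s.mem 2 4 = D.L
  S : s.mem 2 5 = D.S

theorem setup_spec {D : Data} {s : State} (h : Input D s) : Hoare D.w setup s 35 (Env D) := by
  have hn := D.n_pos
  have hp := D.p_le
  have hr := D.r_le
  have hθ := D.θ_le
  have hθr : D.θ * D.r ≤ D.n * D.n := Nat.mul_le_mul hθ hr
  have e0 : 0 % 2 ^ D.w = 0 := Nat.zero_mod _
  have e1 : 1 % 2 ^ D.w = 1 := Nat.mod_eq_of_lt (D.sq_lt (by nlinarith))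
  have e2 : (1 + 1) % 2 ^ D.w = 2 := Nat.mod_eq_of_lt (D.sq_lt (by nlinarith))
  have e3 : (2 + 1) % 2 ^ D.w = 3 := Nat.mod_eq_of_lt (D.sq_lt (by nlinarith))
  have e4 : (3 + 1) % 2 ^ D.w = 4 := Nat.mod_eq_of_lt (D.sq_lt (by nlinarith))
  have e5 : (4 + 1) % 2 ^ D.w = 5 := Nat.mod_eq_of_lt (D.sq_lt (by nlinarith))
  have e6 : D.θ * D.r % 2 ^ D.w = D.θ * D.r := Nat.mod_eq_of_lt (D.sq_lt (by nlinarith))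
  have e7 : (D.p + 1) % 2 ^ D.w = D.p + 1 := Nat.mod_eq_of_lt (D.sq_lt (by nlinarith))
  have e8 : D.n * D.n % 2 ^ D.w = D.n * D.n := Nat.mod_eq_of_lt (D.sq_lt (by nlinarith))
  have e9 : (D.n + D.n) % 2 ^ D.w = 2 * D.n := by
    rw [← two_mul]; exact Nat.mod_eq_of_lt (D.sq_lt (by nlinarith))
  have e10 : (2 * D.n + 2 * D.n) % 2 ^ D.w = 4 * D.n := by
    rw [show 2 * D.n + 2 * D.n = 4 * D.n by ring]
    exact Nat.mod_eq_of_lt (D.sq_lt (by nlinarith))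
  refine Hoare.mono (Hoare.frame (Hoare.exec (Q := fun s' => s' = exec D.w setup s) rfl
    (le_of_eq rfl) rfl)) le_rfl ?_
  rintro s' ⟨h', hF⟩
  have hw := hF.word h.word
  simp only [setup, exec, State.setReg_reg, State.setReg_mem, Op.eval, h.r0, h.m0, h.p, h.r, h.R,
    h.θ, h.L, h.S, e0, e1, e2, e3, e4, e5, e6, e7, e8, e9, e10, Nat.reduceEqDiff, if_true,
    if_false] at h'
  subst h'
  constructor
  · exact hw
  all_goals simp [h.r0, h.m0, h.m1]

/-- The whole program. -/
def program (mm : Cmd) : Cmd :=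
  .seq setup <| .seq initTables <| .seq (sparsify mm) <| .seq colour <| .seq vertexBuckets <|
  .seq edgeBuckets <| .seq outputMarks outputTriples

/-- The final state, when `H` is the remaining graph and `c` the colouring. -/
structure Final (D : Data) (H : SimpleGraph ℕ) (c : ℕ → ℕ) (s : State) : Prop where
  le : H ≤ D.G
  col : ∀ u < D.n, c u < D.p
  r2 : s.reg 2 = D.S
  marks : ∃ m, MarksOK D m ∧ Complete D H m ∧
    edgesAt s 3 4 0 (s.reg 1) = (markedArcs D m (D.arcs D.n)).map fun e => s(e.1, e.2)
  vertices : ∀ t < D.S, vertexList 9 t s =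
    (List.range 9).flatMap fun j => colourClass D c (blockCol D.p t j)
  edges : ∀ t < D.S, edgeList 9 t s = (List.range 9).flatMap fun j =>
    (edgeClass D H c (D.arcs D.n) (blockKey D.p t j)).map fun e => s(e.1, e.2)

theorem ListAt.verticesAt {s : State} {a b : ℕ} {l : List ℕ} (h : ListAt (s.mem a) b l) :
    verticesAt s a b (b + l.length) = l := by
  rw [WordRAM.verticesAt, Nat.add_sub_cancel_left, h.eq_map]

theorem ListAt.edgesAt {s : State} {a₁ a₂ b : ℕ} {l : List (ℕ × ℕ)}
    (h₁ : ListAt (s.mem a₁) b (l.map Prod.fst)) (h₂ : ListAt (s.mem a₂) b (l.map Prod.snd)) :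
    edgesAt s a₁ a₂ b (b + l.length) = l.map fun e => s(e.1, e.2) := by
  rw [WordRAM.edgesAt, Nat.add_sub_cancel_left]
  refine List.ext_getElem (by simp) fun i hi hi' => ?_
  have h1 := h₁ i (by simpa using hi')
  have h2 := h₂ i (by simpa using hi')
  simp [h1, h2]

theorem Emitted.final {D : Data} {H : SimpleGraph ℕ} {c : ℕ → ℕ} {s : State} {m cv ce : ℕ → ℕ}
    (h : Emitted D cv ce (D.S * 9) s) (le : H ≤ D.G) (col : ∀ u < D.n, c u < D.p)
    (hM : MarksOK D m) (hC : Complete D H m)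
    (h1 : s.reg 1 = (markedArcs D m (D.arcs D.n)).length)
    (h3 : ListAt (s.mem 3) 0 ((markedArcs D m (D.arcs D.n)).map Prod.fst))
    (h4 : ListAt (s.mem 4) 0 ((markedArcs D m (D.arcs D.n)).map Prod.snd))
    (hv : ∀ b < D.p + 1, Bucket cv (s.mem 5) D.n b (colourClass D c b))
    (he : ∀ b < (D.p + 1) * (D.p + 1), Bucket₂ ce (s.mem 8) (s.mem 9) (D.n * D.n) b
        (edgeClass D H c (D.arcs D.n) b)) : Final D H c s := by
  refine ⟨le, col, h.env.r2, ⟨m, hM, hC, ?_⟩, fun t ht => ?_, fun t ht => ?_⟩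
  · have := ListAt.edgesAt h3 h4
    rwa [Nat.zero_add, ← h1] at this
  · refine List.flatMap_congr fun j hj => ?_
    rw [List.mem_range] at hj
    have hp := h.ptr t j hj (by omega)
    have hb : blockCol D.p t j ≤ D.p := by
      unfold blockCol
      split_ifs
      exacts [tripleCol_le D.p_pos, le_rfl]
    obtain ⟨e1, e2⟩ := hv _ (Nat.lt_succ_of_le hb)
    rw [hp.m6, hp.m7, e1]
    exact e2.verticesAt
  · refine List.flatMap_congr fun j hj => ?_
    rw [List.mem_range] at hj
    have hp := h.ptr t j hj (by omega)
    have hb : blockKey D.p t j < (D.p + 1) * (D.p + 1) :=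
      Data.idx_lt (Nat.lt_succ_of_le (tripleCol_le D.p_pos))
        (Nat.lt_succ_of_le (tripleCol_le D.p_pos))
    obtain ⟨⟨e1, e2⟩, e3, e4⟩ := he _ hb
    rw [List.length_map] at e1
    rw [hp.m10, hp.m11, e1]
    exact ListAt.edgesAt e2 e4

/-- The joint law of the remaining graph and the colouring. -/
noncomputable def Data.law (D : Data) (c : ℕ → ℕ) : PMF (SimpleGraph ℕ × (ℕ → ℕ)) :=
  (D.evolve D.R D.G).bind fun H => (recolour D.p 0 D.n c).map (Prod.mk H)

/-- The law depends on the initial, arbitrary contents of segment `17`, because the colouring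
overwrites just its first `n` cells. -/
theorem program_spec {D : Data} {Tm : ℕ} {mm : Cmd} (hmm : MulSpec D mm Tm)
    (e : SimpleGraph ℕ → ℕ)
    (hK : ∀ H v, H ≤ D.G → v < D.n → ¬ D.weight H v < D.θ * D.r →
      D.heavyCost Tm H v + e (D.del H v) ≤ e H) {s : State} (hI : Input D s) :
    Spec D.w (program mm) s (D.R * (D.n * 370 + 5) + e D.G + D.n * (D.r * 116 + 60) +
      (D.p + 1) * (D.p + 1) * 8 + D.S * 257 + 100) (D.law (s.mem 17))
      fun i => Final D i.1 i.2 := by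
  have hpp : D.p + 1 ≤ (D.p + 1) * (D.p + 1) := Nat.le_mul_of_pos_left _ (by omega)
  have hnr : ∀ x y, D.n * (D.r * x + y) = x * (D.n * D.r) + y * D.n := fun x y => by ring
  refine Spec.mono (Hoare.seqSpec (T₁ := 35) (T₂ := (D.n * (D.r * 23 + 10) + 3) +
    ((D.R * (D.n * 370 + 5) + e D.G + 3) + ((D.n * 6 + 3) + (((D.p + 1) * 4 + D.n * 16 + 7) +
    (((D.p + 1) * (D.p + 1) * 4 + D.n * (D.r * 70 + 10) + 9) + ((D.n * (D.r * 23 + 10) + 5) +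
    (D.S * 257 + 9) + 1) + 1) + 1) + 1) + 1) + 1) (setup_spec hI) ?_)
    (by simp only [hnr]; omega) fun _ _ h => h
  intro s1 hF1 hE1
  refine Hoare.seqSpec (initTables_spec hE1) ?_
  rintro s2 hF2 ⟨hA2, hM2⟩
  have hR2 : Represents D D.G s2 := by
    refine ⟨hE1.frame hF2 rfl, le_rfl, hA2, fun u v huv => ?_,
      fun a b c h1 h2 h3 => Or.inr ⟨h1, h2, h3⟩⟩
    have := huv.2
    rw [hM2 u v huv.1] at this
    omega
  have hag : (sparsify mm).Agree (sparsify .skip) :=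
    .seq .refl (.loop (.seq .refl (.seq hmm.agree_process .refl)))
  refine Spec.seq (sparsify_spec hmm e hK hR2).frame ?_
  rintro H s3 - ⟨hR3, hF3⟩
  have h17 : s3.mem 17 = s.mem 17 := by rw [hag.mem hF3 17 rfl, hF2.mem 17 rfl, hF1.mem 17 rfl]
  have hcol := colour_spec hR3
  rw [h17] at hcol
  refine Spec.seqHoare (Spec.map (Q' := fun i => Coloured D i.1 i.2) (Prod.mk H) hcol
    fun _ _ h => h) ?_
  rintro ⟨H', c⟩ s4 - hC4
  simp only at hC4
  clear hR3 hF3 hcol h17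
  obtain ⟨hR4, hcp, h17⟩ := hC4
  refine Hoare.seq (vertexBuckets_spec hR4.env h17 hcp) ?_
  intro s5 hF5 hB5
  refine Hoare.seq (edgeBuckets_spec (hR4.env.frame hF5 rfl)
    (by rw [hF5.mem 12 rfl]; exact hR4.alive) (by rw [hF5.mem 17 rfl]; exact h17) hcp) ?_
  intro s6 hF6 hB6
  have hE6 := (hR4.env.frame hF5 rfl).frame hF6 rfl
  refine Hoare.seq (outputMarks_spec hE6) ?_
  rintro s7 hF7 ⟨h71, h73, h74⟩
  have hE7 := hE6.frame hF7 rfl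
  have hv : ∀ b < D.p + 1, Bucket (s7.mem 18) (s7.mem 5) D.n b (colourClass D c b) := by
    rw [hF7.mem 18 rfl, hF7.mem 5 rfl, hF6.mem 18 rfl, hF6.mem 5 rfl]; exact hB5
  have he : ∀ b < (D.p + 1) * (D.p + 1), Bucket₂ (s7.mem 19) (s7.mem 8) (s7.mem 9) (D.n * D.n) b
        (edgeClass D H' c (D.arcs D.n) b) := by
    rw [hF7.mem 19 rfl, hF7.mem 8 rfl, hF7.mem 9 rfl]; exact hB6
  refine Hoare.mono (Hoare.frame (outputTriples_spec (D := D) ?_ ?_ hE7 rfl rfl)) le_rfl ?_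
  · intro i hi
    rw [(hv i hi).1]
    exact (List.length_filter_le _ _).trans (by simp)
  · intro i hi
    rw [(he i hi).1.1, List.length_map]
    exact (List.length_filter_le _ _).trans (Data.length_arcs.trans (Nat.mul_le_mul_left _ D.r_le))
  · rintro s8 ⟨h8, hF8⟩
    have h13 : s6.mem 13 = s4.mem 13 := by rw [hF6.mem 13 rfl, hF5.mem 13 rfl]
    rw [h13] at h71 h73 h74
    refine h8.final hR4.le hcp hR4.marks hR4.complete ?_ ?_ ?_ ?_ ?_
    · rw [hF8.reg 1 rfl, h71]
    · rw [hF8.mem 3 rfl]; exact h73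
    · rw [hF8.mem 4 rfl]; exact h74
    · rw [hF8.mem 5 rfl]; exact hv
    · rw [hF8.mem 8 rfl, hF8.mem 9 rfl]; exact he
-- Expectations
open scoped ENNReal

/-- The expectation of `f` under `μ`. -/
noncomputable def mean {ι : Type} (μ : PMF ι) (f : ι → ℝ≥0∞) : ℝ≥0∞ := ∑' i, μ i * f i

section mean
variable {ι ι' : Type} {μ : PMF ι} {f g : ι → ℝ≥0∞}

theorem mean_pure (i : ι) : mean (PMF.pure i) f = f i := by
  rw [mean, tsum_eq_single i]
  · simp
  · intro j hj
    simp [hj]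

theorem mean_bind (ν : ι → PMF ι') (f : ι' → ℝ≥0∞) :
    mean (μ.bind ν) f = mean μ fun i => mean (ν i) f := by
  simp only [mean, PMF.bind_apply, ← ENNReal.tsum_mul_right, ← ENNReal.tsum_mul_left]
  rw [ENNReal.tsum_comm]
  simp only [mul_assoc]

theorem mean_map (h : ι → ι') (f : ι' → ℝ≥0∞) : mean (μ.map h) f = mean μ fun i => f (h i) := by
  rw [PMF.map, mean_bind]
  simp [mean_pure]

theorem mean_mono (h : ∀ i ∈ μ.support, f i ≤ g i) : mean μ f ≤ mean μ g := by
  refine ENNReal.tsum_le_tsum fun i => ?_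
  by_cases hi : i ∈ μ.support
  · gcongr
    exact h i hi
  · rw [PMF.mem_support_iff, not_not] at hi
    simp [hi]

theorem mean_congr (h : ∀ i ∈ μ.support, f i = g i) : mean μ f = mean μ g :=
  le_antisymm (mean_mono fun i hi => (h i hi).le) (mean_mono fun i hi => (h i hi).ge)

theorem mean_const (c : ℝ≥0∞) : mean μ (fun _ => c) = c := by
  rw [mean, ENNReal.tsum_mul_right, PMF.tsum_coe, one_mul]

theorem mean_const_mul (c : ℝ≥0∞) : mean μ (fun i => c * f i) = c * mean μ f := by
  rw [mean, mean, ← ENNReal.tsum_mul_left]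
  simp only [mul_left_comm]

theorem mean_add : mean μ (fun i => f i + g i) = mean μ f + mean μ g := by
  simp only [mean, mul_add, ENNReal.tsum_add]

theorem mean_sum {κ : Type} (s : Finset κ) (f : κ → ι → ℝ≥0∞) :
    mean μ (fun i => ∑ k ∈ s, f k i) = ∑ k ∈ s, mean μ (f k) := by
  induction s using Finset.induction_on with
  | empty => simp [mean]
  | insert a s ha ih => simp only [Finset.sum_insert ha, mean_add, ih]

/-- The denominator is cleared so that later bounds can be inequalities between natural numbers. -/
theorem mean_uniformBelow {m : ℕ} (hm : 0 < m) (f : ℕ → ℝ≥0∞) :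
    m * mean (uniformBelow m) f = ∑ v ∈ Finset.range m, f v := by
  have hne : (Finset.range m).Nonempty := Finset.nonempty_range_iff.2 hm.ne'
  rw [mean, tsum_eq_sum (s := Finset.range m), Finset.mul_sum]
  · refine Finset.sum_congr rfl fun v hv => ?_
    have e : uniformBelow m v = (m : ℝ≥0∞)⁻¹ := by
      rw [uniformBelow, dif_pos hne, PMF.uniformOfFinset_apply_of_mem _ hv, Finset.card_range]
    rw [e, ← mul_assoc, ENNReal.mul_inv_cancel (by simpa using hm.ne') (ENNReal.natCast_ne_top m),
      one_mul]
  · intro v hv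
    rw [uniformBelow, dif_pos hne, PMF.uniformOfFinset_apply_of_notMem _ hv, zero_mul]

end mean

/-! ### Codegrees, deleted arcs and the decay of the number of closed 4-walks -/

namespace Data
variable {D : Data} {H : SimpleGraph ℕ} {v : ℕ}

/-- The common neighbours of `v` and `y` in `H`, as a finite set. -/
noncomputable def coset (D : Data) (H : SimpleGraph ℕ) (v y : ℕ) : Finset ℕ :=
  (Finset.range D.n).filter fun a => H.Adj v a ∧ H.Adj a y

theorem codeg_eq (hH : H ≤ D.G) (hv : v < D.n) (y : ℕ) :
    D.codeg H v y = (D.coset H v y).card := by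
  have hnd : (D.common H v y).Nodup := ((nodup_nbrs hv).filter _).filter _
  rw [codeg, ← List.toFinset_card_of_nodup hnd]
  congr 1
  ext a
  simp only [List.mem_toFinset, mem_common hH, coset, Finset.mem_filter, Finset.mem_range, hv,
    true_and, iff_and_self]
  exact fun h => (lt_of_adj (hH h.2)).1

/-- The number of neighbours is at most `r`. -/
theorem card_nbrs_le (hH : H ≤ D.G) (hv : v < D.n) :
    ((Finset.range D.n).filter (H.Adj v)).card ≤ D.r := by
  refine le_trans ?_ (length_nbrsIn (H := H) hv)
  refine le_trans (Finset.card_le_card ?_) (List.toFinset_card_le _)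
  intro a ha
  rw [Finset.mem_filter] at ha
  rw [List.mem_toFinset, mem_nbrsIn hH]
  exact ⟨hv, ha.2⟩

/-- Double counting of the walks of length two from `v`. -/
theorem sum_codeg_le (hH : H ≤ D.G) (hv : v < D.n) :
    ∑ y ∈ Finset.range D.n, D.codeg H v y ≤ D.r * D.r := by
  have e : ∀ y, D.codeg H v y = ∑ a ∈ (Finset.range D.n).filter (H.Adj v),
      if H.Adj a y then 1 else 0 := by
    intro y
    rw [codeg_eq hH hv, coset, Finset.sum_boole, Finset.filter_filter]
    rfl
  simp only [e]
  rw [Finset.sum_comm]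
  calc ∑ a ∈ (Finset.range D.n).filter (H.Adj v), ∑ y ∈ Finset.range D.n,
        (if H.Adj a y then 1 else 0)
      ≤ ∑ a ∈ (Finset.range D.n).filter (H.Adj v), D.r := by
        refine Finset.sum_le_sum fun a ha => ?_
        rw [Finset.sum_boole]
        rw [Finset.mem_filter, Finset.mem_range] at ha
        exact card_nbrs_le hH ha.1
    _ ≤ D.r * D.r := by
        rw [Finset.sum_const, smul_eq_mul]
        exact Nat.mul_le_mul_right _ (card_nbrs_le hH hv)

theorem sum_popular (m : ℕ) (f : ℕ → ℕ) :
    ((D.popular H v m).map f).sum =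
      ∑ y ∈ (Finset.range D.n).filter (fun y => m ≤ D.codeg H v y), f y := by
  have hnd : (D.popular H v m).Nodup := List.nodup_range.filter _
  rw [← List.sum_toFinset _ hnd]
  congr 1
  ext y
  simp [mem_popular]

/-- Markov's inequality for codegrees. It bounds the dense vertices by `weight / θ` and those with
codegree at least `L` by `r² / L`. -/
theorem length_popular_mul_le (m : ℕ) :
    (D.popular H v m).length * m ≤ ((D.popular H v m).map (D.codeg H v)).sum := by
  have := List.card_nsmul_le_sum ((D.popular H v m).map (D.codeg H v)) m (by
    intro x hx
    rw [List.mem_map] at hx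
    obtain ⟨y, hy, rfl⟩ := hx
    exact (mem_popular.1 hy).2)
  simpa using this

theorem popular_sum_le (hH : H ≤ D.G) (hv : v < D.n) (m : ℕ) :
    ((D.popular H v m).map (D.codeg H v)).sum ≤ D.r * D.r := by
  rw [sum_popular]
  exact (Finset.sum_le_sum_of_subset (Finset.filter_subset _ _)).trans (sum_codeg_le hH hv)

/-- The number of ordered pairs of adjacent vertices. -/
noncomputable def numArcs (D : Data) (H : SimpleGraph ℕ) : ℕ :=
  ((Finset.range D.n ×ˢ Finset.range D.n).filter fun q => H.Adj q.1 q.2).card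

theorem numArcs_le (hH : H ≤ D.G) : D.numArcs H ≤ D.n * D.r := by
  refine le_trans ?_ D.length_arcs
  refine le_trans (Finset.card_le_card ?_) (List.toFinset_card_le _)
  rintro ⟨a, b⟩ h
  rw [Finset.mem_filter] at h
  rw [List.mem_toFinset, mem_arcs]
  exact hH h.2

/-- The weight counts exactly the ordered pairs of a dense vertex and an adjacent neighbour of `v`.
They are arcs of `H` but not of `del H v`; the reverse arcs disappear as well, which is not needed.
-/
theorem weight_add_numArcs_del_le (hH : H ≤ D.G) (hv : v < D.n) :
    D.weight H v + D.numArcs (D.del H v) ≤ D.numArcs H := by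
  have e : D.weight H v = ((Finset.range D.n ×ˢ Finset.range D.n).filter fun q =>
      (H.Adj v q.2 ∧ H.Adj q.2 q.1) ∧ D.θ ≤ D.codeg H v q.1).card := by
    rw [weight, sum_popular, Finset.card_filter, Finset.sum_product, Finset.sum_filter]
    refine Finset.sum_congr rfl fun y _ => ?_
    by_cases hy : D.θ ≤ D.codeg H v y
    · simp only [hy, if_true, and_true]
      rw [codeg_eq hH hv, coset, Finset.card_filter]
    · simp [hy]
  rw [e, numArcs, numArcs, ← Finset.card_union_of_disjoint]
  · refine Finset.card_le_card ?_
    rintro ⟨a, b⟩ h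
    simp only [Finset.mem_union, Finset.mem_filter] at h ⊢
    rcases h with h | h
    · exact ⟨h.1, h.2.1.2.symm⟩
    · exact ⟨h.1, h.2.1⟩
  · rw [Finset.disjoint_left]
    rintro ⟨a, b⟩ h h'
    simp only [Finset.mem_filter] at h h'
    exact h'.2.2 (Or.inr ⟨h.2.1.1, h.2.2⟩)

/-- The vertices whose neighbourhoods are to be processed. -/
noncomputable def bad (D : Data) (H : SimpleGraph ℕ) : Finset ℕ :=
  (Finset.range D.n).filter fun v => ¬ D.weight H v < D.θ * D.r

/-- Averaged over `v`, a round removes at least `θ r |bad H| / n` arcs. As the number of arcs is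
bounded, there cannot be many bad vertices in most rounds. -/
theorem sum_numArcs_next_le (hH : H ≤ D.G) :
    ∑ v ∈ Finset.range D.n, D.numArcs (D.next H v) + D.θ * D.r * (D.bad H).card ≤
      D.n * D.numArcs H := by
  rw [bad, Finset.card_filter, Finset.mul_sum, ← Finset.sum_add_distrib]
  refine (Finset.sum_le_card_nsmul _ _ (D.numArcs H) ?_).trans (by simp)
  intro v hv
  rw [Finset.mem_range] at hv
  have := weight_add_numArcs_del_le hH hv
  by_cases hb : D.weight H v < D.θ * D.r
  · simp [next, hb]
  · simp only [next, hb, if_false, not_false_eq_true, if_true, mul_one]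
    omega

/-- The number of closed walks of length `4`. -/
noncomputable def sqSum (D : Data) (H : SimpleGraph ℕ) : ℕ :=
  ∑ v ∈ Finset.range D.n, ∑ y ∈ Finset.range D.n, D.codeg H v y ^ 2

/-- A square `codeg ^ 2` is at most `θ * codeg` below the threshold and at most `r * codeg` always.
For a vertex that is not bad the part above the threshold sums up to at most `r * (θ r)`, the part
below to at most `θ r²`; a bad vertex contributes at most `r * r²`. -/
theorem sqSum_le (hH : H ≤ D.G) :
    D.sqSum H ≤ 2 * (D.n * D.θ * D.r ^ 2) + D.r ^ 3 * (D.bad H).card := by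
  have key : ∀ v ∈ Finset.range D.n, ∑ y ∈ Finset.range D.n, D.codeg H v y ^ 2 ≤
      2 * (D.θ * D.r ^ 2) + D.r ^ 3 * if ¬ D.weight H v < D.θ * D.r then 1 else 0 := by
    intro v hv
    rw [Finset.mem_range] at hv
    have h1 := sum_codeg_le hH hv
    by_cases hb : D.weight H v < D.θ * D.r
    · have h2 : ∀ y ∈ Finset.range D.n, D.codeg H v y ^ 2 ≤
          D.θ * D.codeg H v y + D.r * (if D.θ ≤ D.codeg H v y then D.codeg H v y else 0) := by
        intro y _
        have := D.codeg_le (H := H) hv y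
        split_ifs with h
        · nlinarith
        · nlinarith
      refine (Finset.sum_le_sum h2).trans ?_
      rw [Finset.sum_add_distrib, ← Finset.mul_sum, ← Finset.mul_sum, ← Finset.sum_filter,
        ← sum_popular, ← weight]
      have h3 : D.θ * ∑ y ∈ Finset.range D.n, D.codeg H v y ≤ D.θ * (D.r * D.r) :=
        Nat.mul_le_mul_left _ h1
      have h4 : D.r * D.weight H v ≤ D.r * (D.θ * D.r) := Nat.mul_le_mul_left _ hb.le
      have e1 : D.r * (D.θ * D.r) = D.θ * (D.r * D.r) := by ring
      have e2 : D.r ^ 2 = D.r * D.r := sq _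
      rw [e2]
      omega
    · simp only [hb, not_false_eq_true, if_true, mul_one]
      have h2 : ∀ y ∈ Finset.range D.n, D.codeg H v y ^ 2 ≤ D.r * D.codeg H v y := by
        intro y _
        have := D.codeg_le (H := H) hv y
        nlinarith
      refine (Finset.sum_le_sum h2).trans ?_
      rw [← Finset.mul_sum]
      have h3 := Nat.mul_le_mul_left D.r h1
      have e1 : D.r * (D.r * D.r) = D.r ^ 3 := by ring
      omega
  refine (Finset.sum_le_sum key).trans ?_
  rw [Finset.sum_add_distrib, ← Finset.mul_sum (a := D.r ^ 3), bad, Finset.card_filter]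
  simp only [Finset.sum_const, Finset.card_range, smul_eq_mul]
  apply le_of_eq
  ring

theorem sqSum_mono {H' : SimpleGraph ℕ} (hH : H ≤ D.G) (h : H' ≤ H) :
    D.sqSum H' ≤ D.sqSum H := by
  refine Finset.sum_le_sum fun v hv => Finset.sum_le_sum fun y _ => ?_
  rw [Finset.mem_range] at hv
  rw [codeg_eq hH hv, codeg_eq (h.trans hH) hv]
  gcongr
  intro a ha
  simp only [coset, Finset.mem_filter] at ha ⊢
  exact ⟨ha.1, h ha.2.1, h ha.2.2⟩

theorem support_evolve (m : ℕ) {H' : SimpleGraph ℕ} (h : H' ∈ (D.evolve m H).support) :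
    H' ≤ H := by
  induction m generalizing H with
  | zero => simp [evolve] at h; exact h.le
  | succ m ih =>
    rw [evolve, PMF.mem_support_bind_iff] at h
    obtain ⟨v, -, h⟩ := h
    exact (ih h).trans next_le

/-- By monotonicity the final `sqSum` is bounded by its value in each of the `m` rounds, hence by
the average of the bounds `A + r³ |bad|`. The bad vertices occurring there are paid for by deleted
arcs. Multiplying by `θ r m` turns this average into a statement proved by induction on the number
of rounds. -/
theorem mean_sqSum_evolve_le (hH : H ≤ D.G) (m : ℕ) :
    (D.θ * D.r * m : ℕ) * mean (D.evolve m H) (fun H' => (D.sqSum H' : ℝ≥0∞)) ≤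
      ((D.θ * D.r * m * (2 * (D.n * D.θ * D.r ^ 2)) + D.n * D.r ^ 3 * D.numArcs H : ℕ) : ℝ≥0∞) := by
  induction m generalizing H with
  | zero => simp
  | succ m ih =>
    set A := 2 * (D.n * D.θ * D.r ^ 2) with hA
    set B := D.n * D.r ^ 3 with hB
    have hn : (D.n : ℝ≥0∞) ≠ 0 := by have := D.n_pos; simp; omega
    have hn' : (D.n : ℝ≥0∞) ≠ ⊤ := ENNReal.natCast_ne_top _
    -- One of the `m + 1` copies is bounded by the state of the current round.
    have hX : mean (D.evolve (m + 1) H) (fun H' => (D.sqSum H' : ℝ≥0∞)) ≤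
        ((A + D.r ^ 3 * (D.bad H).card : ℕ) : ℝ≥0∞) := by
      refine (mean_mono (g := fun _ => (D.sqSum H : ℝ≥0∞)) fun H' hH' => ?_).trans ?_
      · exact_mod_cast sqSum_mono hH (support_evolve _ hH')
      · rw [mean_const]
        exact_mod_cast sqSum_le hH
    -- The other `m` copies are bounded by induction after conditioning on the vertex drawn first.
    have hsum : (D.n : ℝ≥0∞) * ((D.θ * D.r * m : ℕ) *
        mean (D.evolve (m + 1) H) (fun H' => (D.sqSum H' : ℝ≥0∞))) ≤
        ((D.n * (D.θ * D.r * m * A) + B * ∑ v ∈ Finset.range D.n, D.numArcs (D.next H v) : ℕ) :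
          ℝ≥0∞) := by
      rw [evolve, mean_bind, mul_left_comm, mean_uniformBelow D.n_pos, Finset.mul_sum]
      refine (Finset.sum_le_sum fun v _ => ih (next_le.trans hH)).trans ?_
      rw [← Nat.cast_sum, Finset.sum_add_distrib, ← Finset.mul_sum (a := B), Finset.sum_const,
        Finset.card_range, smul_eq_mul]
    refine (ENNReal.mul_le_mul_iff_right hn hn').1 ?_
    have e : ((D.θ * D.r * (m + 1) : ℕ) : ℝ≥0∞) = (D.θ * D.r * m : ℕ) + (D.θ * D.r : ℕ) := by
      push_cast; ring
    rw [e, add_mul, mul_add]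
    refine (add_le_add hsum (mul_le_mul_right (mul_le_mul_right hX _) _)).trans ?_
    have hstep := Nat.mul_le_mul_left B (sum_numArcs_next_le hH)
    have hBr : D.n * (D.θ * D.r * (D.r ^ 3 * (D.bad H).card)) =
        B * (D.θ * D.r * (D.bad H).card) := by rw [hB]; ring
    rw [mul_add] at hstep
    have : D.n * (D.θ * D.r * m * A) + B * ∑ v ∈ Finset.range D.n, D.numArcs (D.next H v) +
        D.n * (D.θ * D.r * (A + D.r ^ 3 * (D.bad H).card)) ≤
        D.n * (D.θ * D.r * (m + 1) * A + B * D.numArcs H) := by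
      have e1 : D.n * (D.θ * D.r * (A + D.r ^ 3 * (D.bad H).card)) =
        D.n * (D.θ * D.r * A) + D.n * (D.θ * D.r * (D.r ^ 3 * (D.bad H).card)) := by ring
      have e2 : D.n * (D.θ * D.r * (m + 1) * A + B * D.numArcs H) =
        D.n * (D.θ * D.r * m * A) + D.n * (D.θ * D.r * A) + B * (D.n * D.numArcs H) := by ring
      rw [e1, e2, hBr]
      omega
    exact_mod_cast this

end Data
-- Closed walks and cycles
namespace Data
variable {D : Data} {H : SimpleGraph ℕ} {v : ℕ}

/-- The neighbours of `u` in `H`, as a finite set. -/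
noncomputable def nbrset (D : Data) (H : SimpleGraph ℕ) (u : ℕ) : Finset ℕ :=
  (Finset.range D.n).filter (H.Adj u)

/-- The walks of length `j` from `u` to `v`, as lists of vertices. -/
noncomputable def walks (D : Data) (H : SimpleGraph ℕ) : ℕ → ℕ → ℕ → Finset (List ℕ)
  | 0, u, v => if u = v then {[u]} else ∅
  | j + 1, u, v => (D.nbrset H u).biUnion fun a => (D.walks H j a v).image (List.cons u)

/-- The number of walks of length `j` from `u` to `v`. -/
noncomputable def numWalks (D : Data) (H : SimpleGraph ℕ) : ℕ → ℕ → ℕ → ℕ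
  | 0, u, v => if u = v then 1 else 0
  | j + 1, u, v => ∑ a ∈ D.nbrset H u, D.numWalks H j a v

theorem card_walks_le (j u v : ℕ) : (D.walks H j u v).card ≤ D.numWalks H j u v := by
  induction j generalizing u with
  | zero => simp only [walks, numWalks]; split_ifs <;> simp
  | succ j ih =>
    simp only [walks, numWalks]
    exact Finset.card_biUnion_le.trans
      (Finset.sum_le_sum fun a _ => Finset.card_image_le.trans (ih a))

theorem mem_walks (hH : H ≤ D.G) (j : ℕ) (g : ℕ → ℕ) (hg : ∀ i < j, H.Adj (g i) (g (i + 1))) :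
    (List.range (j + 1)).map g ∈ D.walks H j (g 0) (g j) := by
  induction j generalizing g with
  | zero => simp [walks]
  | succ j ih =>
    have := ih (fun i => g (i + 1)) fun i hi => hg (i + 1) (by omega)
    rw [walks, Finset.mem_biUnion]
    refine ⟨g 1, ?_, ?_⟩
    · rw [nbrset, Finset.mem_filter, Finset.mem_range]
      have h0 := hg 0 (by omega)
      exact ⟨(lt_of_adj (hH h0)).2, h0⟩
    · rw [Finset.mem_image]
      refine ⟨_, this, ?_⟩
      rw [List.range_succ_eq_map (n := j + 1), List.map_cons, List.map_map]
      rfl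

theorem sum_nbrset_sum_nbrset (hH : H ≤ D.G) {u : ℕ} (hu : u < D.n) (f : ℕ → ℕ) :
    ∑ a ∈ D.nbrset H u, ∑ b ∈ D.nbrset H a, f b =
      ∑ b ∈ Finset.range D.n, D.codeg H u b * f b := by
  have : ∀ a, ∑ b ∈ D.nbrset H a, f b =
      ∑ b ∈ Finset.range D.n, if H.Adj a b then f b else 0 := by
    intro a
    rw [nbrset, Finset.sum_filter]
  simp only [this]
  rw [Finset.sum_comm]
  refine Finset.sum_congr rfl fun b _ => ?_
  rw [codeg_eq hH hu, ← Finset.sum_filter, Finset.sum_const, smul_eq_mul, nbrset, coset,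
    Finset.filter_filter]

theorem numWalks_two (hH : H ≤ D.G) {u v : ℕ} (hu : u < D.n) (hv : v < D.n) :
    D.numWalks H 2 u v = D.codeg H u v := by
  simp only [numWalks]
  rw [sum_nbrset_sum_nbrset hH hu fun b => if b = v then 1 else 0]
  simp [hv]

/-- Prepending a step costs a factor `r` by Cauchy-Schwarz and another factor `r` because every
vertex is the endpoint of at most `r` such steps. -/
theorem sum_sq_numWalks_le (hH : H ≤ D.G) (t : ℕ) :
    ∑ u ∈ Finset.range D.n, ∑ v ∈ Finset.range D.n, D.numWalks H (t + 2) u v ^ 2 ≤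
      D.r ^ (2 * t) * D.sqSum H := by
  induction t with
  | zero =>
    rw [Nat.mul_zero, pow_zero, one_mul, sqSum]
    refine le_of_eq (Finset.sum_congr rfl fun u hu => Finset.sum_congr rfl fun v hv => ?_)
    rw [Finset.mem_range] at hu hv
    rw [Nat.zero_add, numWalks_two hH hu hv]
  | succ t ih =>
    have h1 : ∀ u ∈ Finset.range D.n, ∀ v, D.numWalks H (t + 1 + 2) u v ^ 2 ≤
        D.r * ∑ a ∈ D.nbrset H u, D.numWalks H (t + 2) a v ^ 2 := by
      intro u hu v
      rw [Finset.mem_range] at hu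
      rw [show t + 1 + 2 = (t + 2) + 1 by ring, numWalks]
      refine sq_sum_le_card_mul_sum_sq.trans ?_
      exact Nat.mul_le_mul_right _ (card_nbrs_le hH hu)
    calc ∑ u ∈ Finset.range D.n, ∑ v ∈ Finset.range D.n, D.numWalks H (t + 1 + 2) u v ^ 2
        ≤ ∑ u ∈ Finset.range D.n, ∑ v ∈ Finset.range D.n,
          D.r * ∑ a ∈ D.nbrset H u, D.numWalks H (t + 2) a v ^ 2 :=
          Finset.sum_le_sum fun u hu => Finset.sum_le_sum fun v _ => h1 u hu v
      _ = D.r * ∑ u ∈ Finset.range D.n, ∑ a ∈ Finset.range D.n, if H.Adj u a then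
            ∑ v ∈ Finset.range D.n, D.numWalks H (t + 2) a v ^ 2 else 0 := by
          rw [Finset.mul_sum]
          refine Finset.sum_congr rfl fun u _ => ?_
          rw [← Finset.mul_sum, Finset.sum_comm, nbrset, Finset.sum_filter]
      _ = D.r * ∑ a ∈ Finset.range D.n, ∑ u ∈ Finset.range D.n, if H.Adj a u then
            ∑ v ∈ Finset.range D.n, D.numWalks H (t + 2) a v ^ 2 else 0 := by
          rw [Finset.sum_comm]
          simp only [H.adj_comm]
      _ ≤ D.r * ∑ a ∈ Finset.range D.n, D.r *
            ∑ v ∈ Finset.range D.n, D.numWalks H (t + 2) a v ^ 2 := by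
          refine Nat.mul_le_mul_left _ (Finset.sum_le_sum fun a ha => ?_)
          rw [Finset.mem_range] at ha
          rw [← Finset.sum_filter, Finset.sum_const, smul_eq_mul]
          exact Nat.mul_le_mul_right _ (card_nbrs_le hH ha)
      _ ≤ D.r * (D.r * (D.r ^ (2 * t) * D.sqSum H)) := by
          rw [← Finset.mul_sum]
          exact Nat.mul_le_mul_left _ (Nat.mul_le_mul_left _ ih)
      _ = D.r ^ (2 * (t + 1)) * D.sqSum H := by ring

/-- Split a closed walk from `u` after two steps, at `b`. The sum of `codeg u b` times the number of
walks of length `t + 2` from `b` back to `u` is at most `r ^ t * sqSum`, by the inequality between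
the two means. -/
theorem sum_numWalks_self_le (hH : H ≤ D.G) (t : ℕ) :
    ∑ u ∈ Finset.range D.n, D.numWalks H (t + 4) u u ≤ D.r ^ t * D.sqSum H := by
  have hr : 0 < D.r ^ t := pow_pos D.r_pos t
  have e : ∀ u ∈ Finset.range D.n, D.numWalks H (t + 4) u u =
      ∑ b ∈ Finset.range D.n, D.codeg H u b * D.numWalks H (t + 2) b u := by
    intro u hu
    rw [Finset.mem_range] at hu
    rw [show t + 4 = (t + 2) + 1 + 1 by ring, numWalks]
    simp only [numWalks]
    rw [← sum_nbrset_sum_nbrset hH hu]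
  rw [Finset.sum_congr rfl e]
  -- The weight `r ^ t` gives both resulting sums of squares the same bound `r ^ (2 t) * sqSum`, and
  -- the factor `2` avoids halves.
  refine Nat.le_of_mul_le_mul_left (c := 2 * D.r ^ t) ?_ (by omega)
  have h1 : ∀ u b, 2 * D.r ^ t * (D.codeg H u b * D.numWalks H (t + 2) b u) ≤
      D.r ^ (2 * t) * D.codeg H u b ^ 2 + D.numWalks H (t + 2) b u ^ 2 := by
    intro u b
    have e2 : D.r ^ (2 * t) = D.r ^ t * D.r ^ t := by rw [two_mul, pow_add]
    rw [e2]
    zify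
    nlinarith [sq_nonneg ((D.r : ℤ) ^ t * D.codeg H u b - D.numWalks H (t + 2) b u)]
  calc 2 * D.r ^ t * ∑ u ∈ Finset.range D.n, ∑ b ∈ Finset.range D.n,
        D.codeg H u b * D.numWalks H (t + 2) b u
      ≤ ∑ u ∈ Finset.range D.n, ∑ b ∈ Finset.range D.n,
        (D.r ^ (2 * t) * D.codeg H u b ^ 2 + D.numWalks H (t + 2) b u ^ 2) := by
        rw [Finset.mul_sum]
        refine Finset.sum_le_sum fun u _ => ?_
        rw [Finset.mul_sum]
        exact Finset.sum_le_sum fun b _ => h1 u b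
    _ = D.r ^ (2 * t) * D.sqSum H +
        ∑ u ∈ Finset.range D.n, ∑ v ∈ Finset.range D.n, D.numWalks H (t + 2) u v ^ 2 := by
        simp only [Finset.sum_add_distrib, ← Finset.mul_sum]
        rw [sqSum, Finset.sum_comm (f := fun u b => D.numWalks H (t + 2) b u ^ 2)]
    _ ≤ D.r ^ (2 * t) * D.sqSum H + D.r ^ (2 * t) * D.sqSum H :=
        Nat.add_le_add_left (sum_sq_numWalks_le hH t) _
    _ = 2 * D.r ^ t * (D.r ^ t * D.sqSum H) := by rw [two_mul t, pow_add]; ring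

/-- The closed walks of length `k`. -/
noncomputable def closedWalks (D : Data) (H : SimpleGraph ℕ) (k : ℕ) : Finset (List ℕ) :=
  (Finset.range D.n).biUnion fun u => D.walks H k u u

theorem card_closedWalks_le (hH : H ≤ D.G) {k : ℕ} (hk : 4 ≤ k) :
    (D.closedWalks H k).card ≤ D.r ^ (k - 4) * D.sqSum H := by
  obtain ⟨t, rfl⟩ : ∃ t, k = t + 4 := ⟨k - 4, by omega⟩
  rw [Nat.add_sub_cancel]
  exact Finset.card_biUnion_le.trans ((Finset.sum_le_sum fun u _ => card_walks_le _ _ _).trans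
    (sum_numWalks_self_le hH t))

theorem length_of_mem_walks {j u v : ℕ} {l : List ℕ} (h : l ∈ D.walks H j u v) :
    l.length = j + 1 := by
  induction j generalizing u l with
  | zero =>
    simp only [walks] at h
    split_ifs at h
    · simp at h; simp [h]
    · simp at h
  | succ j ih =>
    simp only [walks, Finset.mem_biUnion, Finset.mem_image] at h
    obtain ⟨a, -, l', hl', rfl⟩ := h
    simp [ih hl']

theorem lt_of_mem_walks {j u v : ℕ} {l : List ℕ} (hu : u < D.n) (h : l ∈ D.walks H j u v) :
    ∀ x ∈ l, x < D.n := by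
  induction j generalizing u l with
  | zero =>
    simp only [walks] at h
    split_ifs at h
    · simp at h; simp [h, hu]
    · simp at h
  | succ j ih =>
    simp only [walks, Finset.mem_biUnion, Finset.mem_image] at h
    obtain ⟨a, ha, l', hl', rfl⟩ := h
    rw [nbrset, Finset.mem_filter, Finset.mem_range] at ha
    simpa [hu] using ih ha.1 hl'

/-- The closed walks of length `k` that visit each vertex once, apart from the return, and whose
vertices satisfy `P`. -/
noncomputable def cycles (D : Data) (H : SimpleGraph ℕ) (P : ℕ → Prop) (k : ℕ) :
    Finset (List ℕ) :=
  (D.closedWalks H k).filter fun l => l.dropLast.Nodup ∧ ∀ x ∈ l.dropLast, P x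

theorem _root_.SimpleGraph.labelledCopyCount_eq_natCard {V W : Type*} [Fintype V] [Fintype W]
    (G : SimpleGraph V) (H : SimpleGraph W) : G.labelledCopyCount H = Nat.card (H.Copy G) := by
  unfold SimpleGraph.labelledCopyCount
  exact (Nat.card_eq_fintype_card).symm

theorem natCard_le_card_of_injective {α β : Type*} (s : Finset β) (f : α → β)
    (h : ∀ a, f a ∈ s) (hf : Function.Injective f) : Nat.card α ≤ s.card := by
  rw [← Nat.card_eq_finsetCard]
  exact Nat.card_le_card_of_injective (fun a => (⟨f a, h a⟩ : s))
    fun a b hab => hf (congrArg Subtype.val hab)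

-- Reading a copy of the cycle from its vertex `0` on gives a closed walk that determines the copy.
-- Vertices are indexed by natural numbers modulo the length, so that the closing edge is not an
-- exceptional case.
open scoped Fin.NatCast Fin.CommRing in
theorem copyCount_cycleGraph_le (hH : H ≤ D.G) {n k : ℕ} (hk : 4 ≤ k) {P : ℕ → Prop}
    {G' : SimpleGraph (Fin n)} (hG : ∀ u v, G'.Adj u v → H.Adj u v ∧ P u) :
    G'.copyCount (SimpleGraph.cycleGraph k) ≤ (D.cycles H P k).card := by
  obtain ⟨m, rfl⟩ : ∃ m, k = m + 2 := ⟨k - 2, by omega⟩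
  refine SimpleGraph.copyCount_le_labelledCopyCount.trans ?_
  let g : (SimpleGraph.cycleGraph (m + 2)).Copy G' → ℕ → ℕ := fun f i =>
    (f.toHom (i : Fin (m + 2)) : ℕ)
  have hadj : ∀ f i, H.Adj (g f i) (g f (i + 1)) ∧ P (g f i) := by
    intro f i
    refine hG _ _ (f.toHom.map_adj ?_)
    rw [SimpleGraph.cycleGraph_adj]
    right
    rw [Nat.cast_succ, add_sub_cancel_left]
  rw [SimpleGraph.labelledCopyCount_eq_natCard]
  refine natCard_le_card_of_injective _ (fun f => (List.range (m + 2 + 1)).map (g f)) ?_ ?_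
  · intro f
    have hmem := mem_walks hH (m + 2) (g f) fun i _ => (hadj f i).1
    have hlast : g f (m + 2) = g f 0 := by
      have : ((m + 2 : ℕ) : Fin (m + 2)) = ((0 : ℕ) : Fin (m + 2)) := by
        rw [Fin.natCast_self]; rfl
      simp only [g, this]
    rw [hlast] at hmem
    simp only [cycles, closedWalks, Finset.mem_filter, Finset.mem_biUnion,
      Finset.mem_range]
    refine ⟨⟨g f 0, (lt_of_adj (hH (hadj f 0).1)).1, hmem⟩, ?_⟩
    rw [List.range_succ, List.map_append, List.map_singleton, List.dropLast_concat]
    refine ⟨List.nodup_range.map_on fun i hi j hj hij => ?_, ?_⟩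
    · rw [List.mem_range] at hi hj
      have h1 := f.injective' (Fin.val_injective hij)
      have h2 := congrArg Fin.val h1
      rwa [Fin.val_natCast, Fin.val_natCast, Nat.mod_eq_of_lt hi, Nat.mod_eq_of_lt hj] at h2
    · intro x hx
      rw [List.mem_map] at hx
      obtain ⟨i, -, rfl⟩ := hx
      exact (hadj f i).2
  · intro f f' hff
    have h1 : ∀ i < m + 2 + 1, g f i = g f' i := by
      intro i hi
      have := List.map_inj_left.1 hff i (by simpa using hi)
      exact this
    refine DFunLike.ext _ _ fun i => ?_
    have := h1 i (by omega)
    simp only [g, Fin.cast_val_eq_self] at this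
    exact Fin.val_injective this

end Data
-- Independence of the colours, tail bounds and expected numbers of cycles
theorem support_recolour {p : ℕ} (m : ℕ) : ∀ (j : ℕ) (c c' : ℕ → ℕ),
    c' ∈ (recolour p j m c).support → ∀ u < j, c' u = c u := by
  induction m with
  | zero =>
    intro j c c' h u _
    rw [recolour, PMF.mem_support_pure_iff] at h
    rw [h]
  | succ m ih =>
    intro j c c' h u hu
    rw [recolour, PMF.mem_support_bind_iff] at h
    obtain ⟨a, -, h⟩ := h
    rw [ih _ _ _ h u (by omega), Function.update_of_ne hu.ne]

/-- The colours of the vertices are independent. -/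
theorem mean_recolour {p : ℕ} (g : ℕ → ℕ → ℝ≥0∞) (m : ℕ) : ∀ (j : ℕ) (c : ℕ → ℕ),
    mean (recolour p j m c) (fun c' => ∏ u ∈ Finset.Ico j (j + m), g u (c' u)) =
      ∏ u ∈ Finset.Ico j (j + m), mean (uniformBelow p) (g u) := by
  induction m with
  | zero =>
    intro j c
    simp [recolour, mean_pure]
  | succ m ih =>
    intro j c
    have e : ∀ f : ℕ → ℝ≥0∞, ∏ u ∈ Finset.Ico j (j + (m + 1)), f u =
        f j * ∏ u ∈ Finset.Ico (j + 1) (j + 1 + m), f u := by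
      intro f
      rw [Finset.prod_eq_prod_Ico_succ_bot (by omega), show j + (m + 1) = j + 1 + m by omega]
    simp only [e]
    rw [recolour, mean_bind]
    have : ∀ a, mean (recolour p (j + 1) m (Function.update c j a)) (fun c' => g j (c' j) *
        ∏ u ∈ Finset.Ico (j + 1) (j + 1 + m), g u (c' u)) =
        g j a * ∏ u ∈ Finset.Ico (j + 1) (j + 1 + m), mean (uniformBelow p) (g u) := by
      intro a
      rw [← ih, ← mean_const_mul]
      refine mean_congr fun c' hc' => ?_
      -- The colour of `j` is not touched again by the later draws.
      rw [support_recolour _ _ _ _ hc' j (by omega), Function.update_self]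
    simp only [this]
    simp only [mul_comm _ (∏ u ∈ Finset.Ico (j + 1) (j + 1 + m), mean (uniformBelow p) (g u)),
      mean_const_mul]

theorem mean_recolour_range {p n : ℕ} (g : ℕ → ℕ → ℝ≥0∞) (c : ℕ → ℕ) :
    mean (recolour p 0 n c) (fun c' => ∏ u ∈ Finset.range n, g u (c' u)) =
      ∏ u ∈ Finset.range n, mean (uniformBelow p) (g u) := by
  have := mean_recolour (p := p) g n 0 c
  rwa [Nat.zero_add, ← Finset.range_eq_Ico] at this

theorem prod_indicator {V U : Finset ℕ} (hV : V ⊆ U) (x : ℝ≥0∞) :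
    ∏ u ∈ U, (if u ∈ V then x else 1) = x ^ V.card := by
  rw [Finset.prod_ite, Finset.prod_const_one, mul_one, Finset.prod_const,
    Finset.filter_mem_eq_inter, Finset.inter_eq_right.2 hV]

/-- The probability that all vertices of a set receive colours from `A`. -/
theorem mean_recolour_subset {p n : ℕ} (hp : 0 < p) {V : Finset ℕ} (hV : V ⊆ Finset.range n)
    (A : Finset ℕ) (c : ℕ → ℕ) :
    (p : ℝ≥0∞) ^ V.card * mean (recolour p 0 n c) (fun c' => if ∀ u ∈ V, c' u ∈ A then 1 else 0) ≤
      (A.card : ℝ≥0∞) ^ V.card := by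
  have e : ∀ c' : ℕ → ℕ, (if ∀ u ∈ V, c' u ∈ A then (1 : ℝ≥0∞) else 0) =
      ∏ u ∈ Finset.range n, if u ∈ V → c' u ∈ A then 1 else 0 := by
    intro c'
    rw [Finset.prod_ite_zero, Finset.prod_const_one]
    congr 1
    exact propext ⟨fun h u _ => h u, fun h u hu => h u (hV hu) hu⟩
  simp only [e]
  rw [mean_recolour_range (fun u a => if u ∈ V → a ∈ A then 1 else 0)]
  have e' : ∀ u, mean (uniformBelow p) (fun a => if u ∈ V → a ∈ A then (1 : ℝ≥0∞) else 0) =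
      if u ∈ V then mean (uniformBelow p) (fun a => if a ∈ A then 1 else 0) else 1 := by
    intro u
    by_cases hu : u ∈ V <;> simp [hu, mean_const]
  simp only [e', prod_indicator hV]
  rw [← mul_pow, mean_uniformBelow hp, Finset.sum_boole]
  gcongr
  intro a ha
  exact (Finset.mem_filter.1 ha).2

/-- An exponential moment of the number of vertices of one colour in a set. -/
theorem mean_two_pow_le {p n : ℕ} (hp : 0 < p) {U : Finset ℕ} (hU : U ⊆ Finset.range n) (b : ℕ)
    (c : ℕ → ℕ) :
    mean (recolour p 0 n c) (fun c' => (2 : ℝ≥0∞) ^ (U.filter (c' · = b)).card) ≤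
      ENNReal.ofReal (Real.exp (U.card / p)) := by
  have e : ∀ c' : ℕ → ℕ, (2 : ℝ≥0∞) ^ (U.filter (c' · = b)).card =
      ∏ u ∈ Finset.range n, if u ∈ U ∧ c' u = b then 2 else 1 := by
    intro c'
    rw [← prod_indicator ((Finset.filter_subset _ U).trans hU)]
    simp only [Finset.mem_filter]
  simp only [e]
  rw [mean_recolour_range (fun u a => if u ∈ U ∧ a = b then 2 else 1)]
  have e' : ∀ u, mean (uniformBelow p) (fun a => if u ∈ U ∧ a = b then (2 : ℝ≥0∞) else 1) =
      if u ∈ U then mean (uniformBelow p) (fun a => if a = b then 2 else 1) else 1 := by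
    intro u
    by_cases hu : u ∈ U <;> simp [hu, mean_const]
  simp only [e', prod_indicator hU]
  have hp' : (0 : ℝ) < p := by exact_mod_cast hp
  -- At most one of the `p` colours doubles the factor, so its mean is at most `1 + 1 / p ≤ exp (1 /
  -- p)`.
  have hm : mean (uniformBelow p) (fun a => if a = b then (2 : ℝ≥0∞) else 1) ≤
      ENNReal.ofReal (Real.exp (1 / p)) := by
    have h1 : (p : ℝ≥0∞) * mean (uniformBelow p) (fun a => if a = b then (2 : ℝ≥0∞) else 1) ≤
        p + 1 := by
      rw [mean_uniformBelow hp]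
      calc ∑ a ∈ Finset.range p, (if a = b then (2 : ℝ≥0∞) else 1)
          = ∑ a ∈ Finset.range p, (1 + if a = b then (1 : ℝ≥0∞) else 0) := by
            refine Finset.sum_congr rfl fun a _ => ?_
            split_ifs <;> norm_num
        _ ≤ p + 1 := by
            rw [Finset.sum_add_distrib, Finset.sum_ite_eq']
            simp only [Finset.sum_const, Finset.card_range, nsmul_eq_mul, mul_one]
            gcongr
            split_ifs <;> simp
    have h2 : (p + 1 : ℝ≥0∞) = p * ENNReal.ofReal (1 / p + 1) := by
      rw [← ENNReal.ofReal_natCast p, ← ENNReal.ofReal_mul hp'.le, ← ENNReal.ofReal_one,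
        ← ENNReal.ofReal_add hp'.le zero_le_one]
      congr 1
      field_simp
      ring
    rw [h2] at h1
    refine ((ENNReal.mul_le_mul_iff_right ?_ (ENNReal.natCast_ne_top p)).1 h1).trans ?_
    · exact_mod_cast hp.ne'
    · exact ENNReal.ofReal_le_ofReal (Real.add_one_le_exp _)
  refine (pow_le_pow_left₀ zero_le hm _).trans ?_
  rw [← ENNReal.ofReal_pow (Real.exp_nonneg _), ← Real.exp_nat_mul, mul_one_div]

/-- Markov's inequality for `2` to the power of the number of vertices with colour `b`. -/
theorem mean_count_lt_le {p n : ℕ} (hp : 0 < p) {U : Finset ℕ} (hU : U ⊆ Finset.range n) {N : ℕ}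
    (hN : U.card ≤ N) (b M : ℕ) (c : ℕ → ℕ) :
    mean (recolour p 0 n c) (fun c' => if M < (U.filter (c' · = b)).card then 1 else 0) ≤
      ENNReal.ofReal (Real.exp (N / p) / 2 ^ (M + 1)) := by
  have hp' : (0 : ℝ) < p := by exact_mod_cast hp
  have h := (mean_two_pow_le hp hU b c).trans (ENNReal.ofReal_le_ofReal
    (Real.exp_le_exp.2 (div_le_div_of_nonneg_right (Nat.cast_le.2 hN) hp'.le)))
  have h2 : (2 : ℝ≥0∞) ^ (M + 1) * mean (recolour p 0 n c)
      (fun c' => if M < (U.filter (c' · = b)).card then 1 else 0) ≤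
      ENNReal.ofReal (Real.exp (N / p)) := by
    refine le_trans ?_ h
    rw [← mean_const_mul]
    refine mean_mono fun c' _ => ?_
    split_ifs with hM
    · rw [mul_one]
      exact pow_le_pow_right₀ (by norm_num) hM
    · simp
  rw [ENNReal.ofReal_div_of_pos (by positivity), ENNReal.le_div_iff_mul_le (by simp) (by simp),
    mul_comm, ENNReal.ofReal_pow (by norm_num)]
  simpa using h2

/-- Every colour is given to at most `M₁` vertices and to at most `M₂` neighbours of any vertex. -/
def Spread (D : Data) (c : ℕ → ℕ) (M₁ M₂ : ℕ) : Prop :=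
  ∀ b < D.p, ((Finset.range D.n).filter (c · = b)).card ≤ M₁ ∧
    ∀ v < D.n, ((D.nbrset D.G v).filter (c · = b)).card ≤ M₂

/-- Union bound over the `p` colours and, for each, the whole vertex set and the `n` neighbourhoods.
-/
theorem mean_not_spread_le (D : Data) (M₁ M₂ : ℕ) (c : ℕ → ℕ) :
    mean (recolour D.p 0 D.n c) (fun c' => if Spread D c' M₁ M₂ then 0 else 1) ≤
      D.p * (ENNReal.ofReal (Real.exp (D.n / D.p) / 2 ^ (M₁ + 1)) +
        D.n * ENNReal.ofReal (Real.exp (D.r / D.p) / 2 ^ (M₂ + 1))) := by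
  have hp := D.p_pos
  calc mean (recolour D.p 0 D.n c) (fun c' => if Spread D c' M₁ M₂ then 0 else 1)
      ≤ mean (recolour D.p 0 D.n c) (fun c' => ∑ b ∈ Finset.range D.p,
          ((if M₁ < ((Finset.range D.n).filter (c' · = b)).card then 1 else 0) +
            ∑ v ∈ Finset.range D.n,
              if M₂ < ((D.nbrset D.G v).filter (c' · = b)).card then 1 else 0)) := by
        refine mean_mono fun c' _ => ?_
        split_ifs with h
        · simp
        · simp only [Spread, not_forall] at h
          obtain ⟨b, hb, h⟩ := h
          refine le_trans ?_ (Finset.single_le_sum (fun _ _ => zero_le) (Finset.mem_range.2 hb))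
          rw [not_and_or, not_le] at h
          rcases h with h | h
          · rw [if_pos h]
            exact le_self_add
          · simp only [not_forall, not_le] at h
            obtain ⟨v, hv, h⟩ := h
            refine le_trans ?_ le_add_self
            refine le_trans ?_ (Finset.single_le_sum (fun _ _ => zero_le)
              (Finset.mem_range.2 hv))
            rw [if_pos h]
    _ ≤ ∑ b ∈ Finset.range D.p, (ENNReal.ofReal (Real.exp (D.n / D.p) / 2 ^ (M₁ + 1)) +
          ∑ v ∈ Finset.range D.n, ENNReal.ofReal (Real.exp (D.r / D.p) / 2 ^ (M₂ + 1))) := by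
        rw [mean_sum]
        refine Finset.sum_le_sum fun b _ => ?_
        rw [mean_add, mean_sum]
        gcongr with v hv
        · exact mean_count_lt_le hp subset_rfl (by simp) b M₁ c
        · exact mean_count_lt_le hp (Finset.filter_subset _ _)
            (Data.card_nbrs_le le_rfl (Finset.mem_range.1 hv)) b M₂ c
    _ = _ := by simp [mul_add]

/-- The expected number of closed walks of length `k` without repeated vertices on a fixed set of
colours. -/
theorem mean_cycles_le {D : Data} {H : SimpleGraph ℕ} {k : ℕ} (hH : H ≤ D.G) (hk : 4 ≤ k)
    {A : Finset ℕ} (hA : A.card ≤ 3) (c : ℕ → ℕ) :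
    (D.p : ℝ≥0∞) ^ k * mean (recolour D.p 0 D.n c)
      (fun c' => ((D.cycles H (fun x => c' x ∈ A) k).card : ℝ≥0∞)) ≤
      3 ^ k * (D.r ^ (k - 4) * D.sqSum H : ℕ) := by
  set W := (D.closedWalks H k).filter fun l => l.dropLast.Nodup
  have e : ∀ c' : ℕ → ℕ, ((D.cycles H (fun x => c' x ∈ A) k).card : ℝ≥0∞) =
      ∑ l ∈ W, if ∀ u ∈ l.dropLast.toFinset, c' u ∈ A then 1 else 0 := by
    intro c'
    rw [Finset.sum_boole, Finset.filter_filter, Data.cycles]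
    simp only [List.mem_toFinset]
    congr!
  simp only [e]
  rw [mean_sum, Finset.mul_sum]
  calc ∑ l ∈ W, (D.p : ℝ≥0∞) ^ k * mean (recolour D.p 0 D.n c)
        (fun c' => if ∀ u ∈ l.dropLast.toFinset, c' u ∈ A then 1 else 0)
      ≤ ∑ l ∈ W, (3 : ℝ≥0∞) ^ k := by
        refine Finset.sum_le_sum fun l hl => ?_
        obtain ⟨hl, hnd⟩ := Finset.mem_filter.1 hl
        rw [Data.closedWalks, Finset.mem_biUnion] at hl
        obtain ⟨u, hu, hl⟩ := hl
        have hlen := Data.length_of_mem_walks hl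
        have hcard : l.dropLast.toFinset.card = k := by
          rw [List.toFinset_card_of_nodup hnd, List.length_dropLast, hlen, Nat.add_sub_cancel]
        have hsub : l.dropLast.toFinset ⊆ Finset.range D.n := by
          intro x hx
          rw [List.mem_toFinset] at hx
          exact Finset.mem_range.2 <| Data.lt_of_mem_walks (Finset.mem_range.1 hu) hl x (List.mem_of_mem_dropLast hx)
        have := mean_recolour_subset D.p_pos hsub A c
        rw [hcard] at this
        refine this.trans ?_
        gcongr
        exact_mod_cast hA
    _ ≤ _ := by
        rw [Finset.sum_const, nsmul_eq_mul, mul_comm]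
        gcongr
        exact (Finset.card_le_card (Finset.filter_subset _ _)).trans (Data.card_closedWalks_le hH hk)

/-- The colours are drawn after the sparsification and independently of it, so the cycle bound holds
conditionally on `H` with a factor `sqSum H`, whose expectation is then inserted. -/
theorem mean_law_cycles_le {D : Data} {k : ℕ} (hk : 4 ≤ k) {A : Finset ℕ} (hA : A.card ≤ 3)
    (c : ℕ → ℕ) :
    ((D.p ^ k * (D.θ * D.r * D.R) : ℕ) : ℝ≥0∞) * mean (D.law c)
      (fun i => ((D.cycles i.1 (fun x => i.2 x ∈ A) k).card : ℝ≥0∞)) ≤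
      ((3 ^ k * (D.r ^ (k - 4) * (D.θ * D.r * D.R * (2 * (D.n * D.θ * D.r ^ 2)) +
        D.n * D.r ^ 3 * (D.n * D.r))) : ℕ) : ℝ≥0∞) := by
  have h1 : ((D.p ^ k : ℕ) : ℝ≥0∞) * mean (D.law c)
      (fun i => ((D.cycles i.1 (fun x => i.2 x ∈ A) k).card : ℝ≥0∞)) ≤
      ((3 ^ k * D.r ^ (k - 4) : ℕ) : ℝ≥0∞) *
        mean (D.evolve D.R D.G) (fun H => (D.sqSum H : ℝ≥0∞)) := by
    rw [Data.law, mean_bind, ← mean_const_mul, ← mean_const_mul]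
    refine mean_mono fun H hH => ?_
    rw [mean_map]
    refine le_of_eq_of_le ?_ ((mean_cycles_le (Data.support_evolve _ hH) hk hA c).trans ?_)
    · push_cast
      rfl
    · push_cast
      rw [mul_assoc]
  have h2 := (Data.mean_sqSum_evolve_le (le_refl D.G) D.R).trans
    (Nat.cast_le.2 (Nat.add_le_add_left (Nat.mul_le_mul_left _ (Data.numArcs_le le_rfl)) _))
  calc _ = ((D.θ * D.r * D.R : ℕ) : ℝ≥0∞) * (((D.p ^ k : ℕ) : ℝ≥0∞) * mean (D.law c)
      (fun i => ((D.cycles i.1 (fun x => i.2 x ∈ A) k).card : ℝ≥0∞))) := by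
        push_cast
        ring
    _ ≤ ((D.θ * D.r * D.R : ℕ) : ℝ≥0∞) * (((3 ^ k * D.r ^ (k - 4) : ℕ) : ℝ≥0∞) *
        mean (D.evolve D.R D.G) (fun H => (D.sqSum H : ℝ≥0∞))) := by gcongr
    _ = ((3 ^ k * D.r ^ (k - 4) : ℕ) : ℝ≥0∞) * (((D.θ * D.r * D.R : ℕ) : ℝ≥0∞) *
        mean (D.evolve D.R D.G) (fun H => (D.sqSum H : ℝ≥0∞))) := by ring
    _ ≤ _ := by
        refine (mul_le_mul_right h2 _).trans (le_of_eq ?_)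
        push_cast
        ring

theorem mean_law_not_spread_le (D : Data) (M₁ M₂ : ℕ) (c : ℕ → ℕ) :
    mean (D.law c) (fun i => if Spread D i.2 M₁ M₂ then 0 else 1) ≤
      D.p * (ENNReal.ofReal (Real.exp (D.n / D.p) / 2 ^ (M₁ + 1)) +
        D.n * ENNReal.ofReal (Real.exp (D.r / D.p) / 2 ^ (M₂ + 1))) := by
  rw [Data.law, mean_bind]
  refine (mean_mono fun H _ => ?_).trans (mean_const _).le
  rw [mean_map]
  exact mean_not_spread_le D M₁ M₂ c

/-! ### Triples of colours and the lists described by the pointers -/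

/-- The set of colours of the `t`-th triple. -/
def triple (p t : ℕ) : Finset ℕ :=
  ({tripleCol p t 0, tripleCol p t 1, tripleCol p t 2} : Finset ℕ).erase p

theorem card_triple (p t : ℕ) : (triple p t).card ≤ 3 :=
  (Finset.card_erase_le).trans Finset.card_le_three

theorem mem_triple {p t b : ℕ} : b ∈ triple p t ↔ b ≠ p ∧ ∃ x < 3, b = tripleCol p t x := by
  simp only [triple, Finset.mem_erase, Finset.mem_insert, Finset.mem_singleton]
  refine and_congr_right fun _ => ⟨?_, ?_⟩
  · rintro (h | h | h)
    exacts [⟨0, by omega, h⟩, ⟨1, by omega, h⟩, ⟨2, by omega, h⟩]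
  · rintro ⟨x, hx, rfl⟩
    interval_cases x <;> simp

/-- Repeated colours have been replaced by `p`, so a genuine colour occurs only once in a triple.
This is why no vertex and no edge is listed twice. -/
theorem tripleCol_inj {p t x y : ℕ} (hx : x < 3) (hy : y < 3)
    (h : tripleCol p t x = tripleCol p t y) (hp : tripleCol p t x ≠ p) : x = y := by
  unfold tripleCol at h hp
  generalize t / p / p = a at h hp
  generalize t / p % p = b at h hp
  generalize t % p = d at h hp
  by_cases h0 : t < p * p * p
  · simp only [h0, if_true] at h hp
    interval_cases x <;> interval_cases y <;> simp at h hp ⊢ <;> split_ifs at h hp <;> omega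
  · rw [if_neg h0] at hp
    exact absurd rfl hp

/-- The number of a triple has its colours as digits in base `p`. A colour replaced because of a
repetition is still present at its first occurrence. -/
theorem triple_encode {p i j l : ℕ} (hi : i < p) (hj : j < p) (hl : l < p) :
    i * p * p + j * p + l < p * p * p ∧ i ∈ triple p (i * p * p + j * p + l) ∧
      j ∈ triple p (i * p * p + j * p + l) ∧ l ∈ triple p (i * p * p + j * p + l) := by
  have e1 : (i * p * p + j * p + l) / p = i * p + j := by
    rw [show i * p * p + j * p + l = l + p * (i * p + j) by ring,
      Nat.add_mul_div_left _ _ (by omega), Nat.div_eq_of_lt hl, Nat.zero_add]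
  have e2 : (i * p + j) / p = i := by
    rw [show i * p + j = j + p * i by ring,
      Nat.add_mul_div_left _ _ (by omega), Nat.div_eq_of_lt hj, Nat.zero_add]
  have e3 : (i * p + j) % p = j := by
    rw [show i * p + j = j + p * i by ring, Nat.add_mul_mod_self_left, Nat.mod_eq_of_lt hj]
  have e4 : (i * p * p + j * p + l) % p = l := by
    rw [show i * p * p + j * p + l = l + p * (i * p + j) by ring, Nat.add_mul_mod_self_left,
      Nat.mod_eq_of_lt hl]
  have h : i * p * p + j * p + l < p * p * p := by
    have : i * p + j + 1 ≤ p * p := by nlinarith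
    nlinarith
  refine ⟨h, ?_⟩
  simp only [triple, Finset.mem_erase, Finset.mem_insert, Finset.mem_singleton, tripleCol, e1, e2,
    e3, e4]
  refine ⟨⟨by omega, ?_⟩, ⟨by omega, ?_⟩, ⟨by omega, ?_⟩⟩ <;> split_ifs <;> simp_all <;> omega

section lists
variable {D : Data} {H : SimpleGraph ℕ} {c : ℕ → ℕ} {s : State} {t : ℕ}

theorem eq_of_sym2_mk_eq {u v u' v' : ℕ} (h : u < v) (h' : u' < v') (e : s(u, v) = s(u', v')) :
    u = u' ∧ v = v' := by
  rw [Sym2.eq_iff] at e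
  omega

theorem nodup_map_sym2 {l : List (ℕ × ℕ)} (hl : l.Nodup) (h : ∀ e ∈ l, e.1 < e.2) :
    (l.map fun e => s(e.1, e.2)).Nodup := by
  refine hl.map_on fun x hx y hy e => ?_
  obtain ⟨h1, h2⟩ := eq_of_sym2_mk_eq (h x hx) (h y hy) e
  exact Prod.ext h1 h2

theorem Final.mem_vertexList (hF : Final D H c s) (ht : t < D.S) {u : ℕ} :
    u ∈ vertexList 9 t s ↔ u < D.n ∧ c u ∈ triple D.p t := by
  rw [hF.vertices t ht]
  simp only [List.mem_flatMap, List.mem_range, colourClass, List.mem_filter, decide_eq_true_eq,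
    mem_triple]
  constructor
  · rintro ⟨j, hj, hu, h⟩
    have := hF.col u hu
    refine ⟨hu, by omega, ?_⟩
    rw [blockCol] at h
    split_ifs at h
    · exact ⟨j / 3, by omega, h⟩
    · omega
  · rintro ⟨hu, -, x, hx, h⟩
    refine ⟨3 * x, by omega, hu, ?_⟩
    rw [blockCol, if_pos (by omega), h, Nat.mul_div_cancel_left _ (by omega)]

theorem Final.nodup_vertexList (hF : Final D H c s) (ht : t < D.S) :
    (vertexList 9 t s).Nodup := by
  rw [hF.vertices t ht, List.nodup_flatMap]
  refine ⟨fun j _ => List.nodup_range.filter _, ?_⟩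
  refine List.Nodup.pairwise_of_forall_ne List.nodup_range fun j hj j' hj' hne u hu hu' => hne ?_
  simp only [List.mem_range, colourClass, List.mem_filter, decide_eq_true_eq] at hj hj' hu hu'
  have := hF.col u hu.1
  have h1 := hu.2
  have h2 := hu'.2
  simp only [blockCol] at h1 h2
  split_ifs at h1 h2 <;> try omega
  have := tripleCol_inj (p := D.p) (t := t) (x := j / 3) (y := j' / 3) (by omega) (by omega)
    (by omega) (by omega)
  omega

theorem blockKey_eq {p j a b : ℕ} (hp : 1 ≤ p) (hb : b < p)
    (h : a * (p + 1) + b = blockKey p t j) :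
    a = tripleCol p t (j / 3) ∧ b = tripleCol p t (j % 3) := by
  have h1 := tripleCol_le (p := p) (t := t) (x := j / 3) hp
  have h2 := tripleCol_le (p := p) (t := t) (x := j % 3) hp
  rw [blockKey] at h
  have e : ∀ x y, y < p + 1 → (x * (p + 1) + y) / (p + 1) = x ∧ (x * (p + 1) + y) % (p + 1) = y := by
    intro x y hy
    rw [Nat.add_comm, Nat.add_mul_div_right _ _ (by omega), Nat.div_eq_of_lt hy,
      Nat.add_mul_mod_self_right, Nat.mod_eq_of_lt hy]
    simp
  have e1 := e a b (by omega)
  have e2 := e (tripleCol p t (j / 3)) (tripleCol p t (j % 3)) (by omega)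
  rw [h] at e1
  exact ⟨e1.1.symm.trans e2.1, e1.2.symm.trans e2.2⟩

/-- Each edge is stored once, with its smaller endpoint first. All nine ordered pairs of colours of
the triple are listed, so either order of the two colours is found. -/
theorem Final.mem_edgeList (hF : Final D H c s) (ht : t < D.S) {u v : ℕ} :
    s(u, v) ∈ edgeList 9 t s ↔ H.Adj u v ∧ c u ∈ triple D.p t ∧ c v ∈ triple D.p t := by
  have key : ∀ u v, u < v → (s(u, v) ∈ edgeList 9 t s ↔
      H.Adj u v ∧ c u ∈ triple D.p t ∧ c v ∈ triple D.p t) := by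
    intro u v huv
    rw [hF.edges t ht]
    simp only [List.mem_flatMap, List.mem_range, List.mem_map, edgeClass, List.mem_filter,
      decide_eq_true_eq, mem_triple, Prod.exists]
    constructor
    · rintro ⟨j, hj, u', v', ⟨ha, h, hH, hk⟩, e⟩
      obtain ⟨rfl, rfl⟩ := eq_of_sym2_mk_eq h huv e
      have hlt := Data.lt_of_adj (hF.le hH)
      have h1 := hF.col _ hlt.1
      have h2 := hF.col _ hlt.2
      obtain ⟨e1, e2⟩ := blockKey_eq D.p_pos h2 hk
      exact ⟨hH, ⟨h1.ne, j / 3, by omega, e1⟩, ⟨h2.ne, j % 3, by omega, e2⟩⟩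
    · rintro ⟨hH, ⟨-, x, hx, e1⟩, ⟨-, y, hy, e2⟩⟩
      refine ⟨3 * x + y, by omega, u, v, ⟨Data.mem_arcs.2 (hF.le hH), huv, hH, ?_⟩, rfl⟩
      rw [blockKey, show (3 * x + y) / 3 = x by omega, show (3 * x + y) % 3 = y by omega, e1, e2]
  rcases lt_trichotomy u v with h | rfl | h
  · exact key u v h
  · refine iff_of_false ?_ fun h => H.loopless.irrefl u h.1
    rw [hF.edges t ht]
    simp only [List.mem_flatMap, List.mem_range, List.mem_map, edgeClass, List.mem_filter,
      decide_eq_true_eq, Prod.exists]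
    rintro ⟨j, hj, u', v', ⟨ha, h, -, -⟩, e⟩
    rw [Sym2.eq_iff] at e
    omega
  · rw [Sym2.eq_swap, key v u h, H.adj_comm, and_comm (a := c v ∈ _)]

theorem Final.nodup_edgeList (hF : Final D H c s) (ht : t < D.S) : (edgeList 9 t s).Nodup := by
  rw [hF.edges t ht, List.nodup_flatMap]
  constructor
  · intro j _
    refine nodup_map_sym2 (Data.nodup_arcs.filter _) fun e he => ?_
    simp only [edgeClass, List.mem_filter, decide_eq_true_eq] at he
    exact he.2.1
  · refine List.Nodup.pairwise_of_forall_ne List.nodup_range fun j hj j' hj' hne e he he' => hne ?_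
    simp only [List.mem_range, List.mem_map, edgeClass, List.mem_filter, decide_eq_true_eq,
      Prod.exists] at hj hj' he he'
    obtain ⟨u, v, ⟨-, h, hH, hk⟩, rfl⟩ := he
    obtain ⟨u', v', ⟨-, h', -, hk'⟩, e⟩ := he'
    obtain ⟨rfl, rfl⟩ := eq_of_sym2_mk_eq h' h e
    have hlt := Data.lt_of_adj (hF.le hH)
    have h1 := hF.col _ hlt.1
    have h2 := hF.col _ hlt.2
    obtain ⟨e1, e2⟩ := blockKey_eq D.p_pos h2 hk
    obtain ⟨e1', e2'⟩ := blockKey_eq D.p_pos h2 hk'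
    have := tripleCol_inj (p := D.p) (t := t) (x := j / 3) (y := j' / 3) (by omega) (by omega)
      (by omega) (by omega)
    have := tripleCol_inj (p := D.p) (t := t) (x := j % 3) (y := j' % 3) (by omega) (by omega)
      (by omega) (by omega)
    omega

end lists

/-! ### The graphs encoded by a final state -/

/-- The set of edges that a final state holds. -/
def decodeMarks (n : ℕ) (s : State) : Set (Sym2 (Fin n)) :=
  {e | e.map Fin.val ∈ edgesAt s 3 4 0 (s.reg 1)}

/-- The `t`-th subgraph that a final state holds. -/
def decode {n : ℕ} (G : SimpleGraph (Fin n)) (t : ℕ) (s : State) : G.Subgraph where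
  verts := {v | (v : ℕ) ∈ vertexList 9 t s}
  Adj u v := G.Adj u v ∧ ((u : ℕ) ∈ vertexList 9 t s ∧ (v : ℕ) ∈ vertexList 9 t s) ∧
    s((u : ℕ), (v : ℕ)) ∈ edgeList 9 t s
  adj_sub h := h.1
  edge_vert h := h.2.1.1
  symm := ⟨fun _ _ h => ⟨h.1.symm, h.2.1.symm, by rw [Sym2.eq_swap]; exact h.2.2⟩⟩

/-- The data describe the graph `G`. -/
structure Describes {n : ℕ} (D : Data) (G : SimpleGraph (Fin n)) : Prop where
  n_eq : D.n = n
  adj_iff : ∀ u v : Fin n, D.G.Adj u v ↔ G.Adj u v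

section decode
variable {n : ℕ} {D : Data} {G : SimpleGraph (Fin n)} {H : SimpleGraph ℕ} {c : ℕ → ℕ} {s : State}
  {t : ℕ}

theorem Final.mem_decode_verts (hD : Describes D G) (hF : Final D H c s) (ht : t < D.S)
    {v : Fin n} : v ∈ (decode G t s).verts ↔ c v ∈ triple D.p t := by
  rw [decode, Set.mem_ofPred_eq, hF.mem_vertexList ht, and_iff_right]
  rw [hD.n_eq]
  exact v.2

theorem Final.decode_adj (hD : Describes D G) (hF : Final D H c s) (ht : t < D.S)
    {u v : Fin n} : (decode G t s).Adj u v ↔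
      H.Adj u v ∧ c u ∈ triple D.p t ∧ c v ∈ triple D.p t := by
  simp only [decode, hF.mem_edgeList ht, hF.mem_vertexList ht, hD.n_eq, u.2, v.2, true_and]
  exact ⟨fun h => h.2.2, fun h => ⟨(hD.adj_iff u v).1 (hF.le h.1), h.2, h⟩⟩

theorem Describes.exists_fin (hD : Describes D G) {u v : ℕ} (h : D.G.Adj u v) :
    ∃ u' v' : Fin n, (u' : ℕ) = u ∧ (v' : ℕ) = v := by
  have := Data.lt_of_adj h
  rw [hD.n_eq] at this
  exact ⟨⟨u, this.1⟩, ⟨v, this.2⟩, rfl, rfl⟩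

theorem mem_decodeMarks {m : ℕ → ℕ}
    (hm : edgesAt s 3 4 0 (s.reg 1) = (markedArcs D m (D.arcs D.n)).map fun e => s(e.1, e.2))
    {u v : Fin n} (huv : u < v) : s(u, v) ∈ decodeMarks n s ↔ Marked D m u v := by
  simp only [decodeMarks, Set.mem_ofPred_eq, Sym2.map_mk, hm, markedArcs, List.mem_map,
    List.mem_filter, decide_eq_true_eq, Prod.exists, Marked]
  constructor
  · rintro ⟨a, b, ⟨ha, h, h'⟩, e⟩
    obtain ⟨rfl, rfl⟩ := eq_of_sym2_mk_eq h huv e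
    exact ⟨Data.mem_arcs.1 ha, h'⟩
  · rintro ⟨ha, h⟩
    exact ⟨u, v, ⟨Data.mem_arcs.2 ha, huv, h⟩, rfl⟩

theorem Final.holdsOutput (hD : Describes D G) (hF : Final D H c s) {S : ℕ} (hS : D.S = S) :
    HoldsOutput 9 (decodeMarks n s) (fun i : Fin S => decode G i s) s := by
  subst hS
  obtain ⟨m, -, -, hm⟩ := hF.marks
  refine ⟨⟨?_, ?_⟩, hF.r2, fun i => ⟨⟨hF.nodup_vertexList i.2, ?_⟩, hF.nodup_edgeList i.2, ?_⟩⟩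
  · rw [hm]
    refine nodup_map_sym2 (Data.nodup_arcs.filter _) fun e he => ?_
    simp only [markedArcs, List.mem_filter, decide_eq_true_eq] at he
    exact he.2.1
  · intro e
    constructor
    · intro he
      have he' := he
      rw [hm] at he
      simp only [markedArcs, List.mem_map, List.mem_filter, Prod.exists] at he
      obtain ⟨u, v, ⟨ha, -⟩, rfl⟩ := he
      obtain ⟨u, v, rfl, rfl⟩ := hD.exists_fin (Data.mem_arcs.1 ha)
      exact ⟨s(u, v), he', rfl⟩
    · rintro ⟨e, he, rfl⟩
      exact he
  · intro u
    constructor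
    · intro hu
      have := ((hF.mem_vertexList i.2).1 hu).1
      rw [hD.n_eq] at this
      exact ⟨⟨u, this⟩, hu, rfl⟩
    · rintro ⟨u, hu, rfl⟩
      exact hu
  · intro e
    induction e with | _ u v =>
    constructor
    · intro he
      have := (hF.mem_edgeList i.2).1 he
      obtain ⟨u, v, rfl, rfl⟩ := hD.exists_fin (hF.le this.1)
      exact ⟨s(u, v), (hF.decode_adj hD i.2).2 this, rfl⟩
    · rintro ⟨e, he, e'⟩
      induction e with | _ a b =>
      rw [← e']
      exact he.2.2

theorem Final.edgeInTriangle_of_mem (hD : Describes D G) (hF : Final D H c s)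
    {e : Sym2 (Fin n)} (he : e ∈ decodeMarks n s) : EdgeInTriangle G e := by
  obtain ⟨m, hok, -, hm⟩ := hF.marks
  have he' := he
  rw [decodeMarks, Set.mem_ofPred_eq, hm] at he
  induction e with | _ u v =>
  have key : ∀ u v : Fin n, u < v → s(u, v) ∈ decodeMarks n s → EdgeInTriangle G s(u, v) := by
    intro u v huv h
    obtain ⟨x, h1, h2, h3⟩ := hok _ _ ((mem_decodeMarks hm huv).1 h)
    obtain ⟨_, x, -, rfl⟩ := hD.exists_fin h2
    exact ⟨u, v, x, rfl, (hD.adj_iff _ _).1 h1, (hD.adj_iff _ _).1 h2, (hD.adj_iff _ _).1 h3⟩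
  rcases lt_trichotomy u v with h | rfl | h
  · exact key u v h he'
  · simp only [Sym2.map_mk, markedArcs, List.mem_map, List.mem_filter, decide_eq_true_eq,
      Prod.exists] at he
    obtain ⟨a, b, ⟨-, h, -⟩, e⟩ := he
    rw [Sym2.eq_iff] at e
    omega
  · rw [Sym2.eq_swap] at he' ⊢
    exact key v u h he'

/-- A triangle that is not marked survives in `H`, and the triple formed by the colours of its
vertices contains it. This triple exists among the `S` subgraphs because `p³ ≤ S`. -/
theorem Final.complete (hD : Describes D G) (hF : Final D H c s) {S : ℕ} (hS : D.S = S)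
    {e : Sym2 (Fin n)} (he : EdgeInTriangle G e) :
    e ∈ decodeMarks n s ∨ ∃ i : Fin S, EdgeInTriangle (decode G i s).spanningCoe e := by
  subst hS
  obtain ⟨m, -, hc, hm⟩ := hF.marks
  obtain ⟨u, v, x, rfl, h1, h2, h3⟩ := he
  have hu : (u : ℕ) < D.n := by rw [hD.n_eq]; exact u.2
  have hv : (v : ℕ) < D.n := by rw [hD.n_eq]; exact v.2
  have hx : (x : ℕ) < D.n := by rw [hD.n_eq]; exact x.2
  rcases hc u v x ((hD.adj_iff _ _).2 h1) ((hD.adj_iff _ _).2 h2) ((hD.adj_iff _ _).2 h3) with h | h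
  · left
    rcases lt_trichotomy u v with huv | rfl | huv
    · exact (mem_decodeMarks hm huv).2 h.1
    · exact absurd h1 (G.loopless.irrefl u)
    · rw [Sym2.eq_swap]
      exact (mem_decodeMarks hm huv).2 h.2.1
  · right
    obtain ⟨ht, e1, e2, e3⟩ := triple_encode (hF.col _ hu) (hF.col _ hv) (hF.col _ hx)
    have ht := ht.trans_le D.ppp
    refine ⟨⟨_, ht⟩, u, v, x, rfl, ?_, ?_, ?_⟩
    · exact (hF.decode_adj hD ht).2 ⟨h.1, e1, e2⟩
    · exact (hF.decode_adj hD ht).2 ⟨h.2.1, e2, e3⟩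
    · exact (hF.decode_adj hD ht).2 ⟨h.2.2, e1, e3⟩

theorem ncard_le_of_val_subset {A : Set (Fin n)} {p M : ℕ} {B : Finset ℕ} {T : Finset ℕ}
    (hT : T.card ≤ 3) (hTp : ∀ b ∈ T, b < p) (hA : ∀ v ∈ A, (v : ℕ) ∈ B ∧ c v ∈ T)
    (hM : ∀ b < p, (B.filter (c · = b)).card ≤ M) : A.ncard ≤ 3 * M := by
  have h1 : (Fin.val '' A).ncard = A.ncard := Set.ncard_image_of_injective _ Fin.val_injective
  have h2 : Fin.val '' A ⊆ (T.biUnion fun b => B.filter (c · = b) : Finset ℕ) := by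
    rintro _ ⟨v, hv, rfl⟩
    rw [Finset.mem_coe, Finset.mem_biUnion]
    exact ⟨c v, (hA v hv).2, Finset.mem_filter.2 ⟨(hA v hv).1, rfl⟩⟩
  rw [← h1]
  refine (Set.ncard_le_ncard h2 (Finset.finite_toSet _)).trans ?_
  rw [Set.ncard_coe_finset]
  refine (Finset.card_biUnion_le_card_mul _ _ M fun b hb => hM b (hTp b hb)).trans ?_
  exact Nat.mul_le_mul_right _ hT

theorem triple_lt {p : ℕ} (hp : 1 ≤ p) {b : ℕ} (h : b ∈ triple p t) : b < p := by
  obtain ⟨hb, x, -, rfl⟩ := mem_triple.1 h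
  exact lt_of_le_of_ne (tripleCol_le hp) hb

theorem Final.ncard_verts_le (hD : Describes D G) (hF : Final D H c s) (ht : t < D.S) {M₁ M₂ : ℕ}
    (hs : Spread D c M₁ M₂) : (decode G t s).verts.ncard ≤ 3 * M₁ := by
  refine ncard_le_of_val_subset (c := c) (p := D.p) (B := Finset.range D.n) (card_triple D.p t)
    (fun b => triple_lt D.p_pos) (fun v hv => ⟨?_, (hF.mem_decode_verts hD ht).1 hv⟩)
    fun b hb => (hs b hb).1
  rw [Finset.mem_range, hD.n_eq]
  exact v.2

theorem Final.ncard_neighborSet_le (hD : Describes D G) (hF : Final D H c s) (ht : t < D.S)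
    {M₁ M₂ : ℕ} (hs : Spread D c M₁ M₂) (v : Fin n) :
    ((decode G t s).neighborSet v).ncard ≤ 3 * M₂ := by
  have hv : (v : ℕ) < D.n := by rw [hD.n_eq]; exact v.2
  refine ncard_le_of_val_subset (c := c) (p := D.p) (B := D.nbrset D.G v) (card_triple D.p t)
    (fun b => triple_lt D.p_pos) (fun u hu => ?_) fun b hb => (hs b hb).2 v hv
  have := (hF.decode_adj hD ht).1 hu
  refine ⟨?_, this.2.2⟩
  rw [Data.nbrset, Finset.mem_filter, Finset.mem_range, hD.n_eq]
  exact ⟨u.2, hF.le this.1⟩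

theorem Final.numCycles_le (hD : Describes D G) (hF : Final D H c s) (ht : t < D.S) (k : ℕ) :
    numCycles k (decode G t s).spanningCoe ≤
      ∑ k' ∈ Finset.Icc 4 k, (D.cycles H (fun x => c x ∈ triple D.p t) k').card := by
  refine Finset.sum_le_sum fun k' hk' => ?_
  refine Data.copyCount_cycleGraph_le hF.le (Finset.mem_Icc.1 hk').1 fun u v h => ?_
  have := (hF.decode_adj hD ht).1 h
  exact ⟨this.1, this.2.1⟩

end decode
-- Amortized cost, and transfer from the abstract process to the machine
theorem exists_mulSpec {τ : ℝ} (h : MatMulInTime τ) :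
    ∃ (mm : Cmd) (d : ℕ) (C : ℝ), 0 ≤ C ∧ ∀ D : Data, (D.r + 2) ^ d ≤ 2 ^ D.w →
      MulSpec D mm ⌊C * (D.r : ℝ) ^ τ⌋₊ := by
  obtain ⟨P, d, C, h⟩ := h
  refine ⟨P.shift 100, d, max C 0, le_max_right _ _, fun D hd => ⟨fun x hx => P.writes_shift hx,
    fun x hx => P.stores_shift hx, fun A B s hA hB hs h0 h1 h2 => ?_⟩⟩
  obtain ⟨T, hT, hh⟩ := h D.r D.r_pos D.w hd (Matrix.of fun i j => A i j)
    (Matrix.of fun i j => B i j) (fun i j => hA i j) (fun i j => hB i j) (s.shift 100)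
    ⟨fun x => hs.1 _, fun a i => hs.2 _ _⟩ h0 (fun i j => h1 i i.2 j j.2) fun i j => h2 i i.2 j j.2
  refine Hoare.mono hh.shift.hoare (Nat.le_floor (hT.trans ?_)) fun s' h' i hi j hj => ?_
  · gcongr
    exact le_max_left _ _
  · have := h' ⟨i, hi⟩ ⟨j, hj⟩
    simp only [Matrix.mul_apply, Matrix.of_apply] at this
    rw [Finset.sum_range]
    exact this

/-- `K` is a price per deleted arc. Each part of the cost is at most a fixed multiple of the weight
`W`, because there are at most `W / θ` dense vertices and `W ≥ θ r`; and at least `W` arcs are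
deleted. -/
theorem heavyCost_add_le {D : Data} {H : SimpleGraph ℕ} {v Tm K : ℕ} (hH : H ≤ D.G) (hv : v < D.n)
    (hK : 180 * ((D.r : ℝ) * D.L / D.θ) + 2 / ((D.θ : ℝ) * D.r) * ((D.r / D.L + 1) *
      (700 * ((D.r : ℝ) * D.r) + 3 * Tm)) + 70 * ((D.r : ℝ) / D.θ) ≤ K)
    (hw : ¬ D.weight H v < D.θ * D.r) :
    D.heavyCost Tm H v + K * D.numArcs (D.del H v) ≤ K * D.numArcs H := by
  have h1 : (0 : ℝ) < D.θ := by exact_mod_cast D.θ_pos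
  have h2 : (0 : ℝ) < D.r := by exact_mod_cast D.r_pos
  have h3 : (0 : ℝ) < D.L := by exact_mod_cast D.L_pos
  obtain ⟨W, hW⟩ : ∃ W : ℝ, W = (D.weight H v : ℕ) := ⟨_, rfl⟩
  have hWr : (D.θ : ℝ) * D.r ≤ W := by
    rw [hW]
    exact_mod_cast not_lt.1 hw
  have hP : ((D.popular H v D.θ).length : ℝ) ≤ W / D.θ := by
    rw [le_div_iff₀ h1, hW]
    exact_mod_cast Data.length_popular_mul_le D.θ
  have hL : ((D.popular H v D.L).length : ℝ) ≤ D.r * D.r / D.L := by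
    rw [le_div_iff₀ h3]
    exact_mod_cast (Data.length_popular_mul_le D.L).trans (Data.popular_sum_le hH hv D.L)
  have hW0 : 0 ≤ W := by rw [hW]; positivity
  have hc : (D.heavyCost Tm H v : ℝ) ≤ K * W := by
    refine le_trans ?_ (mul_le_mul_of_nonneg_right hK hW0)
    rw [Data.heavyCost]
    push_cast
    have a1 : ((D.popular H v D.θ).length : ℝ) * (180 * (D.r * D.L)) ≤
        180 * ((D.r : ℝ) * D.L / D.θ) * W := by
      calc _ ≤ W / D.θ * (180 * ((D.r : ℝ) * D.L)) := by gcongr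
        _ = _ := by ring
    -- The incomplete block is absorbed since `W / (θ r) ≥ 1`. This is where the threshold for a
    -- heavy step matters.
    have a2 : ((((D.popular H v D.θ).length / D.r : ℕ) : ℝ) + 1) ≤ 2 / ((D.θ : ℝ) * D.r) * W := by
      calc _ ≤ W / D.θ / D.r + W / (D.θ * D.r) := by
            gcongr
            · exact Nat.cast_div_le.trans (by gcongr)
            · rwa [le_div_iff₀ (by positivity), one_mul]
        _ = _ := by
            field_simp
            ring
    have a3 : ((((D.popular H v D.L).length / D.r : ℕ) : ℝ) + 1) ≤ D.r / D.L + 1 := by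
      gcongr
      refine Nat.cast_div_le.trans ?_
      calc _ ≤ (D.r : ℝ) * D.r / D.L / D.r := by gcongr
        _ = _ := by field_simp
    have a4 : (70 : ℝ) * (D.r * D.r) ≤ 70 * ((D.r : ℝ) / D.θ) * W := by
      calc (70 : ℝ) * (D.r * D.r) = 70 * ((D.r : ℝ) / D.θ) * (D.θ * D.r) := by field_simp
        _ ≤ _ := by gcongr
    calc _ ≤ 180 * ((D.r : ℝ) * D.L / D.θ) * W + (2 / ((D.θ : ℝ) * D.r) * W) *
          ((D.r / D.L + 1) * (700 * ((D.r : ℝ) * D.r) + 3 * Tm)) +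
          70 * ((D.r : ℝ) / D.θ) * W := by gcongr
      _ = _ := by ring
  have hc' : D.heavyCost Tm H v ≤ K * D.weight H v := by
    rw [hW] at hc
    exact_mod_cast hc
  calc _ ≤ K * D.weight H v + K * D.numArcs (D.del H v) := by gcongr
    _ = K * (D.weight H v + D.numArcs (D.del H v)) := by ring
    _ ≤ _ := Nat.mul_le_mul_left _ (Data.weight_add_numArcs_del_le hH hv)

theorem prob_eq_mean (μ : PMF Config) (Q : State → Prop) :
    prob μ Q = mean μ fun c => if Q c.2 then 1 else 0 := by
  rw [prob, PMF.toOuterMeasure_apply, mean]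
  refine tsum_congr fun c => ?_
  by_cases h : Q c.2 <;> simp [Set.indicator, h]

theorem expect_eq_mean (μ : PMF Config) (f : State → ℕ) :
    expect μ f = mean μ fun c => (f c.2 : ℝ≥0∞) := rfl

section transfer
variable {w T : ℕ} {ι : Type} {P : Cmd} {s : State} {μ : PMF ι} {Q : ι → State → Prop}

theorem Spec.haltsWith (h : Spec w P s T μ Q) {R : State → Prop} (hR : ∀ i s', Q i s' → R s') :
    HaltsWith w T P s R := by
  obtain ⟨κ, -, h2, h3⟩ := h.run_eq
  intro c hc
  rw [h3, PMF.mem_support_map_iff] at hc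
  obtain ⟨x, hx, rfl⟩ := hc
  exact ⟨rfl, hR _ _ (h2 x hx)⟩

theorem Spec.expect_le (h : Spec w P s T μ Q) {f : State → ℕ} {g : ι → ℝ≥0∞}
    (hf : ∀ i s', Q i s' → (f s' : ℝ≥0∞) ≤ g i) : expect (run w T ([P], s)) f ≤ mean μ g := by
  obtain ⟨κ, h1, h2, h3⟩ := h.run_eq
  rw [h3, expect_eq_mean, mean_map, ← h1, mean_map]
  exact mean_mono fun x hx => hf _ _ (h2 x hx)

/-- Under the coupling the event `R` of the machine contains the event `A` of the process, so only
the probability that `A` fails has to be bounded. -/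
theorem Spec.le_prob (h : Spec w P s T μ Q) {A : ι → Prop} {R : State → Prop}
    (hR : ∀ i s', Q i s' → A i → R s') {y : ℝ} (hy : 0 ≤ y)
    (hA : mean μ (fun i => if A i then 0 else 1) ≤ ENNReal.ofReal y) :
    ENNReal.ofReal (1 - y) ≤ prob (run w T ([P], s)) R := by
  obtain ⟨κ, h1, h2, h3⟩ := h.run_eq
  rw [ENNReal.ofReal_sub _ hy, ENNReal.ofReal_one, tsub_le_iff_right, h3, prob_eq_mean, mean_map]
  rw [← h1, mean_map] at hA
  refine le_trans ?_ (add_le_add le_rfl hA)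
  rw [← mean_add]
  refine (mean_const (μ := κ) (1 : ℝ≥0∞)).ge.trans (mean_mono fun x hx => ?_)
  by_cases ha : A x.1
  · simp [hR _ _ (h2 x hx) ha]
  · simp [ha]

end transfer

/-! ### Well-formedness of the input -/

section input
variable {n : ℕ} {G : SimpleGraph (Fin n)} {s : State} {exps : List ℝ}

/-- The list of `u` has exactly as many positions as `u` has neighbours, and every neighbour occurs.
Counting therefore excludes repetitions and entries that are not neighbours, among them words that
are not vertices at all. -/
theorem HoldsInput.image_eq (h : HoldsInput exps G s) (u : Fin n) :
    ((Finset.Ico (s.mem 0 u) (s.mem 0 (u + 1))).image (s.mem 1) : Set ℕ) =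
        Fin.val '' G.neighborSet u ∧
      ((Finset.Ico (s.mem 0 u) (s.mem 0 (u + 1))).image (s.mem 1)).card =
        (Finset.Ico (s.mem 0 u) (s.mem 0 (u + 1))).card := by
  obtain ⟨-, -, h3, h4, -⟩ := h
  have hsub : Fin.val '' G.neighborSet u ⊆
      ((Finset.Ico (s.mem 0 u) (s.mem 0 (u + 1))).image (s.mem 1) : Finset ℕ) := by
    rintro _ ⟨v, hv, rfl⟩
    obtain ⟨t, ht⟩ := (h4 u v).1 hv
    exact Finset.mem_coe.2 (Finset.mem_image.2 ⟨t, Finset.mem_Ico.2 ⟨ht.1, ht.2.1⟩, ht.2.2⟩)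
  have hcard : (Fin.val '' G.neighborSet u).ncard =
      (Finset.Ico (s.mem 0 u) (s.mem 0 (u + 1))).card := by
    rw [Set.ncard_image_of_injective _ Fin.val_injective, Nat.card_Ico, h3 u,
      Nat.add_sub_cancel_left]
  have hle := Set.ncard_le_ncard hsub (Finset.finite_toSet _)
  rw [Set.ncard_coe_finset, hcard] at hle
  have hc := le_antisymm Finset.card_image_le hle
  refine ⟨?_, hc⟩
  refine (Set.eq_of_subset_of_ncard_le hsub ?_ (Finset.finite_toSet _)).symm
  rw [Set.ncard_coe_finset, hcard, hc]

theorem HoldsInput.adj (h : HoldsInput exps G s) (u v : ℕ) :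
    (G.map Fin.valEmbedding).Adj u v ↔
      u < n ∧ ∃ t, s.mem 0 u ≤ t ∧ t < s.mem 0 (u + 1) ∧ s.mem 1 t = v := by
  rw [SimpleGraph.map_adj]
  constructor
  · rintro ⟨a, b, hab, rfl, rfl⟩
    exact ⟨a.2, (h.2.2.2.1 a b).1 hab⟩
  · rintro ⟨hu, t, h1, h2, rfl⟩
    have : s.mem 1 t ∈ Fin.val '' G.neighborSet ⟨u, hu⟩ := by
      rw [← (h.image_eq ⟨u, hu⟩).1]
      exact Finset.mem_coe.2 (Finset.mem_image.2 ⟨t, Finset.mem_Ico.2 ⟨h1, h2⟩, rfl⟩)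
    obtain ⟨v, hv, e⟩ := this
    exact ⟨⟨u, hu⟩, v, hv, rfl, e⟩

theorem HoldsInput.inj (h : HoldsInput exps G s) {u : ℕ} (hu : u < n) {t t' : ℕ}
    (h1 : s.mem 0 u ≤ t) (h2 : t < s.mem 0 (u + 1)) (h1' : s.mem 0 u ≤ t')
    (h2' : t' < s.mem 0 (u + 1)) (e : s.mem 1 t = s.mem 1 t') : t = t' :=
  Finset.card_image_iff.1 (h.image_eq ⟨u, hu⟩).2 (Finset.mem_coe.2 (Finset.mem_Ico.2 ⟨h1, h2⟩))
    (Finset.mem_coe.2 (Finset.mem_Ico.2 ⟨h1', h2'⟩)) e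

end input
-- Exponents: running time, number of cycles, sizes of the subgraphs
/-- The sizes of the parameters in terms of the number of vertices. -/
structure Sizes (D : Data) (α ε ω : ℝ) : Prop where
  p_le : (D.p : ℝ) ≤ (D.n : ℝ) ^ (1 / 2 - α)
  le_p : (D.n : ℝ) ^ (1 / 2 - α) ≤ 2 * D.p
  r_le : (D.r : ℝ) ≤ (D.n : ℝ) ^ (1 / 2 : ℝ)
  R_le : (D.R : ℝ) ≤ (D.n : ℝ) ^ (1 - ε)
  le_R : (D.n : ℝ) ^ (1 - ε) ≤ 2 * D.R
  θ_le : (D.θ : ℝ) ≤ (D.n : ℝ) ^ ((ω - 1) / 4 + ε)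
  le_θ : (D.n : ℝ) ^ ((ω - 1) / 4 + ε) ≤ 2 * D.θ
  L_le : (D.L : ℝ) ≤ (D.n : ℝ) ^ ((ω - 1) / 4)
  le_L : (D.n : ℝ) ^ ((ω - 1) / 4) ≤ 2 * D.L
  S_le : (D.S : ℝ) ≤ (D.n : ℝ) ^ (3 / 2 - 3 * α)

theorem inv_le_of_rpow_le {x e y : ℝ} (hx : 0 < x) (h : x ^ e ≤ 2 * y) :
    y⁻¹ ≤ 2 * x ^ (-e) := by
  have h1 := Real.rpow_pos_of_pos hx e
  have hy : 0 < y := by linarith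
  rw [Real.rpow_neg hx.le, ← div_eq_mul_inv, inv_eq_one_div, div_le_div_iff₀ hy h1]
  linarith

section sizes
variable {D : Data} {α ε ω : ℝ}

theorem Data.one_le_n (D : Data) : (1 : ℝ) ≤ D.n := by exact_mod_cast D.n_pos

/-- The total cost of the heavy steps. -/
theorem Sizes.cost_le (h : Sizes D α ε ω) (hω : 2 ≤ ω) (hω' : ω ≤ 3) {C Tm : ℝ}
    (hC : 0 ≤ C) (hTm : Tm ≤ C * (D.r : ℝ) ^ ω) :
    (180 * ((D.r : ℝ) * D.L / D.θ) + 2 / ((D.θ : ℝ) * D.r) * ((D.r / D.L + 1) *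
      (700 * ((D.r : ℝ) * D.r) + 3 * Tm)) + 70 * ((D.r : ℝ) / D.θ)) * (D.n * D.r) ≤
      (500 + 12 * (700 + 3 * C)) * (D.n : ℝ) ^ (2 - ε) := by
  have hx1 := D.one_le_n
  have hθ := inv_le_of_rpow_le (by linarith) h.le_θ
  have hL := inv_le_of_rpow_le (by linarith) h.le_L
  have hr := h.r_le
  have hL' := h.L_le
  have hr0 : (0 : ℝ) < D.r := by exact_mod_cast D.r_pos
  have hθ0 : (0 : ℝ) < D.θ := by exact_mod_cast D.θ_pos
  have hL0 : (0 : ℝ) < D.L := by exact_mod_cast D.L_pos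
  obtain ⟨x, hx⟩ : ∃ x : ℝ, x = D.n := ⟨_, rfl⟩
  rw [← hx] at hx1 hθ hL hr hL' ⊢
  have hx0 : 0 < x := by linarith
  -- Bucket search: `L / θ` is of order `n^(-ε)` and `r * n * r` is at most `n²`.
  have t1 : 180 * ((D.r : ℝ) * D.L / D.θ) * (x * D.r) ≤ 360 * x ^ (2 - ε) := by
    calc 180 * ((D.r : ℝ) * D.L / D.θ) * (x * D.r)
        = 180 * ((D.r : ℝ) * D.L * (D.θ : ℝ)⁻¹ * (x * D.r)) := by rw [div_eq_mul_inv]; ring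
      _ ≤ 180 * (x ^ (1 / 2 : ℝ) * x ^ ((ω - 1) / 4) * (2 * x ^ (-((ω - 1) / 4 + ε))) *
          (x * x ^ (1 / 2 : ℝ))) := by gcongr
      _ = 360 * x ^ (2 - ε) := by
          rw [show 2 - ε = 1 / 2 + (ω - 1) / 4 + -((ω - 1) / 4 + ε) + 1 + 1 / 2 by ring,
            Real.rpow_add hx0, Real.rpow_add hx0, Real.rpow_add hx0, Real.rpow_add hx0,
            Real.rpow_one]
          ring
  -- Matrix products: the exponent is `(3 - ω)/4 + ω/2 + 1` minus that of `θ`, again `2 - ε`.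
  -- Equality of these two exponents is what dictates `L = n^((ω-1)/4)`; the summand `1` next to `r
  -- / L` is absorbed because `ω ≤ 3`.
  have t2 : 2 / ((D.θ : ℝ) * D.r) * ((D.r / D.L + 1) * (700 * ((D.r : ℝ) * D.r) + 3 * Tm)) *
      (x * D.r) ≤ 12 * (700 + 3 * C) * x ^ (2 - ε) := by
    have a1 : (D.r : ℝ) * (D.L : ℝ)⁻¹ + 1 ≤ 3 * x ^ ((3 - ω) / 4) := by
      have : (1 : ℝ) ≤ x ^ ((3 - ω) / 4) := Real.one_le_rpow hx1 (by linarith)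
      calc (D.r : ℝ) * (D.L : ℝ)⁻¹ + 1
          ≤ x ^ (1 / 2 : ℝ) * (2 * x ^ (-((ω - 1) / 4))) + x ^ ((3 - ω) / 4) := by gcongr
        _ = 3 * x ^ ((3 - ω) / 4) := by
            rw [show (3 - ω) / 4 = 1 / 2 + -((ω - 1) / 4) by ring, Real.rpow_add hx0]
            ring
    have a2 : 700 * ((D.r : ℝ) * D.r) + 3 * Tm ≤ (700 + 3 * C) * x ^ (ω / 2) := by
      have b1 : (D.r : ℝ) * D.r ≤ x ^ (ω / 2) := by
        calc (D.r : ℝ) * D.r ≤ x ^ (1 / 2 : ℝ) * x ^ (1 / 2 : ℝ) := by gcongr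
          _ = x ^ (1 / 2 + 1 / 2 : ℝ) := by rw [Real.rpow_add hx0]
          _ ≤ _ := Real.rpow_le_rpow_of_exponent_le hx1 (by linarith)
      have b2 : Tm ≤ C * x ^ (ω / 2) := by
        calc Tm ≤ C * (D.r : ℝ) ^ ω := hTm
          _ ≤ C * (x ^ (1 / 2 : ℝ)) ^ ω := by gcongr
          _ = _ := by rw [← Real.rpow_mul hx0.le, show 1 / 2 * ω = ω / 2 by ring]
      linarith
    calc _ = 2 * (D.θ : ℝ)⁻¹ * ((D.r * (D.L : ℝ)⁻¹ + 1) * (700 * ((D.r : ℝ) * D.r) + 3 * Tm)) *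
          x := by
          field_simp
      _ ≤ 2 * (D.θ : ℝ)⁻¹ * ((D.r * (D.L : ℝ)⁻¹ + 1) * ((700 + 3 * C) * x ^ (ω / 2))) * x := by
          gcongr
      _ ≤ 2 * (2 * x ^ (-((ω - 1) / 4 + ε))) * (3 * x ^ ((3 - ω) / 4) *
          ((700 + 3 * C) * x ^ (ω / 2))) * x := by gcongr
      _ = _ := by
          rw [show 2 - ε = -((ω - 1) / 4 + ε) + (3 - ω) / 4 + ω / 2 + 1 by ring,
            Real.rpow_add hx0, Real.rpow_add hx0, Real.rpow_add hx0, Real.rpow_one]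
          ring
  have t3 : 70 * ((D.r : ℝ) / D.θ) * (x * D.r) ≤ 140 * x ^ (2 - ε) := by
    calc 70 * ((D.r : ℝ) / D.θ) * (x * D.r) = 70 * ((D.r : ℝ) * (D.θ : ℝ)⁻¹ * (x * D.r)) := by
          rw [div_eq_mul_inv]; ring
      _ ≤ 70 * (x ^ (1 / 2 : ℝ) * (2 * x ^ (-((ω - 1) / 4 + ε))) * (x * x ^ (1 / 2 : ℝ))) := by
          gcongr
      _ = 140 * x ^ (1 / 2 + -((ω - 1) / 4 + ε) + 1 + 1 / 2) := by
          rw [Real.rpow_add hx0, Real.rpow_add hx0, Real.rpow_add hx0, Real.rpow_one]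
          ring
      _ ≤ _ := by
          gcongr
          linarith
  linarith

/-- The running time. -/
theorem Sizes.time_le (h : Sizes D α ε ω) (hω : 2 ≤ ω) (hω' : ω ≤ 3) (hα : 0 < α)
    (hε : 0 < ε) (hε' : ε < 1 / 4) {C : ℝ} (hC : 0 ≤ C) {Tm K : ℕ}
    (hTm : (Tm : ℝ) ≤ C * (D.r : ℝ) ^ ω)
    (hK : (K : ℝ) ≤ 180 * ((D.r : ℝ) * D.L / D.θ) + 2 / ((D.θ : ℝ) * D.r) * ((D.r / D.L + 1) *
      (700 * ((D.r : ℝ) * D.r) + 3 * Tm)) + 70 * ((D.r : ℝ) / D.θ) + 1) :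
    ((D.R * (D.n * 370 + 5) + K * D.numArcs D.G + D.n * (D.r * 116 + 60) +
      (D.p + 1) * (D.p + 1) * 8 + D.S * 257 + 100 : ℕ) : ℝ) ≤
      (2000 + 12 * (700 + 3 * C)) * (D.n : ℝ) ^ (2 - ε) := by
  have hc := h.cost_le hω hω' hC hTm
  have hna : (D.numArcs D.G : ℝ) ≤ D.n * D.r := by exact_mod_cast Data.numArcs_le le_rfl
  have hp1 : (1 : ℝ) ≤ D.p := by exact_mod_cast D.p_pos
  have hr1 : (1 : ℝ) ≤ D.r := by exact_mod_cast D.r_pos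
  have hx1 := D.one_le_n
  have hx0 : (0 : ℝ) < D.n := by linarith
  have hpow : ∀ {e : ℝ}, e ≤ 2 - ε → (D.n : ℝ) ^ e ≤ (D.n : ℝ) ^ (2 - ε) := fun he =>
    Real.rpow_le_rpow_of_exponent_le hx1 he
  have hnr : (D.n : ℝ) * D.r ≤ (D.n : ℝ) ^ (2 - ε) := by
    calc (D.n : ℝ) * D.r ≤ D.n * (D.n : ℝ) ^ (1 / 2 : ℝ) := by gcongr; exact h.r_le
      _ = (D.n : ℝ) ^ (1 + 1 / 2 : ℝ) := by rw [Real.rpow_add hx0, Real.rpow_one]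
      _ ≤ _ := hpow (by linarith)
  have hRn : (D.R : ℝ) * D.n ≤ (D.n : ℝ) ^ (2 - ε) := by
    calc (D.R : ℝ) * D.n ≤ (D.n : ℝ) ^ (1 - ε) * D.n := by gcongr; exact h.R_le
      _ = _ := by
        rw [show 2 - ε = 1 - ε + 1 by ring, Real.rpow_add hx0, Real.rpow_one]
  have hpp : (D.p : ℝ) * D.p ≤ (D.n : ℝ) ^ (2 - ε) := by
    calc (D.p : ℝ) * D.p ≤ (D.n : ℝ) ^ (1 / 2 - α) * (D.n : ℝ) ^ (1 / 2 - α) := by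
          gcongr <;> exact h.p_le
      _ = (D.n : ℝ) ^ (1 / 2 - α + (1 / 2 - α)) := by rw [Real.rpow_add hx0]
      _ ≤ _ := hpow (by linarith)
  have hS : (D.S : ℝ) ≤ (D.n : ℝ) ^ (2 - ε) := h.S_le.trans (hpow (by linarith))
  have h1 : (1 : ℝ) ≤ (D.n : ℝ) ^ (2 - ε) := Real.one_le_rpow hx1 (by linarith)
  have hKn : (K : ℝ) * D.numArcs D.G ≤ (501 + 12 * (700 + 3 * C)) * (D.n : ℝ) ^ (2 - ε) := by
    calc (K : ℝ) * D.numArcs D.G ≤ K * (D.n * D.r) := by gcongr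
      _ ≤ (180 * ((D.r : ℝ) * D.L / D.θ) + 2 / ((D.θ : ℝ) * D.r) * ((D.r / D.L + 1) *
        (700 * ((D.r : ℝ) * D.r) + 3 * Tm)) + 70 * ((D.r : ℝ) / D.θ) + 1) * (D.n * D.r) := by
        gcongr
      _ ≤ _ := by linarith
  have hR5 : (D.R : ℝ) ≤ D.R * D.n := le_mul_of_one_le_right (by positivity) hx1
  have hn : (D.n : ℝ) ≤ D.n * D.r := le_mul_of_one_le_right (by positivity) hr1
  have hp : (D.p : ℝ) ≤ D.p * D.p := le_mul_of_one_le_right (by positivity) hp1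
  push_cast
  nlinarith

theorem le_ofReal_of_natCast_mul_le {A B : ℕ} {m : ℝ≥0∞} {y : ℝ} (hA : 0 < A)
    (h : (A : ℝ≥0∞) * m ≤ B) (hB : (B : ℝ) ≤ A * y) : m ≤ ENNReal.ofReal y := by
  have hA' : (A : ℝ≥0∞) ≠ 0 := by exact_mod_cast hA.ne'
  refine (ENNReal.mul_le_mul_iff_right hA' (ENNReal.natCast_ne_top A)).1 (h.trans ?_)
  rw [← ENNReal.ofReal_natCast A, ← ENNReal.ofReal_mul (Nat.cast_nonneg A),
    ← ENNReal.ofReal_natCast B]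
  exact ENNReal.ofReal_le_ofReal hB

/-- The expected number of cycles in one of the subgraphs. -/
theorem Sizes.mean_cycles_le (h : Sizes D α ε ω) (hω : 2 ≤ ω) (hε : 0 < ε) {k : ℕ} (hk : 4 ≤ k)
    {A : Finset ℕ} (hA : A.card ≤ 3) (c : ℕ → ℕ) :
    mean (D.law c) (fun i => ((D.cycles i.1 (fun x => i.2 x ∈ A) k).card : ℝ≥0∞)) ≤
      ENNReal.ofReal (6 ^ (k + 1) * (D.n : ℝ) ^ ((ω - 1) / 4 + k * α + ε)) := by
  have hx1 := D.one_le_n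
  have hx0 : (0 : ℝ) < D.n := by linarith
  have hR0 : (0 : ℝ) < D.R := by
    have := Real.rpow_pos_of_pos hx0 (1 - ε)
    linarith [h.le_R]
  have hR1 : 0 < D.R := by exact_mod_cast hR0
  have hp1 := D.p_pos
  have hr1 := D.r_pos
  have hθ1 := D.θ_pos
  refine le_ofReal_of_natCast_mul_le (by positivity) (mean_law_cycles_le hk hA c) ?_
  obtain ⟨t, rfl⟩ : ∃ t, k = t + 4 := ⟨k - 4, by omega⟩
  rw [Nat.add_sub_cancel]
  have hp := h.le_p
  have hr := h.r_le
  have hR := h.le_R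
  have hθ := h.le_θ
  have hθ' := h.θ_le
  push_cast
  obtain ⟨x, hx⟩ : ∃ x : ℝ, x = D.n := ⟨_, rfl⟩
  rw [← hx] at hx1 hx0 hp hr hR hθ hθ' ⊢
  have e1 : ∀ m : ℕ, (D.r : ℝ) ^ m ≤ x ^ (1 / 2 * (m : ℝ)) := fun m => by
    rw [Real.rpow_mul_natCast hx0.le]
    gcongr
  have e2 : x ^ ((1 / 2 - α) * ((t + 4 : ℕ) : ℝ)) ≤ 2 ^ (t + 4) * (D.p : ℝ) ^ (t + 4) := by
    rw [Real.rpow_mul_natCast hx0.le, ← mul_pow]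
    gcongr
  set E := (ω - 1) / 4 + ((t : ℝ) + 4) * α + ε with hE
  -- The contribution of vertices that are not bad determines the exponent of the theorem.
  have b1 : x * D.θ * (D.r : ℝ) ^ (t + 2) ≤ 2 ^ (t + 4) * (D.p : ℝ) ^ (t + 4) * x ^ E := by
    calc x * D.θ * (D.r : ℝ) ^ (t + 2)
        ≤ x * x ^ ((ω - 1) / 4 + ε) * x ^ (1 / 2 * ((t + 2 : ℕ) : ℝ)) := by
          gcongr
          exact e1 _
      _ = x ^ ((1 / 2 - α) * ((t + 4 : ℕ) : ℝ)) * x ^ E := by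
          rw [← Real.rpow_add hx0, ← Real.rpow_one_add' hx0.le, ← Real.rpow_add hx0, hE]
          · congr 1
            push_cast
            ring
          · linarith
      _ ≤ _ := by gcongr
  -- The contribution of bad vertices is dominated because `1/2 - (ω-1)/4 ≤ (ω-1)/4`, that is, by `2
  -- ≤ ω`.
  have b2 : x * x * (D.r : ℝ) ^ (t + 3) ≤
      2 ^ (t + 4) * (D.p : ℝ) ^ (t + 4) * (4 * (D.θ * D.R)) * x ^ E := by
    calc x * x * (D.r : ℝ) ^ (t + 3)
        ≤ x ^ (1 : ℝ) * x ^ (1 : ℝ) * x ^ (1 / 2 * ((t + 3 : ℕ) : ℝ)) := by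
          rw [Real.rpow_one]
          gcongr
          exact e1 _
      _ ≤ x ^ ((1 / 2 - α) * ((t + 4 : ℕ) : ℝ)) * (x ^ ((ω - 1) / 4 + ε) * x ^ (1 - ε)) *
          x ^ E := by
          simp only [← Real.rpow_add hx0]
          refine Real.rpow_le_rpow_of_exponent_le hx1 ?_
          rw [hE]
          push_cast
          linarith
      _ ≤ 2 ^ (t + 4) * (D.p : ℝ) ^ (t + 4) * (2 * D.θ * (2 * D.R)) * x ^ E := by gcongr
      _ = _ := by ring
  have hpos : 0 ≤ 3 ^ (t + 4) * ((D.θ : ℝ) * D.r * D.R) := by positivity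
  have hpos' : 0 ≤ 3 ^ (t + 4) * (D.r : ℝ) := by positivity
  have c1 := mul_le_mul_of_nonneg_left b1 hpos
  have c2 := mul_le_mul_of_nonneg_left b2 hpos'
  -- `3 ^ k` comes from the three colours, `2 ^ k` from rounding `p`, and `6 = 2 + 4` adds up the
  -- two contributions.
  have six : (6 : ℝ) ^ (t + 4 + 1) = 6 * (3 ^ (t + 4) * 2 ^ (t + 4)) := by
    rw [pow_succ, ← mul_pow]
    norm_num
    ring
  rw [six]
  calc _ = 2 * (3 ^ (t + 4) * ((D.θ : ℝ) * D.r * D.R) * (x * D.θ * (D.r : ℝ) ^ (t + 2))) +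
        3 ^ (t + 4) * (D.r : ℝ) * (x * x * (D.r : ℝ) ^ (t + 3)) := by ring
    _ ≤ 2 * (3 ^ (t + 4) * ((D.θ : ℝ) * D.r * D.R) *
        (2 ^ (t + 4) * (D.p : ℝ) ^ (t + 4) * x ^ E)) +
        3 ^ (t + 4) * (D.r : ℝ) *
          (2 ^ (t + 4) * (D.p : ℝ) ^ (t + 4) * (4 * (D.θ * D.R)) * x ^ E) := by linarith
    _ = _ := by ring

/-- The factor in the thresholds for the colour classes. -/
noncomputable def spreadFactor (α c : ℝ) : ℝ := 2 * ((2 + c) / α + 3)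

/-- As `y ≥ x ^ α ≥ α log x`, half of `M` exceeds `(2 + c) log x + 3 y`. Of `3 y`, the part `2 y`
outweighs `z` and the remaining `y ≥ 1` yields a further factor `1 / e ≤ 1 / 2`. -/
theorem exp_div_two_pow_le {x y z c α : ℝ} {M : ℕ} (hx : 1 ≤ x) (hα : 0 < α) (hc : 0 < c)
    (hz : z ≤ 2 * y) (hy : x ^ α ≤ y) (hM : spreadFactor α c * y ≤ M) :
    Real.exp z / 2 ^ M ≤ x ^ (-(2 + c)) / 2 := by
  have hx0 : 0 < x := by linarith
  have h1 : Real.exp (M / 2) ≤ 2 ^ M := by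
    have : Real.exp (1 / 2) ≤ 2 := by
      rw [← Real.le_log_iff_exp_le (by norm_num)]
      linarith [Real.log_two_gt_d9]
    calc Real.exp (M / 2) = Real.exp (1 / 2) ^ M := by rw [← Real.exp_nat_mul]; ring_nf
      _ ≤ 2 ^ M := by gcongr
  have hlog : α * Real.log x ≤ y := by
    rw [← Real.log_rpow hx0]
    exact ((Real.log_le_sub_one_of_pos (Real.rpow_pos_of_pos hx0 α)).trans (by linarith)).trans hy
  have hy1 : 1 ≤ y := (Real.one_le_rpow hx hα.le).trans hy
  have hl : (2 + c) * Real.log x ≤ (2 + c) / α * y := by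
    calc (2 + c) * Real.log x = (2 + c) / α * (α * Real.log x) := by field_simp
      _ ≤ _ := by gcongr
  have h2 : z - M / 2 ≤ -(2 + c) * Real.log x - 1 := by
    rw [spreadFactor] at hM
    nlinarith
  calc Real.exp z / 2 ^ M ≤ Real.exp z / Real.exp (M / 2) := by gcongr
    _ = Real.exp (z - M / 2) := by rw [Real.exp_sub]
    _ ≤ Real.exp (-(2 + c) * Real.log x - 1) := Real.exp_le_exp.2 h2
    _ = x ^ (-(2 + c)) / Real.exp 1 := by
        rw [Real.exp_sub, Real.rpow_def_of_pos hx0, mul_comm]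
    _ ≤ x ^ (-(2 + c)) / 2 := by
        have := Real.rpow_nonneg hx0.le (-(2 + c))
        gcongr
        linarith [Real.add_one_le_exp (1 : ℝ)]

/-- The colour classes are small with high probability. -/
theorem Sizes.mean_not_spread_le (h : Sizes D α ε ω) (hα : 0 < α) {c : ℝ}
    (hc : 0 < c) (col : ℕ → ℕ) :
    mean (D.law col) (fun i => if Spread D i.2 ⌊spreadFactor α c * (D.n : ℝ) ^ (1 / 2 + α)⌋₊
      ⌊spreadFactor α c * (D.n : ℝ) ^ α⌋₊ then 0 else 1) ≤
      ENNReal.ofReal (1 / (D.n : ℝ) ^ c) := by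
  refine (mean_law_not_spread_le D _ _ col).trans ?_
  have hx1 := D.one_le_n
  have hx0 : (0 : ℝ) < D.n := by linarith
  have hp := inv_le_of_rpow_le hx0 h.le_p
  have hr := h.r_le
  have hpn : (D.p : ℝ) ≤ D.n := by exact_mod_cast D.p_le
  have k1 := exp_div_two_pow_le (x := D.n) (y := (D.n : ℝ) ^ (1 / 2 + α)) (z := D.n / D.p)
    (c := c) (α := α) (M := ⌊spreadFactor α c * (D.n : ℝ) ^ (1 / 2 + α)⌋₊ + 1) hx1 hα hc ?_
    (Real.rpow_le_rpow_of_exponent_le hx1 (by linarith)) ?_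
  · have k2 := exp_div_two_pow_le (x := D.n) (y := (D.n : ℝ) ^ α) (z := D.r / D.p)
      (c := c) (α := α) (M := ⌊spreadFactor α c * (D.n : ℝ) ^ α⌋₊ + 1) hx1 hα hc ?_ le_rfl ?_
    · obtain ⟨x, hx⟩ : ∃ x : ℝ, x = D.n := ⟨_, rfl⟩
      have hq : 0 ≤ (D.n : ℝ) ^ (-(2 + c)) := Real.rpow_nonneg hx0.le _
      calc _ ≤ (D.p : ℝ≥0∞) * (ENNReal.ofReal ((D.n : ℝ) ^ (-(2 + c)) / 2) +
            D.n * ENNReal.ofReal ((D.n : ℝ) ^ (-(2 + c)) / 2)) := by gcongr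
        _ = ENNReal.ofReal (D.p * ((D.n : ℝ) ^ (-(2 + c)) / 2 +
            D.n * ((D.n : ℝ) ^ (-(2 + c)) / 2))) := by
            rw [ENNReal.ofReal_mul (by positivity), ENNReal.ofReal_add (by positivity)
              (by positivity), ENNReal.ofReal_mul (by positivity), ENNReal.ofReal_natCast,
              ENNReal.ofReal_natCast]
        _ ≤ _ := by
            refine ENNReal.ofReal_le_ofReal ?_
            -- One factor `n` pays for the `p ≤ n` colours, the other for the `n + 1` sets, each
            -- with failure probability at most half of `n ^ (-(2 + c))`.
            have e : 1 / (D.n : ℝ) ^ c = D.n * (D.n * (D.n : ℝ) ^ (-(2 + c))) := by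
              rw [one_div, ← Real.rpow_neg hx0.le, show -c = 1 + (1 + -(2 + c)) by ring,
                Real.rpow_add hx0, Real.rpow_add hx0, Real.rpow_one]
            rw [e]
            refine mul_le_mul hpn ?_ (by positivity) hx0.le
            nlinarith
    · calc (D.r : ℝ) / D.p = D.r * (D.p : ℝ)⁻¹ := div_eq_mul_inv _ _
        _ ≤ (D.n : ℝ) ^ (1 / 2 : ℝ) * (2 * (D.n : ℝ) ^ (-(1 / 2 - α))) := by gcongr
        _ = 2 * (D.n : ℝ) ^ (1 / 2 + -(1 / 2 - α)) := by rw [Real.rpow_add hx0]; ring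
        _ = _ := by ring_nf
    · push_cast
      exact (Nat.lt_floor_add_one _).le
  · calc (D.n : ℝ) / D.p = D.n * (D.p : ℝ)⁻¹ := div_eq_mul_inv _ _
      _ ≤ D.n * (2 * (D.n : ℝ) ^ (-(1 / 2 - α))) := by gcongr
      _ = 2 * (D.n : ℝ) ^ (1 + -(1 / 2 - α)) := by rw [Real.rpow_add hx0, Real.rpow_one]; ring
      _ = _ := by ring_nf
  · push_cast
    exact (Nat.lt_floor_add_one _).le

end sizes

theorem floor_rpow_bounds {x e : ℝ} (hx : 1 ≤ x) (he : 0 ≤ e) :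
    1 ≤ ⌊x ^ e⌋₊ ∧ (⌊x ^ e⌋₊ : ℝ) ≤ x ^ e ∧ x ^ e ≤ 2 * ⌊x ^ e⌋₊ := by
  have h1 : 1 ≤ x ^ e := Real.one_le_rpow hx he
  have h2 : 1 ≤ ⌊x ^ e⌋₊ := Nat.le_floor (by simpa using h1)
  have h3 : (1 : ℝ) ≤ ⌊x ^ e⌋₊ := by exact_mod_cast h2
  refine ⟨h2, Nat.floor_le (by linarith), ?_⟩
  linarith [Nat.lt_floor_add_one (x ^ e)]
-- Parameters of the program and assembly of the theorem
/-- The exponents of the parameters of the program. -/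
noncomputable def exponents (α ε ω : ℝ) : List ℝ :=
  [1 / 2 - α, 1 / 2, 1 - ε, (ω - 1) / 4 + ε, (ω - 1) / 4, 3 / 2 - 3 * α]

theorem exponents_mem_span {α ε ω : ℝ} :
    ∀ e ∈ exponents α ε ω, e ∈ Submodule.span ℚ ({1, α, ε, ω} : Set ℝ) := by
  have key : ∀ a b c d : ℚ, (a : ℝ) + b * α + c * ε + d * ω ∈
      Submodule.span ℚ ({1, α, ε, ω} : Set ℝ) := by
    intro a b c d
    have h : ∀ x ∈ ({1, α, ε, ω} : Set ℝ), ∀ q : ℚ, (q : ℝ) * x ∈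
        Submodule.span ℚ ({1, α, ε, ω} : Set ℝ) := by
      intro x hx q
      rw [← Rat.smul_def]
      exact Submodule.smul_mem _ _ (Submodule.subset_span hx)
    have h1 := h 1 (by simp) a
    rw [mul_one] at h1
    exact add_mem (add_mem (add_mem h1 (h α (by simp) b)) (h ε (by simp) c)) (h ω (by simp) d)
  intro e he
  simp only [exponents, List.mem_cons, List.not_mem_nil, or_false] at he
  rcases he with rfl | rfl | rfl | rfl | rfl | rfl
  · convert key (1 / 2) (-1) 0 0 using 1
    push_cast
    ring
  · convert key (1 / 2) 0 0 0 using 1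
    push_cast
    ring
  · convert key 1 0 (-1) 0 using 1
    push_cast
    ring
  · convert key (-1 / 4) 0 1 (1 / 4) using 1
    push_cast
    ring
  · convert key (-1 / 4) 0 0 (1 / 4) using 1
    push_cast
    ring
  · convert key (3 / 2) (-3) 0 0 using 1
    push_cast
    ring

/-- The exponents of the parameters used in the computation are nonnegative, so these parameters are
at least `1` and lose at most a factor `2` by rounding. The exception is `S`, which needs upper
bounds and `p³ ≤ S` only. -/
theorem exists_data {α ε ω : ℝ} (hω : 2 ≤ ω) (hα : α ∈ Set.Ioo (0 : ℝ) (1 / 2))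
    (hε : ε ∈ Set.Ioo (0 : ℝ) ((3 - ω) / 4)) {n : ℕ} (hn : 1 ≤ n) {G : SimpleGraph (Fin n)}
    (hdeg : ∀ v, ((G.neighborSet v).ncard : ℝ) ≤ Real.sqrt n) {w : ℕ}
    (hw : 16 * (n + 2) ^ 6 < 2 ^ w) {s : State} (hs : s.IsWord w)
    (hI : HoldsInput (exponents α ε ω) G s) :
    ∃ D : Data, D.w = w ∧ D.S = ⌊(n : ℝ) ^ (3 / 2 - 3 * α)⌋₊ ∧ Describes D G ∧ Sizes D α ε ω ∧
      Input D s := by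
  obtain ⟨hα0, hα1⟩ := hα
  obtain ⟨hε0, hε1⟩ := hε
  have hx : (1 : ℝ) ≤ n := by exact_mod_cast hn
  have hx0 : (0 : ℝ) < n := by linarith
  have bp := floor_rpow_bounds hx (e := 1 / 2 - α) (by linarith)
  have br := floor_rpow_bounds hx (e := 1 / 2) (by norm_num)
  have bR := floor_rpow_bounds hx (e := 1 - ε) (by linarith)
  have bθ := floor_rpow_bounds hx (e := (ω - 1) / 4 + ε) (by linarith)
  have bL := floor_rpow_bounds hx (e := (ω - 1) / 4) (by linarith)
  have bS : (⌊(n : ℝ) ^ (3 / 2 - 3 * α)⌋₊ : ℝ) ≤ (n : ℝ) ^ (3 / 2 - 3 * α) :=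
    Nat.floor_le (Real.rpow_nonneg hx0.le _)
  have hle : ∀ {e : ℝ}, e ≤ 1 → ⌊(n : ℝ) ^ e⌋₊ ≤ n := fun {e} he => by
    refine Nat.floor_le_of_le ?_
    simpa using Real.rpow_le_rpow_of_exponent_le hx he
  have h3 := hI.2.2.1
  let D : Data :=
    { w := w
      n := n
      p := ⌊(n : ℝ) ^ (1 / 2 - α)⌋₊
      r := ⌊(n : ℝ) ^ (1 / 2 : ℝ)⌋₊
      R := ⌊(n : ℝ) ^ (1 - ε)⌋₊
      θ := ⌊(n : ℝ) ^ ((ω - 1) / 4 + ε)⌋₊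
      L := ⌊(n : ℝ) ^ ((ω - 1) / 4)⌋₊
      S := ⌊(n : ℝ) ^ (3 / 2 - 3 * α)⌋₊
      off := s.mem 0
      nb := s.mem 1
      G := G.map Fin.valEmbedding
      n_pos := hn
      adj := hI.adj
      nb_inj := fun u hu t t' h1 h2 h1' h2' e => hI.inj hu h1 h2 h1' h2' e
      off_mono := fun u hu => by
        rw [h3 ⟨u, hu⟩]
        exact Nat.le_add_right _ _
      deg_le := fun u hu => by
        rw [h3 ⟨u, hu⟩]
        refine Nat.add_le_add_left (Nat.le_floor ?_) _
        rw [← Real.sqrt_eq_rpow]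
        exact hdeg _
      off_lt := fun u => hs.2 0 u
      rr := by
        have h : (⌊(n : ℝ) ^ (1 / 2 : ℝ)⌋₊ : ℝ) * ⌊(n : ℝ) ^ (1 / 2 : ℝ)⌋₊ ≤ n := by
          calc _ ≤ (n : ℝ) ^ (1 / 2 : ℝ) * (n : ℝ) ^ (1 / 2 : ℝ) := by
                gcongr <;> exact br.2.1
            _ = n := by rw [← Real.rpow_add hx0]; norm_num
        exact_mod_cast h
      r_pos := br.1
      θ_pos := bθ.1
      θ_le := hle (by linarith)
      L_pos := bL.1
      p_pos := bp.1
      p_le := hle (by linarith)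
      S_le := by
        refine Nat.floor_le_of_le ?_
        push_cast
        calc (n : ℝ) ^ (3 / 2 - 3 * α) ≤ (n : ℝ) ^ (1 + 1 : ℝ) :=
              Real.rpow_le_rpow_of_exponent_le hx (by linarith)
          _ = n * n := by rw [Real.rpow_add hx0, Real.rpow_one]
      R_le := hle (by linarith)
      word := hw
      ppp := by
        refine Nat.le_floor ?_
        push_cast
        calc _ ≤ (n : ℝ) ^ (1 / 2 - α) * (n : ℝ) ^ (1 / 2 - α) * (n : ℝ) ^ (1 / 2 - α) := by
              gcongr <;> exact bp.2.1
          _ = _ := by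
              rw [← Real.rpow_add hx0, ← Real.rpow_add hx0]
              ring_nf }
  have hm := hI.2.2.2.2
  refine ⟨D, rfl, rfl, ⟨rfl, fun u v => ?_⟩, ⟨bp.2.1, bp.2.2, br.2.1, bR.2.1, bR.2.2, bθ.2.1,
    bθ.2.2, bL.2.1, bL.2.2, bS⟩, ⟨hs, hI.1, rfl, rfl, hm ⟨0, by simp [exponents]⟩,
    hm ⟨1, by simp [exponents]⟩, hm ⟨2, by simp [exponents]⟩, hm ⟨3, by simp [exponents]⟩,
    hm ⟨4, by simp [exponents]⟩, hm ⟨5, by simp [exponents]⟩⟩⟩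
  exact SimpleGraph.map_adj_apply (f := Fin.valEmbedding)

theorem ofReal_sum_le {k : ℕ} {x a b α : ℝ} (hx : 1 ≤ x) (hα : 0 ≤ α) {f : ℕ → ℝ≥0∞}
    (hf : ∀ k' ∈ Finset.Icc 4 k, f k' ≤ ENNReal.ofReal (6 ^ (k' + 1) * x ^ (a + k' * α + b))) :
    ∑ k' ∈ Finset.Icc 4 k, f k' ≤ ENNReal.ofReal (k * 6 ^ (k + 1) * x ^ (a + k * α + b)) := by
  calc ∑ k' ∈ Finset.Icc 4 k, f k'
      ≤ ∑ k' ∈ Finset.Icc 4 k, ENNReal.ofReal (6 ^ (k + 1) * x ^ (a + k * α + b)) := by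
        refine Finset.sum_le_sum fun k' hk' => (hf k' hk').trans (ENNReal.ofReal_le_ofReal ?_)
        have hkk : k' ≤ k := (Finset.mem_Icc.1 hk').2
        gcongr
        · norm_num
    _ ≤ k * ENNReal.ofReal (6 ^ (k + 1) * x ^ (a + k * α + b)) := by
        rw [Finset.sum_const, nsmul_eq_mul]
        gcongr
        rw [Nat.card_Icc]
        omega
    _ = _ := by
        rw [← ENNReal.ofReal_natCast, ← ENNReal.ofReal_mul (Nat.cast_nonneg k), mul_assoc]

end WordRAM

open WordRAM
theorem theorem1 (ω : ℝ) (hω₂ : 2 ≤ ω) (hω : MatMulInTime ω)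
    (k : ℕ) (hk : 4 ≤ k) (α ε : ℝ)
    (hα : α ∈ Set.Ioo (0 : ℝ) (1 / 2)) (hε : ε ∈ Set.Ioo (0 : ℝ) ((3 - ω) / 4)) :
    ∃ (P : Cmd) (exps : List ℝ) (q d : ℕ) (C : ℝ) (D : ℝ → ℝ),
      (∀ e ∈ exps, e ∈ Submodule.span ℚ ({1, α, ε, ω} : Set ℝ)) ∧
      ∀ n : ℕ, 1 ≤ n → ∀ G : SimpleGraph (Fin n),
        (∀ v, ((G.neighborSet v).ncard : ℝ) ≤ Real.sqrt n) →
        ∀ w : ℕ, (n + 2) ^ d ≤ 2 ^ w →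
        ∀ s : State, s.IsWord w → HoldsInput exps G s →
        ∃ (T : ℕ) (E' : State → Set (Sym2 (Fin n)))
          (H : State → Fin ⌊(n : ℝ) ^ (3 / 2 - 3 * α)⌋₊ → G.Subgraph),
          (T : ℝ) ≤ C * (n : ℝ) ^ (2 - ε) ∧
          HaltsWith w T P s (fun s' =>
            HoldsOutput q (E' s') (H s') s' ∧
            (∀ e ∈ E' s', EdgeInTriangle G e) ∧
            (∀ e, EdgeInTriangle G e →
              e ∈ E' s' ∨ ∃ i, EdgeInTriangle (H s' i).spanningCoe e)) ∧
          (∀ c : ℝ, 0 < c →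
            ENNReal.ofReal (1 - 1 / (n : ℝ) ^ c) ≤
              prob (run w T ([P], s)) (fun s' => ∀ i,
                ((H s' i).verts.ncard : ℝ) ≤ D c * (n : ℝ) ^ (1 / 2 + α) ∧
                ∀ v, (((H s' i).neighborSet v).ncard : ℝ) ≤ D c * (n : ℝ) ^ α)) ∧
          ∀ i, expect (run w T ([P], s)) (fun s' => numCycles k (H s' i).spanningCoe) ≤
            ENNReal.ofReal (C * (n : ℝ) ^ ((ω - 1) / 4 + k * α + ε)) := by
  obtain ⟨mm, d, C₀, hC₀, hmm⟩ := exists_mulSpec hω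
  have hα0 := hα.1
  have hε0 := hε.1
  have hε1 := hε.2
  -- Nine blocks are the ordered pairs of three colours. In the word length, `d` serves the
  -- multiplication program and `9` the addresses and counters. The factor `3` in the last constant
  -- is the number of colours in a triple.
  refine ⟨program mm, exponents α ε ω, 9, d + 9,
    max (2000 + 12 * (700 + 3 * C₀)) (k * 6 ^ (k + 1)), fun c => 3 * spreadFactor α c,
    exponents_mem_span, fun n hn G hdeg w hw s hs hI => ?_⟩
  have hpow : 16 * (n + 2) ^ 6 < 2 ^ w ∧ (n + 2) ^ d ≤ 2 ^ w := by
    have h1 : 1 ≤ (n + 2) ^ d := Nat.one_le_pow _ _ (by omega)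
    have h2 : 1 ≤ (n + 2) ^ 9 := Nat.one_le_pow _ _ (by omega)
    -- `27 > 16`: three of the nine powers absorb the constant factor.
    have h3 : 3 ^ 3 ≤ (n + 2) ^ 3 := Nat.pow_le_pow_left (by omega) 3
    have h4 : 0 < (n + 2) ^ 6 := by positivity
    rw [pow_add] at hw
    refine ⟨lt_of_lt_of_le ?_ ((Nat.le_mul_of_pos_left _ h1).trans hw),
      (Nat.le_mul_of_pos_right _ h2).trans hw⟩
    rw [show (n + 2) ^ 9 = (n + 2) ^ 3 * (n + 2) ^ 6 by ring]
    exact Nat.mul_lt_mul_of_pos_right (by omega) h4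
  obtain ⟨D, hDw, hDS, hD, hZ, hIn⟩ := exists_data hω₂ hα hε hn hdeg hpow.1 hs hI
  have hDn := hD.n_eq
  have hmul := hmm D (by
    rw [hDw]
    refine le_trans (Nat.pow_le_pow_left ?_ d) hpow.2
    have := D.rr
    have := D.r_pos
    nlinarith)
  set Tm := ⌊C₀ * (D.r : ℝ) ^ ω⌋₊ with hTm
  have hTm' : (Tm : ℝ) ≤ C₀ * (D.r : ℝ) ^ ω := Nat.floor_le (by positivity)
  obtain ⟨κ, hκ⟩ : ∃ κ : ℝ, κ = 180 * ((D.r : ℝ) * D.L / D.θ) + 2 / ((D.θ : ℝ) * D.r) *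
    ((D.r / D.L + 1) * (700 * ((D.r : ℝ) * D.r) + 3 * Tm)) + 70 * ((D.r : ℝ) / D.θ) := ⟨_, rfl⟩
  have hκ0 : 0 ≤ κ := by rw [hκ]; positivity
  -- The potential is the number of remaining arcs times the rounded price of a deleted arc.
  have hspec := program_spec hmul (fun H => ⌈κ⌉₊ * D.numArcs H) (fun H v hH hv hw =>
    heavyCost_add_le hH hv (by rw [← hκ]; exact Nat.le_ceil κ) hw) hIn
  have htime := hZ.time_le hω₂ (by linarith) hα0 hε0 (by linarith) hC₀ hTm'
    (K := ⌈κ⌉₊) (by rw [← hκ]; exact (Nat.ceil_lt_add_one hκ0).le)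
  rw [hDw] at hspec
  rw [hDn] at htime
  have hx : (1 : ℝ) ≤ n := by exact_mod_cast hn
  refine ⟨_, decodeMarks n, fun s' i => decode G i s', ?_, hspec.haltsWith fun i s' hF =>
    ⟨hF.holdsOutput hD hDS, fun e => hF.edgeInTriangle_of_mem hD, fun e => hF.complete hD hDS⟩,
    fun c hc => ?_, fun i => ?_⟩
  · rw [hDn]
    refine htime.trans ?_
    gcongr
    exact le_max_left _ _
  · have hns := hZ.mean_not_spread_le hα0 hc (s.mem 17)
    rw [hDn] at hns
    refine hspec.le_prob (A := fun i => Spread D i.2 _ _) (fun j s' hF hA i => ?_) (by positivity)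
      hns
    have hB : 0 ≤ spreadFactor α c := by
      unfold spreadFactor
      positivity
    have hi : (i : ℕ) < D.S := by rw [hDS]; exact i.2
    refine ⟨?_, fun v => ?_⟩
    · have h1 : (((decode G i s').verts.ncard : ℕ) : ℝ) ≤ (3 * _ : ℕ) :=
        Nat.cast_le.2 (hF.ncard_verts_le hD hi hA)
      refine h1.trans ?_
      push_cast
      rw [mul_assoc]
      gcongr
      exact Nat.floor_le (by positivity)
    · have h1 : ((((decode G i s').neighborSet v).ncard : ℕ) : ℝ) ≤ (3 * _ : ℕ) :=
        Nat.cast_le.2 (hF.ncard_neighborSet_le hD hi hA v)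
      refine h1.trans ?_
      push_cast
      rw [mul_assoc]
      gcongr
      exact Nat.floor_le (by positivity)
  · have hi : (i : ℕ) < D.S := by rw [hDS]; exact i.2
    refine (hspec.expect_le (g := fun j => ∑ k' ∈ Finset.Icc 4 k,
      ((D.cycles j.1 (fun x => j.2 x ∈ triple D.p i) k').card : ENNReal)) fun j s' hF => ?_).trans ?_
    · have := hF.numCycles_le hD hi k
      exact_mod_cast this
    · rw [mean_sum]
      refine (ofReal_sum_le (a := (ω - 1) / 4) (b := ε) hx hα0.le fun k' hk' => ?_).trans (ENNReal.ofReal_le_ofReal ?_)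
      · have := hZ.mean_cycles_le hω₂ hε0 (Finset.mem_Icc.1 hk').1 (card_triple D.p i) (s.mem 17)
        rwa [hDn] at this
      · gcongr
        exact le_max_right _ _
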